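/- **Setting.** Let $k,n\ge 1$. An instance of the Ad Types Problem without gap rules consists of $k$ ad types, $n$ slots and $n$ ads of each type $\theta$, with values $v^{(\theta)}_1\ge\dots\ge v^{(\theta)}_n\ge 0$ and discount curves $\alpha^{(\theta)}_1\ge\dots\ge\alpha^{(\theta)}_n\ge 0$. Assigning ad $i$ of type $\theta$ to slot $j$ has weight $v^{(\theta)}_i\alpha^{(\theta)}_j$. The aim is a matching of ads to slots of maximum total weight. Call an instance *strict* if all these sequences are strictly decreasing and positive. **Algorithm 1** (Hungarian algorithm for strict instances). Start with the empty matching $M$, with $u_a=0$ for all ads $a$ and with $p_j$ equal to the largest edge weight for all slots $j$. The slack of an edge $(a,j)$ of weight $w_{aj}$ is $u_a+p_j-w_{aj}$. For each slot $r$ in descending order run a phase: start an alternating tree $B$ with root $r$ and an empty priority queue, and scan $r$. While $B$ contains no alternating path from an unmatched ad to $r$, remove from the queue an entry $(a,j)$ with the smallest current slack $\Delta$; increase $u$ by $\Delta$ on the ads of $B$ and decrease $p$ by $\Delta$ on the slots of $B$; add the edge $(a,j)$ to $B$, and if $a$ is matched, also add its matching edge $(a,M(a))$ and scan $M(a)$.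 Then augment $M$ along the alternating path. To *scan* a slot $j$, consider for each type the first unmatched ad, the last ad matched to a slot before $j$ and the first ad matched to a slot after $j$ (if they exist); each such ad $a\notin B$ gets the queue entry $(a,j)$, unless it already has an entry with slack at most that of $(a,j)$. **Theorem 1.** (a) On every strict instance, every execution of Algorithm 1 (ties between queue entries are broken arbitrarily) is finite, does not get stuck, and ends with a maximum-weight matching. At any time the queue holds at most $n+k$ ads, and each scan considers at most $3k$ edges. (b) Algorithm 1 can be implemented in time $O(n^2(k+\log n))$: there are a single program for the random access machine with real registers and a constant $C$, such that for all $k,n\ge1$ and every instance (strict or not) with $k$ types, $n$ slots and $n$ ads per type the program halts after at most $C\,n^2(k+\log n)$ units of time and outputs a maximum-weight matching; if the instance is strict, this matching is the result of an execution of Algorithm 1. Here addition, subtraction, multiplication and comparison of reals, arithmetic and comparison of natural numbers of at most $C\log(n+k)$ bits (up to an additive constant), and access to memory each take one unit of time. -/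

import Mathlib

namespace AdTypes

/-! ### The Ad Types Problem without gap rules -/

/-- An ad: its type together with its position in the list of ads of that type.
There are `k` types and `n` ads of each type. -/
abbrev Ad (k n : ℕ) : Type := Fin k × Fin n

/-- An edge of the complete bipartite graph between ads and slots. -/
abbrev Edge (k n : ℕ) : Type := Ad k n × Fin n

/-- An instance: the values of the `n` ads of each type and, for each type, a discount curve over
the `n` slots. Slots and ads are numbered from `0`. -/
structure Instance (k n : ℕ) where
  v : Fin k → Fin n → ℝ
  α : Fin k → Fin n → ℝ

/-- The standing assumption of the problem: the ads of each type are listed in non-increasing order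
of value, and every discount curve is non-increasing; everything is non-negative. -/
def Instance.IsMonotone {k n : ℕ} (I : Instance k n) : Prop :=
  ∀ θ, Antitone (I.v θ) ∧ Antitone (I.α θ) ∧ (∀ i, 0 ≤ I.v θ i) ∧ (∀ j, 0 ≤ I.α θ j)

/-- The input requirement of the Hungarian algorithm below: strictly decreasing and positive. -/
def Instance.IsStrict {k n : ℕ} (I : Instance k n) : Prop :=
  ∀ θ, StrictAnti (I.v θ) ∧ StrictAnti (I.α θ) ∧ (∀ i, 0 < I.v θ i) ∧ (∀ j, 0 < I.α θ j)

/-- The weight of the edge between an ad and a slot. -/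
def Instance.w {k n : ℕ} (I : Instance k n) (a : Ad k n) (j : Fin n) : ℝ :=
  I.v a.1 a.2 * I.α a.1 j

/-- A set of edges is a matching if no two distinct edges share an ad or a slot. -/
def IsMatching {k n : ℕ} (M : Finset (Edge k n)) : Prop :=
  ∀ e ∈ M, ∀ f ∈ M, e.1 = f.1 ∨ e.2 = f.2 → e = f

/-- A matching of maximum total weight among all matchings. -/
def Instance.IsMaxWeightMatching {k n : ℕ} (I : Instance k n) (M : Finset (Edge k n)) : Prop :=
  IsMatching M ∧
    ∀ N : Finset (Edge k n), IsMatching N → ∑ e ∈ N, I.w e.1 e.2 ≤ ∑ e ∈ M, I.w e.1 e.2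

/-! ### The Hungarian algorithm for the Ad Types Problem -/

/-- `a` is matched in `M`. -/
def Matched {k n : ℕ} (M : Finset (Edge k n)) (a : Ad k n) : Prop := ∃ j, (a, j) ∈ M

/-- The ads in the alternating tree with edge set `B`. -/
def treeAds {k n : ℕ} (B : Finset (Edge k n)) : Finset (Ad k n) := B.image Prod.fst

/-- The slots in the alternating tree with root `r` and edge set `B`. -/
def treeSlots {k n : ℕ} (r : Fin n) (B : Finset (Edge k n)) : Finset (Fin n) :=
  insert r (B.image Prod.snd)

/-- `AltPath M B r a A`: the set `A` is the edge set of a path in `B` from the ad `a` to the slot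
`r` whose edges are alternately outside `M` and in `M`, starting and ending outside `M`. -/
inductive AltPath {k n : ℕ} (M B : Finset (Edge k n)) (r : Fin n) :
    Ad k n → Finset (Edge k n) → Prop
  | last (a : Ad k n) : (a, r) ∈ B → (a, r) ∉ M → AltPath M B r a {(a, r)}
  | cons (a b : Ad k n) (j : Fin n) (A : Finset (Edge k n)) :
      (a, j) ∈ B → (a, j) ∉ M → (b, j) ∈ B → (b, j) ∈ M → AltPath M B r b A →
      AltPath M B r a (insert (a, j) (insert (b, j) A))

/-- `A` is an augmenting path in the tree: an alternating path from a free ad to the root. -/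
def IsAugmenting {k n : ℕ} (M B : Finset (Edge k n)) (r : Fin n) (A : Finset (Edge k n)) : Prop :=
  ∃ a, ¬ Matched M a ∧ AltPath M B r a A

/-- The slack of an edge with respect to the dual variables `u` (ads) and `p` (slots); the edge is
tight if its slack is `0`, and the dual solution is feasible if no slack is negative. -/
def Instance.slack {k n : ℕ} (I : Instance k n) (u : Ad k n → ℝ) (p : Fin n → ℝ)
    (a : Ad k n) (j : Fin n) : ℝ :=
  u a + p j - I.w a j

open Classical in
/-- The ads inspected when the slot `j` enters the tree. For every type these are: the first
unmatched ad, the last ad that is matched to a slot before `j` (if any), and the first ad that is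
matched to a slot after `j` (if any). -/
noncomputable def scanSet {k n : ℕ} (M : Finset (Edge k n)) (j : Fin n) : Finset (Ad k n) :=
  Finset.univ.filter fun a =>
    (¬ Matched M a ∧ ∀ i < a.2, Matched M (a.1, i)) ∨
    ((∃ l < j, (a, l) ∈ M) ∧ ∀ i > a.2, ¬ ∃ l < j, ((a.1, i), l) ∈ M) ∨
    ((∃ l > j, (a, l) ∈ M) ∧ ∀ i < a.2, ¬ ∃ l > j, ((a.1, i), l) ∈ M)

open Classical in
/-- The routine UpdatePossibleNewEdges for the slot `j`. The queue `P` stores for each ad in it one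
edge, given by its slot; the priority of an ad is the current slack of that edge. -/
noncomputable def Instance.updateQueue {k n : ℕ} (I : Instance k n) (M B : Finset (Edge k n))
    (u : Ad k n → ℝ) (p : Fin n → ℝ) (P : Ad k n → Option (Fin n)) (j : Fin n) :
    Ad k n → Option (Fin n) := fun a =>
  if a ∈ scanSet M j ∧ a ∉ treeAds B ∧ (∀ l, P a = some l → I.slack u p a j < I.slack u p a l)
  then some j else P a

/-- A state of the algorithm. -/
structure HState (k n : ℕ) where
  /-- the current matching -/
  M : Finset (Edge k n)
  /-- dual variables of the ads -/
  u : Ad k n → ℝ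
  /-- dual variables of the slots -/
  p : Fin n → ℝ
  /-- the slots with index less than `rest` have not been considered yet -/
  rest : ℕ
  /-- the slot of the phase in progress, `none` between two phases -/
  root : Option (Fin n)
  /-- edges of the alternating tree -/
  B : Finset (Edge k n)
  /-- the priority queue -/
  P : Ad k n → Option (Fin n)

/-- The state after initialization. -/
noncomputable def Instance.start {k n : ℕ} (I : Instance k n) : HState k n where
  M := ∅
  u := fun _ => 0
  p := fun _ => ⨆ e : Edge k n, I.w e.1 e.2
  rest := n
  root := none
  B := ∅
  P := fun _ => none

/-- All phases are over. -/
def HState.Final {k n : ℕ} (s : HState k n) : Prop := s.rest = 0 ∧ s.root = none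

open Classical in
/-- The set of ads in the priority queue. -/
noncomputable def HState.queue {k n : ℕ} (s : HState k n) : Finset (Ad k n) :=
  Finset.univ.filter fun a => s.P a ≠ none

/-- `(a, j)` may be removed from the queue next: it becomes tight first. -/
def Instance.IsNext {k n : ℕ} (I : Instance k n) (s : HState k n) (a : Ad k n) (j : Fin n) : Prop :=
  s.P a = some j ∧ ∀ b l, s.P b = some l → I.slack s.u s.p a j ≤ I.slack s.u s.p b l

/-- The dual variables of the ads after the update with amount `δ`. -/
def newU {k n : ℕ} (s : HState k n) (δ : ℝ) : Ad k n → ℝ := fun a =>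
  if a ∈ treeAds s.B then s.u a + δ else s.u a

/-- The dual variables of the slots after the update with amount `δ`. -/
def newP {k n : ℕ} (s : HState k n) (r : Fin n) (δ : ℝ) : Fin n → ℝ := fun j =>
  if j ∈ treeSlots r s.B then s.p j - δ else s.p j

/-- One step of the algorithm; ties between queue entries are broken arbitrarily. -/
inductive Instance.Step {k n : ℕ} (I : Instance k n) : HState k n → HState k n → Prop
  /-- Start the phase of the next slot; slots are considered in descending order. -/
  | enter (s : HState k n) (r : Fin n) :
      s.root = none → s.rest = r.val + 1 →
      I.Step s { s with
        rest := r.val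
        root := some r
        B := ∅
        P := I.updateQueue s.M ∅ s.u s.p (fun _ => none) r }
  /-- The next tight edge leads to a matched ad: update the duals and grow the tree. -/
  | grow (s : HState k n) (r : Fin n) (a : Ad k n) (j m : Fin n) (δ : ℝ) :
      s.root = some r → (¬ ∃ A, IsAugmenting s.M s.B r A) →
      I.IsNext s a j → δ = I.slack s.u s.p a j → (a, m) ∈ s.M →
      I.Step s { s with
        u := newU s δ
        p := newP s r δ
        B := insert (a, j) (insert (a, m) s.B)
        P := I.updateQueue s.M (insert (a, j) (insert (a, m) s.B)) (newU s δ) (newP s r δ)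
          (Function.update s.P a none) m }
  /-- The next tight edge leads to a free ad: update the duals and complete a path. -/
  | reach (s : HState k n) (r : Fin n) (a : Ad k n) (j : Fin n) (δ : ℝ) :
      s.root = some r → (¬ ∃ A, IsAugmenting s.M s.B r A) →
      I.IsNext s a j → δ = I.slack s.u s.p a j → ¬ Matched s.M a →
      I.Step s { s with
        u := newU s δ
        p := newP s r δ
        B := insert (a, j) s.B
        P := Function.update s.P a none }
  /-- The tree contains an augmenting path: augment the matching and end the phase. -/
  | augment (s : HState k n) (r : Fin n) (A : Finset (Edge k n)) :
      s.root = some r → IsAugmenting s.M s.B r A →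
      I.Step s { s with
        M := symmDiff s.M A
        root := none
        B := ∅
        P := fun _ => none }

/-- The states that occur in the executions of the algorithm on `I`. -/
def Instance.Reachable {k n : ℕ} (I : Instance k n) (s : HState k n) : Prop :=
  Relation.ReflTransGen I.Step I.start s

/-! ### A random access machine with real registers, and its running time

Programs of a small imperative language. The memory consists of variables and arrays for natural
numbers (counters and addresses) and of variables and arrays for real numbers. Reals can be added,
subtracted, multiplied and compared; there is no rounding and no conversion from reals to natural
numbers. Every arithmetic operation, comparison, memory access and assignment takes one unit of
time. -/

/-- A memory state. -/
structure Store where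
  nvar : ℕ → ℕ
  narr : ℕ → ℕ → ℕ
  rvar : ℕ → ℝ
  rarr : ℕ → ℕ → ℝ

/-- Expressions of natural number type: constants, variables, array cells, arithmetic. -/
inductive NExp
  | lit (c : ℕ)
  | var (x : ℕ)
  | cell (a : ℕ) (e : NExp)
  | add (e f : NExp)
  | sub (e f : NExp)
  | mul (e f : NExp)
  | div (e f : NExp)

/-- Expressions of real type; the only constants are integers. -/
inductive RExp
  | lit (z : ℤ)
  | var (x : ℕ)
  | cell (a : ℕ) (e : NExp)
  | add (e f : RExp)
  | sub (e f : RExp)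
  | mul (e f : RExp)

/-- Tests. -/
inductive BExp
  | neq (e f : NExp)
  | nle (e f : NExp)
  | rle (e f : RExp)
  | neg (b : BExp)
  | conj (b c : BExp)

/-- Programs. -/
inductive Cmd
  | skip
  | setN (x : ℕ) (e : NExp)
  | putN (a : ℕ) (i e : NExp)
  | setR (x : ℕ) (e : RExp)
  | putR (a : ℕ) (i : NExp) (e : RExp)
  | seq (c d : Cmd)
  | cond (b : BExp) (c d : Cmd)
  | loop (b : BExp) (c : Cmd)

/-- Value of an expression; subtraction is truncated and division rounds down. -/
def NExp.val (s : Store) : NExp → ℕ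
  | .lit c => c
  | .var x => s.nvar x
  | .cell a e => s.narr a (e.val s)
  | .add e f => e.val s + f.val s
  | .sub e f => e.val s - f.val s
  | .mul e f => e.val s * f.val s
  | .div e f => e.val s / f.val s

/-- Value of an expression. -/
def RExp.val (s : Store) : RExp → ℝ
  | .lit z => (z : ℝ)
  | .var x => s.rvar x
  | .cell a e => s.rarr a (e.val s)
  | .add e f => e.val s + f.val s
  | .sub e f => e.val s - f.val s
  | .mul e f => e.val s * f.val s

/-- Truth of a test: equality or order of natural numbers, order of reals, negation, conjunction. -/
def BExp.Holds (s : Store) : BExp → Prop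
  | .neq e f => e.val s = f.val s
  | .nle e f => e.val s ≤ f.val s
  | .rle e f => e.val s ≤ f.val s
  | .neg b => ¬ b.Holds s
  | .conj b c => b.Holds s ∧ c.Holds s

/-- Time to evaluate an expression: the number of its nodes. -/
def NExp.time : NExp → ℕ
  | .lit _ => 1
  | .var _ => 1
  | .cell _ e => e.time + 1
  | .add e f => e.time + f.time + 1
  | .sub e f => e.time + f.time + 1
  | .mul e f => e.time + f.time + 1
  | .div e f => e.time + f.time + 1

/-- Time to evaluate an expression: the number of its nodes. -/
def RExp.time : RExp → ℕ
  | .lit _ => 1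
  | .var _ => 1
  | .cell _ e => e.time + 1
  | .add e f => e.time + f.time + 1
  | .sub e f => e.time + f.time + 1
  | .mul e f => e.time + f.time + 1

/-- Time to evaluate a test: the number of its nodes. -/
def BExp.time : BExp → ℕ
  | .neq e f => e.time + f.time + 1
  | .nle e f => e.time + f.time + 1
  | .rle e f => e.time + f.time + 1
  | .neg b => b.time + 1
  | .conj b c => b.time + c.time + 1

/-- `Exec W c s t s1`: started in `s`, the program `c` halts after exactly `t` units of time in
`s1`, and no natural number greater than `W` is ever stored (a machine word holds the numbers up to
`W`; a program that stores a greater one gets stuck). -/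
inductive Exec (W : ℕ) : Cmd → Store → ℕ → Store → Prop
  | skip (s : Store) : Exec W .skip s 1 s
  | setN (s : Store) (x : ℕ) (e : NExp) : e.val s ≤ W →
      Exec W (.setN x e) s (e.time + 1) { s with nvar := Function.update s.nvar x (e.val s) }
  | putN (s : Store) (a : ℕ) (i e : NExp) : i.val s ≤ W → e.val s ≤ W →
      Exec W (.putN a i e) s (i.time + e.time + 1)
        { s with narr := Function.update s.narr a
                          (Function.update (s.narr a) (i.val s) (e.val s)) }
  | setR (s : Store) (x : ℕ) (e : RExp) :
      Exec W (.setR x e) s (e.time + 1) { s with rvar := Function.update s.rvar x (e.val s) }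
  | putR (s : Store) (a : ℕ) (i : NExp) (e : RExp) : i.val s ≤ W →
      Exec W (.putR a i e) s (i.time + e.time + 1)
        { s with rarr := Function.update s.rarr a
                          (Function.update (s.rarr a) (i.val s) (e.val s)) }
  | seq (c d : Cmd) (s s1 s2 : Store) (t t1 : ℕ) :
      Exec W c s t s1 → Exec W d s1 t1 s2 → Exec W (.seq c d) s (t + t1) s2
  | condTrue (b : BExp) (c d : Cmd) (s s1 : Store) (t : ℕ) :
      b.Holds s → Exec W c s t s1 → Exec W (.cond b c d) s (b.time + 1 + t) s1
  | condFalse (b : BExp) (c d : Cmd) (s s1 : Store) (t : ℕ) :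
      ¬ b.Holds s → Exec W d s t s1 → Exec W (.cond b c d) s (b.time + 1 + t) s1
  | loopDone (b : BExp) (c : Cmd) (s : Store) :
      ¬ b.Holds s → Exec W (.loop b c) s (b.time + 1) s
  | loopStep (b : BExp) (c : Cmd) (s s1 s2 : Store) (t t1 : ℕ) :
      b.Holds s → Exec W c s t s1 → Exec W (.loop b c) s1 t1 s2 →
      Exec W (.loop b c) s (b.time + 1 + t + t1) s2

/-- Row-major encoding of a `k × n` matrix as an array, with `0` beyond the end. -/
noncomputable def encode {k n : ℕ} (f : Fin k → Fin n → ℝ) (i : ℕ) : ℝ :=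
  if h : i / n < k ∧ i % n < n then f ⟨i / n, h.1⟩ ⟨i % n, h.2⟩ else 0

/-- The initial memory: `k` and `n` in the natural number variables `0` and `1`, the values and the
discounts in the real arrays `0` and `1`, and zeros everywhere else. -/
noncomputable def Instance.input {k n : ℕ} (I : Instance k n) : Store where
  nvar := fun x => if x = 0 then k else if x = 1 then n else 0
  narr := fun _ _ => 0
  rvar := fun _ => 0
  rarr := fun a => if a = 0 then encode I.v else if a = 1 then encode I.α else fun _ => 0

/-- The matching in the final memory: cell `j` of the natural number array `0` holds the number
(counted from `1`, in row-major order) of the ad in slot `j`. -/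
def Store.output (s : Store) (k n : ℕ) : Finset (Edge k n) :=
  Finset.univ.filter fun e => s.narr 0 e.2.val = e.1.1.val * n + e.1.2.val + 1

end AdTypes

/-! ### Linear programming duality and augmenting paths -/

namespace AdTypes

variable {k n : ℕ}

/-! Correctness is a primal-dual argument. Throughout an execution the duals are feasible, matched
edges are tight, free ads have `u = 0` and prices are nonnegative (`Instance.IsDual`), while exactly
the slots already treated are matched (`Fills`). When all slots are matched, complementary slackness
makes the matching optimal (`IsDual.isMaxWeightMatching`). The delicate point is that a scan
inspects only three ads per type, whereas a dual update is feasible only if it uses the smallest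
slack of all edges leaving the tree. Two facts rescue this. In a strict instance the duals force the
matched ads of each type to be an initial segment, placed in the order of the slots
(`IsDual.sorted`). And since weights are products of monotone factors, the direct edge from a slot
`l` to an ad `b` is never better than a detour through an ad `c` of the same type matched between
them (`IsMonotone.slack_detour`). Either `c` has been offered to the queue from `l`, or `c` lies in
the tree and the argument continues from its slot, which is closer to that of `b`. So the queue
minimum is the true minimum (`InPhase.exists_entry`). Every step inside a phase adds an ad to the
tree or ends the phase, which gives termination.

For the running time, there are `n` phases, and in each of them at most `n` slots enter the tree;
each costs one search and one extraction in the queue and a scan with `O(k)` offers. A scan must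
therefore find its ads in constant time per type. This works because a sorted matching is determined
by the types of the ads in the slots (`Sorted.lt_typeCount_iff`): the memory keeps only these types,
the numbers of the inspected ads are prefix counts (`Sorted.mem_scanSet_iff`), and the tables of
counts are recomputed in time `O(k * n)` per phase. Augmenting just shifts types along the path.
Dual updates are lazy: with `D` the total update of the phase, the sum of slack and `D` of a queue
entry never changes, a price is written once per phase, and the dual of a matched ad is recovered
from its tight edge. Of the free ads only the best entry is stored, since the first free ad that
becomes tight ends the phase.

The same encoding covers instances that are not strict. There an augmented matching may be unsorted,
but some sorted matching with the same types in the slots is optimal for the same duals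
(`exists_sorted`), and the memory already describes it. In the strict case nothing is replaced and
the run is an execution of the algorithm (`InPhase.exists_between`).

A phase may lower keys about `k * n` times, so lowering a key must take constant amortized time. The
heap has a fixed set of `2 ^ H` nodes; a node outside the queue has the key `⊤`. A node may have a
rank one below its position, but each such deficient node is paired with a spare tree of the same
rank in a pool, at most one per rank. Lowering a key cuts the node and leaves a hole. Each round of
filling the hole either stops or consumes a pool tree by linking (`wp_bubbleC`), so the number of
pool trees serves as potential. The minimum is at the main root or at one of at most `H` pool roots.
Extraction takes the tree of the minimum apart down to its root, sets the key of the root to `⊤` and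
reassembles a tree of the same rank.

The program is tied to the abstract algorithm by a simulation relation (`Layout`, `Sim`), and time
is accounted for by a loop rule with potentials (`Runs.loop`). -/

/-- Dual variables certifying the optimality of a matching. -/
structure Instance.IsDual (I : Instance k n) (M : Finset (Edge k n)) (u : Ad k n → ℝ)
    (p : Fin n → ℝ) : Prop where
  nonneg : ∀ a j, 0 ≤ I.slack u p a j
  tight : ∀ a j, (a, j) ∈ M → I.slack u p a j = 0
  free : ∀ a, ¬ Matched M a → u a = 0
  ads_nonneg : ∀ a, 0 ≤ u a
  slots_nonneg : ∀ j, 0 ≤ p j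

/-- `M` is a matching whose slots are exactly those with index at least `b`. -/
structure Fills (M : Finset (Edge k n)) (b : ℕ) : Prop where
  matching : IsMatching M
  slots : ∀ j : Fin n, (∃ a, (a, j) ∈ M) ↔ b ≤ j.val

/-- The matched ads of each type form an initial segment and are matched in order. -/
structure Sorted (M : Finset (Edge k n)) : Prop where
  order : ∀ a b j l, (a, j) ∈ M → (b, l) ∈ M → a.1 = b.1 → a.2 < b.2 → j < l
  initial : ∀ a b, a.1 = b.1 → a.2 ≤ b.2 → Matched M b → Matched M a

theorem IsMatching.slot_eq {M : Finset (Edge k n)} (h : IsMatching M) {a : Ad k n} {j l : Fin n}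
    (h1 : (a, j) ∈ M) (h2 : (a, l) ∈ M) : j = l := by
  have := h _ h1 _ h2 (Or.inl rfl); simpa using this

theorem IsMatching.ad_eq {M : Finset (Edge k n)} (h : IsMatching M) {a b : Ad k n} {j : Fin n}
    (h1 : (a, j) ∈ M) (h2 : (b, j) ∈ M) : a = b := by
  have := h _ h1 _ h2 (Or.inr rfl); simpa using this

/-- Weak duality: every matching weighs at most the sum of all dual variables. The bound is attained
by `M`, because unmatched ads contribute `0` and `Fills M 0` leaves no slot unmatched. -/
theorem Instance.IsDual.isMaxWeightMatching {I : Instance k n} {M : Finset (Edge k n)}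
    {u : Ad k n → ℝ} {p : Fin n → ℝ} (hd : I.IsDual M u p) (hf : Fills M 0) :
    I.IsMaxWeightMatching M := by
  classical
  have hsum : ∀ N : Finset (Edge k n), IsMatching N →
      ∑ e ∈ N, (u e.1 + p e.2) = ∑ a ∈ N.image Prod.fst, u a + ∑ j ∈ N.image Prod.snd, p j := by
    intro N hN
    rw [Finset.sum_add_distrib, Finset.sum_image, Finset.sum_image]
    · intro e he f hf hef; exact hN e he f hf (Or.inr hef)
    · intro e he f hf hef; exact hN e he f hf (Or.inl hef)
  refine ⟨hf.matching, fun N hN => ?_⟩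
  calc ∑ e ∈ N, I.w e.1 e.2 ≤ ∑ e ∈ N, (u e.1 + p e.2) := by
        refine Finset.sum_le_sum fun e _ => ?_
        have := hd.nonneg e.1 e.2
        simp only [Instance.slack] at this; linarith
    _ = ∑ a ∈ N.image Prod.fst, u a + ∑ j ∈ N.image Prod.snd, p j := hsum N hN
    _ ≤ ∑ a, u a + ∑ j, p j := by
        refine add_le_add ?_ ?_
        · exact Finset.sum_le_sum_of_subset_of_nonneg (Finset.subset_univ _)
            fun a _ _ => hd.ads_nonneg a
        · exact Finset.sum_le_sum_of_subset_of_nonneg (Finset.subset_univ _)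
            fun a _ _ => hd.slots_nonneg a
    _ = ∑ a ∈ M.image Prod.fst, u a + ∑ j ∈ M.image Prod.snd, p j := by
        congr 1
        · symm
          refine Finset.sum_subset (Finset.subset_univ _) fun a _ ha => hd.free a ?_
          rintro ⟨j, hj⟩
          exact ha (Finset.mem_image.2 ⟨_, hj, rfl⟩)
        · symm
          refine Finset.sum_subset (Finset.subset_univ _) fun j _ hj => ?_
          obtain ⟨a, ha⟩ := (hf.slots j).2 (Nat.zero_le _)
          exact absurd (Finset.mem_image.2 ⟨_, ha, rfl⟩) hj
    _ = ∑ e ∈ M, (u e.1 + p e.2) := (hsum M hf.matching).symm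
    _ = ∑ e ∈ M, I.w e.1 e.2 := by
        refine Finset.sum_congr rfl fun e he => ?_
        have := hd.tight e.1 e.2 he
        simp only [Instance.slack] at this; linarith

theorem Instance.IsStrict.isMonotone {I : Instance k n} (h : I.IsStrict) : I.IsMonotone :=
  fun θ => ⟨(h θ).1.antitone, (h θ).2.1.antitone, fun i => ((h θ).2.2.1 i).le,
    fun j => ((h θ).2.2.2 j).le⟩

/-- Exchange argument. For two ads of a type matched in the wrong order, the two tight edges
together with the nonnegative slacks of the exchanged edges contradict the strict monotonicity of
values and discounts. A free ad before a matched one contradicts it in the same way, since its dual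
is `0`. -/
theorem Instance.IsDual.sorted {I : Instance k n} (hI : I.IsStrict) {M : Finset (Edge k n)}
    {u : Ad k n → ℝ} {p : Fin n → ℝ} (hd : I.IsDual M u p) (hm : IsMatching M) : Sorted M := by
  constructor
  · rintro ⟨θ, i⟩ ⟨θ', i'⟩ j l h1 h2 h12 hlt
    obtain rfl : θ = θ' := h12
    simp only at hlt
    by_contra hlj
    have hlj : l ≤ j := not_lt.1 hlj
    have hne : l ≠ j := by
      rintro rfl
      have := hm.ad_eq h1 h2
      simp only [Prod.mk.injEq, true_and] at this
      omega
    have e1 := hd.tight _ _ h1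
    have e2 := hd.tight _ _ h2
    have e3 := hd.nonneg (θ, i) l
    have e4 := hd.nonneg (θ, i') j
    have h5 := (hI θ).1 hlt
    have h6 := (hI θ).2.1 (lt_of_le_of_ne hlj hne)
    simp only [Instance.slack, Instance.w] at e1 e2 e3 e4
    nlinarith [mul_pos (sub_pos.2 h5) (sub_pos.2 h6)]
  · rintro ⟨θ, i⟩ ⟨θ', i'⟩ h12 hle ⟨l, hl⟩
    obtain rfl : θ = θ' := h12
    simp only at hle
    by_contra hn
    have hne : i ≠ i' := by rintro rfl; exact hn ⟨l, hl⟩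
    have e1 := hd.tight _ _ hl
    have e2 := hd.free _ hn
    have e3 := hd.nonneg (θ, i) l
    have e4 := hd.ads_nonneg (θ, i')
    have h5 := (hI θ).1 (lt_of_le_of_ne hle hne)
    have h6 := (hI θ).2.2.2 l
    simp only [Instance.slack, Instance.w] at e1 e3
    nlinarith [mul_pos (sub_pos.2 h5) h6]

theorem mem_treeAds {B : Finset (Edge k n)} {a : Ad k n} : a ∈ treeAds B ↔ ∃ j, (a, j) ∈ B := by
  simp [treeAds]

theorem mem_treeSlots {B : Finset (Edge k n)} {r j : Fin n} :
    j ∈ treeSlots r B ↔ j = r ∨ ∃ a, (a, j) ∈ B := by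
  simp [treeSlots]

theorem root_mem_treeSlots {B : Finset (Edge k n)} {r : Fin n} : r ∈ treeSlots r B :=
  mem_treeSlots.2 (Or.inl rfl)

theorem mem_scanSet {M : Finset (Edge k n)} {j : Fin n} {a : Ad k n} : a ∈ scanSet M j ↔
    (¬ Matched M a ∧ ∀ i < a.2, Matched M (a.1, i)) ∨
    ((∃ l < j, (a, l) ∈ M) ∧ ∀ i > a.2, ¬ ∃ l < j, ((a.1, i), l) ∈ M) ∨
    ((∃ l > j, (a, l) ∈ M) ∧ ∀ i < a.2, ¬ ∃ l > j, ((a.1, i), l) ∈ M) := by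
  simp [scanSet]

/-- The combinatorial structure of the alternating tree. -/
structure IsTree (M B : Finset (Edge k n)) (r : Fin n) : Prop where
  mate_mem : ∀ a j, a ∈ treeAds B → (a, j) ∈ M → (a, j) ∈ B
  slot_mate : ∀ j ∈ treeSlots r B, j = r ∨ ∃ a, (a, j) ∈ M ∧ (a, j) ∈ B
  parent : ∀ a ∈ treeAds B, ∃ j, (a, j) ∈ B ∧ (a, j) ∉ M
  parent_unique : ∀ a j l, (a, j) ∈ B → (a, j) ∉ M → (a, l) ∈ B → (a, l) ∉ M → j = l
  depth : ∃ d : Ad k n → ℕ, ∀ a b j, (a, j) ∈ B → (a, j) ∉ M → (b, j) ∈ M → d b < d a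

theorem isTree_empty (M : Finset (Edge k n)) (r : Fin n) : IsTree M ∅ r where
  mate_mem := by simp [treeAds]
  slot_mate := by simp [treeSlots]
  parent := by simp [treeAds]
  parent_unique := by simp
  depth := ⟨fun _ => 0, by simp⟩

/-- A tree grows by an edge from a tree slot to a new ad, together with the mate of this ad. -/
theorem IsTree.extend {M B B' : Finset (Edge k n)} {r j : Fin n} {a : Ad k n} (h : IsTree M B r)
    (hm : IsMatching M) (hr : ∀ b, (b, r) ∉ M) (hj : j ∈ treeSlots r B) (ha : a ∉ treeAds B)
    (hB : ∀ e, e ∈ B' ↔ e = (a, j) ∨ (e.1 = a ∧ e ∈ M) ∨ e ∈ B) : IsTree M B' r := by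
  classical
  have hads : ∀ b, b ∈ treeAds B' ↔ b = a ∨ b ∈ treeAds B := by
    intro b
    simp only [mem_treeAds, hB, Prod.mk.injEq]
    constructor
    · rintro ⟨l, h | h | h⟩
      exacts [Or.inl h.1, Or.inl h.1, Or.inr ⟨l, h⟩]
    · rintro (h | ⟨l, h⟩)
      exacts [⟨j, Or.inl ⟨h, rfl⟩⟩, ⟨l, Or.inr (Or.inr h)⟩]
  have hB1 : ∀ l, (a, l) ∉ B := fun l hl => ha (mem_treeAds.2 ⟨l, hl⟩)
  have hjM : (a, j) ∉ M := by
    intro hM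
    rcases h.slot_mate j hj with rfl | ⟨b, h1, h2⟩
    · exact hr _ hM
    · rw [hm.ad_eq h1 hM] at h2; exact hB1 _ h2
  refine ⟨?_, ?_, ?_, ?_, ?_⟩
  · intro b l hb hl
    rcases (hads b).1 hb with rfl | hb
    · exact (hB _).2 (Or.inr (Or.inl ⟨rfl, hl⟩))
    · exact (hB _).2 (Or.inr (Or.inr (h.mate_mem b l hb hl)))
  · intro l hl
    have old : l ∈ treeSlots r B → l = r ∨ ∃ a, (a, l) ∈ M ∧ (a, l) ∈ B' := fun hl =>
      (h.slot_mate l hl).imp id fun ⟨b, h1, h2⟩ => ⟨b, h1, (hB _).2 (Or.inr (Or.inr h2))⟩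
    rcases mem_treeSlots.1 hl with rfl | ⟨b, hb⟩
    · exact Or.inl rfl
    rcases (hB _).1 hb with hb | ⟨h1, h2⟩ | h1
    · simp only [Prod.mk.injEq] at hb
      exact old (hb.2 ▸ hj)
    · exact Or.inr ⟨b, h2, hb⟩
    · exact old (mem_treeSlots.2 (Or.inr ⟨b, h1⟩))
  · intro b hb
    rcases (hads b).1 hb with rfl | hb
    · exact ⟨j, (hB _).2 (Or.inl rfl), hjM⟩
    · obtain ⟨l, h1, h2⟩ := h.parent b hb
      exact ⟨l, (hB _).2 (Or.inr (Or.inr h1)), h2⟩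
  · intro b l l' h1 h2 h3 h4
    simp only [hB, h2, h4, and_false, false_or, Prod.mk.injEq] at h1 h3
    rcases h1 with ⟨rfl, rfl⟩ | h1 <;> rcases h3 with ⟨h3, rfl⟩ | h3
    · rfl
    · exact absurd h3 (hB1 _)
    · exact absurd (h3 ▸ h1) (hB1 _)
    · exact h.parent_unique b l l' h1 h2 h3 h4
  · obtain ⟨d, hd⟩ := h.depth
    -- The sum bounds every old depth, so the new ad lies deeper than all old ones.
    refine ⟨Function.update d a (1 + ∑ b, d b), ?_⟩
    intro b c l h1 h2 h3
    simp only [hB, h2, and_false, false_or, Prod.mk.injEq] at h1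
    have hc : c ≠ a := by
      rintro rfl
      have : l ∈ treeSlots r B := by
        rcases h1 with ⟨rfl, rfl⟩ | h1
        · exact absurd h3 h2
        · exact mem_treeSlots.2 (Or.inr ⟨_, h1⟩)
      rcases h.slot_mate l this with rfl | ⟨b', h5, h6⟩
      · exact hr _ h3
      · rw [hm.ad_eq h5 h3] at h6; exact hB1 _ h6
    rw [Function.update_of_ne hc]
    rcases h1 with ⟨rfl, rfl⟩ | h1
    · rw [Function.update_self]
      have := Finset.single_le_sum (fun i _ => Nat.zero_le (d i)) (Finset.mem_univ c)
      omega
    · have hb : b ≠ a := by rintro rfl; exact hB1 _ h1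
      rw [Function.update_of_ne hb]
      exact hd b c l h1 h2 h3

/-- Walk towards the root: the parent slot of an ad is the root or is matched to a tree ad of
smaller depth. -/
theorem IsTree.exists_altPath {M B : Finset (Edge k n)} {r : Fin n} (h : IsTree M B r)
    {a : Ad k n} (ha : a ∈ treeAds B) : ∃ A, AltPath M B r a A := by
  obtain ⟨d, hd⟩ := h.depth
  induction hda : d a using Nat.strong_induction_on generalizing a with
  | _ N ih =>
    obtain ⟨j, h1, h2⟩ := h.parent a ha
    rcases h.slot_mate j (mem_treeSlots.2 (Or.inr ⟨a, h1⟩)) with rfl | ⟨b, h3, h4⟩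
    · exact ⟨_, .last a h1 h2⟩
    · obtain ⟨A, hA⟩ := ih (d b) (hda ▸ hd a b j h1 h2 h3) (mem_treeAds.2 ⟨j, h4⟩) rfl
      exact ⟨_, .cons a b j A h1 h2 h4 h3 hA⟩

theorem AltPath.subset {M B : Finset (Edge k n)} {r : Fin n} {a : Ad k n} {A : Finset (Edge k n)}
    (h : AltPath M B r a A) : A ⊆ B := by
  induction h with
  | last a h1 h2 => simpa using h1
  | cons a b j A h1 h2 h3 h4 _ ih =>
    intro e he
    simp only [Finset.mem_insert] at he
    rcases he with rfl | rfl | he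
    exacts [h1, h3, ih he]

/-- The ads on an alternating path do not lie deeper than its first ad. -/
theorem AltPath.depth_le {M B : Finset (Edge k n)} {r : Fin n} {a : Ad k n}
    {A : Finset (Edge k n)} (h : AltPath M B r a A) {d : Ad k n → ℕ}
    (hd : ∀ a b j, (a, j) ∈ B → (a, j) ∉ M → (b, j) ∈ M → d b < d a) :
    ∀ e ∈ A, d e.1 ≤ d a := by
  induction h with
  | last a h1 h2 => simp
  | cons a b j A h1 h2 h3 h4 _ ih =>
    have := hd a b j h1 h2 h4
    intro e he
    simp only [Finset.mem_insert] at he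
    rcases he with rfl | rfl | he
    exacts [le_rfl, this.le, (ih e he).trans this.le]

theorem AltPath.mem_ads {M B : Finset (Edge k n)} {r : Fin n} {a : Ad k n}
    {A : Finset (Edge k n)} (h : AltPath M B r a A) : ∃ j, (a, j) ∈ A ∧ (a, j) ∉ M := by
  cases h with
  | last a h1 h2 => exact ⟨r, by simp, h2⟩
  | cons a b j A h1 h2 => exact ⟨j, by simp, h2⟩

theorem AltPath.depth_lt {M B : Finset (Edge k n)} {r : Fin n} {a : Ad k n}
    {A : Finset (Edge k n)} (h : AltPath M B r a A) {d : Ad k n → ℕ}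
    (hd : ∀ a b j, (a, j) ∈ B → (a, j) ∉ M → (b, j) ∈ M → d b < d a) :
    ∀ b j, (b, j) ∈ A → (b, j) ∈ M → d b < d a := by
  induction h with
  | last a h1 h2 =>
    intro b j hb hM
    exact absurd (Finset.mem_singleton.1 hb ▸ hM) h2
  | cons a b' j A h1 h2 h3 h4 _ ih =>
    intro b l hb hM
    have h7 := hd a b' j h1 h2 h4
    simp only [Finset.mem_insert, Prod.mk.injEq] at hb
    rcases hb with ⟨rfl, rfl⟩ | ⟨rfl, rfl⟩ | hb
    · exact absurd hM h2
    · exact h7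
    · exact (ih b l hb hM).trans h7

/-- The result of augmenting along an alternating path from `a`, after unmatching `a`. -/
structure IsShift (M A N : Finset (Edge k n)) (a : Ad k n) (r : Fin n) : Prop where
  matching : IsMatching N
  ads : ∀ b, Matched N b ↔ b = a ∨ Matched M b
  slots : ∀ j, (∃ b, (b, j) ∈ N) ↔ j = r ∨ ∃ b, b ≠ a ∧ (b, j) ∈ M
  eq : ∀ e, e ∈ N ↔ if e ∈ A then e ∉ M else e ∈ M ∧ e.1 ≠ a

/-- Induction along the path. The tails of an augmenting path start at matched ads, so the claim has
to allow a matched starting ad `a`, whose old edge is then dropped. The depth function guarantees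
that no ad is visited twice. -/
theorem AltPath.exists_isShift {M B : Finset (Edge k n)} {r : Fin n} {a : Ad k n}
    {A : Finset (Edge k n)} (h : AltPath M B r a A) (hm : IsMatching M) (hr : ∀ b, (b, r) ∉ M)
    {d : Ad k n → ℕ} (hd : ∀ a b j, (a, j) ∈ B → (a, j) ∉ M → (b, j) ∈ M → d b < d a) :
    ∃ N, IsShift M A N a r := by
  classical
  induction h with
  | last a h1 h2 =>
    refine ⟨insert (a, r) (M.filter fun e => e.1 ≠ a), ?_, ?_, ?_, ?_⟩
    · rintro ⟨b, j⟩ he ⟨c, l⟩ hf hef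
      simp only [Finset.mem_insert, Prod.mk.injEq, Finset.mem_filter] at he hf hef ⊢
      rcases he with ⟨rfl, rfl⟩ | ⟨he, he'⟩ <;> rcases hf with ⟨rfl, rfl⟩ | ⟨hf, hf'⟩
      · simp
      · rcases hef with rfl | rfl
        exacts [absurd rfl hf', absurd hf (hr _)]
      · rcases hef with rfl | rfl
        exacts [absurd rfl he', absurd he (hr _)]
      · have := hm _ he _ hf hef
        simpa using this
    · intro b
      simp only [Matched, Finset.mem_insert, Prod.mk.injEq, Finset.mem_filter]
      constructor
      · rintro ⟨j, ⟨h, -⟩ | ⟨h, -⟩⟩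
        exacts [Or.inl h, Or.inr ⟨j, h⟩]
      · by_cases hb : b = a
        · exact fun _ => ⟨r, Or.inl ⟨hb, rfl⟩⟩
        · rintro (h | ⟨j, h⟩)
          exacts [absurd h hb, ⟨j, Or.inr ⟨h, hb⟩⟩]
    · intro j
      simp only [Finset.mem_insert, Prod.mk.injEq, Finset.mem_filter]
      constructor
      · rintro ⟨b, ⟨-, h⟩ | ⟨h, h'⟩⟩
        exacts [Or.inl h, Or.inr ⟨b, h', h⟩]
      · rintro (h | ⟨b, h', h⟩)
        exacts [⟨a, Or.inl ⟨rfl, h⟩⟩, ⟨b, Or.inr ⟨h, h'⟩⟩]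
    · intro e
      by_cases he : e = (a, r)
      · subst he; simp [h2]
      · simp [he]
  | cons a b j A h1 h2 h3 h4 hp ih =>
    obtain ⟨N, hN⟩ := ih
    have hdb := hd a b j h1 h2 h4
    have hab : a ≠ b := by rintro rfl; exact lt_irrefl _ hdb
    have haA : ∀ l, (a, l) ∉ A := fun l hl => by
      have := hp.depth_le hd _ hl
      simp only at this
      omega
    have hjr : j ≠ r := by rintro rfl; exact hr _ h4
    have hjN : ∀ c, (c, j) ∉ N := by
      intro c hc
      rcases (hN.slots j).1 ⟨c, hc⟩ with h | ⟨c', h5, h6⟩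
      · exact hjr h
      · exact h5 (hm.ad_eq h6 h4)
    have haN : ∀ l, (a, l) ∈ N ↔ (a, l) ∈ M := fun l => by
      rw [hN.eq]; simp [haA, hab]
    have hbj : (b, j) ∉ A := by
      intro hA
      have : (a, j) ∉ M := h2
      obtain ⟨l, hl⟩ := (hN.ads b).2 (Or.inl rfl)
      have h5 := (hN.eq (b, l)).1 hl
      by_cases h6 : (b, l) ∈ A
      · exact lt_irrefl _ (hp.depth_lt hd b j hA h4)
      · rw [if_neg h6] at h5
        exact h5.2 rfl
    refine ⟨insert (a, j) (N.filter fun e => e.1 ≠ a), ?_, ?_, ?_, ?_⟩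
    · rintro ⟨b, l⟩ he ⟨c, l'⟩ hf hef
      simp only [Finset.mem_insert, Prod.mk.injEq, Finset.mem_filter] at he hf hef ⊢
      rcases he with ⟨rfl, rfl⟩ | ⟨he, he'⟩ <;> rcases hf with ⟨rfl, rfl⟩ | ⟨hf, hf'⟩
      · simp
      · rcases hef with rfl | rfl
        exacts [absurd rfl hf', absurd hf (hjN _)]
      · rcases hef with rfl | rfl
        exacts [absurd rfl he', absurd he (hjN _)]
      · have := hN.matching _ he _ hf hef
        simpa using this
    · intro c
      have h5 := hN.ads c
      by_cases hc : c = a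
      · simp only [hc, true_or, iff_true]
        exact ⟨j, by simp⟩
      · simp only [Matched, Finset.mem_insert, Prod.mk.injEq, hc, false_and, false_or,
          Finset.mem_filter, ne_eq, not_false_eq_true, and_true] at h5 ⊢
        rw [h5]
        constructor
        · rintro (rfl | h)
          exacts [⟨j, h4⟩, h]
        · exact Or.inr
    · intro l
      by_cases hl : l = j
      · subst hl
        simp only [hjr, false_or]
        exact ⟨fun _ => ⟨b, hab.symm, h4⟩, fun _ => ⟨a, by simp⟩⟩
      · have h5 := hN.slots l
        constructor
        · rintro ⟨c, hc⟩
          simp only [Finset.mem_insert, Prod.mk.injEq, hl, and_false, false_or,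
            Finset.mem_filter] at hc
          rcases h5.1 ⟨c, hc.1⟩ with h | ⟨c', h6, h7⟩
          · exact Or.inl h
          · refine Or.inr ⟨c', ?_, h7⟩
            rintro rfl
            exact hc.2 (hN.matching.ad_eq hc.1 ((haN l).2 h7))
        · intro h
          have : ∃ c, (c, l) ∈ N := by
            refine h5.2 (h.imp id ?_)
            rintro ⟨c, h6, h7⟩
            refine ⟨c, ?_, h7⟩
            rintro rfl
            exact hl (hm.slot_eq h7 h4)
          obtain ⟨c, hc⟩ := this
          refine ⟨c, Finset.mem_insert_of_mem (Finset.mem_filter.2 ⟨hc, ?_⟩)⟩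
          rintro rfl
          have hcM := (haN l).1 hc
          rcases h with rfl | ⟨c', h6, h7⟩
          · exact hr _ hcM
          · exact h6 (hm.ad_eq h7 hcM)
    · rintro ⟨c, l⟩
      have h5 := hN.eq (c, l)
      by_cases hc : c = a
      · subst hc
        simp only [Finset.mem_insert, Prod.mk.injEq, true_and, Finset.mem_filter, ne_eq,
          not_true_eq_false, and_false, or_false, hab, false_and, haA]
        by_cases hl : l = j
        · simp [hl, h2]
        · simp [hl]
      · by_cases hb : c = b ∧ l = j
        · obtain ⟨rfl, rfl⟩ := hb
          simp [hc, hjN, h4]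
        · simp only [Finset.mem_insert, Prod.mk.injEq, hc, false_and, false_or, hb,
            Finset.mem_filter, ne_eq, not_false_eq_true, and_true]
          rw [h5]
          by_cases hA : (c, l) ∈ A
          · simp [hA]
          · simp only [hA, if_false, ne_eq, and_iff_left_iff_imp]
            intro hM hcb
            exact hb ⟨hcb, hm.slot_eq hM (hcb ▸ h4)⟩

end AdTypes

/-! ### Invariants of a phase and their preservation -/

namespace AdTypes

variable {k n : ℕ}

/-- The invariants between two phases. -/
structure Instance.Between (I : Instance k n) (s : HState k n) : Prop where
  root : s.root = none
  rest_le : s.rest ≤ n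
  queue : s.P = fun _ => none
  fills : Fills s.M s.rest
  sorted : Sorted s.M
  dual : I.IsDual s.M s.u s.p

/-- The invariants during the phase of the slot `r`. -/
structure Instance.InPhase (I : Instance k n) (s : HState k n) (r : Fin n) : Prop where
  root : s.root = some r
  rest : s.rest = r.val
  fills : Fills s.M (r.val + 1)
  sorted : Sorted s.M
  dual : I.IsDual s.M s.u s.p
  tree : IsTree s.M s.B r
  tree_tight : ∀ e ∈ s.B, I.slack s.u s.p e.1 e.2 = 0
  entry : ∀ a l, s.P a = some l → l ∈ treeSlots r s.B ∧ a ∉ treeAds s.B ∧ ∃ j, a ∈ scanSet s.M j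
  cover : ∀ j ∈ treeSlots r s.B, ∀ a ∈ scanSet s.M j, a ∉ treeAds s.B →
    ∃ l, s.P a = some l ∧ I.slack s.u s.p a l ≤ I.slack s.u s.p a j

/-- Pigeonhole: a type has as many ads as there are slots, and the slot `0` is still unmatched
because `0 < b`. -/
theorem Fills.exists_first_free {M : Finset (Edge k n)} {b : ℕ} (hf : Fills M b) (hb : 0 < b)
    (hn : 0 < n) (θ : Fin k) :
    ∃ i : Fin n, ¬ Matched M (θ, i) ∧ ∀ i' < i, Matched M (θ, i') := by
  classical
  have : ∃ i : Fin n, ¬ Matched M (θ, i) := by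
    by_contra hcon
    push Not at hcon
    choose f hfM using hcon
    have hinj : Function.Injective f := fun i i' h => by
      have h1 := hfM i; rw [h] at h1
      have := hf.matching.ad_eq h1 (hfM i')
      simpa using this
    obtain ⟨i, hi⟩ := (Finite.injective_iff_surjective.1 hinj) ⟨0, hn⟩
    have h1 := (hf.slots (f i)).1 ⟨_, hfM i⟩
    rw [hi] at h1
    simp at h1
    omega
  obtain ⟨i, hi, hmin⟩ := WellFounded.has_min (wellFounded_lt (α := Fin n))
    {i | ¬ Matched M (θ, i)} this
  exact ⟨i, hi, fun i' h => by_contra fun h' => hmin i' h' h⟩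

/-- Going through an intermediate ad of the same type never increases the total slack. -/
theorem Instance.IsMonotone.slack_detour {I : Instance k n} (hI : I.IsMonotone) {u : Ad k n → ℝ}
    {p : Fin n → ℝ} {b c : Ad k n} {l m : Fin n} (hbc : b.1 = c.1)
    (ht : I.slack u p c m = 0) (h : (b.2 ≤ c.2 ∧ m ≤ l) ∨ (c.2 ≤ b.2 ∧ l ≤ m)) :
    I.slack u p c l + I.slack u p b m ≤ I.slack u p b l := by
  obtain ⟨θ, i⟩ := b
  obtain ⟨θ', i'⟩ := c
  obtain rfl : θ = θ' := hbc
  simp only [Instance.slack, Instance.w] at *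
  rcases h with ⟨h1, h2⟩ | ⟨h1, h2⟩
  · nlinarith [mul_nonneg (sub_nonneg.2 ((hI θ).1 h1)) (sub_nonneg.2 ((hI θ).2.1 h2))]
  · nlinarith [mul_nonneg (sub_nonneg.2 ((hI θ).1 h1)) (sub_nonneg.2 ((hI θ).2.1 h2))]

theorem Instance.InPhase.root_free {I : Instance k n} {s : HState k n} {r : Fin n}
    (h : I.InPhase s r) (b : Ad k n) : (b, r) ∉ s.M := fun hb => by
  have := (h.fills.slots r).1 ⟨b, hb⟩
  omega

theorem Instance.InPhase.not_free_of_mem {I : Instance k n} {s : HState k n} {r : Fin n}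
    (h : I.InPhase s r) (hA : ¬ ∃ A, IsAugmenting s.M s.B r A) {a : Ad k n}
    (ha : a ∈ treeAds s.B) : Matched s.M a := by
  by_contra hn
  obtain ⟨A, hp⟩ := h.tree.exists_altPath ha
  exact hA ⟨A, a, hn, hp⟩

theorem Instance.InPhase.mem_treeSlots_iff {I : Instance k n} {s : HState k n} {r : Fin n}
    (h : I.InPhase s r) {a : Ad k n} {j : Fin n} (haj : (a, j) ∈ s.M) :
    j ∈ treeSlots r s.B ↔ a ∈ treeAds s.B := by
  constructor
  · intro hj
    rcases h.tree.slot_mate j hj with rfl | ⟨b, h1, h2⟩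
    · exact absurd haj (h.root_free a)
    · rw [h.fills.matching.ad_eq haj h1]
      exact mem_treeAds.2 ⟨j, h2⟩
  · intro ha
    exact mem_treeSlots.2 (Or.inr ⟨a, h.tree.mate_mem a j ha haj⟩)

/-- Every edge that leaves the tree is dominated by an entry of the queue. -/
theorem Instance.InPhase.exists_entry {I : Instance k n} (hI : I.IsMonotone) {s : HState k n}
    {r : Fin n} (h : I.InPhase s r) (hA : ¬ ∃ A, IsAugmenting s.M s.B r A) {b : Ad k n}
    {l : Fin n} (hb : b ∉ treeAds s.B) (hl : l ∈ treeSlots r s.B) :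
    ∃ c x, s.P c = some x ∧ I.slack s.u s.p c x ≤ I.slack s.u s.p b l := by
  classical
  have hn : 0 < n := Fin.pos r
  by_cases hbM : Matched s.M b
  swap
  -- Free ads have dual `0`, so among those of one type the first has the smallest slack at every
  -- slot.
  · obtain ⟨i, hi, hmin⟩ := h.fills.exists_first_free (Nat.succ_pos _) hn b.1
    have hib : i ≤ b.2 := by
      by_contra hlt
      exact hbM (hmin b.2 (not_le.1 hlt))
    have hT : (b.1, i) ∉ treeAds s.B := fun hT => hi (h.not_free_of_mem hA hT)
    obtain ⟨x, hx, hle⟩ := h.cover l hl (b.1, i) (mem_scanSet.2 (Or.inl ⟨hi, hmin⟩)) hT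
    refine ⟨_, x, hx, hle.trans ?_⟩
    have h1 := h.dual.free _ hi
    have h2 := h.dual.free _ hbM
    have h3 := (hI b.1).1 hib
    have h4 := (hI b.1).2.2.2 l
    simp only [Instance.slack, Instance.w, h1, h2]
    nlinarith
  · obtain ⟨m, hm⟩ := hbM
    -- With `b` and its slot `m` fixed, the tree slot `l` moves closer to `m`.
    induction hN : ((l : ℤ) - m).natAbs using Nat.strong_induction_on generalizing l with
    | _ N ih =>
      have hml : m ≠ l := by
        rintro rfl
        exact hb ((h.mem_treeSlots_iff hm).1 hl)
      -- a scanned ad of the same type whose slot lies between `m` and `l`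
      have key : ∃ c m', c ∈ scanSet s.M l ∧ (c, m') ∈ s.M ∧ b.1 = c.1 ∧
          ((b.2 ≤ c.2 ∧ m' ≤ l) ∨ (c.2 ≤ b.2 ∧ l ≤ m')) ∧
          (c ≠ b → ((l : ℤ) - m').natAbs < ((l : ℤ) - m).natAbs ∧
            ((m' : ℤ) - m).natAbs < ((l : ℤ) - m).natAbs) := by
        rcases lt_or_gt_of_ne hml with hlt | hlt
        · let S := Finset.univ.filter fun i : Fin n => ∃ l' < l, ((b.1, i), l') ∈ s.M
          have hbS : b.2 ∈ S := by simpa [S] using ⟨m, hlt, hm⟩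
          have hmax := S.max'_mem ⟨_, hbS⟩
          have hle := S.le_max' _ hbS
          set i := S.max' ⟨_, hbS⟩ with hi
          obtain ⟨m', h1, h2⟩ : ∃ l' < l, ((b.1, i), l') ∈ s.M := by simpa [S] using hmax
          refine ⟨(b.1, i), m', mem_scanSet.2 (Or.inr (Or.inl ⟨⟨m', h1, h2⟩, ?_⟩)), h2, rfl,
            Or.inl ⟨hle, h1.le⟩, ?_⟩
          · intro i' hi' hex
            exact absurd (S.le_max' i' (by simpa [S] using hex)) (not_le.2 hi')
          · intro hne
            have : b.2 < i := lt_of_le_of_ne hle fun h => hne (Prod.ext rfl h.symm)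
            have := h.sorted.order _ _ _ _ hm h2 rfl this
            simp only [Fin.lt_def] at *
            omega
        · let S := Finset.univ.filter fun i : Fin n => ∃ l' > l, ((b.1, i), l') ∈ s.M
          have hbS : b.2 ∈ S := by simpa [S] using ⟨m, hlt, hm⟩
          have hmin := S.min'_mem ⟨_, hbS⟩
          have hle := S.min'_le _ hbS
          set i := S.min' ⟨_, hbS⟩ with hi
          obtain ⟨m', h1, h2⟩ : ∃ l' > l, ((b.1, i), l') ∈ s.M := by simpa [S] using hmin
          refine ⟨(b.1, i), m', mem_scanSet.2 (Or.inr (Or.inr ⟨⟨m', h1, h2⟩, ?_⟩)), h2, rfl,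
            Or.inr ⟨hle, h1.le⟩, ?_⟩
          · intro i' hi' hex
            exact absurd (S.min'_le i' (by simpa [S] using hex)) (not_le.2 hi')
          · intro hne
            have : i < b.2 := lt_of_le_of_ne hle fun h => hne (Prod.ext rfl h)
            have := h.sorted.order _ _ _ _ h2 hm rfl this
            simp only [Fin.lt_def, gt_iff_lt] at *
            omega
      obtain ⟨c, m', hc, hcM, htype, hpos, hdist⟩ := key
      have hdet := hI.slack_detour htype (h.dual.tight c m' hcM) hpos
      -- If `c` is in the tree, then so is its slot `m'`, and the edge from `m'` to `b` has no
      -- larger slack by the detour inequality. Otherwise the entry of `c` is already good enough.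
      by_cases hcT : c ∈ treeAds s.B
      · have hne : c ≠ b := by rintro rfl; exact hb hcT
        obtain ⟨c', x, h1, h2⟩ := ih _ (hN ▸ (hdist hne).2)
          ((h.mem_treeSlots_iff hcM).2 hcT) rfl
        refine ⟨c', x, h1, h2.trans ?_⟩
        have := h.dual.nonneg c l
        linarith
      · obtain ⟨x, hx, hle⟩ := h.cover l hl c hc hcT
        refine ⟨c, x, hx, hle.trans ?_⟩
        have := h.dual.nonneg b m'
        linarith

theorem Instance.InPhase.slack_le {I : Instance k n} (hI : I.IsMonotone) {s : HState k n}
    {r : Fin n} (h : I.InPhase s r) (hA : ¬ ∃ A, IsAugmenting s.M s.B r A) {a b : Ad k n}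
    {j l : Fin n} (hnext : I.IsNext s a j) (hb : b ∉ treeAds s.B) (hl : l ∈ treeSlots r s.B) :
    I.slack s.u s.p a j ≤ I.slack s.u s.p b l := by
  obtain ⟨c, x, h1, h2⟩ := h.exists_entry hI hA hb hl
  exact (hnext.2 c x h1).trans h2

/-- The dual variables are updated by the smallest slack of an edge leaving the tree. -/
theorem Instance.InPhase.isDual_update {I : Instance k n} (hI : I.IsMonotone) (hk : 0 < k)
    {s : HState k n} {r : Fin n} (h : I.InPhase s r) (hA : ¬ ∃ A, IsAugmenting s.M s.B r A)
    {δ : ℝ} (hδ : 0 ≤ δ)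
    (hmin : ∀ b l, b ∉ treeAds s.B → l ∈ treeSlots r s.B → δ ≤ I.slack s.u s.p b l) :
    I.IsDual s.M (newU s δ) (newP s r δ) := by
  have hnn : ∀ a j, 0 ≤ I.slack (newU s δ) (newP s r δ) a j := by
    intro a j
    have h1 := h.dual.nonneg a j
    have h2 := hmin a j
    simp only [Instance.slack, newU, newP] at *
    split_ifs with h3 h4 h4
    · linarith
    · linarith
    · linarith [h2 h3 h4]
    · linarith
  have hfree : ∀ a, ¬ Matched s.M a → newU s δ a = 0 := by
    intro a ha
    have : a ∉ treeAds s.B := fun hT => ha (h.not_free_of_mem hA hT)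
    simp [newU, this, h.dual.free a ha]
  refine ⟨hnn, ?_, hfree, ?_, ?_⟩
  · intro a j haj
    have h1 := h.dual.tight a j haj
    have h2 := h.mem_treeSlots_iff haj
    simp only [Instance.slack, newU, newP, h2] at *
    split_ifs <;> linarith
  · intro a
    have := h.dual.ads_nonneg a
    simp only [newU]
    split_ifs <;> linarith
  · intro j
    -- A price cannot become negative because some ad is still free: its dual is `0` and its slack
    -- at `j` is nonnegative, so the price of `j` is at least the weight of that edge.
    obtain ⟨i, hi, -⟩ := h.fills.exists_first_free (Nat.succ_pos _) (Fin.pos r) ⟨0, hk⟩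
    have h1 := hfree _ hi
    have h2 := hnn (⟨0, hk⟩, i) j
    have h3 := (hI ⟨0, hk⟩).2.2.1 i
    have h4 := (hI ⟨0, hk⟩).2.2.2 j
    simp only [Instance.slack, Instance.w, h1] at h2
    nlinarith [mul_nonneg h3 h4]

theorem Instance.updateQueue_eq_some {I : Instance k n} {M B : Finset (Edge k n)}
    {u : Ad k n → ℝ} {p : Fin n → ℝ} {P : Ad k n → Option (Fin n)} {j l : Fin n} {a : Ad k n}
    (h : I.updateQueue M B u p P j a = some l) :
    P a = some l ∨ (l = j ∧ a ∈ scanSet M j ∧ a ∉ treeAds B) := by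
  simp only [Instance.updateQueue] at h
  split_ifs at h with h1
  · exact Or.inr ⟨(Option.some.inj h).symm, h1.1, h1.2.1⟩
  · exact Or.inl h

theorem Instance.updateQueue_self {I : Instance k n} {M B : Finset (Edge k n)}
    {u : Ad k n → ℝ} {p : Fin n → ℝ} {P : Ad k n → Option (Fin n)} {j : Fin n} {a : Ad k n}
    (h1 : a ∈ scanSet M j) (h2 : a ∉ treeAds B) :
    ∃ l, I.updateQueue M B u p P j a = some l ∧ I.slack u p a l ≤ I.slack u p a j := by
  simp only [Instance.updateQueue, h1, h2, not_false_eq_true, true_and]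
  split_ifs with h
  · exact ⟨j, rfl, le_rfl⟩
  · push Not at h
    exact h

theorem Instance.updateQueue_of_some {I : Instance k n} {M B : Finset (Edge k n)}
    {u : Ad k n → ℝ} {p : Fin n → ℝ} {P : Ad k n → Option (Fin n)} {j l : Fin n} {a : Ad k n}
    (h : P a = some l) :
    ∃ l', I.updateQueue M B u p P j a = some l' ∧ I.slack u p a l' ≤ I.slack u p a l := by
  simp only [Instance.updateQueue]
  split_ifs with h1
  · exact ⟨j, rfl, (h1.2.2 l h).le⟩
  · exact ⟨l, h, le_rfl⟩

theorem Instance.Between.enter {I : Instance k n} {s : HState k n} (h : I.Between s) {r : Fin n}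
    (hr : s.rest = r.val + 1) : I.InPhase { s with
        rest := r.val
        root := some r
        B := ∅
        P := I.updateQueue s.M ∅ s.u s.p (fun _ => none) r } r where
  root := rfl
  rest := rfl
  fills := hr ▸ h.fills
  sorted := h.sorted
  dual := h.dual
  tree := isTree_empty _ _
  tree_tight := by simp
  entry := by
    intro a l hal
    dsimp only at hal ⊢
    rcases Instance.updateQueue_eq_some hal with h1 | ⟨rfl, h1, h2⟩
    · simp at h1
    · exact ⟨root_mem_treeSlots, h2, l, h1⟩
  cover := by
    intro j hj a ha hT
    obtain rfl : j = r := by simpa [treeSlots] using hj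
    dsimp only at ha hT ⊢
    exact Instance.updateQueue_self ha hT

/-- The part of the invariant that the steps `grow` and `reach` have in common. -/
theorem Instance.InPhase.extend {I : Instance k n} (hI : I.IsMonotone) (hk : 0 < k)
    {s : HState k n} {r : Fin n} (h : I.InPhase s r) (hA : ¬ ∃ A, IsAugmenting s.M s.B r A)
    {a : Ad k n} {j : Fin n} {δ : ℝ} (hnext : I.IsNext s a j) (hδ : δ = I.slack s.u s.p a j)
    {B : Finset (Edge k n)} (hB : ∀ e, e ∈ B ↔ e = (a, j) ∨ (e.1 = a ∧ e ∈ s.M) ∨ e ∈ s.B) :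
    I.IsDual s.M (newU s δ) (newP s r δ) ∧ IsTree s.M B r ∧
      ∀ e ∈ B, I.slack (newU s δ) (newP s r δ) e.1 e.2 = 0 := by
  obtain ⟨hj, ha, -⟩ := h.entry a j hnext.1
  have hd := h.isDual_update hI hk hA (δ := δ) (hδ ▸ h.dual.nonneg a j)
    (fun b l hb hl => hδ ▸ h.slack_le hI hA hnext hb hl)
  refine ⟨hd, h.tree.extend h.fills.matching h.root_free hj ha hB, ?_⟩
  intro e he
  rcases (hB e).1 he with rfl | ⟨h1, h2⟩ | h1
  · simp only [Instance.slack, newU, newP, ha, hj, if_true, if_false] at *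
    linarith
  · exact hd.tight e.1 e.2 h2
  · have h2 : e.1 ∈ treeAds s.B := mem_treeAds.2 ⟨e.2, h1⟩
    have h3 : e.2 ∈ treeSlots r s.B := mem_treeSlots.2 (Or.inr ⟨e.1, h1⟩)
    have h4 := h.tree_tight e h1
    simp only [Instance.slack, newU, newP, h2, h3, if_true] at *
    linarith

theorem mem_treeAds_extend {M B B' : Finset (Edge k n)} {a b : Ad k n} {j : Fin n}
    (hB : ∀ e, e ∈ B' ↔ e = (a, j) ∨ (e.1 = a ∧ e ∈ M) ∨ e ∈ B) :
    b ∈ treeAds B' ↔ b = a ∨ b ∈ treeAds B := by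
  simp only [mem_treeAds, hB, Prod.mk.injEq]
  constructor
  · rintro ⟨l, h | h | h⟩
    exacts [Or.inl h.1, Or.inl h.1, Or.inr ⟨l, h⟩]
  · rintro (h | ⟨l, h⟩)
    exacts [⟨j, Or.inl ⟨h, rfl⟩⟩, ⟨l, Or.inr (Or.inr h)⟩]

theorem mem_treeSlots_extend {M B B' : Finset (Edge k n)} {a : Ad k n} {r j l : Fin n}
    (hB : ∀ e, e ∈ B' ↔ e = (a, j) ∨ (e.1 = a ∧ e ∈ M) ∨ e ∈ B) (hj : j ∈ treeSlots r B) :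
    l ∈ treeSlots r B' ↔ (a, l) ∈ M ∨ l ∈ treeSlots r B := by
  simp only [mem_treeSlots, hB, Prod.mk.injEq] at hj ⊢
  constructor
  · rintro (h | ⟨b, h | h | h⟩)
    · exact Or.inr (Or.inl h)
    · exact Or.inr (h.2 ▸ hj)
    · exact Or.inl (h.1 ▸ h.2)
    · exact Or.inr (Or.inr ⟨b, h⟩)
  · rintro (h | h | ⟨b, h⟩)
    · exact Or.inr ⟨a, Or.inr (Or.inl ⟨rfl, h⟩)⟩
    · exact Or.inl h
    · exact Or.inr ⟨b, Or.inr (Or.inr h)⟩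

theorem slack_update {I : Instance k n} {s : HState k n} {r : Fin n} {δ : ℝ} {b : Ad k n}
    {l : Fin n} (hb : b ∉ treeAds s.B) (hl : l ∈ treeSlots r s.B) :
    I.slack (newU s δ) (newP s r δ) b l = I.slack s.u s.p b l - δ := by
  simp only [Instance.slack, newU, newP, hb, hl, if_true, if_false]; ring

theorem Fills.grow_mem_iff {M B : Finset (Edge k n)} {b : ℕ} (hf : Fills M b) {a : Ad k n}
    {j m : Fin n} (ham : (a, m) ∈ M) (e : Edge k n) :
    e ∈ insert (a, j) (insert (a, m) B) ↔ e = (a, j) ∨ (e.1 = a ∧ e ∈ M) ∨ e ∈ B := by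
  obtain ⟨c, l⟩ := e
  simp only [Finset.mem_insert, Prod.mk.injEq]
  constructor
  · rintro (h | ⟨rfl, rfl⟩ | h)
    exacts [Or.inl h, Or.inr (Or.inl ⟨rfl, ham⟩), Or.inr (Or.inr h)]
  · rintro (h | ⟨rfl, h⟩ | h)
    exacts [Or.inl h, Or.inr (Or.inl ⟨rfl, hf.matching.slot_eq h ham⟩), Or.inr (Or.inr h)]

/-- All old entries join a tree slot to an ad outside the tree, so the dual update lowers their
slacks by the same amount and keeps their comparisons. Edges from the new slot `m` are handled by
its scan. -/
theorem Instance.InPhase.grow {I : Instance k n} (hI : I.IsMonotone) (hk : 0 < k)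
    {s : HState k n} {r : Fin n} (h : I.InPhase s r) (hA : ¬ ∃ A, IsAugmenting s.M s.B r A)
    {a : Ad k n} {j m : Fin n} {δ : ℝ} (hnext : I.IsNext s a j)
    (hδ : δ = I.slack s.u s.p a j) (ham : (a, m) ∈ s.M) :
    I.InPhase { s with
        u := newU s δ
        p := newP s r δ
        B := insert (a, j) (insert (a, m) s.B)
        P := I.updateQueue s.M (insert (a, j) (insert (a, m) s.B)) (newU s δ) (newP s r δ)
          (Function.update s.P a none) m } r := by
  have hB := h.fills.grow_mem_iff (B := s.B) (j := j) ham
  obtain ⟨hj, ha, -⟩ := h.entry a j hnext.1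
  obtain ⟨h1, h2, h3⟩ := h.extend hI hk hA hnext hδ hB
  refine ⟨h.root, h.rest, h.fills, h.sorted, h1, h2, h3, ?_, ?_⟩
  · intro b l hbl
    simp only [mem_treeSlots_extend hB hj]
    rcases Instance.updateQueue_eq_some hbl with h4 | ⟨rfl, h4, h5⟩
    · by_cases hba : b = a
      · simp [hba] at h4
      · rw [Function.update_of_ne hba] at h4
        obtain ⟨h5, h6, h7⟩ := h.entry b l h4
        refine ⟨Or.inr h5, ?_, h7⟩
        rw [mem_treeAds_extend hB]
        simp [hba, h6]
    · exact ⟨Or.inl ham, h5, l, h4⟩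
  · intro l hl b hb hT
    simp only [mem_treeSlots_extend hB hj] at hl
    by_cases hlm : l = m
    · subst hlm
      exact Instance.updateQueue_self hb hT
    · rcases hl with hl | hl
      · exact absurd (h.fills.matching.slot_eq hl ham) hlm
      · have hT' := hT
        simp only [mem_treeAds_extend hB, not_or] at hT'
        obtain ⟨x, hx, hle⟩ := h.cover l hl b hb hT'.2
        obtain ⟨x', hx', hle'⟩ := Instance.updateQueue_of_some (I := I) (M := s.M)
          (B := insert (a, j) (insert (a, m) s.B)) (u := newU s δ) (p := newP s r δ)
          (P := Function.update s.P a none) (j := m) (a := b) (l := x)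
          (by rw [Function.update_of_ne hT'.1, hx])
        refine ⟨x', hx', hle'.trans ?_⟩
        rw [slack_update hT'.2 hl, slack_update hT'.2 (h.entry b x hx).1]
        linarith

theorem reach_mem_iff {M B : Finset (Edge k n)} {a : Ad k n} {j : Fin n} (ha : ¬ Matched M a)
    (e : Edge k n) : e ∈ insert (a, j) B ↔ e = (a, j) ∨ (e.1 = a ∧ e ∈ M) ∨ e ∈ B := by
  obtain ⟨c, l⟩ := e
  simp only [Finset.mem_insert, Prod.mk.injEq]
  constructor
  · rintro (h | h)
    exacts [Or.inl h, Or.inr (Or.inr h)]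
  · rintro (h | ⟨rfl, h⟩ | h)
    exacts [Or.inl h, absurd ⟨l, h⟩ ha, Or.inr h]

theorem Instance.InPhase.reach {I : Instance k n} (hI : I.IsMonotone) (hk : 0 < k)
    {s : HState k n} {r : Fin n} (h : I.InPhase s r) (hA : ¬ ∃ A, IsAugmenting s.M s.B r A)
    {a : Ad k n} {j : Fin n} {δ : ℝ} (hnext : I.IsNext s a j)
    (hδ : δ = I.slack s.u s.p a j) (ha : ¬ Matched s.M a) :
    I.InPhase { s with
        u := newU s δ
        p := newP s r δ
        B := insert (a, j) s.B
        P := Function.update s.P a none } r := by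
  have hB := reach_mem_iff (B := s.B) (j := j) ha
  obtain ⟨hj, haT, -⟩ := h.entry a j hnext.1
  obtain ⟨h1, h2, h3⟩ := h.extend hI hk hA hnext hδ hB
  refine ⟨h.root, h.rest, h.fills, h.sorted, h1, h2, h3, ?_, ?_⟩
  · intro b l h4
    simp only [mem_treeSlots_extend hB hj]
    by_cases hba : b = a
    · simp [hba] at h4
    · simp only [Function.update_of_ne hba] at h4
      obtain ⟨h5, h6, h7⟩ := h.entry b l h4
      refine ⟨Or.inr h5, ?_, h7⟩
      rw [mem_treeAds_extend hB]
      simp [hba, h6]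
  · intro l hl b hb hT
    simp only [mem_treeSlots_extend hB hj] at hl
    rcases hl with hl | hl
    · exact absurd ⟨l, hl⟩ ha
    · have hT' := hT
      simp only [mem_treeAds_extend hB, not_or] at hT'
      obtain ⟨x, hx, hle⟩ := h.cover l hl b hb hT'.2
      refine ⟨x, by simp only [Function.update_of_ne hT'.1, hx], ?_⟩
      simp only
      rw [slack_update hT'.2 hl, slack_update hT'.2 (h.entry b x hx).1]
      linarith

/-- Augmenting gives a matching that covers one more slot and is tight. -/
theorem Instance.InPhase.augment {I : Instance k n} {s : HState k n} {r : Fin n}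
    (h : I.InPhase s r) {A : Finset (Edge k n)} (hA : IsAugmenting s.M s.B r A) :
    Fills (symmDiff s.M A) r.val ∧ I.IsDual (symmDiff s.M A) s.u s.p := by
  obtain ⟨a, ha, hp⟩ := hA
  obtain ⟨d, hd⟩ := h.tree.depth
  obtain ⟨N, hN⟩ := hp.exists_isShift h.fills.matching h.root_free hd
  -- A free starting ad has no edge to be dropped, hence the shift is the symmetric difference.
  have hNe : symmDiff s.M A = N := by
    ext e
    rw [hN.eq, Finset.mem_symmDiff]
    by_cases heA : e ∈ A
    · simp [heA]
    · simp only [heA, not_false_eq_true, and_true, false_and, or_false, if_false]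
      refine ⟨fun he => ⟨he, ?_⟩, fun he => he.1⟩
      rintro rfl
      exact ha ⟨e.2, he⟩
  rw [hNe]
  refine ⟨⟨hN.matching, fun j => ?_⟩, ?_⟩
  · rw [hN.slots]
    have h1 := h.fills.slots j
    constructor
    · rintro (rfl | ⟨b, -, hb⟩)
      · exact le_rfl
      · have := h1.1 ⟨b, hb⟩; omega
    · intro hj
      by_cases hjr : j = r
      · exact Or.inl hjr
      · have : r.val ≠ j.val := fun h => hjr (Fin.ext h.symm)
        obtain ⟨b, hb⟩ := h1.2 (by omega)
        exact Or.inr ⟨b, fun hba => ha ⟨j, hba ▸ hb⟩, hb⟩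
  · refine ⟨h.dual.nonneg, ?_, ?_, h.dual.ads_nonneg, h.dual.slots_nonneg⟩
    · intro b j hb
      rw [hN.eq] at hb
      split_ifs at hb with h1
      · exact h.tree_tight _ (hp.subset h1)
      · exact h.dual.tight b j hb.1
    · intro b hb
      rw [hN.ads] at hb
      push Not at hb
      exact h.dual.free b hb.2

/-- Send a matched ad to its slot and a free ad to its type. This is injective because a free ad in
the queue comes from a scan and so is the first free one of its type. -/
theorem Instance.InPhase.card_queue_aux {M : Finset (Edge k n)} {b : ℕ} (hf : Fills M b)
    {P : Ad k n → Option (Fin n)} (hP : ∀ a l, P a = some l → ∃ j, a ∈ scanSet M j)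
    (Q : Finset (Ad k n)) (hQ : ∀ a ∈ Q, P a ≠ none) : Q.card ≤ n + k := by
  classical
  have hfun : ∀ a : Ad k n, ∃ x : Fin n ⊕ Fin k,
      (Matched M a → ∃ j, x = Sum.inl j ∧ (a, j) ∈ M) ∧ (¬ Matched M a → x = Sum.inr a.1) := by
    intro a
    by_cases ha : Matched M a
    · obtain ⟨j, hj⟩ := ha
      exact ⟨Sum.inl j, fun _ => ⟨j, rfl, hj⟩, fun h => absurd ⟨j, hj⟩ h⟩
    · exact ⟨Sum.inr a.1, fun h => absurd h ha, fun _ => rfl⟩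
  choose f hf1 hf2 using hfun
  have hfirst : ∀ a ∈ Q, ¬ Matched M a → ∀ i < a.2, Matched M (a.1, i) := by
    intro a ha hM
    obtain ⟨l, hl⟩ := Option.ne_none_iff_exists'.1 (hQ a ha)
    obtain ⟨j, hj⟩ := hP a l hl
    rcases mem_scanSet.1 hj with h | ⟨⟨l, -, h⟩, -⟩ | ⟨⟨l, -, h⟩, -⟩
    exacts [h.2, absurd ⟨l, h⟩ hM, absurd ⟨l, h⟩ hM]
  have : Q.card ≤ (Finset.univ : Finset (Fin n ⊕ Fin k)).card := by
    refine Finset.card_le_card_of_injOn f (fun _ _ => Finset.mem_coe.2 (Finset.mem_univ _)) ?_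
    intro a ha b hb hab
    by_cases h1 : Matched M a <;> by_cases h2 : Matched M b
    · obtain ⟨j, hj, hj'⟩ := hf1 a h1
      obtain ⟨l, hl, hl'⟩ := hf1 b h2
      rw [hj, hl] at hab
      rw [Sum.inl.inj hab] at hj'
      exact hf.matching.ad_eq hj' hl'
    · obtain ⟨j, hj, hj'⟩ := hf1 a h1
      rw [hj, hf2 b h2] at hab; simp at hab
    · obtain ⟨j, hj, hj'⟩ := hf1 b h2
      rw [hj, hf2 a h1] at hab; simp at hab
    · rw [hf2 a h1, hf2 b h2] at hab
      have h3 := Sum.inr.inj hab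
      refine Prod.ext h3 ?_
      by_contra hne
      rcases lt_or_gt_of_ne hne with hlt | hlt
      · have := hfirst b hb h2 a.2 hlt
        rw [← h3] at this; exact h1 this
      · have := hfirst a ha h1 b.2 hlt
        rw [h3] at this; exact h2 this
  simpa using this

/-- Each of the three criteria for inspection determines at most one ad per type. -/
theorem card_scanSet_le (M : Finset (Edge k n)) (j : Fin n) : (scanSet M j).card ≤ 3 * k := by
  classical
  let C : Fin 3 → Ad k n → Prop := fun c a =>
    if c = 0 then ¬ Matched M a ∧ ∀ i < a.2, Matched M (a.1, i)
    else if c = 1 then (∃ l < j, (a, l) ∈ M) ∧ ∀ i > a.2, ¬ ∃ l < j, ((a.1, i), l) ∈ M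
    else (∃ l > j, (a, l) ∈ M) ∧ ∀ i < a.2, ¬ ∃ l > j, ((a.1, i), l) ∈ M
  have huniq : ∀ c a b, C c a → C c b → a.1 = b.1 → a = b := by
    intro c a b ha hb hab
    refine Prod.ext hab ?_
    obtain ⟨θ, i⟩ := a
    obtain ⟨θ', i'⟩ := b
    obtain rfl : θ = θ' := hab
    by_contra hne
    simp only at hne
    fin_cases c
    · simp only [C] at ha hb
      rcases lt_or_gt_of_ne hne with hlt | hlt
      exacts [ha.1 (hb.2 _ hlt), hb.1 (ha.2 _ hlt)]
    · simp [C] at ha hb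
      obtain ⟨⟨l, h1, h2⟩, h3⟩ := ha
      obtain ⟨⟨l', h1', h2'⟩, h3'⟩ := hb
      rcases lt_or_gt_of_ne hne with hlt | hlt
      exacts [h3 _ hlt l' h1' h2', h3' _ hlt l h1 h2]
    · simp [C] at ha hb
      obtain ⟨⟨l, h1, h2⟩, h3⟩ := ha
      obtain ⟨⟨l', h1', h2'⟩, h3'⟩ := hb
      rcases lt_or_gt_of_ne hne with hlt | hlt
      exacts [h3' _ hlt l h1 h2, h3 _ hlt l' h1' h2']
  have hex : ∀ a ∈ scanSet M j, ∃ c, C c a := by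
    intro a ha
    rcases mem_scanSet.1 ha with h | h | h
    exacts [⟨0, h⟩, ⟨1, h⟩, ⟨2, h⟩]
  have : (scanSet M j).card ≤ (Finset.univ : Finset (Fin 3 × Fin k)).card := by
    refine Finset.card_le_card_of_injOn
      (fun a => if h : ∃ c, C c a then (h.choose, a.1) else (0, a.1))
      (fun _ _ => Finset.mem_coe.2 (Finset.mem_univ _)) ?_
    intro a ha b hb hab
    have h1 := hex a ha
    have h2 := hex b hb
    simp only [h1, h2, dif_pos, Prod.mk.injEq] at hab
    exact huniq _ a b h1.choose_spec (hab.1 ▸ h2.choose_spec) hab.2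
  simpa using this

end AdTypes

/-! ### Termination and correctness of the executions -/

namespace AdTypes

variable {k n : ℕ}

theorem HState.queue_eq_empty {s : HState k n} (h : s.P = fun _ => none) : s.queue = ∅ := by
  simp [HState.queue, h]

theorem Instance.between_start {I : Instance k n} (hI : I.IsMonotone) (hk : 0 < k) (hn : 0 < n) :
    I.Between I.start where
  root := rfl
  rest_le := le_rfl
  queue := rfl
  fills := by
    refine ⟨by simp [start, IsMatching], fun j => ?_⟩
    simp [start]
  sorted := ⟨by simp [start], by simp [start, Matched]⟩
  dual := by
    have hle : ∀ a j, I.w a j ≤ ⨆ e : Edge k n, I.w e.1 e.2 := fun a j =>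
      le_ciSup (f := fun e : Edge k n => I.w e.1 e.2) (Set.finite_range _).bddAbove (a, j)
    refine ⟨fun a j => ?_, by simp [start], by simp [start], by simp [start], fun j => ?_⟩
    · have := hle a j
      simp only [slack, start]; linarith
    · have := hle (⟨0, hk⟩, ⟨0, hn⟩) j
      have h1 := (hI ⟨0, hk⟩).2.2.1 ⟨0, hn⟩
      have h2 := (hI ⟨0, hk⟩).2.2.2 j
      exact (mul_nonneg h1 h2).trans this

/-- The invariants of an execution. -/
def Instance.Inv (I : Instance k n) (s : HState k n) : Prop :=
  I.Between s ∨ ∃ r, I.InPhase s r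

/-- The new matching is left arbitrary, because in an instance that is not strict the augmented
matching is replaced by a sorted one. -/
theorem Instance.InPhase.between_of_sorted {I : Instance k n} {s : HState k n} {r : Fin n}
    (h : I.InPhase s r) {M : Finset (Edge k n)} (hf : Fills M r.val) (hd : I.IsDual M s.u s.p)
    (hs : Sorted M) :
    I.Between { s with M := M, root := none, B := ∅, P := fun _ => none } where
  root := rfl
  rest_le := h.rest ▸ r.isLt.le
  queue := rfl
  fills := by dsimp only; rw [h.rest]; exact hf
  sorted := hs
  dual := hd

theorem Instance.Inv.step {I : Instance k n} (hI : I.IsStrict) (hk : 0 < k) {s t : HState k n}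
    (h : I.Inv s) (hst : I.Step s t) : I.Inv t := by
  cases hst with
  | enter r h1 h2 =>
    rcases h with h | ⟨r', h⟩
    · exact Or.inr ⟨r, h.enter h2⟩
    · rw [h.root] at h1; simp at h1
  | grow r a j m δ h1 hA hnext hδ ham =>
    rcases h with h | ⟨r', h⟩
    · rw [h.root] at h1; simp at h1
    · obtain rfl : r' = r := by rw [h.root] at h1; simpa using h1
      exact Or.inr ⟨r', h.grow hI.isMonotone hk hA hnext hδ ham⟩
  | reach r a j δ h1 hA hnext hδ ha =>
    rcases h with h | ⟨r', h⟩
    · rw [h.root] at h1; simp at h1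
    · obtain rfl : r' = r := by rw [h.root] at h1; simpa using h1
      exact Or.inr ⟨r', h.reach hI.isMonotone hk hA hnext hδ ha⟩
  | augment r A h1 hA =>
    rcases h with h | ⟨r', h⟩
    · rw [h.root] at h1; simp at h1
    · obtain rfl : r' = r := by rw [h.root] at h1; simpa using h1
      obtain ⟨hf, hd⟩ := h.augment hA
      exact Or.inl (h.between_of_sorted hf hd (hd.sorted hI hf.matching))

theorem Instance.InPhase.exists_isNext {I : Instance k n} (hI : I.IsMonotone) (hk : 0 < k)
    {s : HState k n} {r : Fin n} (h : I.InPhase s r) (hA : ¬ ∃ A, IsAugmenting s.M s.B r A) :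
    ∃ a j, I.IsNext s a j := by
  classical
  obtain ⟨i, hi, -⟩ := h.fills.exists_first_free (Nat.succ_pos _) (Fin.pos r) ⟨0, hk⟩
  have hT : ((⟨0, hk⟩, i) : Ad k n) ∉ treeAds s.B := fun hT => hi (h.not_free_of_mem hA hT)
  obtain ⟨c, x, hc, -⟩ := h.exists_entry hI hA hT (root_mem_treeSlots)
  obtain ⟨e, he, hmin⟩ := Finset.exists_min_image
    (Finset.univ.filter fun e : Edge k n => s.P e.1 = some e.2)
    (fun e => I.slack s.u s.p e.1 e.2) ⟨(c, x), by simpa using hc⟩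
  refine ⟨e.1, e.2, by simpa using he, fun b l hbl => ?_⟩
  exact hmin (b, l) (by simpa using hbl)

theorem Instance.Inv.exists_step {I : Instance k n} (hI : I.IsMonotone) (hk : 0 < k)
    {s : HState k n} (h : I.Inv s) (hs : ¬ s.Final) : ∃ t, I.Step s t := by
  rcases h with h | ⟨r, h⟩
  · have h0 : s.rest ≠ 0 := fun h0 => hs ⟨h0, h.root⟩
    have h1 := h.rest_le
    exact ⟨_, .enter s ⟨s.rest - 1, by omega⟩ h.root (by simp only; omega)⟩
  · by_cases hA : ∃ A, IsAugmenting s.M s.B r A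
    · obtain ⟨A, hA⟩ := hA
      exact ⟨_, .augment s r A h.root hA⟩
    · obtain ⟨a, j, hnext⟩ := h.exists_isNext hI hk hA
      by_cases ha : Matched s.M a
      · obtain ⟨m, hm⟩ := ha
        exact ⟨_, .grow s r a j m _ h.root hA hnext rfl hm⟩
      · exact ⟨_, .reach s r a j _ h.root hA hnext rfl ha⟩

theorem Instance.Inv.card_queue {I : Instance k n} {s : HState k n} (h : I.Inv s) :
    s.queue.card ≤ n + k := by
  classical
  rcases h with h | ⟨r, h⟩
  · simp [HState.queue_eq_empty h.queue]
  · refine Instance.InPhase.card_queue_aux h.fills (fun a l hal => (h.entry a l hal).2.2)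
      s.queue fun a ha => ?_
    simpa [HState.queue] using ha

/-- A bound for the number of steps that remain. -/
def HState.measure (s : HState k n) : ℕ :=
  s.rest * (k * n + 2) + if s.root = none then 0 else 1 + (k * n - (treeAds s.B).card)

theorem card_treeAds_le (B : Finset (Edge k n)) : (treeAds B).card ≤ k * n := by
  have := (treeAds B).card_le_univ
  simpa using this

/-- A phase consists of one `enter`, at most `k * n` steps that bring a new ad into the tree, and
one `augment`. Hence the weight `k * n + 2` of a remaining slot in `HState.measure`. -/
theorem Instance.Inv.measure_lt {I : Instance k n} {s t : HState k n}
    (h : I.Inv s) (hst : I.Step s t) : t.measure < s.measure := by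
  classical
  have hcard : ∀ {B : Finset (Edge k n)} {a : Ad k n} {j : Fin n}, (a, j) ∈ B → s.B ⊆ B →
      a ∉ treeAds s.B → (treeAds s.B).card < (treeAds B).card := by
    intro B a j h1 h2 h3
    refine Finset.card_lt_card ⟨fun b hb => ?_, fun hsub => h3 (hsub (mem_treeAds.2 ⟨j, h1⟩))⟩
    obtain ⟨l, hl⟩ := mem_treeAds.1 hb
    exact mem_treeAds.2 ⟨l, h2 hl⟩
  cases hst with
  | enter r h1 h2 =>
    simp only [HState.measure, h1, h2, if_true, reduceCtorEq, if_false, treeAds,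
      Finset.image_empty, Finset.card_empty, add_mul]
    omega
  | grow r a j m δ h1 hA hnext hδ ham =>
    rcases h with h | ⟨r', h⟩
    · rw [h.root] at h1; simp at h1
    · have h3 := hcard (B := insert (a, j) (insert (a, m) s.B)) (a := a) (j := j) (by simp)
        (fun e he => by simp [he]) (h.entry a j hnext.1).2.1
      have h4 := card_treeAds_le (insert (a, j) (insert (a, m) s.B))
      simp only [HState.measure, h1, reduceCtorEq, if_false]
      omega
  | reach r a j δ h1 hA hnext hδ ha =>
    rcases h with h | ⟨r', h⟩
    · rw [h.root] at h1; simp at h1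
    · have h3 := hcard (B := insert (a, j) s.B) (a := a) (j := j) (by simp)
        (fun e he => by simp [he]) (h.entry a j hnext.1).2.1
      have h4 := card_treeAds_le (insert (a, j) s.B)
      simp only [HState.measure, h1, reduceCtorEq, if_false]
      omega
  | augment r A h1 hA =>
    simp only [HState.measure, h1, reduceCtorEq, if_false, if_true]
    omega

theorem Instance.Inv.acc {I : Instance k n} (hI : I.IsStrict) (hk : 0 < k) {s : HState k n}
    (h : I.Inv s) : Acc (fun t s => I.Step s t) s := by
  induction hm : s.measure using Nat.strong_induction_on generalizing s with
  | _ N ih =>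
    exact Acc.intro _ fun t hst => ih _ (hm ▸ h.measure_lt hst) (h.step hI hk hst) rfl

theorem Instance.Reachable.inv {I : Instance k n} (hI : I.IsStrict) (hk : 0 < k) (hn : 0 < n)
    {s : HState k n} (h : I.Reachable s) : I.Inv s := by
  induction h with
  | refl => exact Or.inl (between_start hI.isMonotone hk hn)
  | tail _ hst ih => exact ih.step hI hk hst

theorem Instance.Between.isMaxWeightMatching {I : Instance k n} {s : HState k n}
    (h : I.Between s) (hs : s.Final) : I.IsMaxWeightMatching s.M :=
  h.dual.isMaxWeightMatching (hs.1 ▸ h.fills)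

theorem Instance.IsStrict.hungarian_correct {I : Instance k n} (hI : I.IsStrict) (hk : 0 < k)
    (hn : 0 < n) : Acc (fun t s => I.Step s t) I.start ∧
      ∀ s : HState k n, I.Reachable s →
        (¬ s.Final → ∃ t, I.Step s t) ∧
        (s.Final → I.IsMaxWeightMatching s.M) ∧
        s.queue.card ≤ n + k ∧
        ∀ j : Fin n, (scanSet s.M j).card ≤ 3 * k := by
  refine ⟨Instance.Inv.acc hI hk (Or.inl (Instance.between_start hI.isMonotone hk hn)),
    fun s hs => ?_⟩
  have h := hs.inv hI hk hn
  refine ⟨h.exists_step hI.isMonotone hk, fun hF => ?_, h.card_queue, card_scanSet_le s.M⟩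
  rcases h with h | ⟨r, h⟩
  · exact h.isMaxWeightMatching hF
  · exact absurd h.root (by simp [hF.2])

/-! ### Sorting a matching -/

/-- The matching obtained by exchanging two ads. -/
def swapAds (M : Finset (Edge k n)) (a b : Ad k n) : Finset (Edge k n) :=
  M.map ((Equiv.swap a b).prodCongr (Equiv.refl _)).toEmbedding

theorem mem_swapAds {M : Finset (Edge k n)} {a b c : Ad k n} {j : Fin n} :
    (c, j) ∈ swapAds M a b ↔ (Equiv.swap a b c, j) ∈ M := by
  simp only [swapAds, Finset.mem_map_equiv]
  rfl

theorem Fills.swapAds {M : Finset (Edge k n)} {x : ℕ} (h : Fills M x) (a b : Ad k n) :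
    Fills (swapAds M a b) x := by
  constructor
  · rintro ⟨c, j⟩ he ⟨d, l⟩ hf hef
    rw [mem_swapAds] at he hf
    have := h.matching _ he _ hf (by simpa using hef)
    simpa using this
  · intro j
    rw [← h.slots]
    constructor
    · rintro ⟨c, hc⟩
      exact ⟨_, mem_swapAds.1 hc⟩
    · rintro ⟨c, hc⟩
      exact ⟨Equiv.swap a b c, mem_swapAds.2 (by simpa using hc)⟩

theorem Instance.IsDual.swapAds {I : Instance k n} {M : Finset (Edge k n)} {u : Ad k n → ℝ}
    {p : Fin n → ℝ} (hd : I.IsDual M u p) {a b : Ad k n}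
    (ha : ∀ l, (b, l) ∈ M → I.slack u p a l = 0) (hb : ∀ l, (a, l) ∈ M → I.slack u p b l = 0)
    (ha' : ¬ Matched M b → u a = 0) (hb' : ¬ Matched M a → u b = 0) :
    I.IsDual (swapAds M a b) u p := by
  refine ⟨hd.nonneg, ?_, ?_, hd.ads_nonneg, hd.slots_nonneg⟩
  · intro c j hc
    rw [mem_swapAds] at hc
    rcases eq_or_ne c a with rfl | h1
    · exact ha j (by simpa using hc)
    rcases eq_or_ne c b with rfl | h2
    · exact hb j (by simpa using hc)
    · rw [Equiv.swap_apply_of_ne_of_ne h1 h2] at hc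
      exact hd.tight c j hc
  · intro c hc
    simp only [Matched, mem_swapAds] at hc
    rcases eq_or_ne c a with rfl | h1
    · exact ha' (by simpa [Matched] using hc)
    rcases eq_or_ne c b with rfl | h2
    · exact hb' (by simpa [Matched] using hc)
    · rw [Equiv.swap_apply_of_ne_of_ne h1 h2] at hc
      exact hd.free c hc

/-- A potential that increases when a matching becomes more sorted. -/
def sortedness (M : Finset (Edge k n)) : ℤ :=
  ∑ e ∈ M, (e.1.2.val : ℤ) * ((e.2.val : ℤ) - n)

theorem sortedness_swapAds (M : Finset (Edge k n)) (a b : Ad k n) :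
    sortedness (swapAds M a b) - sortedness M =
      ∑ e ∈ M, (((Equiv.swap a b e.1).2.val : ℤ) - e.1.2.val) * ((e.2.val : ℤ) - n) := by
  simp only [sortedness, swapAds, Finset.sum_map]
  rw [← Finset.sum_sub_distrib]
  refine Finset.sum_congr rfl fun e _ => ?_
  simp only [Equiv.coe_toEmbedding, Equiv.prodCongr_apply, Prod.map, Equiv.refl_apply, sub_mul]

/-- Among the finitely many matchings that fill the same slots with the same types and are tight for
the same duals, take one of maximal `sortedness`. A pair violating sortedness could be exchanged,
since the exchange inequality then holds with equality and keeps all edges tight, and this would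
raise the potential. The shift by `n` makes all slot factors negative, so that replacing a matched
ad by an earlier free one counts as an increase as well. -/
theorem exists_sorted {I : Instance k n} (hI : I.IsMonotone) {M : Finset (Edge k n)}
    {u : Ad k n → ℝ} {p : Fin n → ℝ} {x : ℕ} (hf : Fills M x) (hd : I.IsDual M u p) :
    ∃ M', Fills M' x ∧ I.IsDual M' u p ∧ Sorted M' ∧
      ∀ a c j, (a, j) ∈ M → (c, j) ∈ M' → a.1 = c.1 := by
  classical
  let S := Finset.univ.filter fun N : Finset (Edge k n) => Fills N x ∧ I.IsDual N u p ∧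
    ∀ a c j, (a, j) ∈ M → (c, j) ∈ N → a.1 = c.1
  have hMS : M ∈ S := by
    simp only [S, Finset.mem_filter, Finset.mem_univ, true_and]
    exact ⟨hf, hd, fun a c j h1 h2 => by rw [hf.matching.ad_eq h1 h2]⟩
  obtain ⟨N, hNS, hmax⟩ := Finset.exists_max_image S sortedness ⟨M, hMS⟩
  simp only [S, Finset.mem_filter, Finset.mem_univ, true_and] at hNS
  obtain ⟨hNf, hNd, hNt⟩ := hNS
  have hswap : ∀ a b : Ad k n, a.1 = b.1 → I.IsDual (swapAds N a b) u p →
      sortedness (swapAds N a b) - sortedness N ≤ 0 := by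
    intro a b hab h
    have : swapAds N a b ∈ S := by
      simp only [S, Finset.mem_filter, Finset.mem_univ, true_and]
      refine ⟨hNf.swapAds a b, h, fun c d j h1 h2 => ?_⟩
      rw [mem_swapAds] at h2
      rw [hNt c _ j h1 h2]
      rcases eq_or_ne d a with rfl | h3
      · simp [hab]
      rcases eq_or_ne d b with rfl | h4
      · simp [hab]
      · rw [Equiv.swap_apply_of_ne_of_ne h3 h4]
    have := hmax _ this
    omega
  refine ⟨N, hNf, hNd, ⟨?_, ?_⟩, hNt⟩
  · rintro ⟨θ, i⟩ ⟨θ', i'⟩ j l h1 h2 h12 hlt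
    obtain rfl : θ = θ' := h12
    simp only at hlt
    by_contra hlj
    have hne : (θ, i) ≠ (θ, i') := by simp [hlt.ne]
    have hlj : l < j := by
      refine lt_of_le_of_ne (not_lt.1 hlj) ?_
      rintro rfl
      exact hne (hNf.matching.ad_eq h1 h2)
    have e1 := hNd.tight _ _ h1
    have e2 := hNd.tight _ _ h2
    have e3 := hNd.nonneg (θ, i) l
    have e4 := hNd.nonneg (θ, i') j
    have e5 := mul_nonneg (sub_nonneg.2 ((hI θ).1 hlt.le)) (sub_nonneg.2 ((hI θ).2.1 hlj.le))
    -- The slacks of the exchanged edges are nonnegative, and by tightness of the matched edges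
    -- their sum is the negative of the product in `e5`; so both vanish.
    have e6 : I.slack u p (θ, i) l = 0 ∧ I.slack u p (θ, i') j = 0 := by
      simp only [Instance.slack, Instance.w] at *
      constructor <;> nlinarith
    have := hswap (θ, i) (θ, i') rfl (hNd.swapAds
      (fun l' hl' => by rw [hNf.matching.slot_eq hl' h2]; exact e6.1)
      (fun l' hl' => by rw [hNf.matching.slot_eq hl' h1]; exact e6.2)
      (fun h => absurd ⟨l, h2⟩ h) (fun h => absurd ⟨j, h1⟩ h))
    -- Only the two exchanged edges contribute; together they give `(i' - i) * (j - l)`, which is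
    -- positive.
    rw [sortedness_swapAds, ← Finset.sum_subset (s₁ := {((θ, i), j), ((θ, i'), l)}),
      Finset.sum_pair] at this
    · simp only [Equiv.swap_apply_left, Equiv.swap_apply_right] at this
      simp only [Fin.lt_def] at hlt hlj
      zify at hlt hlj
      nlinarith [mul_pos (sub_pos.2 hlt) (sub_pos.2 hlj)]
    · simp [hne]
    · intro e he
      simp only [Finset.mem_insert, Finset.mem_singleton] at he
      rcases he with rfl | rfl
      exacts [h1, h2]
    · rintro ⟨c, l'⟩ he hn
      simp only [Finset.mem_insert, Finset.mem_singleton, Prod.mk.injEq, not_or] at hn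
      have h3 : c ≠ (θ, i) := by
        rintro rfl; exact hn.1 ⟨rfl, hNf.matching.slot_eq he h1⟩
      have h4 : c ≠ (θ, i') := by
        rintro rfl; exact hn.2 ⟨rfl, hNf.matching.slot_eq he h2⟩
      simp [Equiv.swap_apply_of_ne_of_ne h3 h4]
  · rintro ⟨θ, i⟩ ⟨θ', i'⟩ h12 hle ⟨l, hl⟩
    obtain rfl : θ = θ' := h12
    simp only at hle
    by_contra hn
    have hne' : i ≠ i' := by rintro rfl; exact hn ⟨l, hl⟩
    have hlt : i < i' := lt_of_le_of_ne hle hne'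
    have e1 := hNd.tight _ _ hl
    have e2 := hNd.free _ hn
    have e3 := hNd.nonneg (θ, i) l
    have e4 := hNd.ads_nonneg (θ, i')
    have e5 := mul_nonneg (sub_nonneg.2 ((hI θ).1 hle)) ((hI θ).2.2.2 l)
    have e6 : I.slack u p (θ, i) l = 0 ∧ u (θ, i') = 0 := by
      simp only [Instance.slack, Instance.w] at *
      constructor <;> nlinarith
    have := hswap (θ, i) (θ, i') rfl (hNd.swapAds
      (fun l' hl' => by rw [hNf.matching.slot_eq hl' hl]; exact e6.1)
      (fun l' hl' => absurd ⟨l', hl'⟩ hn)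
      (fun h => absurd ⟨l, hl⟩ h) (fun _ => e6.2))
    rw [sortedness_swapAds, Finset.sum_eq_single ((θ, i'), l)] at this
    · simp only [Equiv.swap_apply_right] at this
      have := l.isLt
      simp only [Fin.lt_def] at hlt
      zify at hlt this
      nlinarith [mul_pos (sub_pos.2 hlt) (sub_pos.2 this)]
    · rintro ⟨c, l'⟩ he hne
      have h3 : c ≠ (θ, i) := by
        rintro rfl; exact hn ⟨l', he⟩
      have h4 : c ≠ (θ, i') := by
        rintro rfl; exact hne (by rw [hNf.matching.slot_eq he hl])
      simp [Equiv.swap_apply_of_ne_of_ne h3 h4]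
    · exact fun h => absurd hl h

/-! ### A sorted matching is determined by the types of the ads in the slots -/

/-- The number of slots before `x`, but not before `b`, whose type according to `t` is `θ`. -/
def typeCount (t : ℕ → ℕ) (b θ x : ℕ) : ℕ := Nat.count (fun j => b ≤ j ∧ t j = θ) x

theorem typeCount_succ (t : ℕ → ℕ) (b θ x : ℕ) :
    typeCount t b θ (x + 1) = typeCount t b θ x + if b ≤ x ∧ t x = θ then 1 else 0 :=
  Nat.count_succ _ _

theorem typeCount_mono (t : ℕ → ℕ) (b θ : ℕ) : Monotone (typeCount t b θ) :=
  Nat.count_monotone _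

/-- `t` lists the types of the ads in the slots. -/
def HasTypes (M : Finset (Edge k n)) (t : ℕ → ℕ) : Prop :=
  ∀ a j, (a, j) ∈ M → t j.val = a.1.val

/-- The ads of type `θ` matched before `x` form an initial segment, and its length is the number of
slots of this type before `x`. -/
theorem Sorted.lt_typeCount_iff {M : Finset (Edge k n)} {b x : ℕ} {t : ℕ → ℕ} (hs : Sorted M)
    (hf : Fills M b) (ht : HasTypes M t) (hx : x ≤ n) (θ : Fin k) (i : Fin n) :
    i.val < typeCount t b θ x ↔ ∃ l : Fin n, l.val < x ∧ ((θ, i), l) ∈ M := by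
  classical
  let S := Finset.univ.filter fun i : Fin n => ∃ l : Fin n, l.val < x ∧ ((θ, i), l) ∈ M
  have hS : ∀ i, i ∈ S ↔ ∃ l : Fin n, l.val < x ∧ ((θ, i), l) ∈ M := by simp [S]
  have hlow : ∀ i i', i' ≤ i → i ∈ S → i' ∈ S := by
    intro i i' hle hi
    rw [hS] at hi ⊢
    obtain ⟨l, hl, hM⟩ := hi
    obtain ⟨l', hl'⟩ := hs.initial (θ, i') (θ, i) rfl hle ⟨l, hM⟩
    refine ⟨l', ?_, hl'⟩
    rcases eq_or_lt_of_le hle with rfl | hlt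
    · rwa [hf.matching.slot_eq hl' hM]
    · exact (Fin.lt_def.1 (hs.order _ _ _ _ hl' hM rfl hlt)).trans hl
  have hcard : S.card = typeCount t b θ x := by
    rw [typeCount, Nat.count_eq_card_filter_range]
    have hex : ∀ i (hi : i ∈ S), ∃ l : Fin n, l.val < x ∧ ((θ, i), l) ∈ M := fun i hi => (hS i).1 hi
    refine Finset.card_bij (fun i hi => (hex i hi).choose.val) ?_ ?_ ?_
    · intro i hi
      obtain ⟨h1, h2⟩ := (hex i hi).choose_spec
      simp only [Finset.mem_filter, Finset.mem_range]
      exact ⟨h1, (hf.slots _).1 ⟨_, h2⟩, ht _ _ h2⟩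
    · intro i hi i' hi' h
      have h1 := (hex i hi).choose_spec.2
      have h2 := (hex i' hi').choose_spec.2
      rw [Fin.ext h] at h1
      have := hf.matching.ad_eq h1 h2
      simpa using this
    · intro l hl
      simp only [Finset.mem_filter, Finset.mem_range] at hl
      obtain ⟨hl1, hl2, hl3⟩ := hl
      obtain ⟨⟨θ', i⟩, ha⟩ := (hf.slots ⟨l, by omega⟩).2 hl2
      obtain rfl : θ' = θ := Fin.ext (by rw [← hl3]; exact (ht _ _ ha).symm)
      have hi : i ∈ S := (hS i).2 ⟨_, hl1, ha⟩
      refine ⟨i, hi, ?_⟩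
      have := hf.matching.slot_eq (hex i hi).choose_spec.2 ha
      rw [this]
  rw [← hcard, ← hS]
  constructor
  · intro hlt
    by_contra hi
    have : S ⊆ Finset.Iio i := fun i' hi' => by
      rw [Finset.mem_Iio]
      by_contra hle
      exact hi (hlow i' i (not_lt.1 hle) hi')
    have := Finset.card_le_card this
    simp at this
    omega
  · intro hi
    have : Finset.Iic i ⊆ S := fun i' hi' => hlow i i' (Finset.mem_Iic.1 hi') hi
    have := Finset.card_le_card this
    simp at this
    omega

end AdTypes

namespace AdTypes

/-! ### A heap with lazily repaired binomial trees -/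

/-- Forests on the nodes `0, …, N - 1`. The node `x` is the child number `slot x` of `par x`; the
number `N` stands for the parent of the main root, and `N + 1` for the missing parent of the roots
of the pool. The cell `pool i` holds the root of a tree of rank `i`, or `N`. -/
structure Heap where
  rank : ℕ → ℕ
  ch : ℕ → ℕ → ℕ
  par : ℕ → ℕ
  slot : ℕ → ℕ
  pool : ℕ → ℕ
  defi : ℕ → ℕ

namespace Heap

variable {κ : Type*} [LinearOrder κ] {N H : ℕ} {K : ℕ → κ} {F : Set ℕ} {Hs : Set (ℕ × ℕ)}
  {X : Set ℕ} {h : Heap}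

/-- Make `c` the child number `i` of `p`. -/
def place (h : Heap) (p i c : ℕ) : Heap :=
  { h with
    ch := fun q j => if q = p ∧ j = i then c else h.ch q j
    par := Function.update h.par c p
    slot := Function.update h.slot c i }

def setRank (h : Heap) (x r : ℕ) : Heap := { h with rank := Function.update h.rank x r }

def setPool (h : Heap) (i y : ℕ) : Heap := { h with pool := Function.update h.pool i y }

def setPar (h : Heap) (x y : ℕ) : Heap := { h with par := Function.update h.par x y }

def setDefi (h : Heap) (i y : ℕ) : Heap := { h with defi := Function.update h.defi i y }

/-- The node `p` has a child number `i`, possibly missing. -/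
def IsSlot (h : Heap) (N H p i : ℕ) : Prop := (p < N ∧ i < h.rank p) ∨ (p = N ∧ i = H)

/-- The heap order. -/
def Below (N : ℕ) (K : ℕ → κ) (p x : ℕ) : Prop := p = N ∨ K p ≤ K x

/-- The invariant of a heap in which the trees with roots in `F` are detached, the children in the
positions `Hs` are missing, and the pool trees of the ranks in `X` are missing. A node whose rank
is smaller by one than its position is deficient; there is exactly one such node for every tree of
the pool. -/
structure Inv (h : Heap) (N H : ℕ) (K : ℕ → κ) (F : Set ℕ) (Hs : Set (ℕ × ℕ)) (X : Set ℕ) :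
    Prop where
  attached : ∀ x < N, x ∉ F → h.par x ≠ N + 1 → (h.par x, h.slot x) ∉ Hs ∧
    h.ch (h.par x) (h.slot x) = x ∧ h.IsSlot N H (h.par x) (h.slot x) ∧ Below N K (h.par x) x
  deficient : ∀ x < N, x ∉ F → h.par x ≠ N + 1 → h.rank x = h.slot x ∨
    (h.rank x + 1 = h.slot x ∧ (h.pool (h.rank x) ≠ N ∨ h.rank x ∈ X) ∧ h.defi (h.rank x) = x)
  child : ∀ p i, h.IsSlot N H p i → (p, i) ∉ Hs →
    h.ch p i < N ∧ h.ch p i ∉ F ∧ h.par (h.ch p i) = p ∧ h.slot (h.ch p i) = i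
  pool_lt : ∀ i < H, h.pool i ≠ N →
    h.pool i < N ∧ h.pool i ∉ F ∧ h.par (h.pool i) = N + 1 ∧ h.rank (h.pool i) = i
  defi_lt : ∀ i < H, (h.pool i ≠ N ∨ i ∈ X) → h.defi i < N ∧ h.defi i ∉ F ∧
    h.par (h.defi i) ≠ N + 1 ∧ h.slot (h.defi i) = i + 1 ∧ h.rank (h.defi i) = i
  root : ∀ x < N, x ∉ F → h.par x = N + 1 → h.rank x < H ∧ h.pool (h.rank x) = x
  reserved : ∀ i ∈ X, h.pool i = N
  rank_le : ∀ x < N, h.rank x ≤ H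

theorem Inv.par_lt (hI : h.Inv N H K F Hs X) {x : ℕ} (hx : x < N) (hF : x ∉ F)
    (hp : h.par x ≠ N + 1) : h.par x ≤ N := by
  rcases (hI.attached x hx hF hp).2.2.1 with h1 | h1 <;> omega

theorem Inv.slot_le (hI : h.Inv N H K F Hs X) {x : ℕ} (hx : x < N) (hF : x ∉ F)
    (hp : h.par x ≠ N + 1) : h.slot x ≤ H := by
  rcases (hI.attached x hx hF hp).2.2.1 with h1 | h1
  · have := hI.rank_le _ h1.1; omega
  · omega

set_option maxHeartbeats 4000000 in
-- This and the following primitives keep `Inv` for suitably changed `F`, `Hs` and `X`; heap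
-- operations are composed from them. In each case `clear` retains only the fields on which the new
-- field depends.
theorem Inv.link (hI : h.Inv N H K F Hs X) {z y i : ℕ} (hz : z < N) (hy : y < N) (hzF : z ∈ F)
    (hyF : y ∈ F) (hzy : z ≠ y) (hrz : h.rank z = i) (hry : h.rank y = i) (hi : i < H)
    (hK : K z ≤ K y) (hh : (z, i) ∉ Hs) :
    ((h.place z i y).setRank z (i + 1)).Inv N H K (F \ {y}) Hs X := by
  obtain ⟨h1, h2, h3, h4, h5, h6, h7, h8⟩ := hI
  have hB : Below N K z y := Or.inr hK
  constructor <;> simp only [place, setRank, IsSlot, Function.update_apply, Set.mem_sdiff,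
    Set.mem_singleton_iff] at *
  · clear h2 h4 h5 h6 h7 h8; grind
  · clear h1 h3 h4 h6 h7 h8; grind
  · clear h2 h4 h5 h6 h7 h8; grind
  · clear h1 h2 h3 h5 h7 h8; grind
  · clear h1 h3 h4 h6 h7 h8; grind
  · clear h1 h2 h3 h5 h7 h8; grind
  · clear h1 h2 h3 h4 h5 h6 h8; grind
  · clear h1 h2 h3 h4 h5 h6 h7; grind


set_option maxHeartbeats 4000000 in
theorem Inv.place (hI : h.Inv N H K F Hs X) {z p i : ℕ} (hz : z < N) (hzF : z ∈ F)
    (hp : (p, i) ∈ Hs) (hs : h.IsSlot N H p i) (hK : Below N K p z) (hr : h.rank z = i) :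
    (h.place p i z).Inv N H K (F \ {z}) (Hs \ {(p, i)}) X := by
  obtain ⟨h1, h2, h3, h4, h5, h6, h7, h8⟩ := hI
  constructor <;> simp only [Heap.place, IsSlot, Function.update_apply, Set.mem_sdiff,
    Set.mem_singleton_iff, Prod.mk.injEq] at *
  · clear h2 h4 h5 h6 h7 h8; grind
  · clear h1 h3 h4 h6 h7 h8; grind
  · clear h2 h4 h5 h6 h7 h8; grind
  · clear h1 h2 h3 h5 h7 h8; grind
  · clear h1 h3 h4 h6 h7 h8; grind
  · clear h1 h2 h3 h5 h7 h8; grind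
  · clear h1 h2 h3 h4 h5 h6 h8; grind
  · clear h1 h2 h3 h4 h5 h6 h7; grind


set_option maxHeartbeats 4000000 in
-- Two detached trees of rank `i` are absorbed at once: `z` becomes a deficient child in position `i
-- + 1`, and `y` goes to the pool as its partner.
theorem Inv.storePair (hI : h.Inv N H K F Hs X) {z y p i : ℕ} (hz : z < N) (hzF : z ∈ F)
    (hy : y < N) (hyF : y ∈ F) (hzy : z ≠ y) (hp : (p, i + 1) ∈ Hs)
    (hs : h.IsSlot N H p (i + 1)) (hK : Below N K p z) (hr : h.rank z = i) (hry : h.rank y = i)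
    (hpool : h.pool i = N) (hX : i ∉ X) (hi : i < H) :
    ((((h.place p (i + 1) z).setPool i y).setPar y (N + 1)).setDefi i z).Inv N H K
      (F \ {z, y}) (Hs \ {(p, i + 1)}) X := by
  obtain ⟨h1, h2, h3, h4, h5, h6, h7, h8⟩ := hI
  constructor <;> simp only [Heap.place, setPool, setPar, setDefi, IsSlot, Function.update_apply, Set.mem_sdiff, Set.mem_insert_iff,
    Set.mem_singleton_iff, Prod.mk.injEq] at *
  · clear h2 h4 h5 h6 h7 h8; grind
  · clear h1 h3 h4 h6 h7 h8; grind
  · clear h2 h4 h5 h6 h7 h8; grind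
  · clear h1 h2 h3 h5 h7 h8; grind
  · clear h1 h3 h4 h6 h7 h8; grind
  · clear h1 h2 h3 h5 h7 h8; grind
  · clear h1 h2 h3 h4 h5 h6 h8; grind
  · clear h1 h2 h3 h4 h5 h6 h7; grind


set_option maxHeartbeats 4000000 in
theorem Inv.cut (hI : h.Inv N H K F Hs X) {x : ℕ} (hx : x < N) (hxF : x ∉ F)
    (hp : h.par x ≠ N + 1) (hr : h.rank x = h.slot x) :
    h.Inv N H K (insert x F) (insert (h.par x, h.slot x) Hs) X := by
  obtain ⟨h1, h2, h3, h4, h5, h6, h7, h8⟩ := hI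
  constructor <;> simp only [IsSlot, Set.mem_insert_iff, Prod.mk.injEq] at *
  · clear h2 h4 h5 h6 h7 h8; grind
  · clear h1 h3 h4 h6 h7 h8; grind
  · clear h2 h4 h5 h6 h7 h8; grind
  · clear h1 h2 h3 h5 h7 h8; grind
  · clear h1 h3 h4 h6 h7 h8; grind
  · clear h1 h2 h3 h5 h7 h8; grind
  · clear h1 h2 h3 h4 h5 h6 h8; grind
  · clear h1 h2 h3 h4 h5 h6 h7; grind


set_option maxHeartbeats 4000000 in
-- To keep deficient nodes and pool trees in one-to-one correspondence, cutting a deficient node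
-- also takes its partner out of the pool.
theorem Inv.cutDeficient (hI : h.Inv N H K F Hs X) {x i : ℕ} (hx : x < N) (hxF : x ∉ F)
    (hp : h.par x ≠ N + 1) (hr : h.rank x = i) (hs : h.slot x = i + 1) (hX : i ∉ X) :
    (h.setPool i N).Inv N H K (insert (h.pool i) (insert x F))
      (insert (h.par x, i + 1) Hs) X := by
  have hiH : i < H := by have := hI.slot_le hx hxF hp; omega
  have hpi : h.pool i ≠ N := by
    have := hI.deficient x hx hxF hp
    simp only [hr, hs, hX, or_false] at this
    omega
  have hpi' := hI.pool_lt i hiH hpi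
  obtain ⟨h1, h2, h3, h4, h5, h6, h7, h8⟩ := hI
  constructor <;> simp only [setPool, IsSlot, Function.update_apply, Set.mem_insert_iff,
    Prod.mk.injEq] at *
  · clear h2 h4 h5 h6 h7 h8; grind
  · clear h1 h3 h4 h6 h7 h8; grind
  · clear h2 h4 h5 h6 h7 h8; grind
  · clear h1 h2 h3 h5 h6 h7 h8; grind
  · clear h1 h2 h3 h6 h7 h8; grind
  · clear h1 h2 h3 h5 h7 h8; grind
  · clear h1 h2 h3 h4 h5 h6 h8; grind
  · clear h1 h2 h3 h4 h5 h6 h7; grind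


set_option maxHeartbeats 4000000 in
-- If the last child of a detached root is missing, the hole disappears when the rank is lowered;
-- detached roots are exempt from the condition relating rank and position.
theorem Inv.drop (hI : h.Inv N H K F Hs X) {p i : ℕ} (hp : p < N) (hpF : p ∈ F)
    (hr : h.rank p = i + 1) (hh : (p, i) ∈ Hs) :
    (h.setRank p i).Inv N H K F (Hs \ {(p, i)}) X := by
  obtain ⟨h1, h2, h3, h4, h5, h6, h7, h8⟩ := hI
  constructor <;> simp only [setRank, IsSlot, Function.update_apply, Set.mem_sdiff,
    Set.mem_singleton_iff, Prod.mk.injEq] at *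
  · clear h2 h4 h5 h6 h7 h8; grind
  · clear h1 h3 h4 h6 h7 h8; grind
  · clear h2 h4 h5 h6 h7 h8; grind
  · clear h1 h2 h3 h5 h7 h8; grind
  · clear h1 h3 h4 h6 h7 h8; grind
  · clear h1 h2 h3 h5 h7 h8; grind
  · clear h1 h2 h3 h4 h5 h6 h8; grind
  · clear h1 h2 h3 h4 h5 h6 h7; grind


set_option maxHeartbeats 4000000 in
-- The subtree keeps its position number, so it does not matter whether its root is deficient.
theorem Inv.move (hI : h.Inv N H K F Hs X) {c p i : ℕ} (hc : c < N) (hcF : c ∉ F)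
    (hcp : h.par c ≠ N + 1) (hs : h.slot c = i) (hp : (p, i) ∈ Hs) (hps : h.IsSlot N H p i)
    (hK : Below N K p c) :
    (h.place p i c).Inv N H K F (insert (h.par c, i) (Hs \ {(p, i)})) X := by
  obtain ⟨h1, h2, h3, h4, h5, h6, h7, h8⟩ := hI
  constructor <;> simp only [Heap.place, IsSlot, Function.update_apply, Set.mem_sdiff, Set.mem_insert_iff,
    Set.mem_singleton_iff, Prod.mk.injEq] at *
  · clear h2 h4 h5 h6 h7 h8; grind
  · clear h1 h3 h4 h6 h7 h8; grind
  · clear h2 h4 h5 h6 h7 h8; grind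
  · clear h1 h2 h3 h5 h7 h8; grind
  · clear h1 h3 h4 h6 h7 h8; grind
  · clear h1 h2 h3 h5 h7 h8; grind
  · clear h1 h2 h3 h4 h5 h6 h8; grind
  · clear h1 h2 h3 h4 h5 h6 h7; grind


set_option maxHeartbeats 4000000 in
-- The rank is reserved in `X`, so that the deficient partner of the removed tree remains legitimate
-- until a tree of this rank returns.
theorem Inv.unpool (hI : h.Inv N H K F Hs X) {i : ℕ} (hi : i < H) (hp : h.pool i ≠ N) :
    (h.setPool i N).Inv N H K (insert (h.pool i) F) Hs (insert i X) := by
  obtain ⟨h1, h2, h3, h4, h5, h6, h7, h8⟩ := hI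
  constructor <;> simp only [setPool, IsSlot, Function.update_apply, Set.mem_insert_iff] at *
  · clear h2 h4 h5 h6 h7 h8; grind
  · clear h1 h3 h4 h6 h7 h8; grind
  · clear h1 h2 h5 h6 h7 h8; grind
  · clear h1 h2 h3 h5 h7 h8; grind
  · clear h1 h2 h3 h6 h7 h8; grind
  · clear h1 h2 h3 h5 h7 h8; grind
  · clear h1 h2 h3 h4 h5 h6 h8; grind
  · clear h1 h2 h3 h4 h5 h6 h7; grind


set_option maxHeartbeats 4000000 in
theorem Inv.repool (hI : h.Inv N H K F Hs X) {y i : ℕ} (hi : i < H) (hy : y < N) (hyF : y ∈ F)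
    (hr : h.rank y = i) (hX : i ∈ X) :
    ((h.setPool i y).setPar y (N + 1)).Inv N H K (F \ {y}) Hs (X \ {i}) := by
  obtain ⟨h1, h2, h3, h4, h5, h6, h7, h8⟩ := hI
  constructor <;> simp only [setPool, setPar, IsSlot, Function.update_apply, Set.mem_sdiff,
    Set.mem_singleton_iff] at *
  · clear h2 h4 h5 h6 h7 h8; grind
  · clear h1 h3 h4 h6 h7 h8; grind
  · clear h2 h4 h5 h6 h7 h8; grind
  · clear h1 h2 h3 h5 h7 h8; grind
  · clear h1 h3 h4 h6 h7 h8; grind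
  · clear h1 h2 h3 h5 h8; grind
  · clear h1 h2 h3 h4 h5 h6 h8; grind
  · clear h1 h2 h3 h4 h5 h6 h7; grind


end Heap
end AdTypes

/-! ### Linking trees and moving a hole towards the root -/

namespace AdTypes
namespace Heap

variable {κ : Type*} [LinearOrder κ] {N H : ℕ} {K : ℕ → κ} {h : Heap}

/-- Make `y` the last child of the root `z` of rank `i`. -/
def attach (h : Heap) (z i y : ℕ) : Heap := (h.place z i y).setRank z (i + 1)

/-- Link two trees of rank `i` according to the order of their keys. -/
def link (h : Heap) (K : ℕ → κ) (z i y : ℕ) : Heap :=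
  if K z ≤ K y then h.attach z i y else h.attach y i z

/-- The root of the tree that arises by linking. -/
def winner (K : ℕ → κ) (z y : ℕ) : ℕ := if K z ≤ K y then z else y

theorem winner_eq (K : ℕ → κ) (z y : ℕ) : winner K z y = z ∨ winner K z y = y := by
  unfold winner; split_ifs <;> simp

theorem rank_link_winner (z i y : ℕ) : (h.link K z i y).rank (winner K z y) = i + 1 := by
  unfold link winner; split_ifs <;> simp [attach, setRank]

theorem rank_link_of_ne {z i y x : ℕ} (h1 : x ≠ winner K z y) :
    (h.link K z i y).rank x = h.rank x := by
  unfold link winner at *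
  split_ifs at * <;> simp [attach, setRank, place, h1]

theorem le_rank_link {z i y : ℕ} (hz : h.rank z = i) (hy : h.rank y = i) (x : ℕ) :
    h.rank x ≤ (h.link K z i y).rank x := by
  by_cases h1 : x = winner K z y
  · rw [h1, rank_link_winner]
    rcases winner_eq K z y with h2 | h2 <;> rw [h2] <;> omega
  · rw [rank_link_of_ne h1]

@[simp] theorem pool_link (z i y : ℕ) : (h.link K z i y).pool = h.pool := by
  unfold link; split_ifs <;> rfl

theorem IsSlot.mono {h h' : Heap} {p i : ℕ} (hs : h.IsSlot N H p i)
    (hr : p < N → i < h.rank p → i < h'.rank p) : h'.IsSlot N H p i := by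
  rcases hs with h1 | h1
  · exact Or.inl ⟨h1.1, hr h1.1 h1.2⟩
  · exact Or.inr h1

theorem Inv.linkTrees {F F' : Set ℕ} {Hs : Set (ℕ × ℕ)} {X : Set ℕ} (hI : h.Inv N H K F Hs X)
    {z y i : ℕ} (hz : z < N) (hy : y < N) (hzF : z ∈ F) (hyF : y ∈ F) (hzy : z ≠ y)
    (hrz : h.rank z = i) (hry : h.rank y = i) (hi : i < H) (hh : ∀ x, (x, i) ∉ Hs)
    (hF : F' = insert (winner K z y) (F \ {z, y})) :
    (h.link K z i y).Inv N H K F' Hs X := by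
  subst hF
  unfold Heap.link winner attach
  split_ifs with hK
  · have := hI.link hz hy hzF hyF hzy hrz hry hi hK (hh z)
    convert this using 1
    ext x; simp only [Set.mem_insert_iff, Set.mem_sdiff, Set.mem_singleton_iff]; grind
  · have := hI.link hy hz hyF hzF hzy.symm hry hrz hi (le_of_not_ge hK) (hh y)
    convert this using 1
    ext x; simp only [Set.mem_insert_iff, Set.mem_sdiff, Set.mem_singleton_iff]; grind

/-- All trees are in place. -/
def Whole (h : Heap) (N H : ℕ) (K : ℕ → κ) : Prop := h.Inv N H K ∅ ∅ ∅

/-- The tree with root `z` has to be inserted, and the child number `i` of `p` is missing. -/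
structure Hole (h : Heap) (N H : ℕ) (K : ℕ → κ) (p i z : ℕ) : Prop where
  inv : h.Inv N H K {z} {(p, i)} ∅
  lt : z < N
  rank : h.rank z = i
  isSlot : h.IsSlot N H p i

theorem Hole.fill {p i z : ℕ} (hh : h.Hole N H K p i z) (hB : Below N K p z) :
    (h.place p i z).Whole N H K := by
  have := hh.inv.place hh.lt rfl rfl hh.isSlot hB hh.rank
  simpa [Whole] using this

/-- The hole is at the top of the root of a pool tree. -/
theorem Hole.pool_root {p i z : ℕ} (hh : h.Hole N H K p i z) (hp : p < N) (hK : ¬ K p ≤ K z)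
    (hr : h.rank p = i + 1) (hpar : h.par p = N + 1) :
    (((((h.setPool (i + 1) N).setRank p i).attach z i p).setPool (i + 1) z).setPar z
      (N + 1)).Whole N H K := by
  have hpz : p ≠ z := by rintro rfl; have := hh.rank; omega
  have h1 := hh.inv.root p hp (by simpa using hpz) hpar
  rw [hr] at h1
  have h2 := hh.inv.unpool h1.1 (by omega)
  have h3 := h2.drop hp (by simp [h1.2]) hr (by simp : (p, i) ∈ _)
  have h4 := h3.link (z := z) (y := p) hh.lt hp (by simp) (by simp [h1.2]) hpz.symm
    (i := i) (by simp [setRank, setPool, hpz.symm, hh.rank]) (by simp [setRank])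
    (by omega) (le_of_not_ge hK) (by simp)
  have h5 := h4.repool h1.1 hh.lt (by simp [hpz.symm]) (by simp [setRank]) (by simp)
  unfold Whole attach
  convert h5 using 1
  · ext x; simp only [Set.mem_empty_iff_false, Set.mem_sdiff, Set.mem_insert_iff, Set.mem_singleton_iff]; grind
  · simp
  · ext x; simp only [Set.mem_empty_iff_false, Set.mem_sdiff, Set.mem_insert_iff, Set.mem_singleton_iff]; grind

/-- The hole is at the top of a deficient node. -/
theorem Hole.deficient_top {p i z : ℕ} (hh : h.Hole N H K p i z) (hp : p < N) (hK : ¬ K p ≤ K z)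
    (hr : h.rank p = i + 1) (hpar : h.par p ≠ N + 1) (hs : h.slot p = i + 2) :
    let y := h.pool (i + 1)
    let g := ((h.setPool (i + 1) N).setRank p i).attach z i p
    y ≠ N ∧ y < N ∧ (g.link K z (i + 1) y).Hole N H K (h.par p) (i + 2) (winner K z y) := by
  intro y g
  have hpz : p ≠ z := by rintro rfl; have := hh.rank; omega
  have hpF : p ∉ ({z} : Set ℕ) := by simpa using hpz
  have hH := hh.inv.slot_le hp hpF hpar
  have h0 := hh.inv.deficient p hp hpF hpar
  simp only [hr, hs, Set.mem_empty_iff_false, or_false] at h0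
  have hyN : y ≠ N := by omega
  obtain ⟨hy1, hy2, hy3, hy4⟩ := hh.inv.pool_lt (i + 1) (by omega) hyN
  have hyz : y ≠ z := by simpa using hy2
  have hyp : y ≠ p := by rintro rfl; exact hpar hy3
  -- Cut `p` from its position `i + 2` and take its partner `y` of rank `i + 1`. Reduced to rank `i`
  -- and hung below `z`, the node `p` raises `z` to rank `i + 1`; linking with `y` gives rank `i +
  -- 2`, which fits the new hole.
  have h2 := hh.inv.cutDeficient hp hpF hpar hr hs (by simp)
  have h3 := h2.drop hp (by simp) hr (by simp : (p, i) ∈ _)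
  have h4 := h3.link (z := z) (y := p) hh.lt hp (by simp) (by simp) hpz.symm
    (i := i) (by simp [setRank, setPool, hpz.symm, hh.rank]) (by simp [setRank])
    (by omega) (le_of_not_ge hK) (by simp [hpz.symm]; omega)
  have h4 : g.Inv N H K _ _ _ := h4
  have hgz : g.rank z = i + 1 := by simp [g, attach, setRank]
  have hgy : g.rank y = i + 1 := by
    simp only [g, attach, setRank, place, setPool, Function.update_of_ne hyz,
      Function.update_of_ne hyp]
    exact hy4
  have h5 := h4.linkTrees (z := z) (y := y) (i := i + 1) (F' := {winner K z y}) hh.lt hy1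
    (by simp [hpz.symm]) (by simpa [y] using hyp) hyz.symm hgz hgy (by omega) (by simp)
    (by ext x; simp only [Set.mem_sdiff, Set.mem_insert_iff, Set.mem_singleton_iff]; grind)
  refine ⟨hyN, hy1, ?_, ?_, rank_link_winner _ _ _, ?_⟩
  · convert h5 using 1
    ext ⟨a, b⟩; simp only [Set.mem_sdiff, Set.mem_insert_iff, Set.mem_singleton_iff, Prod.mk.injEq]; omega
  · rcases winner_eq K z y with h6 | h6 <;> rw [h6]
    exacts [hh.lt, hy1]
  · have h7 := (hh.inv.attached p hp hpF hpar).2.2.1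
    rw [hs] at h7
    refine h7.mono fun h8 h9 => lt_of_lt_of_le ?_ (le_rank_link hgz hgy _)
    simp only [g, attach, setRank, place, setPool, Function.update_apply]
    have := hh.rank
    grind

/-- The right neighbour of the hole is a deficient node. -/
theorem Hole.deficient_sibling {p i z : ℕ} (hh : h.Hole N H K p i z) (hp : p < N)
    (hK : ¬ K p ≤ K z) (hr : i + 1 < h.rank p) (hrx : h.rank (h.ch p (i + 1)) = i) :
    let x := h.ch p (i + 1)
    let y := h.pool i
    let g := (h.setPool i N).place p i x
    y ≠ N ∧ y < N ∧ x < N ∧ (g.link K z i y).Hole N H K p (i + 1) (winner K z y) := by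
  intro x y g
  have hpz : p ≠ z := by rintro rfl; have := hh.rank; omega
  obtain ⟨hx1, hx2, hx3, hx4⟩ := hh.inv.child p (i + 1) (Or.inl ⟨hp, hr⟩) (by simp)
  have hxz : x ≠ z := by simpa using hx2
  have hxpar : h.par x ≠ N + 1 := by rw [hx3]; omega
  have hH := hh.inv.slot_le hx1 hx2 hxpar
  rw [hx4] at hH
  have h0 := hh.inv.deficient x hx1 hx2 hxpar
  simp only [x, hrx, hx4, Set.mem_empty_iff_false, or_false] at h0
  have hyN : y ≠ N := by omega
  obtain ⟨hy1, hy2, hy3, hy4⟩ := hh.inv.pool_lt i (by omega) hyN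
  have hyz : y ≠ z := by simpa using hy2
  have hyx : y ≠ x := by rintro h; rw [← h] at hxpar; exact hxpar hy3
  have hxp : x ≠ p := by
    rintro h'
    have : h.rank x = i := hrx
    rw [h'] at this; omega
  have hB : Below N K p x := by
    have := (hh.inv.attached x hx1 hx2 hxpar).2.2.2; rwa [hx3] at this
  -- The deficient `x` has exactly the rank needed in the hole. The position `i + 1` that it leaves
  -- asks for a tree of rank `i + 1`, which `z` and the partner `y` provide.
  have h2 := hh.inv.cutDeficient hx1 hx2 hxpar hrx hx4 (by simp)
  have h3 := h2.place (z := x) (p := p) (i := i) hx1 (by simp [x]) (by simp)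
    (Or.inl ⟨hp, by simp only [setPool]; omega⟩) hB hrx
  have h5 := h3.linkTrees (z := z) (y := y) (i := i) (F' := {winner K z y}) hh.lt hy1
    (by simp [hxz.symm]) (by simpa [y] using hyx) hyz.symm hh.rank hy4 (by omega)
    (by simp [hx3])
    (by ext w; simp only [Set.mem_sdiff, Set.mem_insert_iff, Set.mem_singleton_iff]; grind)
  refine ⟨hyN, hy1, hx1, ?_, ?_, rank_link_winner _ _ _, ?_⟩
  · convert h5 using 1
    ext ⟨a, b⟩
    simp only [Set.mem_sdiff, Set.mem_insert_iff, Set.mem_singleton_iff, Prod.mk.injEq, hx3]; omega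
  · rcases winner_eq K z y with h6 | h6 <;> rw [h6]
    exacts [hh.lt, hy1]
  · exact Or.inl ⟨hp, lt_of_lt_of_le hr (le_rank_link (h := g) hh.rank hy4 _)⟩

/-- The node `p` of rank `i` has been removed from the position `i + 1` below `pp`, and there is
another tree of rank `i`. -/
structure TopHole (h : Heap) (N H : ℕ) (K : ℕ → κ) (pp p i z : ℕ) : Prop where
  inv : h.Inv N H K {p, z} {(pp, i + 1)} ∅
  lt : z < N
  rank : h.rank z = i
  ne : p ≠ z
  p_lt : p < N
  p_rank : h.rank p = i
  isSlot : h.IsSlot N H pp (i + 1)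
  below : Below N K pp p

theorem TopHole.i_lt {pp p i z : ℕ} (hh : h.TopHole N H K pp p i z) : i < H := by
  rcases hh.isSlot with h1 | h1
  · have := hh.inv.rank_le pp h1.1; omega
  · omega

/-- Without its missing last child, `p` has rank `i` and would be deficient in its position `i + 1`;
the tree `z` of the same rank is a possible partner. -/
theorem Hole.top {p i z : ℕ} (hh : h.Hole N H K p i z) (hp : p < N)
    (hr : h.rank p = i + 1) (hpar : h.par p ≠ N + 1) (hs : h.slot p ≠ i + 2) :
    (h.setRank p i).TopHole N H K (h.par p) p i z := by
  have hpz : p ≠ z := by rintro rfl; have := hh.rank; omega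
  have hpF : p ∉ ({z} : Set ℕ) := by simpa using hpz
  have h0 := hh.inv.deficient p hp hpF hpar
  have hs' : h.slot p = i + 1 := by omega
  have h2 := hh.inv.cut hp hpF hpar (by omega)
  have h3 := h2.drop hp (by simp) hr (by simp : (p, i) ∈ _)
  have h7 := hh.inv.attached p hp hpF hpar
  rw [hs'] at h7
  have hpp : h.par p ≠ p := by
    intro h; have := h7.2.2.1
    rw [h] at this
    rcases this with h | h <;> omega
  refine ⟨?_, hh.lt, by simp [setRank, hpz.symm, hh.rank], hpz, hp, by simp [setRank], ?_,
    h7.2.2.2⟩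
  · convert h3 using 1
    ext ⟨a, b⟩
    simp only [Set.mem_sdiff, Set.mem_insert_iff, Set.mem_singleton_iff, Prod.mk.injEq, hs']; omega
  · refine h7.2.2.1.mono fun h8 h9 => ?_
    simpa [setRank, hpp] using h9

/-- The right neighbour `x` of the hole is not deficient: move the hole to the top of `x`. -/
theorem Hole.sibling {p i z : ℕ} (hh : h.Hole N H K p i z) (hp : p < N)
    (hr : i + 1 < h.rank p) (hrx : h.rank (h.ch p (i + 1)) ≠ i) :
    let x := h.ch p (i + 1)
    let c := h.ch x i
    x < N ∧ c < N ∧ ((h.place p i c).setRank x i).TopHole N H K p x i z := by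
  intro x c
  have hpz : p ≠ z := by rintro rfl; have := hh.rank; omega
  obtain ⟨hx1, hx2, hx3, hx4⟩ := hh.inv.child p (i + 1) (Or.inl ⟨hp, hr⟩) (by simp)
  have hxz : x ≠ z := by simpa using hx2
  have hxpar : h.par x ≠ N + 1 := by rw [hx3]; omega
  have hxp : x ≠ p := by
    rintro h'
    have := (hh.inv.attached x hx1 hx2 hxpar).2.2.1
    rw [hx3, hx4] at this
    have h0 := hh.inv.deficient x hx1 hx2 hxpar
    rw [hx4, h'] at h0
    omega
  have hH := hh.inv.slot_le hx1 hx2 hxpar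
  rw [hx4] at hH
  have h0 := hh.inv.deficient x hx1 hx2 hxpar
  have hrx' : h.rank x = i + 1 := by
    rw [hx4] at h0
    have : h.rank x ≠ i := hrx
    omega
  obtain ⟨hc1, hc2, hc3, hc4⟩ := hh.inv.child x i (Or.inl ⟨hx1, by omega⟩) (by simp [hxp])
  have hcz : c ≠ z := by simpa using hc2
  have hcpar : h.par c ≠ N + 1 := by rw [hc3]; omega
  have hBx : Below N K p x := by
    have := (hh.inv.attached x hx1 hx2 hxpar).2.2.2; rwa [hx3] at this
  have hBc : Below N K x c := by
    have := (hh.inv.attached c hc1 hc2 hcpar).2.2.2; rwa [hc3] at this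
  have hB : Below N K p c := by
    rcases hBx with h1 | h1
    · exact Or.inl h1
    · rcases hBc with h2 | h2
      · omega
      · exact Or.inr (h1.trans h2)
  have hcx : c ≠ x := by
    intro h'
    have h5 : h.slot c = i := hc4
    rw [h'] at h5
    have h6 : h.slot x = i + 1 := hx4
    omega
  -- The last child `c` of `x` moves into the hole, where the heap order holds because `p` is above
  -- `x`. Now `x` lacks its last child and is the candidate for a deficient node of rank `i`.
  have h2 := hh.inv.move (c := c) (p := p) hc1 hc2 hcpar hc4 (by simp) hh.isSlot hB
  have hparx : (h.place p i c).par x = p := by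
    simp only [place, Function.update_of_ne hcx.symm]; exact hx3
  have hslotx : (h.place p i c).slot x = i + 1 := by
    simp only [place, Function.update_of_ne hcx.symm]; exact hx4
  have h3 := h2.cut hx1 hx2 (by rw [hparx]; omega) (by rw [hslotx]; exact hrx')
  have h4 := h3.drop (p := x) (i := i) hx1 (by simp [x]) hrx' (by simp [c, hc3])
  refine ⟨hx1, hc1, ?_, hh.lt, by simp [setRank, place, hxz.symm, hh.rank], hxz, hx1,
    by simp [setRank], ?_, hBx⟩
  · convert h4 using 1
    ext ⟨a, b⟩
    have e1 : (h.place p i c).par (h.ch p (i + 1)) = p := hparx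
    have e2 : (h.place p i c).slot (h.ch p (i + 1)) = i + 1 := hslotx
    have e3 : h.par c = x := hc3
    simp only [Set.mem_sdiff, Set.mem_insert_iff, Set.mem_singleton_iff, Prod.mk.injEq, e1, e2, e3]
    omega
  · refine Or.inl ⟨hp, ?_⟩
    simpa [setRank, place, hxp.symm] using hr

/-- With no pool tree of rank `i` so far, there is room for one more pair: `p` as the deficient node
and `z` as its partner. -/
theorem TopHole.store {pp p i z : ℕ} (hh : h.TopHole N H K pp p i z) (hpool : h.pool i = N) :
    ((((h.place pp (i + 1) p).setPool i z).setPar z (N + 1)).setDefi i p).Whole N H K := by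
  have := hh.inv.storePair (z := p) (y := z) hh.p_lt (by simp) hh.lt (by simp) hh.ne (by simp)
    hh.isSlot hh.below hh.p_rank hh.rank hpool (by simp) hh.i_lt
  unfold Whole
  convert this using 1
  · simp
  · simp

/-- Two deficient nodes with the same position number are joined, and so are the corresponding
trees. -/
theorem TopHole.join {pp p i z : ℕ} (hh : h.TopHole N H K pp p i z) (hpool : h.pool i ≠ N) :
    let q := h.defi i
    let y := h.pool i
    let pq := h.par q
    let g := ((h.setPool i N).link K z i y).link K p i q
    q < N ∧ y < N ∧
    (K p ≤ K q → (g.place pp (i + 1) p).Hole N H K pq (i + 1) (winner K z y)) ∧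
    (¬ K p ≤ K q → (g.place pq (i + 1) q).Hole N H K pp (i + 1) (winner K z y)) := by
  intro q y pq g
  have hi := hh.i_lt
  obtain ⟨hq1, hq2, hq3, hq4, hq5⟩ := hh.inv.defi_lt i hi (Or.inl hpool)
  obtain ⟨hy1, hy2, hy3, hy4⟩ := hh.inv.pool_lt i hi hpool
  simp only [Set.mem_insert_iff, Set.mem_singleton_iff, not_or] at hq2 hy2
  have hyq : y ≠ q := by 
    intro h'
    have h1 : h.par y = N + 1 := hy3
    rw [h'] at h1
    exact hq3 h1
  have hatt := hh.inv.attached q hq1 (by simp [q, hq2]) hq3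
  rw [hq4] at hatt
  have hparq : (h.par (h.defi i), i + 1) ≠ (pp, i + 1) := by simpa using hatt.1
  have hpq : pq ≠ pp := fun h' => hparq (by rw [← h'])
  have h2 := hh.inv.cutDeficient hq1 (by simp [hq2]) hq3 hq5 hq4 (by simp)
  -- The four trees `z`, `y`, `p`, `q` of rank `i` become two trees of rank `i + 1` for the two
  -- holes in position `i + 1`. The winner of `p` and `q` returns to its own parent, where the heap
  -- order is known; the winner of `z` and `y` is left for the other hole.
  have h3 := h2.linkTrees (z := z) (y := y) (i := i) (F' := {p, q, winner K z y}) hh.lt hy1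
    (by simp) (by simp [y]) (Ne.symm hy2.2) hh.rank hy4 hi (by simp)
    (by ext w; simp only [Set.mem_sdiff, Set.mem_insert_iff, Set.mem_singleton_iff]
        have := hh.ne; grind)
  have hw : winner K z y = z ∨ winner K z y = y := winner_eq K z y
  have hpw : p ≠ winner K z y := by
    rcases hw with h5 | h5 <;> rw [h5]
    exacts [hh.ne, Ne.symm hy2.1]
  have hqw : q ≠ winner K z y := by
    rcases hw with h5 | h5 <;> rw [h5]
    exacts [hq2.2, hyq.symm]
  have hrp : ((h.setPool i N).link K z i y).rank p = i := by
    rw [rank_link_of_ne hpw]; exact hh.p_rank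
  have hrq : ((h.setPool i N).link K z i y).rank q = i := by
    rw [rank_link_of_ne hqw]; exact hq5
  have h4 := h3.linkTrees (z := p) (y := q) (i := i) (F' := {winner K p q, winner K z y})
    hh.p_lt hq1 (by simp) (by simp) (Ne.symm hq2.1) hrp hrq hi (by simp)
    (by ext w; simp only [Set.mem_sdiff, Set.mem_insert_iff, Set.mem_singleton_iff]; grind)
  have hslot : ∀ {a}, h.IsSlot N H a (i + 1) → g.IsSlot N H a (i + 1) := fun {a} h5 =>
    h5.mono fun _ h7 => lt_of_lt_of_le h7
      ((le_rank_link (h := h.setPool i N) hh.rank hy4 a).trans (le_rank_link hrp hrq a))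
  have hgw : g.rank (winner K z y) = i + 1 := by
    have : winner K z y ≠ winner K p q := by
      rcases winner_eq K p q with h5 | h5 <;> rw [h5]
      exacts [hpw.symm, hqw.symm]
    simp only [g]
    rw [rank_link_of_ne this, rank_link_winner]
  have hwlt : winner K z y < N := by
    rcases hw with h6 | h6 <;> rw [h6]
    exacts [hh.lt, hy1]
  have hgpq : g.rank (winner K p q) = i + 1 := rank_link_winner _ _ _
  refine ⟨hq1, hy1, fun hK => ?_, fun hK => ?_⟩
  · have hwin : winner K p q = p := by simp [winner, hK]
    rw [hwin] at h4 hgpq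
    have h5 := h4.place (z := p) (p := pp) (i := i + 1) hh.p_lt (by simp) (by simp)
      (hslot hh.isSlot) hh.below hgpq
    refine ⟨?_, hwlt, hgw, ?_⟩
    · convert h5 using 1
      · ext w; simp only [Set.mem_sdiff, Set.mem_insert_iff, Set.mem_singleton_iff]; grind
      · ext ⟨a, b⟩
        simp only [Set.mem_sdiff, Set.mem_insert_iff, Set.mem_singleton_iff, Prod.mk.injEq]
        simp only [pq, q] at *
        omega
    · exact (hslot hatt.2.2.1).mono fun _ h => h
  · have hwin : winner K p q = q := by simp [winner, hK]
    rw [hwin] at h4 hgpq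
    have h5 := h4.place (z := q) (p := pq) (i := i + 1) hq1 (by simp) (by simp [pq, q])
      (hslot hatt.2.2.1) hatt.2.2.2 hgpq
    refine ⟨?_, hwlt, hgw, ?_⟩
    · convert h5 using 1
      · ext w; simp only [Set.mem_sdiff, Set.mem_insert_iff, Set.mem_singleton_iff]; grind
      · ext ⟨a, b⟩
        simp only [Set.mem_sdiff, Set.mem_insert_iff, Set.mem_singleton_iff, Prod.mk.injEq]
        simp only [pq, q] at *
        omega
    · exact (hslot hh.isSlot).mono fun _ h => h

end Heap
end AdTypes

/-! ### Lowering a key, repairing the main root, taking a tree apart -/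

namespace AdTypes
namespace Heap

variable {κ : Type*} [LinearOrder κ] {N H : ℕ} {K K' : ℕ → κ} {h : Heap} {F : Set ℕ}
  {Hs : Set (ℕ × ℕ)} {X : Set ℕ}

theorem Inv.rekey (hI : h.Inv N H K F Hs X)
    (hK : ∀ y < N, y ∉ F → h.par y < N → K (h.par y) ≤ K y → K' (h.par y) ≤ K' y) :
    h.Inv N H K' F Hs X := by
  refine ⟨fun x hx hF hp => ?_, hI.deficient, hI.child, hI.pool_lt, hI.defi_lt, hI.root,
    hI.reserved, hI.rank_le⟩
  obtain ⟨h1, h2, h3, h4⟩ := hI.attached x hx hF hp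
  refine ⟨h1, h2, h3, ?_⟩
  rcases h4 with h4 | h4
  · exact Or.inl h4
  · rcases h3 with h5 | h5
    · exact Or.inr (hK x hx hF h5.1 h4)
    · exact Or.inl h5.1

/-- One of the roots has the smallest key. -/
theorem Whole.exists_le (hW : h.Whole N H K) {x : ℕ} (hx : x < N) :
    ∃ y, (y = h.ch N H ∨ ∃ i < H, h.pool i ≠ N ∧ y = h.pool i) ∧ K y ≤ K x := by
  -- Climbing to the parent increases the rank: the rank of `x` is at most its position, which is
  -- less than the rank of the parent.
  induction hd : H - h.rank x using Nat.strong_induction_on generalizing x with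
  | _ d ih =>
    by_cases hp : h.par x = N + 1
    · obtain ⟨h1, h2⟩ := hW.root x hx (by simp) hp
      exact ⟨x, Or.inr ⟨_, h1, by omega, h2.symm⟩, le_rfl⟩
    · obtain ⟨-, h2, h3, h4⟩ := hW.attached x hx (by simp) hp
      rcases h3 with h3 | h3
      · have h5 := hW.deficient x hx (by simp) hp
        have h6 := hW.rank_le _ h3.1
        obtain ⟨y, hy1, hy2⟩ := ih (H - h.rank (h.par x)) (by omega) h3.1 rfl
        refine ⟨y, hy1, hy2.trans ?_⟩
        rcases h4 with h4 | h4
        · omega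
        · exact h4
      · rw [h3.1, h3.2] at h2
        exact ⟨x, Or.inl h2.symm, le_rfl⟩

/-- A root has no parent whose key the lowered one could undercut, so nothing needs to move. -/
theorem Whole.lower_root (hW : h.Whole N H K) {x : ℕ} (hp : N ≤ h.par x)
    (hlow : K' x ≤ K x) (hne : ∀ y, y ≠ x → K' y = K y) : h.Whole N H K' := by
  refine Inv.rekey hW fun y hy _ hyp hle => ?_
  have hyx : y ≠ x := by rintro rfl; omega
  rw [hne y hyx]
  by_cases h1 : h.par y = x
  · rw [h1] at hle ⊢; exact hlow.trans hle
  · rw [hne _ h1]; exact hle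

/-- The subtree of `x` itself is the tree to be inserted into the hole it leaves; once `x` is
detached, its smaller key violates nothing. -/
theorem Whole.lower_cut (hW : h.Whole N H K) {x : ℕ} (hx : x < N) (hp : h.par x < N)
    (hlow : K' x ≤ K x) (hne : ∀ y, y ≠ x → K' y = K y) (hr : h.rank x = h.slot x) :
    h.Hole N H K' (h.par x) (h.slot x) x := by
  have h1 := hW.cut hx (by simp) (by omega) hr
  refine ⟨?_, hx, hr, (hW.attached x hx (by simp) (by omega)).2.2.1⟩
  have h2 : h.Inv N H K' (insert x ∅) (insert (h.par x, h.slot x) ∅) ∅ := by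
    refine h1.rekey fun y hy hyF hyp hle => ?_
    have hyx : y ≠ x := by simpa using hyF
    rw [hne y hyx]
    by_cases h1 : h.par y = x
    · rw [h1] at hle ⊢; exact hlow.trans hle
    · rw [hne _ h1]; exact hle
  simpa using h2

/-- The tree of a deficient `x` is one rank too small for the position it leaves; linking it with
its partner from the pool makes it fit. -/
theorem Whole.lower_cut_deficient (hW : h.Whole N H K) {x : ℕ} (hx : x < N) (hp : h.par x < N)
    (hlow : K' x ≤ K x) (hne : ∀ y, y ≠ x → K' y = K y) (hr : h.rank x ≠ h.slot x) :
    let y := h.pool (h.rank x)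
    y ≠ N ∧ y < N ∧ h.slot x = h.rank x + 1 ∧ ((h.setPool (h.rank x) N).link K' x (h.rank x) y).Hole
      N H K' (h.par x) (h.rank x + 1) (winner K' x y) := by
  intro y
  have h0 := hW.deficient x hx (by simp) (by omega)
  simp only [hr, false_or, Set.mem_empty_iff_false, or_false] at h0
  obtain ⟨hs, hpool, -⟩ := h0
  have hatt := hW.attached x hx (by simp) (by omega)
  have hH := hW.slot_le hx (by simp) (by omega)
  obtain ⟨hy1, -, hy3, hy4⟩ := hW.pool_lt (h.rank x) (by omega) hpool
  have hyx : y ≠ x := by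
    intro h1
    have h2 : h.par y = N + 1 := hy3
    rw [h1] at h2; omega
  have h1 := hW.cutDeficient hx (by simp) (by omega) rfl hs.symm (by simp)
  have h2 : (h.setPool (h.rank x) N).Inv N H K' {y, x} {(h.par x, h.rank x + 1)} ∅ := by
    have h3 := h1.rekey (K' := K') fun z hz hzF hzp hle => ?_
    · simpa using h3
    · have hzx : z ≠ x := by
        simp only [Set.mem_insert_iff, not_or] at hzF; exact hzF.2.1
      have hle : K (h.par z) ≤ K z := hle
      change K' (h.par z) ≤ K' z
      rw [hne z hzx]
      by_cases h1 : h.par z = x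
      · rw [h1] at hle ⊢; exact hlow.trans hle
      · rw [hne _ h1]; exact hle
  have h3 := h2.linkTrees (z := x) (y := y) (i := h.rank x) (F' := {winner K' x y}) hx hy1
    (by simp) (by simp) hyx.symm rfl hy4 (by omega) (by simp)
    (by ext w; simp only [Set.mem_sdiff, Set.mem_insert_iff, Set.mem_singleton_iff]; grind)
  refine ⟨hpool, hy1, hs.symm, h3, ?_, rank_link_winner _ _ _, ?_⟩
  · rcases winner_eq K' x y with h6 | h6 <;> rw [h6]
    exacts [hx, hy1]
  · have h7 := hatt.2.2.1
    rw [← hs] at h7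
    exact h7.mono fun _ h9 => lt_of_lt_of_le h9
      (le_rank_link (h := h.setPool (h.rank x) N) rfl hy4 _)

/-- Linking a deficient main root with the corresponding tree of the pool. -/
theorem Whole.repair_root (hW : h.Whole N H K) (hr : h.rank (h.ch N H) ≠ H) :
    let x := h.ch N H
    let i := h.rank x
    let y := h.pool i
    x < N ∧ y ≠ N ∧ y < N ∧ i < H ∧
      (((h.setPool i N).link K x i y).place N H (winner K x y)).Whole N H K := by
  intro x i y
  obtain ⟨hx, -, hx3, hx4⟩ := hW.child N H (Or.inr ⟨rfl, rfl⟩) (by simp)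
  have hxp : h.par x ≠ N + 1 := by rw [hx3]; omega
  have h0 := hW.deficient x hx (by simp) hxp
  rw [hx4] at h0
  simp only [x, hr, false_or, Set.mem_empty_iff_false, or_false] at h0
  obtain ⟨hs, hpool, -⟩ := h0
  have hs : i + 1 = H := hs
  obtain ⟨hy1, -, hy3, hy4⟩ := hW.pool_lt i (by omega) hpool
  have hyx : y ≠ x := by
    intro h1
    have h2 : h.par y = N + 1 := hy3
    rw [h1] at h2; omega
  have h1 := hW.cutDeficient (i := i) hx (by simp) hxp rfl (by rw [hx4, hs]) (by simp)
  have h3 := h1.linkTrees (z := x) (y := y) (i := i) (F' := {winner K x y}) hx hy1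
    (by simp [x]) (by simp [y]) hyx.symm rfl hy4 (by omega) (by simp)
    (by ext w; simp only [Set.mem_sdiff, Set.mem_insert_iff, Set.mem_singleton_iff,
          Set.mem_empty_iff_false]; grind)
  have hwlt : winner K x y < N := by
    rcases winner_eq K x y with h6 | h6 <;> rw [h6]
    exacts [hx, hy1]
  have h4 := h3.place (z := winner K x y) (p := N) (i := H) hwlt (by simp)
    (by simp [hx3, hs]) (Or.inr ⟨rfl, rfl⟩) (Or.inl rfl) (by rw [rank_link_winner, hs])
  refine ⟨hx, hpool, hy1, by omega, ?_⟩
  unfold Whole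
  convert h4 using 1
  · simp
  · ext ⟨a, b⟩
    simp only [Set.mem_sdiff, Set.mem_insert_iff, Set.mem_singleton_iff, Prod.mk.injEq, hx3, hs,
      Set.mem_empty_iff_false]
    grind

def setCh (h : Heap) (p i c : ℕ) : Heap :=
  { h with ch := fun q j => if q = p ∧ j = i then c else h.ch q j }

/-- Child cells beyond the rank are unconstrained. While a tree is being taken apart, they store the
roots of its detached subtrees. -/
theorem Inv.setCh (hI : h.Inv N H K F Hs X) {p i c : ℕ} (hs : ¬ h.IsSlot N H p i) :
    (h.setCh p i c).Inv N H K F Hs X := by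
  obtain ⟨h1, h2, h3, h4, h5, h6, h7, h8⟩ := hI
  refine ⟨fun x hx hF hp => ?_, h2, fun q j hq hqj => ?_, h4, h5, h6, h7, h8⟩
  · obtain ⟨a, b, c', d⟩ := h1 x hx hF hp
    refine ⟨a, ?_, c', d⟩
    have : ¬ (h.par x = p ∧ h.slot x = i) := by
      rintro ⟨rfl, rfl⟩; exact hs c'
    simp only [Heap.setCh, this, if_false]
    exact b
  · have : ¬ (q = p ∧ j = i) := by
      rintro ⟨rfl, rfl⟩; exact hs hq
    simp only [Heap.setCh, this, if_false]
    exact h3 q j hq hqj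

/-- The cells `ch x l` with `i ≤ l < r`. -/
def kids (h : Heap) (x i r : ℕ) : Set ℕ := {y | ∃ l, i ≤ l ∧ l < r ∧ y = h.ch x l}

/-- The detached tree with root `t` of rank `i` and the detached trees of the ranks `i, …, r - 1`,
whose roots are stored as children of `x`. -/
structure Opened (h : Heap) (N H : ℕ) (K : ℕ → κ) (x i r t : ℕ) (Hs : Set (ℕ × ℕ)) (X : Set ℕ) :
    Prop where
  inv : h.Inv N H K (insert t (h.kids x i r)) Hs X
  lt : t < N
  rank : h.rank t = i
  kid : ∀ l, i ≤ l → l < r → h.ch x l < N ∧ h.rank (h.ch x l) = l ∧ h.ch x l ≠ t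
  hole : ∀ p l, (p, l) ∈ Hs → p = N
  miss : ∀ l ∈ X, r ≤ l
  le : r ≤ H

/-- Reassembly works like binary counting: the tree built so far has rank `i` and meets the stored
tree of the same rank. -/
theorem Opened.up {x i r t : ℕ} (hO : h.Opened N H K x i r t Hs X) (hi : i < r) :
    (h.link K t i (h.ch x i)).Opened N H K x (i + 1) r (winner K t (h.ch x i)) Hs X := by
  obtain ⟨hc1, hc2, hc3⟩ := hO.kid i le_rfl hi
  have hle := hO.le
  have hholes : ∀ w, w < N → (w, i) ∉ Hs := fun w hw hmem => by
    have := hO.hole w i hmem; omega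
  have hw := winner_eq K t (h.ch x i)
  have hch : ∀ l, i + 1 ≤ l → (h.link K t i (h.ch x i)).ch x l = h.ch x l := by
    intro l hl
    unfold link
    split_ifs <;> simp only [attach, setRank, place] <;> grind
  have hne : ∀ l, i + 1 ≤ l → l < r → h.ch x l ≠ winner K t (h.ch x i) := by
    intro l hl hlr h1
    obtain ⟨-, h2, h3⟩ := hO.kid l (by omega) hlr
    rcases hw with h4 | h4 <;> rw [h4] at h1
    · exact h3 h1
    · rw [h1] at h2; omega
  have hkids : (h.link K t i (h.ch x i)).kids x (i + 1) r = h.kids x (i + 1) r := by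
    ext y
    simp only [kids, Set.mem_ofPred_eq]
    constructor
    · rintro ⟨l, h1, h2, h3⟩; exact ⟨l, h1, h2, by rw [h3, hch l h1]⟩
    · rintro ⟨l, h1, h2, h3⟩; exact ⟨l, h1, h2, by rw [h3, hch l h1]⟩
  refine ⟨?_, ?_, rank_link_winner _ _ _, ?_, hO.hole, hO.miss, hO.le⟩
  · rw [hkids]
    unfold link winner
    have hF : ∀ w v, (w = t ∧ v = h.ch x i ∨ w = h.ch x i ∧ v = t) →
        insert w (h.kids x (i + 1) r) = insert t (h.kids x i r) \ {v} := by
      intro w v hwv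
      ext y
      simp only [Set.mem_insert_iff, kids, Set.mem_ofPred_eq, Set.mem_sdiff, Set.mem_singleton_iff]
      constructor
      · rintro (rfl | ⟨l, h1, h2, rfl⟩)
        · rcases hwv with ⟨rfl, rfl⟩ | ⟨rfl, rfl⟩
          · exact ⟨Or.inl rfl, Ne.symm hc3⟩
          · exact ⟨Or.inr ⟨i, le_rfl, hi, rfl⟩, hc3⟩
        · refine ⟨Or.inr ⟨l, by omega, h2, rfl⟩, ?_⟩
          obtain ⟨-, h5, h6⟩ := hO.kid l (by omega) h2
          rcases hwv with ⟨rfl, rfl⟩ | ⟨rfl, rfl⟩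
          · intro h7; rw [h7] at h5; omega
          · exact h6
      · rintro ⟨rfl | ⟨l, h1, h2, rfl⟩, h3⟩
        · rcases hwv with ⟨rfl, rfl⟩ | ⟨rfl, rfl⟩
          · exact Or.inl rfl
          · exact absurd rfl h3
        · rcases hwv with ⟨rfl, rfl⟩ | ⟨rfl, rfl⟩
          · by_cases hl : l = i
            · subst hl; exact absurd rfl h3
            · exact Or.inr ⟨l, by omega, h2, rfl⟩
          · by_cases hl : l = i
            · subst hl; exact Or.inl rfl
            · exact Or.inr ⟨l, by omega, h2, rfl⟩
    have hmem : h.ch x i ∈ insert t (h.kids x i r) := Or.inr ⟨i, le_rfl, hi, rfl⟩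
    split_ifs with hK
    · rw [hF t (h.ch x i) (Or.inl ⟨rfl, rfl⟩)]
      exact hO.inv.link hO.lt hc1 (Or.inl rfl) hmem hc3.symm hO.rank hc2 (by omega) hK
        (hholes _ hO.lt)
    · rw [hF (h.ch x i) t (Or.inr ⟨rfl, rfl⟩)]
      exact hO.inv.link hc1 hO.lt hmem (Or.inl rfl) hc3 hc2 hO.rank (by omega)
        (le_of_not_ge hK) (hholes _ hc1)
  · rcases hw with h6 | h6 <;> rw [h6]
    exacts [hO.lt, hc1]
  · intro l h1 h2
    rw [hch l h1, rank_link_of_ne (hne l h1 h2)]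
    obtain ⟨h3, h4, -⟩ := hO.kid l (by omega) h2
    exact ⟨h3, h4, hne l h1 h2⟩

theorem Opened.child_facts {x i r : ℕ} (hO : h.Opened N H K x (i + 1) r x Hs X) :
    h.ch x i < N ∧ h.ch x i ∉ insert x (h.kids x (i + 1) r) ∧ h.par (h.ch x i) = x ∧
      h.slot (h.ch x i) = i ∧ (h.rank (h.ch x i) = i ∨ h.rank (h.ch x i) + 1 = i) := by
  have hx := hO.lt
  obtain ⟨h1, h2, h3, h4⟩ := hO.inv.child x i (Or.inl ⟨hx, by rw [hO.rank]; omega⟩)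
    (fun hmem => by have := hO.hole x i hmem; omega)
  refine ⟨h1, h2, h3, h4, ?_⟩
  have := hO.inv.deficient _ h1 h2 (by rw [h3]; omega)
  rw [h4] at this
  exact this.imp id fun h => h.1

theorem Opened.down {x i r : ℕ} (hO : h.Opened N H K x (i + 1) r x Hs X) (hi : i < r)
    (hr : h.rank (h.ch x i) = i) : (h.setRank x i).Opened N H K x i r x Hs X := by
  obtain ⟨hc1, hc2, hc3, hc4, -⟩ := hO.child_facts
  have hx := hO.lt
  have hcx : h.ch x i ≠ x := fun h' => hc2 (Or.inl h')
  have hxi : (x, i) ∉ Hs := fun hmem => by have := hO.hole x i hmem; omega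
  have h1 := hO.inv.cut hc1 hc2 (by rw [hc3]; omega) (by rw [hr, hc4])
  rw [hc3, hc4] at h1
  have h2 := h1.drop hx (by simp) hO.rank (by simp)
  refine ⟨?_, hx, by simp [setRank], ?_, hO.hole, hO.miss, hO.le⟩
  · convert h2 using 1
    · ext y
      simp only [Set.mem_insert_iff, kids, Set.mem_ofPred_eq, setRank]
      constructor
      · rintro (rfl | ⟨l, h3, h4, rfl⟩)
        · exact Or.inr (Or.inl rfl)
        · by_cases hl : l = i
          · subst hl; exact Or.inl rfl
          · exact Or.inr (Or.inr ⟨l, by omega, h4, rfl⟩)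
      · rintro (rfl | rfl | ⟨l, h3, h4, rfl⟩)
        · exact Or.inr ⟨i, le_rfl, hi, rfl⟩
        · exact Or.inl rfl
        · exact Or.inr ⟨l, by omega, h4, rfl⟩
    · ext y
      simp only [Set.mem_sdiff, Set.mem_insert_iff, Set.mem_singleton_iff]
      constructor
      · intro h3; exact ⟨Or.inr h3, by rintro rfl; exact hxi h3⟩
      · rintro ⟨h3 | h3, h4⟩
        exacts [absurd h3 h4, h3]
  · intro l h3 h4
    by_cases hl : l = i
    · subst hl
      refine ⟨hc1, ?_, hcx⟩
      simp only [setRank, Function.update_of_ne hcx]; exact hr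
    · obtain ⟨h5, h6, h7⟩ := hO.kid l (by omega) h4
      refine ⟨h5, ?_, h7⟩
      simp only [setRank, Function.update_of_ne h7]; exact h6

/-- A deficient child of `x` has rank `i - 1` and is completed by its pool partner. This partner is
still in the pool, because only ranks from `r` on can be reserved in `X`. -/
theorem Opened.down_deficient {x i r : ℕ} (hO : h.Opened N H K x (i + 1) r x Hs X) (hi : i < r)
    (hr : h.rank (h.ch x i) ≠ i) :
    let c := h.ch x i
    let j := h.rank c
    let y := h.pool j
    y ≠ N ∧ y < N ∧ j < H ∧ ((((h.setRank x i).setPool j N).link K c j y).setCh x i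
      (winner K c y)).Opened N H K x i r x Hs X := by
  intro c j y
  obtain ⟨hc1, hc2, hc3, hc4, hc5⟩ := hO.child_facts
  have hx := hO.lt
  have hle := hO.le
  have hcx : c ≠ x := fun h' => hc2 (Or.inl h')
  have hxi : (x, i) ∉ Hs := fun hmem => by have := hO.hole x i hmem; omega
  have hji : j + 1 = i := by
    rcases hc5 with h' | h'
    exacts [absurd h' hr, h']
  have hcp : h.par c ≠ N + 1 := by
    have : h.par c = x := hc3
    omega
  have hjX : j ∉ X := fun hmem => by have := hO.miss j hmem; omega
  have h0 := hO.inv.deficient c hc1 hc2 hcp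
  have hpool : y ≠ N := by
    rcases h0 with h' | ⟨-, h' | h', -⟩
    · have : h.slot c = i := hc4
      omega
    · exact h'
    · exact absurd h' hjX
  obtain ⟨hy1, hy2, hy3, hy4⟩ := hO.inv.pool_lt j (by omega) hpool
  have hyx : y ≠ x := fun h' => hy2 (Or.inl h')
  have hyc : y ≠ c := by
    intro h'
    have : h.par y = N + 1 := hy3
    rw [h'] at this; exact hcp this
  have h1 := hO.inv.cutDeficient (x := c) (i := j) hc1 hc2 hcp rfl
    (by have : h.slot c = i := hc4
        omega) hjX
  have hpc : h.par c = x := hc3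
  rw [hpc, hji] at h1
  have h2 := h1.drop hx (by simp) hO.rank (by simp : (x, i) ∈ _)
  have hHs : insert (x, i) Hs \ {(x, i)} = Hs := by
    ext y
    simp only [Set.mem_sdiff, Set.mem_insert_iff, Set.mem_singleton_iff]
    constructor
    · rintro ⟨h3 | h3, h4⟩
      exacts [absurd h3 h4, h3]
    · intro h3; exact ⟨Or.inr h3, by rintro rfl; exact hxi h3⟩
  rw [hHs] at h2
  have h2 : ((h.setRank x i).setPool j N).Inv N H K
      (insert y (insert c (insert x (h.kids x (i + 1) r)))) Hs X := h2
  have hkw : ∀ l, i + 1 ≤ l → l < r → h.ch x l ≠ c ∧ h.ch x l ≠ y := by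
    intro l h3 h4
    constructor
    · rintro h'; exact hc2 (Or.inr ⟨l, h3, h4, h'.symm⟩)
    · rintro h'; exact hy2 (Or.inr ⟨l, h3, h4, h'.symm⟩)
  have hrc : ((h.setRank x i).setPool j N).rank c = j := by
    simp only [setPool, setRank, Function.update_of_ne hcx]; rfl
  have hry : ((h.setRank x i).setPool j N).rank y = j := by
    simp only [setPool, setRank, Function.update_of_ne hyx]; exact hy4
  have hholes : ∀ w, w < N → (w, j) ∉ Hs := fun w hw hmem => by
    have := hO.hole w j hmem; omega
  have hw := winner_eq K c y
  have hwx : winner K c y ≠ x := by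
    rcases hw with h' | h' <;> rw [h']
    exacts [hcx, hyx]
  have hrx : (((h.setRank x i).setPool j N).link K c j y).rank x = i := by
    rw [rank_link_of_ne hwx.symm]; simp [setPool, setRank]
  have hchx : ∀ l, (((h.setRank x i).setPool j N).link K c j y).ch x l = h.ch x l := by
    intro l
    unfold link
    split_ifs <;> simp only [attach, setRank, place, setPool, hcx.symm, hyx.symm, false_and,
      if_false]
  have h3 : (((h.setRank x i).setPool j N).link K c j y).Inv N H K
      (insert (winner K c y) (insert x (h.kids x (i + 1) r))) Hs X := by
    unfold link winner attach
    have hcm : c ∉ insert x (h.kids x (i + 1) r) := hc2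
    split_ifs with hK
    · have h3 := h2.link (z := c) (y := y) (i := j) hc1 hy1 (by simp) (by simp) hyc.symm hrc hry
        (by omega) hK (hholes _ hc1)
      convert h3 using 1
      ext w; simp only [Set.mem_sdiff, Set.mem_insert_iff, Set.mem_singleton_iff] at *; grind
    · have h3 := h2.link (z := y) (y := c) (i := j) hy1 hc1 (by simp) (by simp) hyc hry hrc
        (by omega) (le_of_not_ge hK) (hholes _ hy1)
      convert h3 using 1
      ext w; simp only [Set.mem_sdiff, Set.mem_insert_iff, Set.mem_singleton_iff] at *; grind
  have h4 := h3.setCh (p := x) (i := i) (c := winner K c y) (by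
    rintro (h' | h')
    · rw [hrx] at h'; omega
    · omega)
  refine ⟨hpool, hy1, by omega, ?_, hx, hrx, ?_, hO.hole, hO.miss, hO.le⟩
  · convert h4 using 1
    ext w
    simp only [Set.mem_insert_iff, kids, Set.mem_ofPred_eq, setCh, hchx, true_and]
    constructor
    · rintro (rfl | ⟨l, h5, h6, h7⟩)
      · exact Or.inr (Or.inl rfl)
      · by_cases hl : l = i
        · rw [if_pos hl] at h7; exact Or.inl h7
        · rw [if_neg hl] at h7; exact Or.inr (Or.inr ⟨l, by omega, h6, h7⟩)
    · rintro (rfl | rfl | ⟨l, h5, h6, rfl⟩)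
      · exact Or.inr ⟨i, le_rfl, hi, by simp⟩
      · exact Or.inl rfl
      · exact Or.inr ⟨l, by omega, h6, by rw [if_neg (by omega)]⟩
  · intro l h5 h6
    simp only [setCh, hchx, true_and]
    by_cases hl : l = i
    · simp only [hl, if_true]
      refine ⟨?_, ?_, hwx⟩
      · rcases hw with h' | h' <;> rw [h']
        exacts [hc1, hy1]
      · rw [rank_link_winner, hji]
    · simp only [hl, if_false]
      obtain ⟨h7, h8, h9⟩ := hO.kid l (by omega) h6
      have h10 := hkw l (by omega) h6
      refine ⟨h7, ?_, h9⟩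
      rw [rank_link_of_ne (by rcases hw with h' | h' <;> rw [h']; exacts [h10.1, h10.2])]
      simp only [setPool, setRank, Function.update_of_ne h9]
      exact h8

/-- When all children have been detached, the key of `x` may change. -/
theorem Opened.rekey {x r : ℕ} (hO : h.Opened N H K x 0 r x Hs X)
    (hne : ∀ y, y ≠ x → K' y = K y) : h.Opened N H K' x 0 r x Hs X := by
  refine ⟨hO.inv.rekey fun y hy hyF hyp hle => ?_, hO.lt, hO.rank, hO.kid, hO.hole, hO.miss,
    hO.le⟩
  have hyx : y ≠ x := fun h' => hyF (Or.inl h')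
  have hpx : h.par y ≠ x := by
    intro h'
    rcases (hO.inv.attached y hy hyF (by omega)).2.2.1 with h1 | h1
    · rw [h', hO.rank] at h1; omega
    · omega
  rw [hne y hyx, hne _ hpx]; exact hle

theorem kids_self (h : Heap) (x r : ℕ) : h.kids x r r = ∅ := by
  ext y; simp only [kids, Set.mem_ofPred_eq, Set.mem_empty_iff_false, iff_false]; grind

/-- The rank stays reserved in `X`: its deficient node waits for the reassembled tree of the same
rank, which `Opened.close_pool` delivers. -/
theorem Whole.open_pool (hW : h.Whole N H K) {i : ℕ} (hi : i < H) (hp : h.pool i ≠ N) :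
    (h.setPool i N).Opened N H K (h.pool i) i i (h.pool i) ∅ {i} := by
  obtain ⟨h1, -, -, h4⟩ := hW.pool_lt i hi hp
  refine ⟨?_, h1, h4, fun l h5 h6 => by omega, by simp, by simp, hi.le⟩
  have := hW.unpool hi hp
  rw [kids_self]
  simpa using this

theorem Whole.open_root (hW : h.Whole N H K) (hr : h.rank (h.ch N H) = H) :
    h.Opened N H K (h.ch N H) H H (h.ch N H) {(N, H)} ∅ := by
  obtain ⟨hx, -, hx3, hx4⟩ := hW.child N H (Or.inr ⟨rfl, rfl⟩) (by simp)
  refine ⟨?_, hx, hr, fun l h5 h6 => by omega, by simp, by simp, le_rfl⟩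
  have := hW.cut hx (by simp) (by rw [hx3]; omega) (by rw [hr, hx4])
  rw [kids_self]
  simpa [hx3, hx4] using this

theorem Opened.close_pool {x r t : ℕ} (hO : h.Opened N H K x r r t ∅ {r}) (hr : r < H) :
    ((h.setPool r t).setPar t (N + 1)).Whole N H K := by
  have h1 := hO.inv
  rw [kids_self] at h1
  have := h1.repool hr hO.lt (by simp) hO.rank rfl
  unfold Whole
  convert this using 1 <;> simp

theorem Opened.close_root {x t : ℕ} (hO : h.Opened N H K x H H t {(N, H)} ∅) :
    (h.place N H t).Whole N H K := by
  have h1 := hO.inv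
  rw [kids_self] at h1
  have := h1.place hO.lt (by simp) rfl (Or.inr ⟨rfl, rfl⟩) (Or.inl rfl) hO.rank
  unfold Whole
  convert this using 1 <;> simp

/-- The number of trees in the pool. -/
def size (h : Heap) (N H : ℕ) : ℕ := ((Finset.range H).filter fun i => h.pool i ≠ N).card

theorem size_le (h : Heap) (N H : ℕ) : h.size N H ≤ H := by
  unfold size
  simpa using Finset.card_filter_le (Finset.range H) fun i => h.pool i ≠ N

theorem size_congr {h h' : Heap} (hp : h.pool = h'.pool) : h.size N H = h'.size N H := by
  simp [size, hp]

theorem size_clear {h h' : Heap} {i : ℕ} (hi : i < H) (hp : h.pool i ≠ N)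
    (hp' : h'.pool = Function.update h.pool i N) : h'.size N H + 1 = h.size N H := by
  have : (Finset.range H).filter (fun l => h'.pool l ≠ N) =
      ((Finset.range H).filter fun l => h.pool l ≠ N).erase i := by
    ext l
    simp only [hp', Finset.mem_filter, Finset.mem_range, Finset.mem_erase, Function.update_apply]
    by_cases hl : l = i <;> simp [hl]
  unfold size
  rw [this, Finset.card_erase_add_one]
  simp [hi, hp]

theorem size_set_le {h h' : Heap} {i y : ℕ} (hp' : h'.pool = Function.update h.pool i y) :
    h'.size N H ≤ h.size N H + 1 := by
  have : (Finset.range H).filter (fun l => h'.pool l ≠ N) ⊆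
      insert i ((Finset.range H).filter fun l => h.pool l ≠ N) := by
    intro l
    simp only [hp', Finset.mem_filter, Finset.mem_range, Finset.mem_insert, Function.update_apply]
    by_cases hl : l = i <;> simp [hl]
  exact (Finset.card_le_card this).trans (Finset.card_insert_le _ _)

end Heap
end AdTypes

namespace AdTypes

/-! ### Reasoning about programs -/

/-- The program `c` halts when started in `s`, and its running time and the final memory satisfy
`Q`. -/
def Runs (W : ℕ) (c : Cmd) (s : Store) (Q : ℕ → Store → Prop) : Prop :=
  ∃ t s', Exec W c s t s' ∧ Q t s'

section Runs

variable {W : ℕ} {b : BExp} {c d : Cmd} {s : Store} {Q Q' : ℕ → Store → Prop}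

theorem Runs.mono (h : Runs W c s Q) (hQ : ∀ t s', Q t s' → Q' t s') : Runs W c s Q' := by
  obtain ⟨t, s', h1, h2⟩ := h
  exact ⟨t, s', h1, hQ t s' h2⟩

theorem Runs.seq (h : Runs W c s fun t s' => Runs W d s' fun t' s'' => Q (t + t') s'') :
    Runs W (.seq c d) s Q := by
  obtain ⟨t, s', h1, t', s'', h2, h3⟩ := h
  exact ⟨_, _, .seq _ _ _ _ _ _ _ h1 h2, h3⟩

theorem Runs.cond (h1 : b.Holds s → Runs W c s fun t s' => Q (b.time + 1 + t) s')
    (h2 : ¬ b.Holds s → Runs W d s fun t s' => Q (b.time + 1 + t) s') :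
    Runs W (.cond b c d) s Q := by
  by_cases hb : b.Holds s
  · obtain ⟨t, s', h3, h4⟩ := h1 hb
    exact ⟨_, _, .condTrue _ _ _ _ _ _ hb h3, h4⟩
  · obtain ⟨t, s', h3, h4⟩ := h2 hb
    exact ⟨_, _, .condFalse _ _ _ _ _ _ hb h3, h4⟩

/-- The rule for loops: `Φ` bounds the remaining running time in terms of the ghost state. -/
theorem Runs.loop {γ : Type*} (J : γ → Store → Prop) (Φ : γ → ℕ)
    (hstep : ∀ g s, J g s → b.Holds s →
      Runs W c s fun t s' => ∃ g', J g' s' ∧ b.time + 1 + t + Φ g' ≤ Φ g)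
    (g : γ) (hJ : J g s) :
    Runs W (.loop b c) s fun t s' =>
      ∃ g', J g' s' ∧ ¬ b.Holds s' ∧ t + Φ g' ≤ Φ g + (b.time + 1) := by
  induction hm : Φ g using Nat.strong_induction_on generalizing g s with
  | _ m ih =>
    by_cases hb : b.Holds s
    · obtain ⟨t, s', h1, g', h2, h3⟩ := hstep g s hJ hb
      obtain ⟨t', s'', h4, g'', h5, h6, h7⟩ := ih (Φ g') (by omega) g' h2 rfl
      exact ⟨_, _, .loopStep _ _ _ _ _ _ _ hb h1 h4, g'', h5, h6, by omega⟩
    · exact ⟨_, _, .loopDone _ _ _ hb, g, hJ, hb, by omega⟩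

/-- The weakest precondition of a program without loops. -/
def Cmd.wp (W : ℕ) : Cmd → (Store → Prop) → Store → Prop
  | .skip, Q, s => Q s
  | .setN x e, Q, s => e.val s ≤ W ∧ Q { s with nvar := Function.update s.nvar x (e.val s) }
  | .putN a i e, Q, s => i.val s ≤ W ∧ e.val s ≤ W ∧
      Q { s with narr := Function.update s.narr a
                          (Function.update (s.narr a) (i.val s) (e.val s)) }
  | .setR x e, Q, s => Q { s with rvar := Function.update s.rvar x (e.val s) }
  | .putR a i e, Q, s => i.val s ≤ W ∧
      Q { s with rarr := Function.update s.rarr a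
                          (Function.update (s.rarr a) (i.val s) (e.val s)) }
  | .seq c d, Q, s => c.wp W (fun s' => d.wp W Q s') s
  | .cond b c d, Q, s => (b.Holds s → c.wp W Q s) ∧ (¬ b.Holds s → d.wp W Q s)
  | .loop _ _, _, _ => False

/-- An upper bound on the running time of a program without loops. -/
def Cmd.cost : Cmd → ℕ
  | .skip => 1
  | .setN _ e => e.time + 1
  | .putN _ i e => i.time + e.time + 1
  | .setR _ e => e.time + 1
  | .putR _ i e => i.time + e.time + 1
  | .seq c d => c.cost + d.cost
  | .cond b c d => b.time + 1 + (c.cost + d.cost)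
  -- A dummy value: `Cmd.wp` of a loop is `False`, so this cost is never used as a bound for a loop.
  | .loop _ _ => 0

theorem Cmd.wp_mono {Q Q' : Store → Prop} (c : Cmd) (hQ : ∀ s, Q s → Q' s) :
    ∀ s, c.wp W Q s → c.wp W Q' s := by
  induction c generalizing Q Q' with
  | skip => exact hQ
  | setN x e => exact fun s h => ⟨h.1, hQ _ h.2⟩
  | putN a i e => exact fun s h => ⟨h.1, h.2.1, hQ _ h.2.2⟩
  | setR x e => exact fun s h => hQ _ h
  | putR a i e => exact fun s h => ⟨h.1, hQ _ h.2⟩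
  | seq c d ihc ihd => exact fun s h => ihc (fun s' h' => ihd hQ s' h') s h
  | cond b c d ihc ihd => exact fun s h => ⟨fun hb => ihc hQ s (h.1 hb), fun hb => ihd hQ s (h.2 hb)⟩
  | loop b c => exact fun s h => h.elim

theorem runs_of_wp {c : Cmd} {Q : Store → Prop} {s : Store} (h : c.wp W Q s) :
    Runs W c s fun t s' => t ≤ c.cost ∧ Q s' := by
  induction c generalizing Q s with
  | skip => exact ⟨_, _, .skip _, le_rfl, h⟩
  | setN x e => exact ⟨_, _, .setN _ _ _ h.1, le_rfl, h.2⟩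
  | putN a i e => exact ⟨_, _, .putN _ _ _ _ h.1 h.2.1, le_rfl, h.2.2⟩
  | setR x e => exact ⟨_, _, .setR _ _ _, le_rfl, h⟩
  | putR a i e => exact ⟨_, _, .putR _ _ _ _ h.1, le_rfl, h.2⟩
  | seq c d ihc ihd =>
    exact .seq ((ihc h).mono fun t s' h' => (ihd h'.2).mono fun t' s'' h'' =>
      ⟨by have := h'.1; have := h''.1; simp only [Cmd.cost]; omega, h''.2⟩)
  | cond b c d ihc ihd =>
    exact .cond
      (fun hb => (ihc (h.1 hb)).mono fun t s' h' =>
        ⟨by have := h'.1; simp only [Cmd.cost]; omega, h'.2⟩)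
      (fun hb => (ihd (h.2 hb)).mono fun t s' h' =>
        ⟨by have := h'.1; simp only [Cmd.cost]; omega, h'.2⟩)
  | loop b c => exact h.elim

/-- Straight-line code followed by another program. -/
theorem Runs.wp_seq (h : c.wp W (fun s' => Runs W d s' fun t' s'' => ∀ t ≤ c.cost,
    Q (t + t') s'') s) : Runs W (.seq c d) s Q :=
  .seq ((runs_of_wp h).mono fun t _ h' => h'.2.mono fun _ _ h'' => h'' t h'.1)

theorem Runs.of_wp (h : c.wp W (fun s' => ∀ t ≤ c.cost, Q t s') s) : Runs W c s Q :=
  (runs_of_wp h).mono fun t _ h' => h'.2 t h'.1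

end Runs

instance (c : ℕ) : OfNat NExp c := ⟨.lit c⟩
instance : Add NExp := ⟨.add⟩
instance : Sub NExp := ⟨.sub⟩
instance : Mul NExp := ⟨.mul⟩
instance (c : ℕ) : OfNat RExp c := ⟨.lit c⟩
instance : Add RExp := ⟨.add⟩
instance : Sub RExp := ⟨.sub⟩
instance : Mul RExp := ⟨.mul⟩

/-- The variable number `x`, as an expression. -/
abbrev V (x : ℕ) : NExp := .var x

section val

variable (s : Store)

@[simp] theorem NExp.val_ofNat (c : ℕ) : NExp.val s (no_index (OfNat.ofNat c)) = c := rfl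
@[simp] theorem NExp.val_zero : NExp.val s 0 = 0 := rfl
@[simp] theorem NExp.val_one : NExp.val s 1 = 1 := rfl
@[simp] theorem NExp.val_var (x : ℕ) : NExp.val s (.var x) = s.nvar x := rfl
@[simp] theorem NExp.val_cell (a : ℕ) (e : NExp) : NExp.val s (.cell a e) = s.narr a (e.val s) := rfl
@[simp] theorem NExp.val_add (e f : NExp) : NExp.val s (e + f) = e.val s + f.val s := rfl
@[simp] theorem NExp.val_sub (e f : NExp) : NExp.val s (e - f) = e.val s - f.val s := rfl
@[simp] theorem NExp.val_mul (e f : NExp) : NExp.val s (e * f) = e.val s * f.val s := rfl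
@[simp] theorem RExp.val_zero : RExp.val s 0 = 0 := by
  change (((0 : ℕ) : ℤ) : ℝ) = 0; simp
@[simp] theorem RExp.val_var (x : ℕ) : RExp.val s (.var x) = s.rvar x := rfl
@[simp] theorem RExp.val_cell (a : ℕ) (e : NExp) : RExp.val s (.cell a e) = s.rarr a (e.val s) := rfl
@[simp] theorem RExp.val_add (e f : RExp) : RExp.val s (e + f) = e.val s + f.val s := rfl
@[simp] theorem RExp.val_sub (e f : RExp) : RExp.val s (e - f) = e.val s - f.val s := rfl
@[simp] theorem RExp.val_mul (e f : RExp) : RExp.val s (e * f) = e.val s * f.val s := rfl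
@[simp] theorem BExp.holds_neq (e f : NExp) : BExp.Holds s (.neq e f) ↔ e.val s = f.val s := Iff.rfl
@[simp] theorem BExp.holds_nle (e f : NExp) : BExp.Holds s (.nle e f) ↔ e.val s ≤ f.val s := Iff.rfl
@[simp] theorem BExp.holds_rle (e f : RExp) : BExp.Holds s (.rle e f) ↔ e.val s ≤ f.val s := Iff.rfl
@[simp] theorem BExp.holds_neg (b : BExp) : BExp.Holds s (.neg b) ↔ ¬ b.Holds s := Iff.rfl
@[simp] theorem BExp.holds_conj (b c : BExp) :
    BExp.Holds s (.conj b c) ↔ b.Holds s ∧ c.Holds s := Iff.rfl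

end val

infixr:35 " ;; " => Cmd.seq
infix:40 " ::= " => Cmd.setN

/-- The test `e < f`. -/
abbrev BExp.nlt (e f : NExp) : BExp := .neg (.nle f e)

end AdTypes

namespace AdTypes

/-! ### The heap in memory

The heap occupies the natural number arrays `8` (ranks), `9` (children), `10` (parents),
`11` (positions), `12` (pool) and `13` (deficient nodes). A node `x` has a key if cell `x` of the
natural number array `7` is `1`; it is then stored in cell `x` of the real array `3`. -/

/-- Replace the natural number variables and the heap in a memory state. -/
def Store.withHeap (s : Store) (v : ℕ → ℕ) (N : ℕ) (h : Heap) : Store :=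
  { s with
    nvar := v
    narr := fun a => if a = 8 then h.rank else if a = 9 then fun x => h.ch (x % (N + 1)) (x / (N + 1))
      else if a = 10 then h.par else if a = 11 then h.slot else if a = 12 then h.pool
      else if a = 13 then h.defi else s.narr a }

/-- The heap found in the memory. -/
def Store.heap (s : Store) (N : ℕ) : Heap where
  rank := s.narr 8
  ch p i := s.narr 9 (p + (N + 1) * i)
  par := s.narr 10
  slot := s.narr 11
  pool := s.narr 12
  defi := s.narr 13

/-- The keys found in the memory. -/
noncomputable def Store.key (s : Store) (x : ℕ) : WithTop ℝ := if s.narr 7 x = 1 then s.rarr 3 x else ⊤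

theorem Store.withHeap_heap (s : Store) (N : ℕ) : s.withHeap s.nvar N (s.heap N) = s := by
  cases s
  simp only [withHeap, heap, Nat.mod_add_div, Store.mk.injEq, true_and, and_true]
  funext a
  split_ifs <;> simp_all

section lemmas

variable (s : Store) (v : ℕ → ℕ) (N : ℕ) (h : Heap)

@[simp] theorem nvar_withHeap : (s.withHeap v N h).nvar = v := rfl
@[simp] theorem rvar_withHeap : (s.withHeap v N h).rvar = s.rvar := rfl
@[simp] theorem rarr_withHeap : (s.withHeap v N h).rarr = s.rarr := rfl
@[simp] theorem rank_withHeap : (s.withHeap v N h).narr 8 = h.rank := rfl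
@[simp] theorem par_withHeap : (s.withHeap v N h).narr 10 = h.par := rfl
@[simp] theorem slot_withHeap : (s.withHeap v N h).narr 11 = h.slot := rfl
@[simp] theorem pool_withHeap : (s.withHeap v N h).narr 12 = h.pool := rfl
@[simp] theorem defi_withHeap : (s.withHeap v N h).narr 13 = h.defi := rfl
@[simp] theorem inq_withHeap : (s.withHeap v N h).narr 7 = s.narr 7 := rfl

variable {N}

/-- The stride is `N + 1` rather than `N`, since the number `N` also acts as a parent, namely of the
main root. -/
theorem ch_withHeap {p : ℕ} (hp : p ≤ N) (i : ℕ) :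
    (s.withHeap v N h).narr 9 (p + (N + 1) * i) = h.ch p i := by
  have h1 : (p + (N + 1) * i) % (N + 1) = p := by
    rw [Nat.add_mul_mod_self_left]; exact Nat.mod_eq_of_lt (by omega)
  have h2 : (p + (N + 1) * i) / (N + 1) = i := by
    rw [Nat.add_mul_div_left _ _ (by omega), Nat.div_eq_of_lt (by omega), zero_add]
  simp [Store.withHeap, h1, h2]

theorem narr_withHeap_of_lt {a : ℕ} (ha : a < 8) : (s.withHeap v N h).narr a = s.narr a := by
  simp only [Store.withHeap]
  split_ifs <;> first | rfl | omega

end lemmas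

namespace Heap

def setRankC (x r : ℕ) : Cmd := .putN 8 (V x) (V r)
def setPoolC (i y : ℕ) : Cmd := .putN 12 (V i) (V y)
def setParC (x y : ℕ) : Cmd := .putN 10 (V x) (V y)
def setDefiC (i y : ℕ) : Cmd := .putN 13 (V i) (V y)
def setChC (p i c : ℕ) : Cmd := .putN 9 (V p + V 5 * V i) (V c)
def placeC (p i c : ℕ) : Cmd := setChC p i c ;; .putN 10 (V c) (V p) ;; .putN 11 (V c) (V i)

/-- The test whether the key of `x` is at most the key of `y`. -/
def leC (x y : ℕ) : BExp :=
  .neg (.conj (.neq (.cell 7 (V y)) 1)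
    (.neg (.conj (.neq (.cell 7 (V x)) 1) (.rle (.cell 3 (V x)) (.cell 3 (V y))))))

/-- Link the trees of rank `i` with roots `z` and `y`, where `j = i + 1`, and store the new root
in `w`. -/
def linkC (z i y w j : ℕ) : Cmd :=
  .cond (leC z y) (placeC z i y ;; setRankC z j ;; w ::= V z)
    (placeC y i z ;; setRankC y j ;; w ::= V y)

/-- The variables `3`, `4`, `5` hold the height, the number of nodes, and its successor. -/
structure Env (v : ℕ → ℕ) (N H W : ℕ) : Prop where
  height : v 3 = H
  nodes : v 4 = N
  stride : v 5 = N + 1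
  word : (N + 1) * (H + 2) ≤ W

variable {s : Store} {v : ℕ → ℕ} {N H W : ℕ} {h : Heap} {Q : Store → Prop}

theorem Env.congr {v' : ℕ → ℕ} (hv : Env v N H W) (h : ∀ x < 40, v' x = v x) : Env v' N H W :=
  ⟨by rw [h _ (by omega), hv.height], by rw [h _ (by omega), hv.nodes],
    by rw [h _ (by omega), hv.stride], hv.word⟩

theorem index_le_word (hW : (N + 1) * (H + 2) ≤ W) {p i : ℕ} (hp : p ≤ N) (hi : i ≤ H) :
    p + (N + 1) * i ≤ W := by
  have h2 : (N + 1) * i ≤ (N + 1) * H := Nat.mul_le_mul_left _ hi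
  nlinarith

theorem le_word (hW : (N + 1) * (H + 2) ≤ W) {x : ℕ} (hx : x ≤ N + H + 2) : x ≤ W := by
  nlinarith

@[simp] theorem holds_leC (x y : ℕ) :
    (leC x y).Holds (s.withHeap v N h) ↔ s.key (v x) ≤ s.key (v y) := by
  unfold leC Store.key
  simp only [BExp.holds_neg, BExp.holds_conj, BExp.holds_neq, BExp.holds_rle, NExp.val_cell,
    RExp.val_cell, NExp.val_var, NExp.val_one, nvar_withHeap, inq_withHeap, rarr_withHeap]
  split_ifs with h1 h2 h2 <;> simp [h1, h2]

theorem wp_seq {c d : Cmd} : (c ;; d).wp W Q s ↔ c.wp W (fun s' => d.wp W Q s') s := Iff.rfl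

theorem wp_cond {b : BExp} {c d : Cmd} : (Cmd.cond b c d).wp W Q s ↔
    (b.Holds s → c.wp W Q s) ∧ (¬ b.Holds s → d.wp W Q s) := Iff.rfl

theorem wp_setN {x : ℕ} {e : NExp} (he : e.val (s.withHeap v N h) ≤ W) :
    (x ::= e).wp W Q (s.withHeap v N h) ↔
      Q (s.withHeap (Function.update v x (e.val (s.withHeap v N h))) N h) :=
  ⟨fun h => h.2, fun h => ⟨he, h⟩⟩

theorem wp_setN_zero {x : ℕ} : (x ::= 0).wp W Q (s.withHeap v N h) ↔
    Q (s.withHeap (Function.update v x 0) N h) := by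
  rw [wp_setN (by simp)]; simp

theorem withHeap_eq {s' : Store} (h1 : s'.nvar = v) (h2 : s'.rvar = s.rvar) (h3 : s'.rarr = s.rarr)
    (h4 : ∀ a, s'.narr a = (s.withHeap v N h).narr a) : s' = s.withHeap v N h := by
  cases s'
  simp only at h1 h2 h3
  subst h1 h2 h3
  simp only [Store.withHeap, Store.mk.injEq, true_and, and_true]
  funext a
  exact h4 a

/-- On memory states of the form `withHeap`, each primitive program acts as its counterpart on
abstract heaps, provided that the numbers involved fit into a word. -/
theorem wp_setRankC (hW : (N + 1) * (H + 2) ≤ W) {x r : ℕ} (hx : v x ≤ N) (hr : v r ≤ H) :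
    (setRankC x r).wp W Q (s.withHeap v N h) ↔
      Q (s.withHeap v N (h.setRank (v x) (v r))) := by
  have h1 : v x ≤ W := le_word hW (by omega)
  have h2 : v r ≤ W := le_word hW (by omega)
  simp only [setRankC, Cmd.wp, NExp.val_var, nvar_withHeap, h1, h2, true_and]
  refine iff_of_eq (congrArg Q (withHeap_eq rfl rfl rfl fun a => ?_))
  by_cases ha : a = 8
  · subst ha; simp [setRank]
  · simp [ha, Store.withHeap, setRank]

theorem wp_setPoolC (hW : (N + 1) * (H + 2) ≤ W) {x r : ℕ} (hx : v x ≤ H) (hr : v r ≤ N + 1) :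
    (setPoolC x r).wp W Q (s.withHeap v N h) ↔
      Q (s.withHeap v N (h.setPool (v x) (v r))) := by
  have h1 : v x ≤ W := le_word hW (by omega)
  have h2 : v r ≤ W := le_word hW (by omega)
  simp only [setPoolC, Cmd.wp, NExp.val_var, nvar_withHeap, h1, h2, true_and]
  refine iff_of_eq (congrArg Q (withHeap_eq rfl rfl rfl fun a => ?_))
  by_cases ha : a = 12
  · subst ha; simp [setPool]
  · simp [ha, Store.withHeap, setPool]

theorem wp_setParC (hW : (N + 1) * (H + 2) ≤ W) {x r : ℕ} (hx : v x ≤ N) (hr : v r ≤ N + 1) :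
    (setParC x r).wp W Q (s.withHeap v N h) ↔
      Q (s.withHeap v N (h.setPar (v x) (v r))) := by
  have h1 : v x ≤ W := le_word hW (by omega)
  have h2 : v r ≤ W := le_word hW (by omega)
  simp only [setParC, Cmd.wp, NExp.val_var, nvar_withHeap, h1, h2, true_and]
  refine iff_of_eq (congrArg Q (withHeap_eq rfl rfl rfl fun a => ?_))
  by_cases ha : a = 10
  · subst ha; simp [setPar]
  · simp [ha, Store.withHeap, setPar]

theorem wp_setDefiC (hW : (N + 1) * (H + 2) ≤ W) {x r : ℕ} (hx : v x ≤ H) (hr : v r ≤ N + 1) :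
    (setDefiC x r).wp W Q (s.withHeap v N h) ↔
      Q (s.withHeap v N (h.setDefi (v x) (v r))) := by
  have h1 : v x ≤ W := le_word hW (by omega)
  have h2 : v r ≤ W := le_word hW (by omega)
  simp only [setDefiC, Cmd.wp, NExp.val_var, nvar_withHeap, h1, h2, true_and]
  refine iff_of_eq (congrArg Q (withHeap_eq rfl rfl rfl fun a => ?_))
  by_cases ha : a = 13
  · subst ha; simp [setDefi]
  · simp [ha, Store.withHeap, setDefi]

theorem index_eq_iff {p i x : ℕ} (hp : p ≤ N) :
    x = p + (N + 1) * i ↔ x % (N + 1) = p ∧ x / (N + 1) = i := by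
  constructor
  · rintro rfl
    constructor
    · rw [Nat.add_mul_mod_self_left]; exact Nat.mod_eq_of_lt (by omega)
    · rw [Nat.add_mul_div_left _ _ (by omega), Nat.div_eq_of_lt (by omega), zero_add]
  · rintro ⟨rfl, rfl⟩
    exact (Nat.mod_add_div _ _).symm

theorem wp_setChC (hW : (N + 1) * (H + 2) ≤ W) (hv : v 5 = N + 1) {p i c : ℕ} (hp : v p ≤ N) (hi : v i ≤ H)
    (hc : v c ≤ N + 1) : (setChC p i c).wp W Q (s.withHeap v N h) ↔
      Q (s.withHeap v N (h.setCh (v p) (v i) (v c))) := by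
  have h1 : v p + (N + 1) * v i ≤ W := index_le_word hW hp hi
  have h2 : v c ≤ W := le_word hW (by omega)
  simp only [setChC, Cmd.wp, NExp.val_var, NExp.val_add, NExp.val_mul, nvar_withHeap, hv,
    h1, h2, true_and]
  refine iff_of_eq (congrArg Q (withHeap_eq rfl rfl rfl fun a => ?_))
  by_cases ha : a = 9
  · subst ha
    funext x
    simp only [Function.update_self, Function.update_apply, index_eq_iff hp]
    simp [Store.withHeap, setCh]
  · simp [ha, Store.withHeap, setCh]

theorem wp_placeC (hW : (N + 1) * (H + 2) ≤ W) (hv : v 5 = N + 1) {p i c : ℕ} (hp : v p ≤ N) (hi : v i ≤ H)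
    (hc : v c ≤ N) : (placeC p i c).wp W Q (s.withHeap v N h) ↔
      Q (s.withHeap v N (h.place (v p) (v i) (v c))) := by
  have h1 : v p ≤ W := le_word hW (by omega)
  have h2 : v c ≤ W := le_word hW (by omega)
  have h3 : v i ≤ W := le_word hW (by omega)
  rw [placeC, wp_seq, wp_setChC hW hv hp hi (by omega)]
  simp only [Cmd.wp, NExp.val_var, nvar_withHeap, h1, h2, h3, true_and]
  refine iff_of_eq (congrArg Q (withHeap_eq rfl rfl rfl fun a => ?_))
  by_cases ha : a = 10
  · subst ha; simp [place, setCh]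
  by_cases hb : a = 11
  · subst hb; simp [place, setCh]
  · simp [ha, hb, Store.withHeap, place, setCh]

theorem wp_linkC (hW : (N + 1) * (H + 2) ≤ W) (hv : v 5 = N + 1) {z i y w j : ℕ} (hz : v z ≤ N) (hy : v y ≤ N) (hi : v i ≤ H)
    (hj : v j = v i + 1) (hj' : v j ≤ H) : (linkC z i y w j).wp W Q (s.withHeap v N h) ↔
      Q (s.withHeap (Function.update v w (winner s.key (v z) (v y))) N
        (h.link s.key (v z) (v i) (v y))) := by
  have h1 : v z ≤ W := le_word hW (by omega)
  have h2 : v y ≤ W := le_word hW (by omega)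
  simp only [linkC, wp_cond, wp_seq, holds_leC, wp_placeC hW hv hz hi hy, wp_placeC hW hv hy hi hz,
    wp_setRankC hW hz hj', wp_setRankC hW hy hj', wp_setN (e := V z) h1, wp_setN (e := V y) h2,
    NExp.val_var, nvar_withHeap, winner, link, attach, hj]
  split_ifs <;> simp_all

end Heap
end AdTypes

/-! ### One round of filling a hole, as a program -/

namespace AdTypes
namespace Heap

variable {s : Store} {v : ℕ → ℕ} {N H W : ℕ} {h : Heap} {Q : Store → Prop}

/-! Temporary variables: `40` is the root of the tree to be inserted, `(41, 42)` the position of the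
missing child, `43` tells whether the loop goes on. -/

/-- Store the deficient node `52`, to be placed as child `44 = 42 + 1` of `49`, together with the
tree `40`, both of rank `42`. -/
def joinC : Cmd :=
  44 ::= V 42 + 1 ;;
  .cond (.neq (.cell 12 (V 42)) (V 4))
    (placeC 49 44 52 ;; setPoolC 42 40 ;; setParC 40 5 ;; setDefiC 42 52 ;; 43 ::= 0)
    (48 ::= .cell 13 (V 42) ;; 45 ::= .cell 12 (V 42) ;; 50 ::= .cell 10 (V 48) ;;
      setPoolC 42 4 ;; linkC 40 42 45 46 44 ;; linkC 52 42 48 47 44 ;;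
      .cond (leC 52 48) (placeC 49 44 52 ;; 41 ::= V 50) (placeC 50 44 48 ;; 41 ::= V 49) ;;
      40 ::= V 46 ;; 42 ::= V 44)

/-- The state after one round of the loop, which started with `m` trees in the pool. -/
def Round (s : Store) (v : ℕ → ℕ) (N H m : ℕ) (s' : Store) : Prop :=
  ∃ v' h', s' = s.withHeap v' N h' ∧ (∀ x < 40, v' x = v x) ∧
    ((v' 43 = 1 ∧ h'.Hole N H s.key (v' 41) (v' 42) (v' 40) ∧ h'.size N H + 1 = m) ∨
      (v' 43 = 0 ∧ h'.Whole N H s.key ∧ h'.size N H ≤ m + 1))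

/-- If the pool has no tree of this rank, the pair is stored and the loop ends; otherwise a pool
tree is used up and a hole one position higher remains. -/
theorem wp_joinC (hv : Env v N H W) (hgo : v 43 = 1)
    (hh : h.TopHole N H s.key (v 49) (v 52) (v 42) (v 40)) :
    joinC.wp W (Round s v N H (h.size N H)) (s.withHeap v N h) := by
  have hi := hh.i_lt
  have hz := hh.lt
  have hp := hh.p_lt
  have hpp : v 49 ≤ N := by rcases hh.isSlot with h1 | h1 <;> omega
  have hW := hv.word
  have hw : N + H + 2 ≤ W := le_word hW le_rfl
  have e3 := hv.height
  have e4 := hv.nodes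
  have e5 := hv.stride
  rw [joinC, wp_seq, wp_setN (by simp; omega), wp_cond]
  refine ⟨fun hpool => ?_, fun hpool => ?_⟩
  · simp [e4] at hpool
    have h1 := hh.store hpool
    simp (disch := first | omega | (simp; done) | (simp <;> omega) | fail) [wp_seq, wp_setN_zero, wp_placeC hW, wp_setPoolC hW,
      wp_setParC hW, wp_setDefiC hW]
    refine ⟨_, _, rfl, fun x hx => ?_, Or.inr ⟨by simp, ?_, ?_⟩⟩
    · simp (disch := omega) [Function.update_of_ne]
    · rwa [e5]
    · exact size_set_le rfl
  · simp [e4] at hpool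
    have hwz := winner_eq s.key (v 40) (h.pool (v 42))
    have hwp := winner_eq s.key (v 52) (h.defi (v 42))
    obtain ⟨h1, h2, h3, h4⟩ := hh.join hpool
    have h5 : h.par (h.defi (v 42)) ≤ N := by
      obtain ⟨h6, h7, h8, -⟩ := hh.inv.defi_lt _ hi (Or.inl hpool)
      exact hh.inv.par_lt h6 h7 h8
    have h6 : ∀ p i c, ((((h.setPool (v 42) N).link s.key (v 40) (v 42) (h.pool (v 42))).link
        s.key (v 52) (v 42) (h.defi (v 42))).place p i c).size N H + 1 = h.size N H :=
      fun p i c => size_clear hi hpool (by simp [place, setPool])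
    simp (disch := first | omega | (simp; done) | (simp <;> omega) | fail) [wp_seq, wp_setN, wp_cond, wp_placeC hW,
      wp_setPoolC hW, wp_linkC hW, e4]
    refine ⟨fun hK => ⟨_, _, rfl, fun x hx => ?_, Or.inl ⟨by simp [hgo], ?_, h6 _ _ _⟩⟩,
      fun hK => ⟨_, _, rfl, fun x hx => ?_, Or.inl ⟨by simp [hgo], ?_, h6 _ _ _⟩⟩⟩
    · simp (disch := omega) [Function.update_of_ne]
    · simpa using h3 hK
    · simp (disch := omega) [Function.update_of_ne]
    · simpa using h4 (not_le.2 hK)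

/-- The case of a missing child at the top of `41`. -/
def topC : Cmd :=
  49 ::= .cell 10 (V 41) ;;
  .cond (.neq (V 49) (V 5))
    (setPoolC 44 4 ;; setRankC 41 42 ;; placeC 40 42 41 ;; setRankC 40 44 ;; setPoolC 44 40 ;;
      setParC 40 5 ;; 43 ::= 0)
    (.cond (.neq (.cell 11 (V 41)) (V 54))
      (45 ::= .cell 12 (V 44) ;; setPoolC 44 4 ;; setRankC 41 42 ;; placeC 40 42 41 ;;
        setRankC 40 44 ;; linkC 40 44 45 46 54 ;; 40 ::= V 46 ;; 41 ::= V 49 ;; 42 ::= V 54)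
      (52 ::= V 41 ;; setRankC 41 42 ;; joinC))

/-- The case of a missing child with a younger sibling. -/
def siblingC : Cmd :=
  53 ::= .cell 9 (V 41 + V 5 * V 44) ;;
  .cond (.neq (.cell 8 (V 53)) (V 42))
    (45 ::= .cell 12 (V 42) ;; setPoolC 42 4 ;; placeC 41 42 53 ;; linkC 40 42 45 46 44 ;;
      40 ::= V 46 ;; 42 ::= V 44)
    (51 ::= .cell 9 (V 53 + V 5 * V 42) ;; placeC 41 42 51 ;; setRankC 53 42 ;; 52 ::= V 53 ;;
      49 ::= V 41 ;; joinC)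

theorem Round.congr {v' : ℕ → ℕ} {m : ℕ} {s' : Store} (h : Round s v' N H m s')
    (hv : ∀ x < 40, v' x = v x) : Round s v N H m s' := by
  obtain ⟨w, h', h1, h2, h3⟩ := h
  exact ⟨w, h', h1, fun x hx => by rw [h2 x hx, hv x hx], h3⟩

theorem wp_topC (hv : Env v N H W) (hgo : v 43 = 1)
    (hh : h.Hole N H s.key (v 41) (v 42) (v 40)) (hp : v 41 < N) (hK : ¬ s.key (v 41) ≤ s.key (v 40))
    (hr : h.rank (v 41) = v 42 + 1) (h44 : v 44 = v 42 + 1) (h54 : v 54 = v 42 + 2) :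
    topC.wp W (Round s v N H (h.size N H)) (s.withHeap v N h) := by
  have hz := hh.lt
  have hpz : v 41 ≠ v 40 := by intro h1; exact hK (by rw [h1])
  have hpF : v 41 ∉ ({v 40} : Set ℕ) := by simpa using hpz
  have hi : v 42 + 1 ≤ H := by have := hh.inv.rank_le _ hp; omega
  have hW := hv.word
  have hw : N + H + 2 ≤ W := le_word hW le_rfl
  have e4 := hv.nodes
  have e5 := hv.stride
  have hpar : h.par (v 41) ≤ N + 1 := by
    by_cases h1 : h.par (v 41) = N + 1
    · omega
    · have := hh.inv.par_lt hp hpF h1; omega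
  rw [topC, wp_seq, wp_setN (by simp; omega), wp_cond]
  refine ⟨fun hpool => ?_, fun hpool => ?_⟩
  · simp [e5] at hpool
    have h1 := hh.pool_root hp hK hr hpool
    simp (disch := first | omega | (simp; done) | (simp <;> omega) | fail) [wp_seq, wp_setN_zero,
      wp_placeC hW, wp_setPoolC hW, wp_setParC hW, wp_setRankC hW]
    refine ⟨_, _, rfl, fun x hx => ?_, Or.inr ⟨by simp, ?_, ?_⟩⟩
    · simp (disch := omega) [Function.update_of_ne]
    · rw [h44, e4, e5]; exact h1
    · exact size_set_le (i := v 44) (y := v 40) (by simp [place, setPool, setPar, setRank])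
  · simp [e5] at hpool
    have hsl := hh.inv.slot_le hp hpF hpool
    have hpN := hh.inv.par_lt hp hpF hpool
    rw [wp_cond]
    refine ⟨fun hs => ?_, fun hs => ?_⟩
    · simp [h54] at hs
      obtain ⟨h1, h2, h3⟩ := hh.deficient_top hp hK hr hpool hs
      have hwz := winner_eq s.key (v 40) (h.pool (v 42 + 1))
      rw [← h44] at h1 h2 hwz
      simp (disch := first | omega | (simp; done) | (simp <;> omega) | fail) [wp_seq, wp_setN,
        wp_placeC hW, wp_setPoolC hW, wp_setRankC hW, wp_linkC hW]
      refine ⟨_, _, rfl, fun x hx => ?_, Or.inl ⟨by simp [hgo], ?_, ?_⟩⟩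
      · simp (disch := omega) [Function.update_of_ne]
      · simpa [h44, h54, e4, attach] using h3
      · exact size_clear (i := v 44) (by omega) h1 (by simp [place, setPool, setRank, e4])
    · simp [h54] at hs
      simp (disch := first | omega | (simp; done) | (simp <;> omega) | fail) only [wp_seq, wp_setN,
        wp_setRankC hW]
      simp only [NExp.val_var, NExp.val_cell, nvar_withHeap, par_withHeap]
      have h1 := hh.top hp hr hpool hs
      refine Cmd.wp_mono _ (fun s' h' => ?_) _ (wp_joinC (hv.congr ?_) ?_ ?_)
      · refine Round.congr h' fun x hx => ?_
        simp (disch := omega) [Function.update_of_ne]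
      · intro x hx
        simp (disch := omega) [Function.update_of_ne]
      · simpa
      · simpa using h1

theorem wp_siblingC (hv : Env v N H W) (hgo : v 43 = 1)
    (hh : h.Hole N H s.key (v 41) (v 42) (v 40)) (hp : v 41 < N) (hK : ¬ s.key (v 41) ≤ s.key (v 40))
    (hr : v 42 + 1 < h.rank (v 41)) (h44 : v 44 = v 42 + 1) :
    siblingC.wp W (Round s v N H (h.size N H)) (s.withHeap v N h) := by
  have hz := hh.lt
  have hi : v 42 + 1 < H := by have := hh.inv.rank_le _ hp; omega
  have hW := hv.word
  have hw : N + H + 2 ≤ W := le_word hW le_rfl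
  have e4 := hv.nodes
  have e5 := hv.stride
  have hx1 := (hh.inv.child (v 41) (v 42 + 1) (Or.inl ⟨hp, hr⟩) (by simp)).1
  rw [siblingC, wp_seq, wp_setN (by simp [e5, h44, ch_withHeap _ _ _ hp.le]; omega), wp_cond]
  simp only [NExp.val_var, NExp.val_cell, NExp.val_add, NExp.val_mul, e5, h44, nvar_withHeap,
    ch_withHeap _ _ _ hp.le]
  refine ⟨fun hs => ?_, fun hs => ?_⟩
  · simp at hs
    obtain ⟨h1, h2, h3, h4⟩ := hh.deficient_sibling hp hK hr hs
    have hwz := winner_eq s.key (v 40) (h.pool (v 42))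
    simp (disch := first | omega | (simp; done) | (simp <;> omega) | fail) [wp_seq, wp_setN,
      wp_placeC hW, wp_setPoolC hW, wp_linkC hW]
    refine ⟨_, _, rfl, fun x hx => ?_, Or.inl ⟨by simp [hgo], ?_, ?_⟩⟩
    · simp (disch := omega) [Function.update_of_ne]
    · simpa [h44, e4] using h4
    · exact size_clear (i := v 42) (by omega) h1 (by simp [place, setPool, e4])
  · simp at hs
    obtain ⟨h1, h2, h3⟩ := hh.sibling hp hr hs
    have hc := ch_withHeap s (Function.update v 53 (h.ch (v 41) (v 42 + 1))) h h1.le (v 42)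
    rw [wp_seq, wp_setN (by simp [e5, hc]; omega)]
    simp [e5, hc]
    simp (disch := first | omega | (simp; done) | (simp <;> omega) | fail) [wp_seq, wp_setN,
      wp_placeC hW, wp_setRankC hW]
    refine Cmd.wp_mono _ (fun s' h' => ?_) _ (wp_joinC (hv.congr ?_) ?_ ?_)
    · refine Round.congr h' fun x hx => ?_
      simp (disch := omega) [Function.update_of_ne]
    · intro x hx
      simp (disch := omega) [Function.update_of_ne]
    · simpa
    · simpa using h3

end Heap
end AdTypes

/-! ### Lowering a key in constant amortized time -/

namespace AdTypes
namespace Heap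

variable {s : Store} {v : ℕ → ℕ} {N H W : ℕ} {h : Heap} {Q : Store → Prop}

/-- One round of the insertion of the tree `40`. -/
def bubbleC : Cmd :=
  .cond (.neg (.conj (.neg (.neq (V 41) (V 4))) (.neg (leC 41 40))))
    (placeC 41 42 40 ;; 43 ::= 0)
    (44 ::= V 42 + 1 ;; 54 ::= V 44 + 1 ;;
      .cond (.neq (.cell 8 (V 41)) (V 44)) topC siblingC)

/-- This is the source of the amortization: a round after which the hole persists has used up a pool
tree, and a final round adds at most one. -/
theorem wp_bubbleC (hv : Env v N H W) (hgo : v 43 = 1)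
    (hh : h.Hole N H s.key (v 41) (v 42) (v 40)) :
    bubbleC.wp W (Round s v N H (h.size N H)) (s.withHeap v N h) := by
  have hz := hh.lt
  have hp : v 41 ≤ N := by rcases hh.isSlot with h1 | h1 <;> omega
  have hi : v 42 ≤ H := by
    rcases hh.isSlot with h1 | h1
    · have := hh.inv.rank_le _ h1.1; omega
    · omega
  have hW := hv.word
  have hw : N + H + 2 ≤ W := le_word hW le_rfl
  have e4 := hv.nodes
  have e5 := hv.stride
  rw [bubbleC, wp_cond]
  refine ⟨fun hb => ?_, fun hb => ?_⟩
  · simp only [BExp.holds_neg, BExp.holds_conj, BExp.holds_neq, NExp.val_var, nvar_withHeap, e4,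
      holds_leC] at hb
    have h1 := hh.fill (by unfold Below; tauto)
    simp (disch := first | omega | (simp; done) | (simp <;> omega) | fail) [wp_seq, wp_setN_zero,
      wp_placeC hW]
    refine ⟨_, _, rfl, fun x hx => ?_, Or.inr ⟨by simp, h1, ?_⟩⟩
    · simp (disch := omega) [Function.update_of_ne]
    · exact (size_congr rfl).le.trans (Nat.le_succ _)
  · simp only [BExp.holds_neg, BExp.holds_conj, BExp.holds_neq, NExp.val_var, nvar_withHeap, e4,
      holds_leC, not_not] at hb
    have hpN : v 41 < N := by omega
    have hr := hh.isSlot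
    have hi2 : v 42 + 1 ≤ H := by
      rcases hh.isSlot with h1 | h1
      · have := hh.inv.rank_le _ h1.1; omega
      · omega
    simp (disch := first | omega | (simp; done) | (simp <;> omega) | fail) only [wp_seq, wp_setN]
    simp only [NExp.val_var, NExp.val_add, NExp.val_one, nvar_withHeap, Function.update_self]
    have hf : ∀ x < 40, Function.update (Function.update v 44 (v 42 + 1)) 54 (v 42 + 1 + 1) x
        = v x := fun x hx => by simp (disch := omega) [Function.update_of_ne]
    have hmono := fun (s' : Store) (h' : Round s _ N H (h.size N H) s') => Round.congr h' hf
    rw [wp_cond]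
    refine ⟨fun hb2 => ?_, fun hb2 => ?_⟩
    · simp at hb2
      exact Cmd.wp_mono _ hmono _ (wp_topC (hv.congr hf) (by simpa) (by simpa using hh)
        (by simpa) (by simpa using hb.2) (by simpa) (by simp) (by simp))
    · simp at hb2
      have hlt : v 42 + 1 < h.rank (v 41) := by rcases hr with h1 | h1 <;> omega
      exact Cmd.wp_mono _ hmono _ (wp_siblingC (hv.congr hf) (by simpa) (by simpa using hh)
        (by simpa) (by simpa using hb.2) (by simpa) (by simp))

/-- Insertion of the tree `40` at the position `(41, 42)`. -/
def insertC : Cmd := 43 ::= 1 ;; .loop (.neq (V 43) 1) bubbleC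

/-- The potential of a tree in the pool. -/
def unit : ℕ := bubbleC.cost + 5

/-- The program has rearranged the heap in amortized time `m`. -/
def Done (s : Store) (v : ℕ → ℕ) (N H : ℕ) (h : Heap) (m t : ℕ) (s' : Store) : Prop :=
  ∃ v' h', s' = s.withHeap v' N h' ∧ (∀ x < 40, v' x = v x) ∧ h'.Whole N H s.key ∧
    t + unit * h'.size N H ≤ unit * h.size N H + m

theorem runs_insertC (hv : Env v N H W) (hh : h.Hole N H s.key (v 41) (v 42) (v 40)) :
    Runs W insertC (s.withHeap v N h) (Done s v N H h (2 * unit + 6)) := by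
  have hw : N + H + 2 ≤ W := le_word hv.word le_rfl
  refine Runs.wp_seq ?_
  rw [wp_setN (by simp; omega)]
  let J : (ℕ → ℕ) × Heap → Store → Prop := fun g s' => s' = s.withHeap g.1 N g.2 ∧
    (∀ x < 40, g.1 x = v x) ∧ ((g.1 43 = 1 ∧ g.2.Hole N H s.key (g.1 41) (g.1 42) (g.1 40)) ∨
      (g.1 43 = 0 ∧ g.2.Whole N H s.key))
  -- The flag `43` counts twice: the final round clears it, so that even if it adds a pool tree, the
  -- potential drops by one `unit`.
  refine (Runs.loop J (fun g => unit * (g.2.size N H + 2 * g.1 43)) ?_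
    (Function.update v 43 1, h) ⟨by simp, ?_, ?_⟩).mono ?_
  · rintro ⟨w, g⟩ s' ⟨h1, h2, h3⟩ hb
    simp only at h1 h2 h3
    subst h1
    simp only [BExp.holds_neq, NExp.val_var, NExp.val_one, nvar_withHeap] at hb
    rcases h3 with ⟨-, h3⟩ | h3
    · refine (runs_of_wp (wp_bubbleC (hv.congr h2) hb h3)).mono ?_
      rintro t s' ⟨ht, w', g', h4, h5, h6⟩
      refine ⟨(w', g'), ⟨h4, fun x hx => (h5 x hx).trans (h2 x hx), ?_⟩, ?_⟩
      · rcases h6 with h6 | h6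
        exacts [Or.inl ⟨h6.1, h6.2.1⟩, Or.inr ⟨h6.1, h6.2.1⟩]
      · have : g'.size N H + 2 * w' 43 + 1 ≤ g.size N H + 2 * w 43 := by omega
        calc _ ≤ unit + unit * (g'.size N H + 2 * w' 43) := by
              gcongr
              have h7 : (BExp.neq (V 43) 1).time = 3 := rfl
              simp only [h7, unit]; omega
          _ = unit * (g'.size N H + 2 * w' 43 + 1) := by ring
          _ ≤ _ := Nat.mul_le_mul_left _ this
    · omega
  · intro x hx; simp (disch := omega) [Function.update_of_ne]
  · left; simpa using hh
  · rintro t s' ⟨⟨w, g⟩, ⟨h1, h2, h3⟩, hb, ht⟩ t' ht'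
    simp only at h1 h2 h3 ht
    subst h1
    simp only [BExp.holds_neq, NExp.val_var, NExp.val_one, nvar_withHeap] at hb
    have h4 : w 43 = 0 ∧ g.Whole N H s.key := by tauto
    refine ⟨w, g, rfl, h2, h4.2, ?_⟩
    have h5 : (BExp.neq (V 43) 1).time = 3 := rfl
    have h6 : (43 ::= 1).cost = 2 := rfl
    rw [h4.1, h5] at ht
    rw [h6] at ht'
    simp only [Function.update_self, mul_one, mul_add, mul_zero, add_zero] at ht
    omega

/-- Restore the heap order after the key of the node `40` has been decreased. -/
def decreaseC : Cmd :=
  41 ::= .cell 10 (V 40) ;;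
  .cond (.nle (V 4) (V 41)) .skip
    (42 ::= .cell 8 (V 40) ;;
      .cond (.neq (V 42) (.cell 11 (V 40))) .skip
        (44 ::= V 42 + 1 ;; 45 ::= .cell 12 (V 42) ;; setPoolC 42 4 ;; linkC 40 42 45 46 44 ;;
          40 ::= V 46 ;; 42 ::= V 44) ;;
      insertC)

/-- Here `K` are the old keys, for which the heap is in order, while the memory already holds the
new ones. A node with a parent is cut, completed by its partner if it is deficient, and reinserted
at its old position. -/
theorem runs_decreaseC {K : ℕ → WithTop ℝ} (hv : Env v N H W) (hW : h.Whole N H K) (hx : v 40 < N)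
    (hlow : s.key (v 40) ≤ K (v 40)) (hne : ∀ y, y ≠ v 40 → s.key y = K y) :
    Runs W decreaseC (s.withHeap v N h) (Done s v N H h (4 * unit + 100)) := by
  have hWd := hv.word
  have hw : N + H + 2 ≤ W := le_word hv.word le_rfl
  have e4 := hv.nodes
  have e5 := hv.stride
  have hpar : h.par (v 40) ≤ N + 1 := by
    by_cases h1 : h.par (v 40) = N + 1
    · omega
    · have := hW.par_lt hx (by simp) h1; omega
  refine Runs.wp_seq ?_
  rw [wp_setN (by simp; omega)]
  refine Runs.cond (fun hb => ?_) fun hb => ?_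
  · simp [e4] at hb
    refine Runs.of_wp fun t ht t' ht' => ?_
    refine ⟨_, _, rfl, fun x hx => ?_, hW.lower_root hb hlow hne, ?_⟩
    · simp (disch := omega) [Function.update_of_ne]
    · have h5 : (BExp.nle (V 4) (V 41)).time = 3 := rfl
      have h6 : (41 ::= .cell 10 (V 40)).cost = 3 := rfl
      have h7 : Cmd.skip.cost = 1 := rfl
      omega
  simp [e4] at hb
  have hrank := hW.rank_le _ hx
  refine Runs.wp_seq ?_
  rw [wp_setN (by simp; omega)]
  refine Runs.wp_seq ?_
  suffices hs : Cmd.wp W _ (fun s' => ∃ v' h', s' = s.withHeap v' N h' ∧ (∀ x < 40, v' x = v x) ∧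
      h'.Hole N H s.key (v' 41) (v' 42) (v' 40) ∧ h'.size N H ≤ h.size N H) _ by
    refine Cmd.wp_mono _ ?_ _ hs
    rintro s' ⟨v', h', rfl, h2, h3, h4⟩
    refine (runs_insertC (hv.congr h2) h3).mono ?_
    rintro t s' ⟨v'', h'', rfl, h6, h7, h8⟩ t1 ht1 t2 ht2 t3 ht3
    refine ⟨v'', h'', rfl, fun x hx => (h6 x hx).trans (h2 x hx), h7, ?_⟩
    have h5 : (BExp.nle (V 4) (V 41)).time = 3 := rfl
    have h9 : (41 ::= .cell 10 (V 40)).cost = 3 := rfl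
    have h10 : (42 ::= .cell 8 (V 40)).cost = 3 := rfl
    have h11 : (Cmd.cond (.neq (V 42) (.cell 11 (V 40))) .skip
        (44 ::= V 42 + 1 ;; 45 ::= .cell 12 (V 42) ;; setPoolC 42 4 ;; linkC 40 42 45 46 44 ;;
          40 ::= V 46 ;; 42 ::= V 44)).cost ≤ 80 := by decide
    have h12 := Nat.mul_le_mul_left unit h4
    omega
  rw [wp_cond]
  refine ⟨fun hs => ?_, fun hs => ?_⟩
  · simp at hs
    have h1 := hW.lower_cut hx hb hlow hne hs
    refine ⟨_, _, rfl, fun x hx => ?_, ?_, le_rfl⟩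
    · simp (disch := omega) [Function.update_of_ne]
    · simpa [hs] using h1
  · simp at hs
    obtain ⟨h1, h2, h3, h4⟩ := hW.lower_cut_deficient hx hb hlow hne hs
    have hwz := winner_eq s.key (v 40) (h.pool (h.rank (v 40)))
    have hsl := hW.slot_le hx (by simp) (by omega)
    simp (disch := first | omega | (simp; done) | (simp <;> omega) | fail) [wp_seq, wp_setN,
      wp_setPoolC hWd, wp_linkC hWd]
    refine ⟨_, _, rfl, fun x hx => ?_, ?_, ?_⟩
    · simp (disch := omega) [Function.update_of_ne]
    · simpa [e4] using h4
    · have := size_clear (h := h) (h' := (h.setPool (h.rank (v 40)) (v 4)).link s.key (v 40)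
        (h.rank (v 40)) (h.pool (h.rank (v 40)))) (i := h.rank (v 40)) (N := N) (H := H)
        (by omega) h1 (by simp [setPool, e4])
      omega

/-- Repair the main root and store it in `55`. -/
def repairC : Cmd :=
  55 ::= .cell 9 (V 4 + V 5 * V 3) ;; 42 ::= .cell 8 (V 55) ;;
  .cond (.neq (V 42) (V 3)) .skip
    (44 ::= V 42 + 1 ;; 45 ::= .cell 12 (V 42) ;; setPoolC 42 4 ;; linkC 55 42 45 46 44 ;;
      55 ::= V 46 ;; placeC 4 3 46)

/-- A deficient main root is linked with its partner of rank `H - 1`. The full rank `H` is what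
`Whole.open_root` requires, in case the main root is to be extracted. -/
theorem wp_repairC (hv : Env v N H W) (hN : 0 < N) (hW : h.Whole N H s.key) :
    repairC.wp W (fun s' => ∃ v' h', s' = s.withHeap v' N h' ∧ (∀ x < 40, v' x = v x) ∧
      h'.Whole N H s.key ∧ h'.rank (h'.ch N H) = H ∧ v' 55 = h'.ch N H) (s.withHeap v N h) := by
  have hWd := hv.word
  have hw : N + H + 2 ≤ W := le_word hv.word le_rfl
  have e3 := hv.height
  have e4 := hv.nodes
  have e5 := hv.stride
  obtain ⟨hx, -, hx3, hx4⟩ := hW.child N H (Or.inr ⟨rfl, rfl⟩) (by simp)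
  have hrx := hW.rank_le _ hx
  rw [repairC, wp_seq, wp_setN (by simp [e3, e4, e5, ch_withHeap _ _ _ le_rfl]; omega)]
  simp [e3, e4, e5, ch_withHeap _ _ _ le_rfl]
  rw [wp_seq, wp_setN (by simp; omega), wp_cond]
  refine ⟨fun hs => ?_, fun hs => ?_⟩
  · simp [e3] at hs
    refine ⟨_, _, rfl, fun x hx => ?_, hW, hs, by simp⟩
    simp (disch := omega) [Function.update_of_ne]
  · simp [e3] at hs
    obtain ⟨-, h1, h2, h3, h4⟩ := hW.repair_root hs
    have hwz := winner_eq s.key (h.ch N H) (h.pool (h.rank (h.ch N H)))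
    simp (disch := first | omega | (simp; done) | (simp <;> omega) | fail) [wp_seq, wp_setN,
      wp_setPoolC hWd, wp_linkC hWd, wp_placeC hWd]
    refine ⟨_, _, rfl, fun x hx => ?_, by simpa [e3, e4] using h4, ?_, by simp [place, e3, e4]⟩
    · simp (disch := omega) [Function.update_of_ne]
    · have h5 := hW.deficient _ hx (by simp) (by omega)
      simp [place, e3, e4, rank_link_winner]
      omega

end Heap
end AdTypes

/-! ### Finding and extracting the minimum in logarithmic time -/

namespace AdTypes

/-- Remove the key of `x`. -/
def Store.dequeue (s : Store) (x : ℕ) : Store :=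
  { s with narr := Function.update s.narr 7 (Function.update (s.narr 7) x 0) }

namespace Heap

variable {s : Store} {v : ℕ → ℕ} {N H W : ℕ} {h : Heap} {Q : Store → Prop}

/-- The node `x` is the main root, with `r = H`, or the root of the tree of rank `r` in the pool. -/
def IsTop (h : Heap) (N H x r : ℕ) : Prop :=
  (r = H ∧ x = h.ch N H) ∨ (r < H ∧ h.pool r ≠ N ∧ x = h.pool r)

/-- One round of the search for the smallest key among the roots. -/
def findRoundC : Cmd :=
  45 ::= .cell 12 (V 42) ;;
  .cond (.neq (V 45) (V 4)) .skip (.cond (leC 55 45) .skip (55 ::= V 45 ;; 56 ::= V 42)) ;;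
  42 ::= V 42 + 1

/-- Find a node with the smallest key and store it in `55` and its rank in `56`. -/
def findC : Cmd :=
  repairC ;; 56 ::= V 3 ;; 42 ::= 0 ;; .loop (BExp.nlt (V 42) (V 3)) findRoundC

/-- The result of the search. -/
structure Found (s : Store) (v : ℕ → ℕ) (N H : ℕ) (v' : ℕ → ℕ) (h' : Heap) : Prop where
  frame : ∀ x < 40, v' x = v x
  whole : h'.Whole N H s.key
  rank : h'.rank (h'.ch N H) = H
  isTop : h'.IsTop N H (v' 55) (v' 56)

theorem Found.lt {v' : ℕ → ℕ} (hf : Found s v N H v' h) : v' 55 < N := by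
  rcases hf.isTop with h1 | h1
  · rw [h1.2]; exact (hf.whole.child N H (Or.inr ⟨rfl, rfl⟩) (by simp)).1
  · rw [h1.2.2]; exact (hf.whole.pool_lt _ h1.1 h1.2.1).1

theorem wp_findRoundC {w : ℕ → ℕ} (hv : Env w N H W) (hf : Found s v N H w h) (hi : w 42 < H)
    (hroot : s.key (w 55) ≤ s.key (h.ch N H))
    (hle : ∀ i < w 42, h.pool i ≠ N → s.key (w 55) ≤ s.key (h.pool i)) :
    findRoundC.wp W (fun s' => ∃ w', s' = s.withHeap w' N h ∧ Found s v N H w' h ∧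
      w' 42 = w 42 + 1 ∧ s.key (w' 55) ≤ s.key (h.ch N H) ∧
      ∀ i < w' 42, h.pool i ≠ N → s.key (w' 55) ≤ s.key (h.pool i)) (s.withHeap w N h) := by
  have hw : N + H + 2 ≤ W := le_word hv.word le_rfl
  have e4 := hv.nodes
  have hpN : h.pool (w 42) ≤ N := by
    by_cases h1 : h.pool (w 42) = N
    · omega
    · exact (hf.whole.pool_lt _ hi h1).1.le
  have h55 := hf.lt
  rw [findRoundC, wp_seq, wp_setN (by simp; omega), wp_seq, wp_cond, wp_cond]
  refine ⟨fun hs => ?_, fun hs => ⟨fun hK => ?_, fun hK => ?_⟩⟩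
  · simp [e4] at hs
    simp only [Cmd.wp.eq_1]
    rw [wp_setN (by simp; omega)]
    refine ⟨_, rfl, ⟨fun x hx => ?_, hf.whole, hf.rank, by simpa using hf.isTop⟩, by simp,
      by simpa using hroot, fun i hi hp => ?_⟩
    · simpa (disch := omega) [Function.update_of_ne] using hf.frame x hx
    · simp at hi ⊢
      rcases lt_or_eq_of_le hi with h1 | rfl
      exacts [hle i h1 hp, absurd hs hp]
  · simp [e4] at hs hK
    simp only [Cmd.wp.eq_1]
    rw [wp_setN (by simp; omega)]
    refine ⟨_, rfl, ⟨fun x hx => ?_, hf.whole, hf.rank, by simpa using hf.isTop⟩, by simp,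
      by simpa using hroot, fun i hi hp => ?_⟩
    · simpa (disch := omega) [Function.update_of_ne] using hf.frame x hx
    · simp at hi ⊢
      rcases lt_or_eq_of_le hi with h1 | rfl
      exacts [hle i h1 hp, hK]
  · simp [e4] at hs hK
    simp (disch := first | omega | (simp; done) | (simp <;> omega) | fail) only [wp_seq, wp_setN]
    refine ⟨_, rfl, ⟨fun x hx => ?_, hf.whole, hf.rank, Or.inr ?_⟩, by simp,
      by simpa using hK.le.trans hroot, fun i hi hp => ?_⟩
    · simpa (disch := omega) [Function.update_of_ne] using hf.frame x hx
    · simpa using ⟨hi, hs⟩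
    · simp at hi ⊢
      rcases lt_or_eq_of_le hi with h1 | rfl
      exacts [hK.le.trans (hle i h1 hp), le_rfl]

/-- By the heap order the minimum is attained at the main root or at a root of the pool, of which
there are at most `H`. -/
theorem runs_findC (hv : Env v N H W) (hN : 0 < N) (hW : h.Whole N H s.key) :
    Runs W findC (s.withHeap v N h) fun t s' => ∃ v' h', s' = s.withHeap v' N h' ∧
      Found s v N H v' h' ∧ (∀ x < N, s.key (v' 55) ≤ s.key x) ∧ t ≤ 200 * (H + 1) := by
  refine Runs.wp_seq (Cmd.wp_mono _ ?_ _ (wp_repairC hv hN hW))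
  rintro s' ⟨v1, h', rfl, h2, h3, h4, h5⟩
  have hv1 := hv.congr h2
  have hw : N + H + 2 ≤ W := le_word hv.word le_rfl
  have e3 := hv1.height
  refine Runs.wp_seq ?_
  rw [wp_setN (by simp; omega)]
  refine Runs.wp_seq ?_
  rw [wp_setN_zero]
  let J : (ℕ → ℕ) → Store → Prop := fun w s' => s' = s.withHeap w N h' ∧ Found s v N H w h' ∧
    s.key (w 55) ≤ s.key (h'.ch N H) ∧ w 42 ≤ H ∧
    ∀ i < w 42, h'.pool i ≠ N → s.key (w 55) ≤ s.key (h'.pool i)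
  have hc1 : findRoundC.cost ≤ 60 := by decide
  have hc2 : repairC.cost ≤ 100 := by decide
  have hc3 : (BExp.nlt (V 42) (V 3)).time = 4 := rfl
  refine (Runs.loop J (fun w => 65 * (H - w 42)) ?_ _
    ⟨rfl, ⟨fun x hx => ?_, h3, h4, ?_⟩, ?_, by simp, by simp⟩).mono ?_
  · rintro w s' ⟨rfl, h6, h7, h8, h9⟩ hb
    have hvw : Env w N H W := hv.congr h6.frame
    simp [hvw.height] at hb
    refine (runs_of_wp (wp_findRoundC hvw h6 hb h7 h9)).mono ?_
    rintro t s' ⟨ht, w', rfl, h10, h11, h12, h13⟩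
    refine ⟨w', ⟨rfl, h10, h12, by omega, h13⟩, ?_⟩
    omega
  · simpa (disch := omega) [Function.update_of_ne] using h2 x hx
  · left; simp [e3, h5]
  · simp [h5]
  · rintro t s' ⟨w, ⟨rfl, h6, h7, h8, h9⟩, hb, ht⟩ t1 ht1 t2 ht2 t3 ht3
    have hvw : Env w N H W := hv.congr h6.frame
    simp [hvw.height] at hb
    refine ⟨w, h', rfl, h6, fun x hx => ?_, ?_⟩
    · obtain ⟨y, hy1 | ⟨i, hi, hy1, hy2⟩, hy3⟩ := h3.exists_le hx
      · rw [hy1] at hy3; exact h7.trans hy3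
      · rw [hy2] at hy3; exact (h9 i (by omega) hy1).trans hy3
    · have h10 : (56 ::= V 3).cost = 2 := rfl
      have h11 : (42 ::= 0).cost = 2 := rfl
      simp at ht
      omega

/-- Detach the child number `42 - 1` of `55`. -/
def downC : Cmd :=
  42 ::= V 42 - 1 ;; 48 ::= .cell 9 (V 55 + V 5 * V 42) ;; 49 ::= .cell 8 (V 48) ;;
  setRankC 55 42 ;;
  .cond (.neq (V 49) (V 42)) .skip
    (44 ::= V 49 + 1 ;; 45 ::= .cell 12 (V 49) ;; setPoolC 49 4 ;; linkC 48 49 45 46 44 ;;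
      setChC 55 42 46)

/-- Link the tree `40` with the tree whose root was the child number `42` of `55`. -/
def upC : Cmd :=
  44 ::= V 42 + 1 ;; 45 ::= .cell 9 (V 55 + V 5 * V 42) ;; linkC 40 42 45 46 44 ;;
  40 ::= V 46 ;; 42 ::= V 44

/-- Remove the key of the node `55`, where `56` is its rank. -/
def extractC : Cmd :=
  .cond (.neq (V 56) (V 3)) .skip (setPoolC 56 4) ;;
  42 ::= V 56 ;; .loop (BExp.nlt 0 (V 42)) downC ;;
  .putN 7 (V 55) 0 ;; 40 ::= V 55 ;;
  .loop (BExp.nlt (V 42) (V 56)) upC ;;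
  .cond (.neq (V 56) (V 3)) (placeC 4 3 40) (setPoolC 56 40 ;; setParC 40 5)

variable {x r : ℕ} {Hs : Set (ℕ × ℕ)} {X : Set ℕ}

theorem wp_downC (hv : Env v N H W) (hi : 0 < v 42) (hr : v 42 ≤ r)
    (hO : h.Opened N H s.key (v 55) (v 42) r (v 55) Hs X) :
    downC.wp W (fun s' => ∃ v' h', s' = s.withHeap v' N h' ∧ (∀ x < 40, v' x = v x) ∧
      v' 42 + 1 = v 42 ∧ v' 55 = v 55 ∧ v' 56 = v 56 ∧
      h'.Opened N H s.key (v' 55) (v' 42) r (v' 55) Hs X) (s.withHeap v N h) := by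
  have hWd := hv.word
  have hw : N + H + 2 ≤ W := le_word hv.word le_rfl
  have e4 := hv.nodes
  have e5 := hv.stride
  obtain ⟨i, hvi⟩ : ∃ i, v 42 = i + 1 := ⟨v 42 - 1, by omega⟩
  rw [hvi] at hO
  obtain ⟨hc1, hc2, hc3, hc4, hc5⟩ := hO.child_facts
  have hx := hO.lt
  have hle := hO.le
  have hch := fun w => ch_withHeap s w h hx.le i
  have hrk := hO.inv.rank_le _ hc1
  rw [downC, wp_seq, wp_setN (by simp; omega)]
  simp only [NExp.val_sub, NExp.val_var, NExp.val_one, nvar_withHeap, hvi, Nat.add_sub_cancel]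
  rw [wp_seq, wp_setN (by simp [e5, hch]; omega)]
  simp [e5, hch]
  simp (disch := first | omega | (simp; done) | (simp <;> omega) | fail) only [wp_seq, wp_setN,
    wp_setRankC hWd, wp_cond]
  have hcx : h.ch (v 55) i ≠ v 55 := fun h' => hc2 (Or.inl h')
  refine ⟨fun hs => ?_, fun hs => ?_⟩
  · simp at hs
    refine ⟨_, _, rfl, fun x hx => ?_, by simp, by simp, by simp, ?_⟩
    · simp (disch := omega) [Function.update_of_ne]
    · simpa using hO.down (by omega) hs
  · simp at hs
    obtain ⟨h1, h2, h3, h4⟩ := hO.down_deficient (by omega) hs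
    have hwz := winner_eq s.key (h.ch (v 55) i) (h.pool (h.rank (h.ch (v 55) i)))
    have hpool : (h.setRank (v 55) i).pool = h.pool := rfl
    have h5 : (h.setRank (v 55) i).pool (h.rank (h.ch (v 55) i)) < N := h2
    simp (disch := first | omega | (simp; done) | (simp <;> omega) | fail) [wp_setN,
      wp_setPoolC hWd, wp_linkC hWd, wp_setChC hWd, hpool]
    refine ⟨_, _, rfl, fun x hx => ?_, by simp, by simp, by simp, ?_⟩
    · simp (disch := omega) [Function.update_of_ne]
    · simpa [e4] using h4

theorem wp_upC (hv : Env v N H W) (hr : v 42 < r) (hx : v 55 < N)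
    (hO : h.Opened N H s.key (v 55) (v 42) r (v 40) Hs X) :
    upC.wp W (fun s' => ∃ v' h', s' = s.withHeap v' N h' ∧ (∀ x < 40, v' x = v x) ∧
      v' 42 = v 42 + 1 ∧ v' 55 = v 55 ∧ v' 56 = v 56 ∧
      h'.Opened N H s.key (v' 55) (v' 42) r (v' 40) Hs X) (s.withHeap v N h) := by
  have hWd := hv.word
  have hw : N + H + 2 ≤ W := le_word hv.word le_rfl
  have e5 := hv.stride
  obtain ⟨hc1, hc2, hc3⟩ := hO.kid _ le_rfl hr
  have ht := hO.lt
  have hle := hO.le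
  have hch := fun w => ch_withHeap s w h hx.le (v 42)
  have hwz := winner_eq s.key (v 40) (h.ch (v 55) (v 42))
  rw [upC, wp_seq, wp_setN (by simp; omega), wp_seq, wp_setN (by simp [e5, hch]; omega)]
  simp [e5, hch]
  simp (disch := first | omega | (simp; done) | (simp <;> omega) | fail) [wp_seq, wp_setN,
    wp_linkC hWd]
  refine ⟨_, _, rfl, fun x hx => ?_, by simp, by simp, by simp, ?_⟩
  · simp (disch := omega) [Function.update_of_ne]
  · simpa using hO.up hr

theorem runs_downLoop (hv : Env v N H W)
    (hO : h.Opened N H s.key (v 55) (v 42) (v 42) (v 55) Hs X) :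
    Runs W (.loop (BExp.nlt 0 (V 42)) downC) (s.withHeap v N h) fun t s' =>
      ∃ v' h', s' = s.withHeap v' N h' ∧ (∀ x < 40, v' x = v x) ∧
        v' 42 = 0 ∧ v' 55 = v 55 ∧ v' 56 = v 56 ∧
        h'.Opened N H s.key (v 55) 0 (v 42) (v 55) Hs X ∧ t ≤ 200 * (v 42 + 1) := by
  let J : (ℕ → ℕ) × Heap → Store → Prop := fun g s' => s' = s.withHeap g.1 N g.2 ∧
    (∀ x < 40, g.1 x = v x) ∧ g.1 42 ≤ v 42 ∧ g.1 55 = v 55 ∧ g.1 56 = v 56 ∧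
    g.2.Opened N H s.key (g.1 55) (g.1 42) (v 42) (g.1 55) Hs X
  have hc1 : downC.cost ≤ 150 := by decide
  have hc3 : (BExp.nlt 0 (V 42)).time = 4 := rfl
  refine (Runs.loop J (fun g => 200 * g.1 42) ?_ (v, h)
    ⟨rfl, fun x hx => rfl, le_rfl, rfl, rfl, hO⟩).mono ?_
  · rintro ⟨w, g⟩ s' ⟨h1, h2, h3, h4, h5, h6⟩ hb
    simp only at h1 h2 h3 h4 h5 h6
    subst h1
    simp at hb
    refine (runs_of_wp (wp_downC (hv.congr h2) (by omega) h3 h6)).mono ?_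
    rintro t s' ⟨ht, w', g', rfl, h7, h8, h9, h10, h11⟩
    refine ⟨(w', g'), ⟨rfl, fun x hx => (h7 x hx).trans (h2 x hx), ?_, h9.trans h4, h10.trans h5,
      h11⟩, ?_⟩
    · simp only; omega
    · simp only; omega
  · rintro t s' ⟨⟨w, g⟩, ⟨h1, h2, h3, h4, h5, h6⟩, hb, ht⟩
    simp only at h1 h2 h3 h4 h5 h6 ht
    subst h1
    simp at hb
    rw [h4, hb] at h6
    exact ⟨w, g, rfl, h2, hb, h4, h5, h6, by omega⟩

theorem runs_upLoop (hv : Env v N H W) (hx : v 55 < N) (h42 : v 42 = 0)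
    (hO : h.Opened N H s.key (v 55) 0 (v 56) (v 40) Hs X) :
    Runs W (.loop (BExp.nlt (V 42) (V 56)) upC) (s.withHeap v N h) fun t s' =>
      ∃ v' h', s' = s.withHeap v' N h' ∧ (∀ x < 40, v' x = v x) ∧ v' 56 = v 56 ∧
        h'.Opened N H s.key (v 55) (v 56) (v 56) (v' 40) Hs X ∧ t ≤ 200 * (v 56 + 1) := by
  let J : (ℕ → ℕ) × Heap → Store → Prop := fun g s' => s' = s.withHeap g.1 N g.2 ∧
    (∀ x < 40, g.1 x = v x) ∧ g.1 42 ≤ v 56 ∧ g.1 55 = v 55 ∧ g.1 56 = v 56 ∧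
    g.2.Opened N H s.key (g.1 55) (g.1 42) (v 56) (g.1 40) Hs X
  have hc1 : upC.cost ≤ 150 := by decide
  have hc3 : (BExp.nlt (V 42) (V 56)).time = 4 := rfl
  refine (Runs.loop J (fun g => 200 * (v 56 - g.1 42)) ?_ (v, h)
    ⟨rfl, fun x hx => rfl, by simp [h42], rfl, rfl, by simpa [h42] using hO⟩).mono ?_
  · rintro ⟨w, g⟩ s' ⟨h1, h2, h3, h4, h5, h6⟩ hb
    simp only at h1 h2 h3 h4 h5 h6
    subst h1
    simp [h5] at hb
    refine (runs_of_wp (wp_upC (hv.congr h2) hb (by omega) h6)).mono ?_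
    rintro t s' ⟨ht, w', g', rfl, h7, h8, h9, h10, h11⟩
    refine ⟨(w', g'), ⟨rfl, fun x hx => (h7 x hx).trans (h2 x hx), ?_, h9.trans h4, h10.trans h5,
      h11⟩, ?_⟩
    · simp only; omega
    · simp only; omega
  · rintro t s' ⟨⟨w, g⟩, ⟨h1, h2, h3, h4, h5, h6⟩, hb, ht⟩
    simp only at h1 h2 h3 h4 h5 h6 ht
    subst h1
    simp [h5] at hb
    rw [h4, show w 42 = v 56 by omega] at h6
    exact ⟨w, g, rfl, h2, h5, h6, by omega⟩

theorem wp_dequeue (hw : v 55 ≤ W) {Q : Store → Prop} :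
    (Cmd.putN 7 (V 55) 0).wp W Q (s.withHeap v N h) ↔
      Q ((s.dequeue (v 55)).withHeap v N h) := by
  simp only [Cmd.wp, NExp.val_var, NExp.val_zero, nvar_withHeap, hw, zero_le, true_and]
  refine iff_of_eq (congrArg Q (withHeap_eq rfl rfl rfl fun a => ?_))
  by_cases ha : a = 7
  · subst ha; simp [Store.withHeap, Store.dequeue]
  · simp [ha, Store.withHeap, Store.dequeue]

theorem key_dequeue {y : ℕ} (hy : y ≠ x) : (s.dequeue x).key y = s.key y := by
  simp [Store.key, Store.dequeue, hy]

/-- The node is not deleted but receives the key `⊤`, so the heap keeps its node set. For this its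
tree is taken apart down to the single node, whose key can change freely, and then reassembled to
the same rank. -/
theorem runs_extractC {v₀ : ℕ → ℕ} (hv : Env v N H W) (hf : Found s v₀ N H v h) :
    Runs W extractC (s.withHeap v N h) fun t s' =>
      ∃ v' h', s' = (s.dequeue (v 55)).withHeap v' N h' ∧ (∀ x < 40, v' x = v x) ∧
        h'.Whole N H (s.dequeue (v 55)).key ∧ t ≤ 800 * (H + 1) := by
  have hWd := hv.word
  have hw : N + H + 2 ≤ W := le_word hv.word le_rfl
  have e3 := hv.height
  have e4 := hv.nodes
  have e5 := hv.stride
  have hx := hf.lt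
  have h56 : v 56 ≤ H := by rcases hf.isTop with h1 | h1 <;> omega
  -- Taking out the main tree leaves a missing position, taking out a pool tree leaves a reserved
  -- rank.
  let Hs : Set (ℕ × ℕ) := if v 56 = H then {(N, H)} else ∅
  let X : Set ℕ := if v 56 = H then ∅ else {v 56}
  refine Runs.wp_seq ?_
  suffices hs : Cmd.wp W _ (fun s' => ∃ h', s' = s.withHeap v N h' ∧
      h'.Opened N H s.key (v 55) (v 56) (v 56) (v 55) Hs X) _ by
    refine Cmd.wp_mono _ ?_ _ hs
    rintro s' ⟨h1, rfl, hO⟩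
    refine Runs.wp_seq ?_
    rw [wp_setN (by simp; omega)]
    refine Runs.seq ((runs_downLoop (Hs := Hs) (X := X) (hv.congr fun x hx => ?_) ?_).mono ?_)
    · simp (disch := omega) [Function.update_of_ne]
    · simpa using hO
    rintro t2 s' ⟨v2, h2, rfl, h3, h4, h5, h6, h7, h8⟩
    have hf2 : ∀ x < 40, v2 x = v x := fun x hx => by
      rw [h3 x hx]; simp (disch := omega) [Function.update_of_ne]
    simp at h5 h6 h7 h8
    refine Runs.wp_seq ?_
    rw [wp_dequeue (by omega)]
    refine Runs.wp_seq ?_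
    rw [wp_setN (by simp; omega), h5]
    have h9 := h7.rekey (K' := (s.dequeue (v 55)).key) fun y hy => key_dequeue hy
    refine Runs.seq ((runs_upLoop (Hs := Hs) (X := X) (hv.congr fun x hx => ?_) ?_ ?_ ?_).mono ?_)
    · simpa (disch := omega) [Function.update_of_ne] using hf2 x hx
    · simpa [h5]
    · simpa
    · simpa [h5, h6] using h9
    rintro t3 s' ⟨v3, h10, rfl, h11, h12, h13, h14⟩
    simp [h5, h6] at h12 h13 h14
    have hf3 : ∀ x < 40, v3 x = v x := fun x hx => by
      rw [h11 x hx]; simpa (disch := omega) [Function.update_of_ne] using hf2 x hx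
    have g3 : v3 3 = H := (hf3 3 (by omega)).trans e3
    have g4 : v3 4 = N := (hf3 4 (by omega)).trans e4
    have g5 : v3 5 = N + 1 := (hf3 5 (by omega)).trans e5
    have ht := h13.lt
    refine Runs.of_wp ?_
    have htime : ∀ t ≤ (Cmd.cond (.neq (V 56) (V 3)) (placeC 4 3 40)
        (setPoolC 56 40 ;; setParC 40 5)).cost, ∀ t4 ≤ (40 ::= V 55).cost,
        ∀ t5 ≤ (Cmd.putN 7 (V 55) 0).cost, ∀ t6 ≤ (42 ::= V 56).cost,
        ∀ t7 ≤ (Cmd.cond (.neq (V 56) (V 3)) .skip (setPoolC 56 4)).cost,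
        t7 + (t6 + (t2 + (t5 + (t4 + (t3 + t))))) ≤ 800 * (H + 1) := by
      have c1 : (Cmd.cond (.neq (V 56) (V 3)) (placeC 4 3 40)
        (setPoolC 56 40 ;; setParC 40 5)).cost ≤ 50 := by decide
      have c2 : (Cmd.cond (.neq (V 56) (V 3)) .skip (setPoolC 56 4)).cost ≤ 50 := by decide
      have c3 : (40 ::= V 55).cost = 2 := rfl
      have c4 : (42 ::= V 56).cost = 2 := rfl
      have c5 : (Cmd.putN 7 (V 55) 0).cost = 3 := rfl
      intros; omega
    rw [wp_cond]
    refine ⟨fun hb => ?_, fun hb => ?_⟩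
    · simp [g3, h12] at hb
      simp only [Hs, X, if_pos hb, hb] at h13
      rw [wp_placeC hWd g5 g4.le g3.le ht.le]
      intro t ht t4 ht4 t5 ht5 t6 ht6 t7 ht7
      exact ⟨_, _, rfl, hf3, by simpa [g3, g4] using h13.close_root,
        htime t ht t4 ht4 t5 ht5 t6 ht6 t7 ht7⟩
    · simp [g3, h12] at hb
      simp only [Hs, X, if_neg hb] at h13
      rw [wp_seq, wp_setPoolC hWd (by omega) (by omega), wp_setParC hWd (by omega) (by omega)]
      intro t ht t4 ht4 t5 ht5 t6 ht6 t7 ht7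
      exact ⟨_, _, rfl, hf3, by simpa [g5, h12] using h13.close_pool (by omega),
        htime t ht t4 ht4 t5 ht5 t6 ht6 t7 ht7⟩
  rw [wp_cond]
  refine ⟨fun hb => ?_, fun hb => ?_⟩
  · simp [e3] at hb
    refine ⟨h, rfl, ?_⟩
    simp only [Hs, X, if_pos hb]
    rcases hf.isTop with h1 | h1
    · rw [h1.1, h1.2]; exact hf.whole.open_root hf.rank
    · omega
  · simp [e3] at hb
    rw [wp_setPoolC hWd h56 (by omega)]
    refine ⟨_, rfl, ?_⟩
    simp only [Hs, X, if_neg hb]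
    rcases hf.isTop with h1 | h1
    · omega
    · rw [h1.2.2, e4]; exact hf.whole.open_pool h1.1 h1.2.1

end Heap
end AdTypes

/-! ### The initial binomial tree -/

namespace AdTypes
namespace Heap

variable {s : Store} {v : ℕ → ℕ} {N H W n : ℕ} {h : Heap}

/-- The binomial tree in which the parent of `x` arises by removing the leading binary digit. -/
structure IsBinomial (h : Heap) (N H x : ℕ) : Prop where
  rank_zero : h.rank 0 = H
  par_zero : h.par 0 = N
  slot_zero : h.slot 0 = H
  ch_root : h.ch N H = 0
  pool : ∀ i < H, h.pool i = N
  rank : ∀ y, 1 ≤ y → y < x → h.rank y + 1 + Nat.log 2 y = H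
  slot : ∀ y, 1 ≤ y → y < x → h.slot y + 1 + Nat.log 2 y = H
  par : ∀ y, 1 ≤ y → y < x → h.par y + 2 ^ Nat.log 2 y = y
  ch : ∀ y, 1 ≤ y → y < x → h.ch (h.par y) (h.slot y) = y

/-- The children of `p` are the numbers `p + 2 ^ e < 2 ^ H` with `p < 2 ^ e`, and `e = H - 1 - i`
for the child number `i`. The heap order is trivial as all keys are `⊤`, and neither deficient nodes
nor pool trees occur. -/
theorem IsBinomial.whole {K : ℕ → WithTop ℝ} (hb : h.IsBinomial N H N) (hN : N = 2 ^ H)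
    (hK : ∀ x, K x = ⊤) : h.Whole N H K := by
  have hpos : 0 < N := by rw [hN]; positivity
  have hrank : ∀ p < N, ∀ i, i < h.rank p ↔ i < H ∧ p < 2 ^ (H - 1 - i) := by
    intro p hp i
    rcases Nat.eq_zero_or_pos p with rfl | hp0
    · simp [hb.rank_zero]
    · have h1 := hb.rank p hp0 hp
      constructor
      · intro h2
        refine ⟨by omega, ?_⟩
        have h3 := Nat.lt_pow_succ_log_self (b := 2) (by norm_num) p
        exact h3.trans_le (Nat.pow_le_pow_right (by norm_num) (by omega))
      · rintro ⟨h2, h3⟩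
        have h4 := Nat.log_lt_of_lt_pow (by omega) h3
        omega
  have hpar : ∀ y, 1 ≤ y → y < N → h.par y < N ∧ h.slot y < h.rank (h.par y) := by
    intro y hy hyN
    have h1 := hb.par y hy hyN
    have h2 := hb.slot y hy hyN
    have h3 := Nat.lt_pow_succ_log_self (b := 2) (by norm_num) y
    rw [pow_succ] at h3
    have h4 : h.par y < N := by omega
    refine ⟨h4, (hrank _ h4 _).2 ⟨by omega, ?_⟩⟩
    rw [show H - 1 - h.slot y = Nat.log 2 y by omega]; omega
  constructor
  · intro x hx _ _
    rcases Nat.eq_zero_or_pos x with rfl | hx0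
    · rw [hb.par_zero, hb.slot_zero]
      exact ⟨by simp, hb.ch_root, Or.inr ⟨rfl, rfl⟩, Or.inl rfl⟩
    · exact ⟨by simp, hb.ch x hx0 hx, Or.inl (hpar x hx0 hx), Or.inr (by simp [hK])⟩
  · intro x hx _ _
    left
    rcases Nat.eq_zero_or_pos x with rfl | hx0
    · rw [hb.rank_zero, hb.slot_zero]
    · have h1 := hb.rank x hx0 hx
      have h2 := hb.slot x hx0 hx
      omega
  · intro p i hs _
    rcases hs with ⟨h1, h2⟩ | ⟨rfl, rfl⟩
    · obtain ⟨h3, h4⟩ := (hrank p h1 i).1 h2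
      have h5 : 0 < 2 ^ (H - 1 - i) := by positivity
      have h6 : p + 2 ^ (H - 1 - i) < N := by
        have : 2 ^ (H - 1 - i + 1) ≤ 2 ^ H := Nat.pow_le_pow_right (by norm_num) (by omega)
        rw [pow_succ] at this; omega
      have h7 : Nat.log 2 (p + 2 ^ (H - 1 - i)) = H - 1 - i := by
        rw [Nat.log_eq_iff (by omega), pow_succ]; omega
      have h8 := hb.par _ (by omega) h6
      have h9 := hb.slot _ (by omega) h6
      have h10 := hb.ch _ (by omega) h6
      rw [h7] at h8 h9
      rw [show h.par (p + 2 ^ (H - 1 - i)) = p by omega,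
        show h.slot (p + 2 ^ (H - 1 - i)) = i by omega] at h10
      rw [h10]
      exact ⟨h6, by simp, by omega, by omega⟩
    · rw [hb.ch_root]
      exact ⟨hpos, by simp, hb.par_zero, hb.slot_zero⟩
  · intro i hi hp; exact absurd (hb.pool i hi) hp
  · intro i hi hp; exact absurd (hb.pool i hi) (by simpa using hp)
  · intro x hx _ hp
    rcases Nat.eq_zero_or_pos x with rfl | hx0
    · rw [hb.par_zero] at hp; omega
    · have := (hpar x hx0 hx).1; omega
  · simp
  · intro x hx
    rcases Nat.eq_zero_or_pos x with rfl | hx0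
    · exact hb.rank_zero.le
    · have := hb.rank x hx0 hx; omega

/-- Compute the dimensions of the heap. -/
def dimC : Cmd :=
  3 ::= 0 ;; 4 ::= 1 ;; .loop (BExp.nlt (V 4) (V 1)) (4 ::= V 4 + V 4 ;; 3 ::= V 3 + 1) ;;
  5 ::= V 4 + 1

/-- Clear the pool. -/
def clearPoolC : Cmd :=
  42 ::= 0 ;; .loop (BExp.nlt (V 42) (V 3)) (setPoolC 42 4 ;; 42 ::= V 42 + 1)

/-- Insert the node `41` into the binomial tree. -/
def nodeC : Cmd :=
  .cond (.neq (V 41) (V 43 + V 43)) (43 ::= V 43 + V 43 ;; 42 ::= V 42 - 1) .skip ;;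
  44 ::= V 41 - V 43 ;; setRankC 41 42 ;; placeC 44 42 41 ;; 41 ::= V 41 + 1

def buildC : Cmd :=
  dimC ;; clearPoolC ;; 40 ::= 0 ;; setRankC 40 3 ;; placeC 4 3 40 ;;
  41 ::= 1 ;; 43 ::= 1 ;; 42 ::= V 3 - 1 ;; .loop (BExp.nlt (V 41) (V 4)) nodeC

theorem runs_dimC (hn : 1 ≤ s.nvar 1) (hW : 2 * s.nvar 1 + 1 ≤ W) :
    Runs W dimC s fun t s' => ∃ v H, s' = { s with nvar := v } ∧
      (∀ x, x ≠ 3 → x ≠ 4 → x ≠ 5 → v x = s.nvar x) ∧ v 3 = H ∧ v 4 = 2 ^ H ∧ v 5 = 2 ^ H + 1 ∧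
      s.nvar 1 ≤ 2 ^ H ∧ 2 ^ H ≤ 2 * s.nvar 1 ∧ t ≤ 40 * s.nvar 1 := by
  refine Runs.wp_seq ⟨by simp, Runs.wp_seq ⟨by simp; omega, Runs.seq ?_⟩⟩
  let J : (ℕ → ℕ) → Store → Prop := fun v s' => s' = { s with nvar := v } ∧
    (∀ x, x ≠ 3 → x ≠ 4 → v x = s.nvar x) ∧ v 4 = 2 ^ v 3 ∧ v 4 ≤ 2 * s.nvar 1
  refine (Runs.loop J (fun v => 25 * (s.nvar 1 - v 4)) ?_ _ ⟨rfl, ?_, ?_, ?_⟩).mono ?_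
  · rintro v s' ⟨rfl, h1, h2, h3⟩ hb
    simp [h1 1] at hb
    have hlt : v 3 < 2 ^ v 3 := Nat.lt_two_pow_self
    refine (runs_of_wp (c := 4 ::= V 4 + V 4 ;; 3 ::= V 3 + 1) ⟨by simp; omega, by simp; omega,
      (rfl : _ = _)⟩).mono ?_
    rintro t s' ⟨ht, rfl⟩
    have hc : (4 ::= V 4 + V 4 ;; 3 ::= V 3 + 1).cost = 8 := rfl
    have hc2 : (BExp.nlt (V 4) (V 1)).time = 4 := rfl
    refine ⟨_, ⟨rfl, fun x h4 h5 => ?_, ?_, ?_⟩, ?_⟩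
    · simp [h4, h5, h1 x]
    · simp [h2, pow_succ]; ring
    · simp; omega
    · simp; omega
  · intro x h1 h2; simp [h1, h2]
  · simp
  · simp; omega
  · rintro t s' ⟨v, ⟨rfl, h1, h2, h3⟩, hb, ht⟩
    simp [h1 1] at hb
    refine Runs.of_wp ⟨by simp; omega, fun t1 ht1 t2 ht2 t3 ht3 => ?_⟩
    refine ⟨_, v 3, rfl, fun x h4 h5 h6 => ?_, by simp, by simpa using h2, by simp [h2],
      by omega, by omega, ?_⟩
    · simp [h6, h1 x h4 h5]
    · have c1 : (5 ::= V 4 + 1).cost = 4 := rfl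
      have c2 : (4 ::= 1).cost = 2 := rfl
      have c3 : (3 ::= 0).cost = 2 := rfl
      have c4 : (BExp.nlt (V 4) (V 1)).time = 4 := rfl
      simp at ht
      omega

theorem runs_clearPoolC (hv : Env v N H W) :
    Runs W clearPoolC (s.withHeap v N h) fun t s' => ∃ v' h', s' = s.withHeap v' N h' ∧
      (∀ x < 40, v' x = v x) ∧ (∀ i < H, h'.pool i = N) ∧ t ≤ 20 * (H + 1) := by
  have hWd := hv.word
  have hw : N + H + 2 ≤ W := le_word hv.word le_rfl
  refine Runs.wp_seq ?_
  rw [wp_setN_zero]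
  let J : (ℕ → ℕ) × Heap → Store → Prop := fun g s' => s' = s.withHeap g.1 N g.2 ∧
    (∀ x < 40, g.1 x = v x) ∧ g.1 42 ≤ H ∧ ∀ i < g.1 42, g.2.pool i = N
  have hc1 : (setPoolC 42 4 ;; 42 ::= V 42 + 1).cost = 7 := rfl
  have hc3 : (BExp.nlt (V 42) (V 3)).time = 4 := rfl
  refine (Runs.loop J (fun g => 20 * (H - g.1 42)) ?_ (Function.update v 42 0, h)
    ⟨rfl, fun x hx => ?_, ?_, ?_⟩).mono ?_
  · rintro ⟨w, g⟩ s' ⟨h1, h2, h3, h4⟩ hb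
    simp only at h1 h2 h3 h4
    subst h1
    have hvw := hv.congr h2
    have e3 := hvw.height
    have e4 := hvw.nodes
    simp [e3] at hb
    have hwp : (setPoolC 42 4 ;; 42 ::= V 42 + 1).wp W (fun s' => s' = s.withHeap
        (Function.update w 42 (w 42 + 1)) N (g.setPool (w 42) N)) (s.withHeap w N g) := by
      rw [wp_seq, wp_setPoolC hWd (by omega) (by omega), wp_setN (by simp; omega), e4]; simp
    refine (runs_of_wp hwp).mono ?_
    rintro t s' ⟨ht, rfl⟩
    refine ⟨(Function.update w 42 (w 42 + 1), g.setPool (w 42) N),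
      ⟨rfl, fun x hx => ?_, ?_, fun i hi => ?_⟩, ?_⟩
    · simpa (disch := omega) [Function.update_of_ne] using h2 x hx
    · simp; omega
    · simp at hi
      by_cases hiw : i = w 42
      · simp [setPool, hiw]
      · simp [setPool, hiw]; exact h4 i (by omega)
    · simp; omega
  · simp (disch := omega) [Function.update_of_ne]
  · simp
  · simp
  · rintro t s' ⟨⟨w, g⟩, ⟨h1, h2, h3, h4⟩, hb, ht⟩ t1 ht1
    simp only at h1 h2 h3 h4 ht
    subst h1
    have e3 := (hv.congr h2).height
    simp [e3] at hb
    have c1 : (42 ::= 0).cost = 2 := rfl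
    exact ⟨w, g, rfl, h2, fun i hi => h4 i (by omega), by simp at ht; omega⟩

theorem wp_nodeC {t : ℕ} (hv : Env v N H W) (hb : h.IsBinomial N H (v 41)) (hx : v 41 < N)
    (hNH : N = 2 ^ H) (h43 : v 43 = 2 ^ t) (h42 : v 42 + 1 + t = H) (h1 : 2 ^ t ≤ v 41)
    (h2 : v 41 ≤ 2 ^ (t + 1)) :
    nodeC.wp W (fun s' => ∃ v' h' t', s' = s.withHeap v' N h' ∧ (∀ x < 40, v' x = v x) ∧
      v' 41 = v 41 + 1 ∧ h'.IsBinomial N H (v 41 + 1) ∧ v' 43 = 2 ^ t' ∧ v' 42 + 1 + t' = H ∧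
      2 ^ t' ≤ v' 41 ∧ v' 41 ≤ 2 ^ (t' + 1)) (s.withHeap v N h) := by
  have hWd := hv.word
  have hw : N + H + 2 ≤ W := le_word hv.word le_rfl
  have hpos : 0 < 2 ^ t := by positivity
  -- The leading power of two is doubled exactly when the node reaches the next power. The common
  -- rest of the code is treated with the exponent `t'` that is correct for this node.
  suffices hs : ∀ t', 2 ^ t' ≤ v 41 → v 41 < 2 ^ (t' + 1) → ∀ w : ℕ → ℕ, (∀ x < 40, w x = v x) →
      w 41 = v 41 → w 43 = 2 ^ t' → w 42 + 1 + t' = H → Cmd.wp W (44 ::= V 41 - V 43 ;;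
        setRankC 41 42 ;; placeC 44 42 41 ;; 41 ::= V 41 + 1) (fun s' => ∃ v' h' t',
          s' = s.withHeap v' N h' ∧ (∀ x < 40, v' x = v x) ∧
      v' 41 = v 41 + 1 ∧ h'.IsBinomial N H (v 41 + 1) ∧ v' 43 = 2 ^ t' ∧ v' 42 + 1 + t' = H ∧
      2 ^ t' ≤ v' 41 ∧ v' 41 ≤ 2 ^ (t' + 1)) (s.withHeap w N h) by
    rw [nodeC, wp_seq, wp_cond]
    refine ⟨fun hc => ?_, fun hc => ?_⟩
    · simp [h43] at hc
      have ht : t + 1 < H := by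
        have : 2 ^ (t + 1) < 2 ^ H := by rw [pow_succ]; omega
        exact (Nat.pow_lt_pow_iff_right (by norm_num)).1 this
      rw [wp_seq, wp_setN (by simp [h43]; omega), wp_setN (by simp; omega)]
      refine hs (t + 1) (by rw [pow_succ]; omega) (by rw [pow_succ, pow_succ]; omega) _ ?_ ?_ ?_ ?_
      · intro x hx; simp (disch := omega) [Function.update_of_ne]
      · simp
      · simp [h43, pow_succ]; ring
      · simp; omega
    · simp [h43] at hc
      exact hs t h1 (by rw [pow_succ] at h2 ⊢; omega) _ (fun x hx => rfl) rfl h43 h42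
  intro t' h3 h4 w hwv hw1 hw3 hw2
  have e5 := (hv.congr hwv).stride
  have hp0 : 0 < 2 ^ t' := by positivity
  rw [wp_seq, wp_setN (by simp; omega)]
  simp only [NExp.val_sub, NExp.val_var, nvar_withHeap, hw1, hw3]
  simp (disch := first | omega | (simp; done) | (simp <;> omega) | fail) only [wp_seq, wp_setN,
    wp_setRankC hWd, wp_placeC hWd]
  refine ⟨_, _, t', rfl, fun x hx => ?_, by simp [hw1], ?_, by simp [hw3], by simp [hw2],
    by simp; omega, by simp [hw1]; omega⟩
  · simpa (disch := omega) [Function.update_of_ne] using hwv x hx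
  have hlog : Nat.log 2 (v 41) = t' := by
    rw [Nat.log_eq_iff (by omega)]; exact ⟨h3, h4⟩
  have hx0 : v 41 ≠ 0 := by omega
  simp [hw1]
  obtain ⟨b1, b2, b3, b4, b5, b6, b7, b8, b9⟩ := hb
  rw [pow_succ] at h4
  constructor
  · simp [place, setRank, hx0.symm, b1]
  · simp [place, setRank, hx0.symm, b2]
  · simp [place, setRank, hx0.symm, b3]
  · simp only [place, setRank]
    rw [if_neg (by omega), b4]
  · simpa [place, setRank] using b5
  · intro y hy hyx
    by_cases hyv : y = v 41
    · simp [place, setRank, hyv, hlog, hw2]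
    · simp [place, setRank, hyv]; exact b6 y hy (by omega)
  · intro y hy hyx
    by_cases hyv : y = v 41
    · simp [place, setRank, hyv, hlog, hw2]
    · simp [place, setRank, hyv]; exact b7 y hy (by omega)
  · intro y hy hyx
    by_cases hyv : y = v 41
    · simp [place, setRank, hyv, hlog]; omega
    · simp [place, setRank, hyv]; exact b8 y hy (by omega)
  · intro y hy hyx
    by_cases hyv : y = v 41
    · simp [place, setRank, hyv]
    · have c1 := b7 y hy (by omega)
      have c2 := b8 y hy (by omega)
      simp only [place, setRank, Function.update_of_ne hyv]
      rw [if_neg, b9 y hy (by omega)]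
      -- Equal positions mean equal leading exponents; with equal parents the nodes would coincide.
      rintro ⟨d1, d2⟩
      have : Nat.log 2 y = t' := by omega
      rw [this] at c2
      omega

theorem runs_buildC (hn : 1 ≤ s.nvar 1) (hW : (2 * s.nvar 1 + 1) * (2 * s.nvar 1 + 2) ≤ W)
    (hK : ∀ x, s.key x = ⊤) :
    Runs W buildC s fun t s' => ∃ v h N H, s' = s.withHeap v N h ∧
      (∀ x < 40, x ≠ 3 → x ≠ 4 → x ≠ 5 → v x = s.nvar x) ∧ Env v N H W ∧ h.Whole N H s.key ∧
      s.nvar 1 ≤ N ∧ N = 2 ^ H ∧ N ≤ 2 * s.nvar 1 ∧ t ≤ 1000 * s.nvar 1 := by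
  refine Runs.seq ((runs_dimC hn (by nlinarith)).mono ?_)
  rintro t1 s' ⟨v1, H, rfl, h1, h2, h3, h4, h5, h6, h7⟩
  obtain ⟨N, hN⟩ : ∃ N, N = 2 ^ H := ⟨_, rfl⟩
  rw [← hN] at h3 h4 h5 h6
  have hHN : H < N := by rw [hN]; exact Nat.lt_two_pow_self
  have hv1 : Env v1 N H W := ⟨h2, h3, h4, (Nat.mul_le_mul (by omega) (by omega)).trans hW⟩
  have hWd := hv1.word
  have hw : N + H + 2 ≤ W := le_word hWd le_rfl
  have he : ({ s with nvar := v1 } : Store) =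
      s.withHeap v1 N (Store.heap { s with nvar := v1 } N) :=
    (Store.withHeap_heap { s with nvar := v1 } N).symm
  rw [he]
  refine Runs.seq ((runs_clearPoolC hv1).mono ?_)
  rintro t2 s' ⟨v2, g, rfl, h8, h9, h10⟩
  have hv2 := hv1.congr h8
  have e3 := hv2.height
  have e4 := hv2.nodes
  have e5 := hv2.stride
  refine Runs.wp_seq ?_
  rw [wp_setN_zero]
  refine Runs.wp_seq ?_
  rw [wp_setRankC hWd (by simp) (by simp; omega)]
  refine Runs.wp_seq ?_
  rw [wp_placeC hWd (by simpa) (by simp; omega) (by simp; omega) (by simp)]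
  refine Runs.wp_seq ?_
  rw [wp_setN (by simp; omega)]
  refine Runs.wp_seq ?_
  rw [wp_setN (by simp; omega)]
  refine Runs.wp_seq ?_
  rw [wp_setN (by simp; omega)]
  simp only [NExp.val_sub, NExp.val_var, NExp.val_one, nvar_withHeap, Function.update_self, ne_eq,
    not_false_eq_true, Function.update_of_ne, e3, e4, Nat.reduceEqDiff]
  let J : (ℕ → ℕ) × Heap → Store → Prop := fun f s' => s' = s.withHeap f.1 N f.2 ∧
    (∀ x < 40, f.1 x = v2 x) ∧ 1 ≤ f.1 41 ∧ f.1 41 ≤ N ∧ f.2.IsBinomial N H (f.1 41) ∧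
    (f.1 41 < N → ∃ t, f.1 43 = 2 ^ t ∧ f.1 42 + 1 + t = H ∧ 2 ^ t ≤ f.1 41 ∧
      f.1 41 ≤ 2 ^ (t + 1))
  have hc1 : nodeC.cost ≤ 60 := by decide
  have hc3 : (BExp.nlt (V 41) (V 4)).time = 4 := rfl
  refine (Runs.loop J (fun f => 65 * (N - f.1 41)) ?_ (Function.update (Function.update
    (Function.update (Function.update v2 40 0) 41 1) 43 1) 42 (H - 1),
    (g.setRank 0 H).place N H 0) ⟨rfl, fun x hx => ?_, ?_, ?_, ?_, ?_⟩).mono ?_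
  · rintro ⟨w, f⟩ s' ⟨g1, g2, g3, g4, g5, g6⟩ hb
    simp only at g1 g2 g3 g4 g5 g6
    subst g1
    have f4 := (hv2.congr g2).nodes
    simp [f4] at hb
    obtain ⟨t, g7, g8, g9, g10⟩ := g6 hb
    refine (runs_of_wp (wp_nodeC (hv2.congr g2) g5 hb hN g7 g8 g9 g10)).mono ?_
    rintro t s' ⟨ht, w', f', t', rfl, k1, k2, k3, k4, k5, k6, k7⟩
    refine ⟨(w', f'), ⟨rfl, fun x hx => (k1 x hx).trans (g2 x hx), ?_, ?_, ?_, ?_⟩, ?_⟩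
    · simp only; omega
    · simp only; omega
    · simpa only [k2] using k3
    · exact fun _ => ⟨t', k4, k5, k6, k7⟩
    · simp only; omega
  · simp (disch := omega) [Function.update_of_ne]
  · simp
  · simp; omega
  · simp
    constructor
    · simp [place, setRank]
    · simp [place, setRank]
    · simp [place, setRank]
    · simp [place, setRank]
    · exact h9
    all_goals intro y _ _; omega
  · intro hlt
    simp at hlt
    have : H ≠ 0 := by rintro rfl; simp at hN; omega
    exact ⟨0, by simp, by simp; omega, by simp, by simp⟩
  · rintro t s' ⟨⟨w, f⟩, ⟨g1, g2, g3, g4, g5, g6⟩, hb, ht⟩ t3 ht3 t4 ht4 t5 ht5 t6 ht6 t7 ht7 t8 ht8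
    simp only at g1 g2 g3 g4 g5 g6 ht
    subst g1
    have f4 := (hv2.congr g2).nodes
    simp [f4] at hb
    rw [show w 41 = N by omega] at g5
    refine ⟨w, f, N, H, rfl, fun x hx k3 k4 k5 => ?_, hv2.congr g2, g5.whole hN hK, h5, hN, h6, ?_⟩
    · rw [g2 x hx, h8 x hx, h1 x k3 k4 k5]
    · have c1 : (42 ::= V 3 - 1).cost = 4 := rfl
      have c2 : (43 ::= 1).cost = 2 := rfl
      have c3 : (41 ::= 1).cost = 2 := rfl
      have c4 : (placeC 4 3 40).cost ≤ 30 := by decide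
      have c5 : (setRankC 40 3).cost = 3 := rfl
      have c6 : (40 ::= 0).cost = 2 := rfl
      simp at ht
      omega

end Heap
end AdTypes

/-! ### The heap operations as black boxes on the memory -/

namespace AdTypes

/-- The memory states agree outside the heap and the temporary variables. -/
structure Store.Near (s s' : Store) : Prop where
  nvar : ∀ x < 40, s'.nvar x = s.nvar x
  narr : ∀ a < 8, s'.narr a = s.narr a
  rvar : ∀ x < 2, s'.rvar x = s.rvar x
  rarr : s'.rarr = s.rarr

/-- The memory states agree on the heap and its parameters. -/
structure Store.SameHeap (s s' : Store) : Prop where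
  nvar : ∀ x, x = 3 ∨ x = 4 ∨ x = 5 → s'.nvar x = s.nvar x
  narr : ∀ a, 8 ≤ a → s'.narr a = s.narr a

/-- The memory holds a heap with keys `K` and `m` trees in the pool. -/
def Store.HasHeap (s : Store) (K : ℕ → WithTop ℝ) (N H W m : ℕ) : Prop :=
  Heap.Env s.nvar N H W ∧ ∃ h, s.withHeap s.nvar N h = s ∧ h.Whole N H K ∧ h.size N H = m

/-- The memory holds a heap, and `55` is a node with the smallest key. -/
def Store.HasMin (s : Store) (N H W : ℕ) : Prop :=
  Heap.Env s.nvar N H W ∧ ∃ h, s.withHeap s.nvar N h = s ∧ Heap.Found s s.nvar N H s.nvar h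

section

variable {s s' s'' : Store} {K : ℕ → WithTop ℝ} {N H W m : ℕ}

theorem Store.near_withHeap {v : ℕ → ℕ} {h : Heap} (hv : ∀ x < 40, v x = s.nvar x) :
    s.Near (s.withHeap v N h) :=
  ⟨hv, fun _ ha => narr_withHeap_of_lt s v h ha, fun _ _ => rfl, rfl⟩

theorem Heap.Env.congr_params {v v' : ℕ → ℕ} (h : Heap.Env v N H W) (h3 : v' 3 = v 3)
    (h4 : v' 4 = v 4) (h5 : v' 5 = v 5) : Heap.Env v' N H W :=
  ⟨h3.trans h.height, h4.trans h.nodes, h5.trans h.stride, h.word⟩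

theorem Store.withHeap_withHeap (s : Store) (v : ℕ → ℕ) (N : ℕ) (h : Heap) :
    (s.withHeap v N h).withHeap (s.withHeap v N h).nvar N h = s.withHeap v N h := by
  symm
  refine Heap.withHeap_eq rfl rfl rfl fun a => ?_
  simp only [withHeap]
  split_ifs <;> rfl

theorem Store.withHeap_congr {h : Heap} (h1 : s.withHeap s.nvar N h = s)
    (hn : ∀ a, 8 ≤ a → s'.narr a = s.narr a) : s'.withHeap s'.nvar N h = s' := by
  symm
  refine Heap.withHeap_eq rfl rfl rfl fun a => ?_
  by_cases ha : a < 8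
  · rw [narr_withHeap_of_lt _ _ _ ha]
  · rw [hn a (by omega), ← h1]
    simp only [withHeap]
    split_ifs <;> first | rfl | skip
    have : (s.withHeap s.nvar N h).narr a = s.narr a := by rw [h1]
    rw [hn a (by omega)]

theorem Store.HasHeap.congr (h : s.HasHeap K N H W m) (hs : s.SameHeap s') :
    s'.HasHeap K N H W m := by
  obtain ⟨h1, g, h2, h3⟩ := h
  exact ⟨h1.congr_params (hs.nvar 3 (by simp)) (hs.nvar 4 (by simp)) (hs.nvar 5 (by simp)), g,
    withHeap_congr h2 hs.narr, h3⟩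

theorem Store.HasMin.congr (h : s.HasMin N H W) (hs : s.SameHeap s') (hk : s'.key = s.key)
    (h55 : s'.nvar 55 = s.nvar 55) (h56 : s'.nvar 56 = s.nvar 56) :
    s'.HasMin N H W := by
  obtain ⟨h1, g, h2, h3⟩ := h
  refine ⟨h1.congr_params (hs.nvar 3 (by simp)) (hs.nvar 4 (by simp)) (hs.nvar 5 (by simp)), g,
    withHeap_congr h2 hs.narr, fun x hx => rfl, hk ▸ h3.whole, h3.rank, ?_⟩
  rw [h55, h56]
  exact h3.isTop

theorem Store.HasHeap.env (h : s.HasHeap K N H W m) : Heap.Env s.nvar N H W := h.1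

theorem Store.HasHeap.le (h : s.HasHeap K N H W m) : m ≤ H := by
  obtain ⟨-, g, -, -, rfl⟩ := h
  exact g.size_le N H

theorem Store.HasHeap.runs_decreaseC (h : s.HasHeap K N H W m) (hx : s.nvar 40 < N)
    (hlow : s.key (s.nvar 40) ≤ K (s.nvar 40)) (hne : ∀ y, y ≠ s.nvar 40 → s.key y = K y) :
    Runs W Heap.decreaseC s fun t s' => s.Near s' ∧ ∃ m', s'.HasHeap s'.key N H W m' ∧
      t + Heap.unit * m' ≤ Heap.unit * m + (4 * Heap.unit + 100) := by
  obtain ⟨h1, g, h2, h3, rfl⟩ := h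
  have := Heap.runs_decreaseC (s := s) h1 h3 hx hlow hne
  rw [h2] at this
  refine this.mono ?_
  rintro t s' ⟨v', h', rfl, h5, h6, h7⟩
  exact ⟨near_withHeap h5, _, ⟨h1.congr h5, h', withHeap_withHeap _ _ _ _, h6, rfl⟩, h7⟩

theorem Store.HasHeap.runs_findC (h : s.HasHeap s.key N H W m) (hN : 0 < N) :
    Runs W Heap.findC s fun t s' => s.Near s' ∧ s'.HasMin N H W ∧ s'.nvar 55 < N ∧
      (∀ x < N, s'.key (s'.nvar 55) ≤ s'.key x) ∧ t ≤ 200 * (H + 1) := by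
  obtain ⟨h1, g, h2, h3, rfl⟩ := h
  have := Heap.runs_findC (s := s) h1 hN h3
  rw [h2] at this
  refine this.mono ?_
  rintro t s' ⟨v', h', rfl, h5, h6, h7⟩
  exact ⟨near_withHeap h5.frame, ⟨h1.congr h5.frame, h', withHeap_withHeap _ _ _ _,
    ⟨fun x hx => rfl, h5.whole, h5.rank, h5.isTop⟩⟩, h5.lt, h6, h7⟩

theorem Store.HasMin.runs_extractC (h : s.HasMin N H W) :
    Runs W Heap.extractC s fun t s' => (s.dequeue (s.nvar 55)).Near s' ∧
      (∃ m', s'.HasHeap s'.key N H W m') ∧ t ≤ 800 * (H + 1) := by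
  obtain ⟨h1, g, h2, h3⟩ := h
  have := Heap.runs_extractC (s := s) h1 h3
  rw [h2] at this
  refine this.mono ?_
  rintro t s' ⟨v', h', rfl, h5, h6, h7⟩
  exact ⟨near_withHeap h5, ⟨_, h1.congr h5, h', withHeap_withHeap _ _ _ _, h6, rfl⟩, h7⟩

theorem runs_buildC (hn : 1 ≤ s.nvar 1) (hW : (2 * s.nvar 1 + 1) * (2 * s.nvar 1 + 2) ≤ W)
    (hK : ∀ x, s.key x = ⊤) :
    Runs W Heap.buildC s fun t s' => (∀ x < 40, x ≠ 3 → x ≠ 4 → x ≠ 5 → s'.nvar x = s.nvar x) ∧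
      (∀ a < 8, s'.narr a = s.narr a) ∧ s'.rvar = s.rvar ∧ s'.rarr = s.rarr ∧
      ∃ N H m, s'.HasHeap s'.key N H W m ∧ s.nvar 1 ≤ N ∧ N = 2 ^ H ∧ N ≤ 2 * s.nvar 1 ∧
        t ≤ 1000 * s.nvar 1 := by
  refine (Heap.runs_buildC hn hW hK).mono ?_
  rintro t s' ⟨v, h, N, H, rfl, h1, h2, h3, h4, h5, h6, h7⟩
  exact ⟨h1, fun a ha => narr_withHeap_of_lt s v h ha, rfl, rfl, N, H, _, ⟨h2, h, Store.withHeap_withHeap _ _ _ _, h3, rfl⟩,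
    h4, h5, h6, h7⟩

/-- In a heap all of whose keys are infinite, the keys may be changed to infinite keys. -/
theorem Store.HasHeap.rekey {K' : ℕ → WithTop ℝ} (h : s.HasHeap K N H W m)
    (hK : ∀ x < N, K' x = ⊤) : s.HasHeap K' N H W m := by
  obtain ⟨h1, g, h2, h3, h4⟩ := h
  exact ⟨h1, g, h2, h3.rekey fun y hy _ _ _ => by rw [hK y hy]; exact le_top, h4⟩

end
end AdTypes

/-! ### Matchings and states of the algorithm in memory -/

namespace AdTypes

variable {k n : ℕ}

section Sorted

variable {M : Finset (Edge k n)} {b : ℕ} {t : ℕ → ℕ}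

theorem typeCount_le (t : ℕ → ℕ) (b θ x : ℕ) : typeCount t b θ x ≤ x := Nat.count_le _

theorem Sorted.matched_iff (hs : Sorted M) (hf : Fills M b) (ht : HasTypes M t) (θ : Fin k)
    (i : Fin n) : Matched M (θ, i) ↔ i.val < typeCount t b θ n := by
  rw [hs.lt_typeCount_iff hf ht le_rfl]
  exact ⟨fun ⟨l, hl⟩ => ⟨l, l.isLt, hl⟩, fun ⟨l, _, hl⟩ => ⟨l, hl⟩⟩

theorem Sorted.typeCount_eq (hs : Sorted M) (hf : Fills M b) (ht : HasTypes M t) {θ : Fin k}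
    {i l : Fin n} (h : ((θ, i), l) ∈ M) : typeCount t b θ l = i.val := by
  have h1 : ¬ i.val < typeCount t b θ l := by
    rw [hs.lt_typeCount_iff hf ht l.isLt.le]
    rintro ⟨l', h2, h3⟩
    rw [hf.matching.slot_eq h3 h] at h2
    omega
  have h2 : i.val < typeCount t b θ (l + 1) :=
    (hs.lt_typeCount_iff hf ht l.isLt θ i).2 ⟨l, Nat.lt_succ_self _, h⟩
  rw [typeCount_succ] at h2
  split_ifs at h2 <;> omega

/-- This makes a scan fast: the first free ad, the last ad before `j` and the first ad after `j` are
read off from three counts per type. -/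
theorem Sorted.mem_scanSet_iff (hs : Sorted M) (hf : Fills M b) (ht : HasTypes M t) (θ : Fin k)
    (i j : Fin n) : (θ, i) ∈ scanSet M j ↔ i.val = typeCount t b θ n ∨
      i.val + 1 = typeCount t b θ j ∨
      (i.val = typeCount t b θ (j + 1) ∧ i.val < typeCount t b θ n) := by
  have hbefore : ∀ i : Fin n, (∃ l < j, ((θ, i), l) ∈ M) ↔ i.val < typeCount t b θ j := fun i => by
    rw [hs.lt_typeCount_iff hf ht j.isLt.le]; rfl
  have hafter : ∀ i : Fin n, (∃ l > j, ((θ, i), l) ∈ M) ↔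
      typeCount t b θ (j + 1) ≤ i.val ∧ i.val < typeCount t b θ n := fun i => by
    rw [← hs.matched_iff hf ht, ← not_lt, hs.lt_typeCount_iff hf ht j.isLt]
    constructor
    · rintro ⟨l, hl, h1⟩
      refine ⟨?_, l, h1⟩
      rintro ⟨l', hl', h2⟩
      rw [hf.matching.slot_eq h2 h1] at hl'
      have : j.val < l.val := hl
      omega
    · rintro ⟨h1, l, h2⟩
      refine ⟨l, ?_, h2⟩
      by_contra h3
      exact h1 ⟨l, by have : ¬ j.val < l.val := h3; omega, h2⟩
  have hc1 := typeCount_le t b θ j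
  have hj := j.isLt
  have hi := i.isLt
  rw [mem_scanSet, hbefore, hafter]
  simp only [hbefore, hafter, hs.matched_iff hf ht]
  refine or_congr ?_ (or_congr ?_ ?_)
  · constructor
    · rintro ⟨h1, h2⟩
      by_contra h3
      have h4 := h2 ⟨typeCount t b θ n, by omega⟩ (Fin.lt_def.2 (by simp only; omega))
      simp at h4
    · rintro h1
      exact ⟨by omega, fun i' hi' => by have := Fin.lt_def.1 hi'; omega⟩
  · constructor
    · rintro ⟨h1, h2⟩
      by_contra h3
      have h4 := h2 ⟨i + 1, by omega⟩ (Fin.lt_def.2 (by simp))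
      simp at h4; omega
    · rintro h1
      exact ⟨by omega, fun i' hi' => by have := Fin.lt_def.1 hi'; omega⟩
  · constructor
    · rintro ⟨⟨h1, h2⟩, h3⟩
      refine ⟨?_, h2⟩
      by_contra h4
      exact h3 ⟨typeCount t b θ (j + 1), by omega⟩ (Fin.lt_def.2 (by simp only; omega))
        ⟨le_rfl, by simp only; omega⟩
    · rintro ⟨h1, h2⟩
      exact ⟨⟨by omega, h2⟩, fun i' hi' => by have := Fin.lt_def.1 hi'; omega⟩

end Sorted

/-- The data that do not change during the phase of the slot `r`: the variables `0`, `1`, `2` hold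
`k`, `n`, `r`, the real arrays `0` and `1` hold the instance. For the matching `M`, the natural
number array `1` holds the types of the matched ads, the array `2` counts the slots of every type
before a given slot, the array `3` holds the slots of the ads, the array `4` the number of matched
ads of every type. -/
structure Layout (I : Instance k n) (M : Finset (Edge k n)) (r : Fin n) (s : Store) : Prop where
  types : s.nvar 0 = k
  slots : s.nvar 1 = n
  root : s.nvar 2 = r.val
  value : ∀ (θ : Fin k) (i : Fin n), s.rarr 0 (θ.val * n + i.val) = I.v θ i
  discount : ∀ (θ : Fin k) (j : Fin n), s.rarr 1 (θ.val * n + j.val) = I.α θ j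
  hasTypes : HasTypes M (s.narr 1)
  -- The value `k` is not a type, so the unmatched root slot is never counted.
  root_type : s.narr 1 r.val = k
  cnt : ∀ (θ : Fin k) (j : Fin n), r ≤ j →
    s.narr 2 (θ.val * n + j.val) = typeCount (s.narr 1) (r.val + 1) θ j
  slotOf : ∀ (θ : Fin k) (i l : Fin n), ((θ, i), l) ∈ M → s.narr 3 (θ.val * n + i.val) = l.val
  tot : ∀ θ : Fin k, s.narr 4 θ.val = typeCount (s.narr 1) (r.val + 1) θ n

/-- The memory describes the state `σ` in the phase of the slot `r`. The real variable `0` holds the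
total `D` of the dual updates of the phase; the price of a slot of the tree is the price in the real
array `2`, reduced by the difference of `D` and its value in the array `4`. The array `3` holds the
sum of the slack and `D` for the queue entry of the ad in a slot. The real variable `1` holds the
same for the best free ad, if there is one according to the variable `15`, and the variables `13`
and `14` hold the type of this ad and the slot of its entry. -/
structure Sim (I : Instance k n) (σ : HState k n) (r : Fin n) (s : Store) : Prop where
  price_tree : ∀ j ∈ treeSlots r σ.B, σ.p j = s.rarr 2 j.val - (s.rvar 0 - s.rarr 4 j.val)
  price : ∀ j, j ∉ treeSlots r σ.B → σ.p j = s.rarr 2 j.val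
  visited : ∀ j : Fin n, s.narr 5 j.val = 1 ↔ j ∈ treeSlots r σ.B
  parent : ∀ a j, (a, j) ∈ σ.M → j ∈ treeSlots r σ.B →
    ∃ l : Fin n, s.narr 6 j.val = l.val ∧ (a, l) ∈ σ.B ∧ (a, l) ∉ σ.M
  queued : ∀ a j l, (a, j) ∈ σ.M → σ.P a = some l →
    s.narr 7 j.val = 1 ∧ s.narr 6 j.val = l.val ∧
      s.rarr 3 j.val = I.slack σ.u σ.p a l + s.rvar 0
  unqueued : ∀ x : ℕ, s.narr 7 x = 1 → ∃ a j l, x = j.val ∧ (a, j) ∈ σ.M ∧ σ.P a = some l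
  -- The first free ad that becomes tight ends the phase. Hence it suffices that no free entry beats
  -- the stored one.
  free : ∀ a l, ¬ Matched σ.M a → σ.P a = some l →
    s.nvar 15 = 1 ∧ s.rvar 1 ≤ I.slack σ.u σ.p a l + s.rvar 0
  best : s.nvar 15 = 1 → ∃ a l, ¬ Matched σ.M a ∧ σ.P a = some l ∧ s.nvar 13 = a.1.val ∧
    s.nvar 14 = l.val ∧ s.rvar 1 = I.slack σ.u σ.p a l + s.rvar 0

/-- The memory states agree on everything that a scan does not change. -/
structure Store.Kept (s s' : Store) : Prop where
  nvar : ∀ x, x < 6 ∨ x = 7 ∨ 16 ≤ x ∧ x < 40 → s'.nvar x = s.nvar x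
  narr : ∀ a < 6, s'.narr a = s.narr a
  rvar : s'.rvar 0 = s.rvar 0
  rarr : ∀ a < 5, a ≠ 3 → s'.rarr a = s.rarr a

section

variable {I : Instance k n} {M : Finset (Edge k n)} {σ : HState k n} {r : Fin n} {s s' s'' : Store}
  {N H W m : ℕ}

theorem Store.Kept.refl : s.Kept s := ⟨fun _ _ => rfl, fun _ _ => rfl, rfl, fun _ _ _ => rfl⟩

theorem Store.Kept.trans (h : s.Kept s') (h' : s'.Kept s'') : s.Kept s'' :=
  ⟨fun x hx => (h'.nvar x hx).trans (h.nvar x hx), fun a ha => (h'.narr a ha).trans (h.narr a ha),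
    h'.rvar.trans h.rvar, fun a ha h3 => (h'.rarr a ha h3).trans (h.rarr a ha h3)⟩

theorem Store.Near.kept (h : s.Near s') : s.Kept s' :=
  ⟨fun x hx => h.nvar x (by omega), fun a ha => h.narr a (by omega), h.rvar 0 (by omega),
    fun a _ _ => by rw [h.rarr]⟩

theorem Layout.congr (h : Layout I M r s) (hs : s.Kept s') : Layout I M r s' := by
  obtain ⟨h1, h2, h3, h4, h5, h6, h7, h8, h9, h10⟩ := h
  constructor
  · rw [hs.nvar 0 (by simp), h1]
  · rw [hs.nvar 1 (by simp), h2]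
  · rw [hs.nvar 2 (by simp), h3]
  · rwa [hs.rarr 0 (by simp) (by simp)]
  · rwa [hs.rarr 1 (by simp) (by simp)]
  · rwa [hs.narr 1 (by simp)]
  · rwa [hs.narr 1 (by simp)]
  · rwa [hs.narr 1 (by simp), hs.narr 2 (by simp)]
  · rwa [hs.narr 3 (by simp)]
  · rwa [hs.narr 1 (by simp), hs.narr 4 (by simp)]

theorem Sim.congr (h : Sim I σ r s) (hs : s.Near s') : Sim I σ r s' := by
  obtain ⟨h1, h2, h3, h4, h5, h6, h7, h8⟩ := h
  constructor
  · rwa [hs.rarr, hs.rvar 0 (by simp)]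
  · rwa [hs.rarr]
  · rwa [hs.narr 5 (by simp)]
  · rwa [hs.narr 6 (by simp)]
  · rwa [hs.narr 6 (by simp), hs.narr 7 (by simp), hs.rarr, hs.rvar 0 (by simp)]
  · rwa [hs.narr 7 (by simp)]
  · rwa [hs.nvar 15 (by simp), hs.rvar 0 (by simp), hs.rvar 1 (by simp)]
  · rwa [hs.nvar 13 (by simp), hs.nvar 14 (by simp), hs.nvar 15 (by simp), hs.rvar 0 (by simp), hs.rvar 1 (by simp)]

end
end AdTypes

/-! ### Offering the edge of a matched ad to the queue -/

namespace AdTypes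

variable {k n : ℕ} {I : Instance k n} {M : Finset (Edge k n)} {σ : HState k n} {r : Fin n}
  {s s' s'' : Store} {N H W m : ℕ}

/-- Offer the edge between the ad with index `11`, of type `6` and matched to the slot `10`, and the
slot `7` to the queue. -/
def relaxC : Cmd :=
  .cond (.neq (.cell 5 (V 10)) 1) .skip
    (.setR 2 (.cell 0 (V 11) * .cell 1 (V 6 * V 1 + V 10) - .cell 0 (V 11) *
      .cell 1 (V 6 * V 1 + V 7) + .cell 2 (V 7) + .var 0 - .cell 2 (V 10)) ;;
    .cond (.conj (.neq (.cell 7 (V 10)) 1) (.rle (.cell 3 (V 10)) (.var 2))) .skip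
      (.putR 3 (V 10) (.var 2) ;; .putN 6 (V 10) (V 7) ;; .putN 7 (V 10) 1 ;; 40 ::= V 10 ;;
        Heap.decreaseC))

open Classical in
/-- The queue after the edge between `a` and `j` has been offered. -/
noncomputable def Instance.offer (I : Instance k n) (σ : HState k n) (j : Fin n) (a : Ad k n) :
    Option (Fin n) :=
  if a ∉ treeAds σ.B ∧ ∀ l, σ.P a = some l → I.slack σ.u σ.p a j < I.slack σ.u σ.p a l then some j
  else σ.P a

open Classical in
/-- The state after the edge between `a` and `j` has been offered to the queue. -/
noncomputable def Instance.offered (I : Instance k n) (σ : HState k n) (j : Fin n) (a : Ad k n) :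
    HState k n :=
  { σ with P := Function.update σ.P a (I.offer σ j a) }

theorem Instance.offered_of_offer_eq {j : Fin n} {a : Ad k n} (h : I.offer σ j a = σ.P a) :
    I.offered σ j a = σ := by
  cases σ; simp only [offered, h, Function.update_eq_self]

/-- What a part of a scan does to the memory. -/
structure ScanPost (I : Instance k n) (σ : HState k n) (r : Fin n)
    (N H W : ℕ) (s : Store) (c m : ℕ) (t : ℕ) (s' : Store) : Prop where
  kept : s.Kept s'
  sim : Sim I σ r s'
  heap : ∃ m', s'.HasHeap s'.key N H W m' ∧ t + Heap.unit * m' ≤ Heap.unit * m + c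

/-- The second memory state results from the first by storing the slot `j` and the key `κ` for the
ad in the slot `l`. -/
structure Store.Enqueued (s s' : Store) (l j : ℕ) (κ : ℝ) : Prop where
  nvar : ∀ x < 40, s'.nvar x = s.nvar x
  node : s'.nvar 40 = l
  narr : ∀ a, a ≠ 6 → a ≠ 7 → s'.narr a = s.narr a
  from_eq : s'.narr 6 = Function.update (s.narr 6) l j
  inq_eq : s'.narr 7 = Function.update (s.narr 7) l 1
  rvar : ∀ x < 2, s'.rvar x = s.rvar x
  rarr : ∀ a, a ≠ 3 → s'.rarr a = s.rarr a
  key_eq : s'.rarr 3 = Function.update (s.rarr 3) l κ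

theorem Sim.enqueued (hS : Sim I σ r s) (hM : IsMatching σ.M) {a : Ad k n} {j l : Fin n}
    (hal : (a, l) ∈ σ.M) (hl : l ∉ treeSlots r σ.B)
    (hs : s.Enqueued s' l j (I.slack σ.u σ.p a j + s.rvar 0)) :
    Sim I { σ with P := Function.update σ.P a (some j) } r s' := by
  have hne : ∀ {b l'}, ¬ Matched σ.M b → Function.update σ.P a (some j) b = some l' →
      σ.P b = some l' := by
    intro b l' hb h
    rwa [Function.update_of_ne] at h
    rintro rfl
    exact hb ⟨l, hal⟩
  constructor
  · rw [hs.rarr 2 (by simp), hs.rarr 4 (by simp), hs.rvar 0 (by simp)]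
    exact hS.price_tree
  · rw [hs.rarr 2 (by simp)]
    exact hS.price
  · rw [hs.narr 5 (by simp) (by simp)]
    exact hS.visited
  · intro b j' hb hj'
    rw [hs.from_eq, Function.update_of_ne]
    · exact hS.parent b j' hb hj'
    · intro h
      exact hl (Fin.ext h ▸ hj')
  · intro b j' l' hb hl'
    by_cases hba : b = a
    · subst hba
      obtain rfl := hM.slot_eq hal hb
      simp only [Function.update_self, Option.some.injEq] at hl'
      subst hl'
      simp only [hs.inq_eq, hs.from_eq, hs.key_eq, hs.rvar 0 (by simp), Function.update_self,
        true_and]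
    · have hjl : j'.val ≠ l.val := fun h => hba (hM.ad_eq hb (Fin.ext h ▸ hal))
      simp only [Function.update_of_ne hba] at hl'
      rw [hs.inq_eq, hs.from_eq, hs.key_eq, hs.rvar 0 (by simp), Function.update_of_ne hjl,
        Function.update_of_ne hjl, Function.update_of_ne hjl]
      exact hS.queued b j' l' hb hl'
  · intro x hx
    by_cases hxl : x = l.val
    · exact ⟨a, l, j, hxl, hal, by simp⟩
    · rw [hs.inq_eq, Function.update_of_ne hxl] at hx
      obtain ⟨b, j', l', h1, h2, h3⟩ := hS.unqueued x hx
      refine ⟨b, j', l', h1, h2, ?_⟩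
      simp only
      rwa [Function.update_of_ne]
      rintro rfl
      exact hxl (h1.trans (congrArg Fin.val (hM.slot_eq h2 hal)))
  · intro b l' hb hl'
    rw [hs.nvar 15 (by simp), hs.rvar 0 (by simp), hs.rvar 1 (by simp)]
    exact hS.free b l' hb (hne hb hl')
  · rw [hs.nvar 15 (by simp), hs.nvar 13 (by simp), hs.nvar 14 (by simp), hs.rvar 0 (by simp),
      hs.rvar 1 (by simp)]
    intro h
    obtain ⟨b, l', h1, h2, h3⟩ := hS.best h
    refine ⟨b, l', h1, ?_, h3⟩
    simp only
    rwa [Function.update_of_ne]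
    rintro rfl
    exact h1 ⟨l, hal⟩

theorem Store.Enqueued.key_of_ne {l j : ℕ} {κ : ℝ} (hs : s.Enqueued s' l j κ) {y : ℕ}
    (hy : y ≠ l) : s'.key y = s.key y := by
  simp only [key, hs.inq_eq, hs.key_eq, Function.update_of_ne hy]

theorem Store.Enqueued.key_self {l j : ℕ} {κ : ℝ} (hs : s.Enqueued s' l j κ) :
    s'.key l = κ := by
  simp only [key, hs.inq_eq, hs.key_eq, Function.update_self, if_true]

def relaxCost : ℕ := 4 * Heap.unit + 200

/-- Duals of ads are not stored: the dual of a matched ad follows from its tight edge to the slot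
`l`, whose price is stored because `l` is outside the tree. The price of `j` is its stored price
too, since `j` has entered the tree at the current value of `D`. The key is the slack plus `D`,
which later dual updates leave unchanged. -/
theorem runs_relaxC (hL : Layout I σ.M r s) (hS : Sim I σ r s) (hH : s.HasHeap s.key N H W m)
    (hn : n ≤ N) (hM : IsMatching σ.M) {θ : Fin k} {i j l : Fin n} (h6 : s.nvar 6 = θ.val)
    (h7 : s.nvar 7 = j.val) (h10 : s.nvar 10 = l.val) (h11 : s.nvar 11 = θ.val * n + i.val)
    (hal : ((θ, i), l) ∈ σ.M) (ht : I.slack σ.u σ.p (θ, i) l = 0)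
    (hT : (θ, i) ∈ treeAds σ.B ↔ l ∈ treeSlots r σ.B) (hj : j ∈ treeSlots r σ.B)
    (hD : s.rarr 4 j.val = s.rvar 0) :
    Runs W relaxC s fun t s' => ScanPost I (I.offered σ j (θ, i)) r N H W s relaxCost m t s' ∧
      ∀ x < 40, s'.nvar x = s.nvar x := by
  have hskip : ∀ t ≤ 100, I.offer σ j (θ, i) = σ.P (θ, i) → ∀ s' : Store, s.Near s' →
      s'.HasHeap s'.key N H W m →
      ScanPost I (I.offered σ j (θ, i)) r N H W s relaxCost m t s' ∧
      ∀ x < 40, s'.nvar x = s.nvar x := by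
    intro t ht hP s' hs hH'
    rw [Instance.offered_of_offer_eq hP]
    exact ⟨⟨hs.kept, hS.congr hs, m, hH', by unfold relaxCost; omega⟩, hs.nvar⟩
  have hw := Heap.le_word hH.env.word le_rfl
  have hcost : (Cmd.setR 2 (.cell 0 (V 11) * .cell 1 (V 6 * V 1 + V 10) - .cell 0 (V 11) *
      .cell 1 (V 6 * V 1 + V 7) + .cell 2 (V 7) + .var 0 - .cell 2 (V 10))).cost ≤ 40 := by decide
  have htime1 : (BExp.neq (.cell 5 (V 10)) 1).time = 4 := rfl
  have htime2 : (BExp.conj (.neq (.cell 7 (V 10)) 1) (.rle (.cell 3 (V 10)) (.var 2))).time = 9 := rfl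
  have hskipc : Cmd.skip.cost = 1 := rfl
  refine Runs.cond (fun hb => ?_) fun hb => ?_
  · simp only [BExp.holds_neq, NExp.val_cell, NExp.val_var, NExp.val_one, h10, hS.visited] at hb
    refine Runs.of_wp fun t ht => hskip _ (by omega) ?_ s
      ⟨fun _ _ => rfl, fun _ _ => rfl, fun _ _ => rfl, rfl⟩ hH
    simp [Instance.offer, hT.2 hb]
  · simp only [BExp.holds_neq, NExp.val_cell, NExp.val_var, NExp.val_one, h10, hS.visited] at hb
    have hκ : RExp.val s (.cell 0 (V 11) * .cell 1 (V 6 * V 1 + V 10) - .cell 0 (V 11) *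
        .cell 1 (V 6 * V 1 + V 7) + .cell 2 (V 7) + .var 0 - .cell 2 (V 10)) =
        I.slack σ.u σ.p (θ, i) j + s.rvar 0 := by
      simp only [RExp.val_add, RExp.val_sub, RExp.val_mul, RExp.val_cell, RExp.val_var,
        NExp.val_var, NExp.val_add, NExp.val_mul, h6, h7, h10, h11, hL.slots, hL.value, hL.discount]
      have h1 := hS.price_tree j hj
      have h2 := hS.price l hb
      simp only [Instance.slack, Instance.w, hD, h2] at ht h1 ⊢
      rw [h1]
      linarith
    obtain ⟨κ, hκ'⟩ : ∃ κ, κ = I.slack σ.u σ.p (θ, i) j + s.rvar 0 := ⟨_, rfl⟩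
    refine Runs.wp_seq ?_
    simp only [Cmd.wp]
    rw [hκ, ← hκ']
    have hnear : s.Near { s with rvar := Function.update s.rvar 2 κ } :=
      ⟨fun _ _ => rfl, fun _ _ => rfl, fun x hx => Function.update_of_ne (by omega) _ _, rfl⟩
    refine Runs.cond (fun hb2 => ?_) fun hb2 => ?_
    · simp only [BExp.holds_conj, BExp.holds_neq, BExp.holds_rle, NExp.val_cell, NExp.val_var,
        NExp.val_one, RExp.val_cell, RExp.val_var, h10, Function.update_self] at hb2
      obtain ⟨a, j', l', e1, e2, e3⟩ := hS.unqueued _ hb2.1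
      obtain rfl := Fin.ext e1
      obtain rfl := hM.ad_eq e2 hal
      refine Runs.of_wp fun t ht t1 ht1 => hskip _ (by omega) ?_ _ hnear (hH.congr
        ⟨fun _ _ => rfl, fun _ _ => rfl⟩)
      have h3 := (hS.queued _ _ _ e2 e3).2.2
      rw [Instance.offer, if_neg]
      rintro ⟨-, h4⟩
      have := h4 _ e3
      linarith
    · simp only [BExp.holds_conj, BExp.holds_neq, BExp.holds_rle, NExp.val_cell, NExp.val_var,
        NExp.val_one, RExp.val_cell, RExp.val_var, h10, Function.update_self] at hb2
      have hoff : I.offer σ j (θ, i) = some j := by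
        rw [Instance.offer, if_pos]
        refine ⟨fun h => hb (hT.1 h), fun l' hl' => ?_⟩
        obtain ⟨h1, -, h3⟩ := hS.queued _ _ _ hal hl'
        have : ¬ s.rarr 3 l.val ≤ κ := fun h => hb2 ⟨h1, h⟩
        linarith
      refine Runs.wp_seq ⟨?_, Runs.wp_seq ⟨?_, ?_, Runs.wp_seq ⟨?_, ?_, Runs.wp_seq ⟨?_, ?_⟩⟩⟩⟩
      iterate 6 (simp [h10, h7]; omega)
      simp only [NExp.val_var, NExp.val_one, RExp.val_var, Function.update_self, h10, h7]
      generalize hs2 : Store.mk _ _ _ _ = s2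
      have henq : s.Enqueued s2 l j κ := by
        subst hs2
        constructor <;> simp +contextual (disch := omega) [Function.update_of_ne]
      have hsame : s.SameHeap s2 := ⟨fun x hx => henq.nvar x (by omega),
        fun a ha => henq.narr a (by omega) (by omega)⟩
      clear hs2
      have hlow : s2.key l ≤ s.key l := by
        rw [henq.key_self, Store.key]
        split_ifs with h
        · have : ¬ s.rarr 3 l.val ≤ κ := fun h' => hb2 ⟨h, h'⟩
          exact WithTop.coe_le_coe.2 (by linarith)
        · exact le_top
      have hS2 := hS.enqueued hM hal hb (hκ' ▸ henq)
      rw [← hoff] at hS2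
      refine ((hH.congr hsame).runs_decreaseC (by rw [henq.node]; omega)
        (by rw [henq.node]; exact hlow)
        (by rw [henq.node]; exact fun y hy => henq.key_of_ne hy)).mono ?_
      rintro t5 s5 ⟨hs5, m', hm1, hm2⟩ t4 ht4 t3 ht3 t2 ht2 t1 ht1 t0 ht0
      have e1 : ∀ x, (Cmd.putR 3 (V 10) (.var x)).cost = 3 := fun _ => rfl
      have e2 : (Cmd.putN 6 (V 10) (V 7)).cost = 3 := rfl
      have e3 : (Cmd.putN 7 (V 10) 1).cost = 3 := rfl
      have e4 : (40 ::= V 10).cost = 2 := rfl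
      refine ⟨⟨?_, hS2.congr hs5, m', hm1, ?_⟩, fun x hx => (hs5.nvar x hx).trans (henq.nvar x hx)⟩
      · refine Store.Kept.trans ⟨fun x hx => henq.nvar x (by omega),
          fun a ha => henq.narr a (by omega) (by omega), henq.rvar 0 (by simp),
          fun a ha h3 => henq.rarr a h3⟩ hs5.kept
      · rw [e1] at *
        unfold relaxCost
        omega

end AdTypes

/-! ### The scan of a slot: single ads -/

namespace AdTypes

variable {k n : ℕ} {I : Instance k n} {σ : HState k n} {r j : Fin n}
  {s s' : Store} {N H W m : ℕ}

open Classical in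
/-- The state after the edges between the ads of `S` and `j` have been offered to the queue. -/
noncomputable def Instance.scanned (I : Instance k n) (σ : HState k n) (j : Fin n)
    (S : Set (Ad k n)) : HState k n :=
  { σ with P := fun a => if a ∈ S then I.offer σ j a else σ.P a }

theorem Instance.scanned_empty : I.scanned σ j ∅ = σ := by
  cases σ; simp [scanned]

/-- Offers to different ads are independent, and a repeated offer changes nothing because an entry
is replaced only by a strictly better one. So a scan may proceed ad by ad in any order. -/
theorem Instance.offered_scanned (S : Set (Ad k n)) (a : Ad k n) :
    I.offered (I.scanned σ j S) j a = I.scanned σ j (insert a S) := by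
  simp only [offered, scanned, HState.mk.injEq, true_and]
  funext b
  by_cases hb : b = a
  · subst hb
    rw [Function.update_self, if_pos (Set.mem_insert _ _)]
    simp only [offer]
    by_cases hbS : b ∈ S
    · simp only [hbS, if_true]
      by_cases h : b ∉ treeAds σ.B ∧ ∀ l, σ.P b = some l → I.slack σ.u σ.p b j < I.slack σ.u σ.p b l
      · rw [if_pos h]; simp
      · rw [if_neg h]
        exact if_neg h
    · simp only [if_neg hbS]
  · rw [Function.update_of_ne hb]
    have hiff : b ∈ insert a S ↔ b ∈ S := by rw [Set.mem_insert_iff]; simp [hb]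
    by_cases hbS : b ∈ S
    · rw [if_pos hbS, if_pos (hiff.2 hbS)]
    · rw [if_neg hbS, if_neg (mt hiff.1 hbS)]

theorem Instance.scanned_scanSet :
    I.scanned σ j {a | a ∈ scanSet σ.M j} =
      { σ with P := I.updateQueue σ.M σ.B σ.u σ.p σ.P j } := by
  simp only [scanned, HState.mk.injEq, true_and]
  funext a
  simp only [updateQueue, offer, Set.mem_ofPred_eq]
  by_cases h : a ∈ scanSet σ.M j <;> simp [h]

/-- What a scan of the slot `j` relies on. -/
structure Instance.Scannable (I : Instance k n) (σ : HState k n) (r j : Fin n) : Prop where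
  fills : Fills σ.M (r.val + 1)
  sorted : Sorted σ.M
  tight : ∀ a l, (a, l) ∈ σ.M → I.slack σ.u σ.p a l = 0
  mates : ∀ a l, (a, l) ∈ σ.M → (a ∈ treeAds σ.B ↔ l ∈ treeSlots r σ.B)
  free : ∀ a, ¬ Matched σ.M a → a ∉ treeAds σ.B ∧ σ.u a = 0
  slot : j ∈ treeSlots r σ.B
  le : r ≤ j

/-- The memory during the scan of the slot `j`: the ads of `S` have been considered. -/
structure ScanAt (I : Instance k n) (σ : HState k n) (r j : Fin n) (N H W : ℕ) (s : Store)
    (S : Set (Ad k n)) (m : ℕ) (s' : Store) : Prop where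
  layout : Layout I σ.M r s'
  sim : Sim I (I.scanned σ j S) r s'
  heap : s'.HasHeap s'.key N H W m
  slot : s'.nvar 7 = j.val
  time : s'.rarr 4 j.val = s'.rvar 0
  kept : s.Kept s'

theorem ScanAt.mono {S S' : Set (Ad k n)} (h : ScanAt I σ r j N H W s S m s') (hS : S = S') :
    ScanAt I σ r j N H W s S' m s' := hS ▸ h

theorem ScanAt.step {S S' : Set (Ad k n)} {s'' : Store} {m' : ℕ}
    (h : ScanAt I σ r j N H W s S m s') (hk : s'.Kept s'')
    (hS : Sim I (I.scanned σ j S') r s'') (hH : s''.HasHeap s''.key N H W m') :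
    ScanAt I σ r j N H W s S' m' s'' where
  layout := h.layout.congr hk
  sim := hS
  heap := hH
  slot := (hk.nvar 7 (by simp)).trans h.slot
  time := by rw [hk.rarr 4 (by simp) (by simp), hk.rvar]; exact h.time
  kept := h.kept.trans hk

theorem Sim.set_nvar (h : Sim I σ r s) {v : ℕ → ℕ} (h13 : v 13 = s.nvar 13)
    (h14 : v 14 = s.nvar 14) (h15 : v 15 = s.nvar 15) : Sim I σ r { s with nvar := v } := by
  obtain ⟨h1, h2, h3, h4, h5, h6, h7, h8⟩ := h
  exact ⟨h1, h2, h3, h4, h5, h6, by simpa only [h15] using h7, by simpa only [h13, h14, h15] using h8⟩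

theorem ScanAt.set_nvar {S : Set (Ad k n)} (h : ScanAt I σ r j N H W s S m s') {v : ℕ → ℕ}
    (hv : ∀ x < 40, x ≠ 6 → x ≠ 8 → x ≠ 9 → x ≠ 10 → x ≠ 11 → x ≠ 12 → v x = s'.nvar x) :
    ScanAt I σ r j N H W s S m { s' with nvar := v } := by
  have hH : Store.HasHeap { s' with nvar := v } s'.key N H W m :=
    h.heap.congr ⟨fun x hx => hv x (by omega) (by omega) (by omega) (by omega) (by omega) (by omega)
      (by omega), fun _ _ => rfl⟩
  refine h.step ⟨fun x hx => hv x (by omega) (by omega) (by omega) (by omega) (by omega) (by omega)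
    (by omega), fun _ _ => rfl, rfl, fun _ _ _ => rfl⟩ ?_ hH
  exact h.sim.set_nvar (hv 13 (by simp) (by simp) (by simp) (by simp) (by simp) (by simp) (by simp))
    (hv 14 (by simp) (by simp) (by simp) (by simp) (by simp) (by simp) (by simp))
    (hv 15 (by simp) (by simp) (by simp) (by simp) (by simp) (by simp) (by simp))

/-- Offer the ad number `e` of the type `6`, which is matched, to the queue. -/
def relaxAtC (e : NExp) : Cmd := 11 ::= V 6 * V 1 + e ;; 10 ::= .cell 3 (V 11) ;; relaxC

theorem row_lt {k n i : ℕ} {θ : Fin k} (hi : i < n) : θ.val * n + i < k * n := by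
  have : (θ.val + 1) * n ≤ k * n := Nat.mul_le_mul_right _ θ.isLt
  rw [Nat.succ_mul] at this
  omega

theorem runs_relaxAtC {S : Set (Ad k n)} (hσ : I.Scannable σ r j)
    (h : ScanAt I σ r j N H W s S m s') (hn : n ≤ N) (hkn : k * n ≤ W) {e : NExp}
    (he : e.time ≤ 3) {θ : Fin k} {i : Fin n} (h6 : s'.nvar 6 = θ.val)
    (hi : NExp.val s' e = i.val) (hM : Matched σ.M (θ, i)) :
    Runs W (relaxAtC e) s' fun t s'' => (∃ m', ScanAt I σ r j N H W s (insert (θ, i) S) m' s'' ∧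
      t + Heap.unit * m' ≤ Heap.unit * m + (relaxCost + 20)) ∧
      ∀ x < 40, x ≠ 10 → x ≠ 11 → s''.nvar x = s'.nvar x := by
  obtain ⟨l, hl⟩ := hM
  have hw : n ≤ W := le_trans hn (by have := h.heap.env.word; exact Heap.le_word this (by omega))
  have hix := row_lt (θ := θ) i.isLt
  unfold relaxAtC
  refine Runs.wp_seq ⟨?_, Runs.wp_seq ⟨?_, ?_⟩⟩
  · simp only [NExp.val_add, NExp.val_mul, NExp.val_var, h6, hi, h.layout.slots]; omega
  · simp only [NExp.val_cell, NExp.val_var, Function.update_self, NExp.val_add, NExp.val_mul, h6,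
      hi, h.layout.slots, h.layout.slotOf _ _ _ hl]
    omega
  · simp only [NExp.val_cell, NExp.val_var, Function.update_self, NExp.val_add, NExp.val_mul, h6,
      hi, h.layout.slots, h.layout.slotOf _ _ _ hl]
    set v := Function.update (Function.update s'.nvar 11 (θ.val * n + i.val)) 10 l.val with hv
    have hvx : ∀ x, x ≠ 10 → x ≠ 11 → v x = s'.nvar x := by
      intro x h1 h2; rw [hv, Function.update_of_ne h1, Function.update_of_ne h2]
    have h' := h.set_nvar (v := v) fun x _ _ _ _ h1 h2 _ => hvx x h1 h2
    have := runs_relaxC (σ := I.scanned σ j S) (θ := θ) (i := i) (j := j) (l := l) h'.layout h'.sim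
      h'.heap hn hσ.fills.matching ((hvx 6 (by simp) (by simp)).trans h6) h'.slot (by simp [hv])
      (by simp [hv]) hl (hσ.tight _ _ hl) (hσ.mates _ _ hl) hσ.slot h'.time
    refine this.mono ?_
    rintro t s'' ⟨⟨h1, h2, m', h3, h4⟩, h5⟩ t1 ht1 t2 ht2
    have e1 : (10 ::= .cell 3 (V 11)).cost = 3 := rfl
    have e2 : (11 ::= V 6 * V 1 + e).cost = e.time + 5 := by
      change 1 + 1 + 1 + e.time + 1 + 1 = _; omega
    rw [Instance.offered_scanned] at h2
    refine ⟨⟨m', h'.step h1 h2 h3, by omega⟩, fun x hx h6 h7 => (h5 x hx).trans (hvx x h6 h7)⟩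

/-- Offer the first free ad of the type `6` to the queue; its number is in `12`. -/
def freeC : Cmd :=
  11 ::= V 6 * V 1 + V 12 ;;
  .setR 2 (.cell 2 (V 7) + .var 0 - .cell 0 (V 11) * .cell 1 (V 6 * V 1 + V 7)) ;;
  .cond (.conj (.neq (V 15) 1) (.rle (.var 1) (.var 2))) .skip
    (.setR 1 (.var 2) ;; 13 ::= V 6 ;; 14 ::= V 7 ;; 15 ::= 1)

/-- The stored entry remains valid even if it belongs to the same ad, since the queue does not
replace an entry by one of equal or larger slack. -/
theorem Sim.offered_of_best_le (hS : Sim I σ r s) {a : Ad k n} (ha : ¬ Matched σ.M a)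
    (h15 : s.nvar 15 = 1) (hb : s.rvar 1 ≤ I.slack σ.u σ.p a j + s.rvar 0) :
    Sim I (I.offered σ j a) r s := by
  have hne : ∀ b, Matched σ.M b → (I.offered σ j a).P b = σ.P b := by
    intro b hbM
    have : b ≠ a := by rintro rfl; exact ha hbM
    simp [Instance.offered, this]
  have hPa : (I.offered σ j a).P a = I.offer σ j a := by simp [Instance.offered]
  have hPb : ∀ b, b ≠ a → (I.offered σ j a).P b = σ.P b := fun b h => by
    simp [Instance.offered, h]
  obtain ⟨h1, h2, h3, h4, h5, h6, h7, h8⟩ := hS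
  refine ⟨h1, h2, h3, h4, ?_, ?_, ?_, ?_⟩
  · intro b j' l hb' hl
    rw [hne b ⟨j', hb'⟩] at hl
    exact h5 b j' l hb' hl
  · intro x hx
    obtain ⟨b, j', l, e1, e2, e3⟩ := h6 x hx
    exact ⟨b, j', l, e1, e2, (hne b ⟨j', e2⟩).trans e3⟩
  · intro b l hbM hl
    by_cases hba : b = a
    · subst hba
      rw [hPa, Instance.offer] at hl
      split_ifs at hl
      · obtain rfl := Option.some.inj hl
        exact ⟨h15, hb⟩
      · exact h7 b l hbM hl
    · rw [hPb b hba] at hl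
      exact h7 b l hbM hl
  · intro _
    obtain ⟨b, l, e1, e2, e3, e4, e5⟩ := h8 h15
    refine ⟨b, l, e1, ?_, e3, e4, e5⟩
    by_cases hba : b = a
    · subst hba
      rw [hPa, Instance.offer, if_neg]
      · exact e2
      · rintro ⟨-, h⟩
        have := h l e2
        linarith
    · rw [hPb b hba, e2]

/-- An entry that the ad might already have is no better than the stored one and hence worse than
the new one, so the queue does accept the offer. -/
theorem Sim.offered_of_lt_best (hS : Sim I σ r s) {a : Ad k n} (ha : ¬ Matched σ.M a)
    (haB : a ∉ treeAds σ.B)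
    (hb : ¬ (s.nvar 15 = 1 ∧ s.rvar 1 ≤ I.slack σ.u σ.p a j + s.rvar 0))
    (hs' : s'.narr = s.narr ∧ s'.rarr = s.rarr ∧ s'.rvar 0 = s.rvar 0)
    (h13 : s'.nvar 13 = a.1.val) (h14 : s'.nvar 14 = j.val) (h15 : s'.nvar 15 = 1)
    (hr1 : s'.rvar 1 = I.slack σ.u σ.p a j + s.rvar 0) :
    Sim I (I.offered σ j a) r s' := by
  have hne : ∀ b, Matched σ.M b → (I.offered σ j a).P b = σ.P b := by
    intro b hbM
    have : b ≠ a := by rintro rfl; exact ha hbM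
    simp [Instance.offered, this]
  have hPb : ∀ b, b ≠ a → (I.offered σ j a).P b = σ.P b := fun b h => by
    simp [Instance.offered, h]
  have hPa : (I.offered σ j a).P a = some j := by
    simp only [Instance.offered, Function.update_self, Instance.offer]
    rw [if_pos]
    refine ⟨haB, fun l hl => ?_⟩
    obtain ⟨h1, h2⟩ := hS.free a l ha hl
    by_contra h3
    exact hb ⟨h1, by linarith⟩
  obtain ⟨h1, h2, h3, h4, h5, h6, h7, h8⟩ := hS
  obtain ⟨n1, n2, n3⟩ := hs'
  generalize s.rvar 0 = D at *
  refine ⟨by rwa [n2, n3], by rwa [n2], by rwa [n1], by rwa [n1], ?_, ?_, ?_, ?_⟩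
  · intro b j' l hb' hl
    rw [hne b ⟨j', hb'⟩] at hl
    rw [n1, n2, n3]
    exact h5 b j' l hb' hl
  · intro x hx
    rw [n1] at hx
    obtain ⟨b, j', l, e1, e2, e3⟩ := h6 x hx
    exact ⟨b, j', l, e1, e2, (hne b ⟨j', e2⟩).trans e3⟩
  · intro b l hbM hl
    refine ⟨h15, ?_⟩
    rw [n3]
    by_cases hba : b = a
    · subst hba
      rw [hPa] at hl
      obtain rfl := Option.some.inj hl
      exact hr1.le
    · rw [hPb b hba] at hl
      obtain ⟨e1, e2⟩ := h7 b l hbM hl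
      have : ¬ s.rvar 1 ≤ I.slack σ.u σ.p a j + D := fun h => hb ⟨e1, h⟩
      change s'.rvar 1 ≤ I.slack σ.u σ.p b l + D
      linarith
  · intro _
    exact ⟨a, j, ha, hPa, h13, h14, by rw [n3]; exact hr1⟩

theorem runs_freeC {S : Set (Ad k n)} (hσ : I.Scannable σ r j)
    (h : ScanAt I σ r j N H W s S m s') (hn : n ≤ N) (hkn : k * n ≤ W) {θ : Fin k} {i : Fin n}
    (h6 : s'.nvar 6 = θ.val) (hi : s'.nvar 12 = i.val) (hM : ¬ Matched σ.M (θ, i)) :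
    Runs W freeC s' fun t s'' => ScanAt I σ r j N H W s (insert (θ, i) S) m s'' ∧ t ≤ 50 ∧
      s''.nvar 6 = θ.val := by
  have hw : n + 1 ≤ W := by have := h.heap.env.word; exact Heap.le_word this (by omega)
  have hix := row_lt (θ := θ) i.isLt
  refine Runs.of_wp ?_
  have hκ : I.slack σ.u σ.p (θ, i) j = s'.rarr 2 j.val - I.v θ i * I.α θ j := by
    have := h.sim.price_tree j hσ.slot
    simp only [Instance.scanned] at this
    simp only [Instance.slack, Instance.w, (hσ.free _ hM).2, this, h.time]
    ring
  have hcost : ∀ t ≤ freeC.cost, t ≤ 50 := fun t ht => ht.trans (by decide)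
  generalize freeC.cost = C at hcost
  refine ⟨?_, ?_, ?_⟩
  · simp only [NExp.val_add, NExp.val_mul, NExp.val_var, h6, hi, h.layout.slots]; omega
  · simp (disch := omega) only [NExp.val_var, NExp.val_add, NExp.val_mul, RExp.val_add,
      RExp.val_sub, RExp.val_mul, RExp.val_cell, RExp.val_var, Function.update_self,
      Function.update_of_ne, h6, hi, h.layout.slots, h.slot, h.layout.value, h.layout.discount,
      BExp.holds_conj, BExp.holds_neq, BExp.holds_rle, NExp.val_one]
    rintro ⟨h1, h2⟩ t ht
    refine ⟨?_, hcost t ht, by simp (disch := omega) [Function.update_of_ne, h6]⟩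
    have hA := h.set_nvar (v := Function.update s'.nvar 11 (θ.val * n + i.val))
      fun x _ _ _ _ _ h1 _ => Function.update_of_ne h1 _ _
    have hs := Sim.offered_of_best_le (j := j) (a := (θ, i)) hA.sim hM
      (show Function.update s'.nvar 11 (θ.val * n + i.val) 15 = 1 by simpa using h1) (by
        change s'.rvar 1 ≤ I.slack σ.u σ.p (θ, i) j + s'.rvar 0
        linarith)
    rw [Instance.offered_scanned] at hs
    refine hA.step ?_ (hs.congr ?_) (hA.heap.congr ⟨fun _ _ => rfl, fun _ _ => rfl⟩)
    · refine ⟨fun _ _ => rfl, fun _ _ => rfl, ?_, fun _ _ _ => rfl⟩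
      simp
    · exact ⟨fun _ _ => rfl, fun _ _ => rfl, fun x hx => Function.update_of_ne (by omega) _ _, rfl⟩
  · simp (disch := omega) only [NExp.val_var, NExp.val_add, NExp.val_mul, RExp.val_add,
      RExp.val_sub, RExp.val_mul, RExp.val_cell, RExp.val_var, Function.update_self,
      Function.update_of_ne, h6, hi, h.layout.slots, h.slot, h.layout.value, h.layout.discount,
      BExp.holds_conj, BExp.holds_neq, BExp.holds_rle, NExp.val_one]
    intro hb
    have := θ.isLt
    have := Nat.le_mul_of_pos_right k (Fin.pos j)
    refine ⟨?_, ?_, ?_, fun t ht => ⟨?_, hcost t ht, ?_⟩⟩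
    · simp (disch := omega) [Function.update_of_ne, h6]; omega
    · simp (disch := omega) [Function.update_of_ne, h.slot]; omega
    · simp; omega
    · simp only [NExp.val_var]
      have hs := @Sim.offered_of_lt_best _ _ _ _ _ j _
        { nvar := Function.update (Function.update (Function.update (Function.update s'.nvar 11
            (θ.val * n + i.val)) 13 θ.val) 14 j.val) 15 1
          narr := s'.narr
          rvar := Function.update (Function.update s'.rvar 2
            (s'.rarr 2 j.val + s'.rvar 0 - I.v θ i * I.α θ j)) 1
            (s'.rarr 2 j.val + s'.rvar 0 - I.v θ i * I.α θ j)
          rarr := s'.rarr } h.sim (θ, i) hM (hσ.free _ hM).1 (by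
          rintro ⟨h1, h2⟩
          refine hb ⟨h1, ?_⟩
          change s'.rvar 1 ≤ I.slack σ.u σ.p (θ, i) j + s'.rvar 0 at h2
          linarith)
          ⟨rfl, rfl, by simp⟩
          (by simp (disch := omega) [Function.update_of_ne])
          (by simp (disch := omega) [Function.update_of_ne])
          (by simp)
          (by
            dsimp only
            rw [Function.update_self]
            change _ = I.slack σ.u σ.p (θ, i) j + s'.rvar 0
            linarith)
      rw [Instance.offered_scanned] at hs
      have hv : ∀ x, x < 11 ∨ 16 ≤ x → Function.update (Function.update (Function.update (Function.update
          s'.nvar 11 (θ.val * n + i.val)) 13 θ.val) 14 j.val) 15 1 x = s'.nvar x := by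
        intro x hx
        simp (disch := omega) [Function.update_of_ne]
      have hk : ∀ x y, Function.update (Function.update s'.rvar 2 x) 1 y 0 = s'.rvar 0 := by
        intro x y
        simp (disch := omega) [Function.update_of_ne]
      simp (disch := omega) only [Function.update_of_ne, h6, h.slot]
      exact h.step ⟨fun x hx => hv x (by omega), fun _ _ => rfl,
        by dsimp only; exact hk _ _, fun _ _ _ => rfl⟩ hs
        (h.heap.congr ⟨fun x hx => hv x (by omega), fun _ _ => rfl⟩)
    · simp (disch := omega) [Function.update_of_ne, h6]

end AdTypes

/-! ### The scan of a slot: all types -/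

namespace AdTypes

variable {k n : ℕ} {I : Instance k n} {σ : HState k n} {r j : Fin n}
  {s s' : Store} {N H W m : ℕ}

/-- Offer the ads of the type `6` to the queue. -/
def scanTypeC : Cmd :=
  8 ::= .cell 2 (V 6 * V 1 + V 7) ;;
  12 ::= .cell 4 (V 6) ;;
  .cond (.neq (.cell 1 (V 7)) (V 6)) (9 ::= V 8 + 1) (9 ::= V 8) ;;
  .cond (.nlt 0 (V 8)) (relaxAtC (V 8 - 1)) .skip ;;
  .cond (.nlt (V 9) (V 12)) (relaxAtC (V 9)) .skip ;;
  freeC ;;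
  6 ::= V 6 + 1

/-- Scan the slot `7`. -/
def scanC : Cmd := 6 ::= 0 ;; .loop (.nlt (V 6) (V 0)) scanTypeC

/-- The ads a scan of the slot `j` considers, for the types below `x`. -/
def scanPrefix (M : Finset (Edge k n)) (j : Fin n) (x : ℕ) : Set (Ad k n) :=
  {a | a.1.val < x ∧ a ∈ scanSet M j}

def scanTypeCost : ℕ := 2 * relaxCost + 400

theorem scanPrefix_succ {M : Finset (Edge k n)} {b : ℕ} {t : ℕ → ℕ} (hs : Sorted M)
    (hf : Fills M b) (ht : HasTypes M t) (θ : Fin k) (a : Ad k n) :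
    a ∈ scanPrefix M j (θ.val + 1) ↔ a ∈ scanPrefix M j θ ∨
      (a.1 = θ ∧ (a.2.val = typeCount t b θ n ∨
      a.2.val + 1 = typeCount t b θ j ∨
      (a.2.val = typeCount t b θ (j + 1) ∧ a.2.val < typeCount t b θ n))) := by
  obtain ⟨θ', i⟩ := a
  simp only [scanPrefix, Set.mem_ofPred_eq]
  by_cases h : θ' = θ
  · subst h
    rw [hs.mem_scanSet_iff hf ht]
    simp
  · have : θ'.val ≠ θ.val := fun h' => h (Fin.ext h')
    simp only [h, false_and, or_false]
    exact and_congr_left fun _ => by omega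

theorem runs_scanTypeC (hσ : I.Scannable σ r j) {θ : Fin k}
    (h : ScanAt I σ r j N H W s (scanPrefix σ.M j θ) m s') (hn : n ≤ N) (hkn : k * n ≤ W)
    (h6 : s'.nvar 6 = θ.val) :
    Runs W scanTypeC s' fun t s'' => s''.nvar 6 = θ.val + 1 ∧
      ∃ m', ScanAt I σ r j N H W s (scanPrefix σ.M j (θ.val + 1)) m' s'' ∧
      t + Heap.unit * m' ≤ Heap.unit * m + scanTypeCost := by
  have hw : n + 2 ≤ W := by have := h.heap.env.word; exact Heap.le_word this (by omega)
  have hkw : k ≤ W := (Nat.le_mul_of_pos_right k (Fin.pos j)).trans hkn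
  have hθ := θ.isLt
  obtain ⟨t, ht⟩ : ∃ t, t = s'.narr 1 := ⟨_, rfl⟩
  have hT : HasTypes σ.M t := ht ▸ h.layout.hasTypes
  have hcnt := h.layout.cnt θ j hσ.le
  have htot := h.layout.tot θ
  have hroot := h.layout.root_type
  rw [← ht] at hcnt htot
  have hj := j.isLt
  have hc := typeCount_le t (r.val + 1) θ j
  have he := typeCount_le t (r.val + 1) θ (j + 1)
  -- The program compares types only. For `j = r` the sentinel type `k` prevents counting, in
  -- agreement with `typeCount` starting at `r + 1`.
  have hnx : (if t j.val = θ.val then typeCount t (r.val + 1) θ j + 1 else typeCount t (r.val + 1) θ j) =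
      typeCount t (r.val + 1) θ (j + 1) := by
    rw [typeCount_succ]
    have hle : r.val ≤ j.val := hσ.le
    rcases hle.eq_or_lt with h | h
    · have : t j.val = k := by rw [← h, ht]; exact hroot
      rw [if_neg (by omega), if_neg (by omega)]; rfl
    · by_cases h' : t j.val = θ.val
      · rw [if_pos h', if_pos ⟨by omega, h'⟩]
      · rw [if_neg h', if_neg (fun h => h' h.2)]; rfl
  have htn : typeCount t (r.val + 1) θ n < n := by
    obtain ⟨i, hi, -⟩ := hσ.fills.exists_first_free (by omega) (Fin.pos j) θ
    rw [hσ.sorted.matched_iff hσ.fills hT] at hi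
    have := i.isLt
    omega
  have hmono : typeCount t (r.val + 1) θ j ≤ typeCount t (r.val + 1) θ n := typeCount_mono t (r.val + 1) θ hj.le
  have hmatch : ∀ i : Fin n, i.val < typeCount t (r.val + 1) θ n → Matched σ.M (θ, i) := fun i hi =>
    (hσ.sorted.matched_iff hσ.fills hT θ i).2 hi
  have hfree : ¬ Matched σ.M (θ, ⟨typeCount t (r.val + 1) θ n, htn⟩) := by
    rw [hσ.sorted.matched_iff hσ.fills hT]; simp
  have hpre := scanPrefix_succ (j := j) hσ.sorted hσ.fills hT θ
  generalize hC1 : typeCount t (r.val + 1) θ j = C1 at *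
  generalize hC2 : typeCount t (r.val + 1) θ (j + 1) = C2 at *
  generalize hC3 : typeCount t (r.val + 1) θ n = C3 at *
  have hcell : s'.narr 2 (θ.val * n + j.val) = C1 := hcnt
  have hcell4 : s'.narr 4 θ.val = C3 := htot
  -- The code after the test on the type of the slot, treated once for both branches; `200` leaves
  -- room for the time spent before.
  have hkey : ∀ v : ℕ → ℕ, (∀ x < 40, x ≠ 6 → x ≠ 8 → x ≠ 9 → x ≠ 10 → x ≠ 11 → x ≠ 12 →
      v x = s'.nvar x) → v 6 = θ.val → v 8 = C1 → v 9 = C2 → v 12 = C3 →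
      Runs W (.cond (.nlt 0 (V 8)) (relaxAtC (V 8 - 1)) .skip ;;
        .cond (.nlt (V 9) (V 12)) (relaxAtC (V 9)) .skip ;; freeC ;; 6 ::= V 6 + 1)
        { s' with nvar := v } fun t s'' => ∀ t' ≤ 200, s''.nvar 6 = θ.val + 1 ∧
      ∃ m', ScanAt I σ r j N H W s (scanPrefix σ.M j (θ.val + 1)) m' s'' ∧
      t' + t + Heap.unit * m' ≤ Heap.unit * m + scanTypeCost := by
    intro v hv v6 v8 v9 v12
    have hA := h.set_nvar hv
    have htime1 : (BExp.nlt 0 (V 8)).time = 4 := rfl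
    have htime2 : (BExp.nlt (V 9) (V 12)).time = 4 := rfl
    have hskip : Cmd.skip.cost = 1 := rfl
    refine Runs.seq (Runs.mono (Q := fun t s'' => ∃ m', ScanAt I σ r j N H W s
      (scanPrefix σ.M j θ ∪ {a | a.1 = θ ∧ a.2.val + 1 = C1}) m' s'' ∧
      t + Heap.unit * m' ≤ Heap.unit * m + (relaxCost + 25) ∧
      (s''.nvar 6 = θ.val ∧ s''.nvar 9 = C2 ∧ s''.nvar 12 = C3)) ?_ ?_)
    · refine Runs.cond (fun hb => ?_) fun hb => ?_
      · simp [v8] at hb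
        refine (runs_relaxAtC (i := ⟨C1 - 1, by omega⟩) hσ hA hn hkn (e := V 8 - 1) (by decide)
          v6 (by simp [v8]) (hmatch _ (by simp only; omega))).mono ?_
        rintro t1 s1 ⟨⟨m1, h1, h2⟩, h3⟩
        refine ⟨m1, h1.mono ?_, by omega, (h3 6 (by simp) (by simp) (by simp)).trans v6,
          (h3 9 (by simp) (by simp) (by simp)).trans v9,
          (h3 12 (by simp) (by simp) (by simp)).trans v12⟩
        ext ⟨θ', i⟩
        simp only [Set.mem_insert_iff, Set.mem_union, Set.mem_ofPred_eq, Prod.mk.injEq, Fin.ext_iff]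
        constructor
        · rintro (⟨h1, h2⟩ | h1)
          · exact Or.inr ⟨h1, by omega⟩
          · exact Or.inl h1
        · rintro (h1 | ⟨h1, h2⟩)
          · exact Or.inr h1
          · exact Or.inl ⟨h1, by omega⟩
      · simp [v8] at hb
        refine Runs.of_wp fun t1 ht1 => ⟨m, hA.mono ?_, by omega, v6, v9, v12⟩
        ext ⟨θ', i⟩
        simp only [Set.mem_union, Set.mem_ofPred_eq]
        constructor
        · exact Or.inl
        · rintro (h1 | ⟨h1, h2⟩)
          · exact h1
          · omega
    · rintro t1 s1 ⟨m1, h1, ht1, w6, w9, w12⟩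
      refine Runs.seq (Runs.mono (Q := fun t s'' => ∃ m', ScanAt I σ r j N H W s
        (scanPrefix σ.M j θ ∪ {a | a.1 = θ ∧ a.2.val + 1 = C1} ∪
          {a | a.1 = θ ∧ a.2.val = C2 ∧ a.2.val < C3}) m' s'' ∧
        t + Heap.unit * m' ≤ Heap.unit * m1 + (relaxCost + 25) ∧
        (s''.nvar 6 = θ.val ∧ s''.nvar 12 = C3)) ?_ ?_)
      · refine Runs.cond (fun hb => ?_) fun hb => ?_
        · simp [w9, w12] at hb
          refine (runs_relaxAtC (i := ⟨C2, by omega⟩) hσ h1 hn hkn (e := V 9) (by decide)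
            w6 (by simp [w9]) (hmatch _ (by simp only; omega))).mono ?_
          rintro t2 s2 ⟨⟨m2, h2, h3⟩, h4⟩
          refine ⟨m2, h2.mono ?_, by omega, (h4 6 (by simp) (by simp) (by simp)).trans w6,
            (h4 12 (by simp) (by simp) (by simp)).trans w12⟩
          ext ⟨θ', i⟩
          simp only [Set.mem_insert_iff, Set.mem_union, Set.mem_ofPred_eq, Prod.mk.injEq,
            Fin.ext_iff]
          constructor
          · rintro (⟨h1, h2⟩ | h1)
            · exact Or.inr ⟨h1, by omega, by omega⟩
            · exact Or.inl h1
          · rintro (h1 | ⟨h1, h2, h3⟩)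
            · exact Or.inr h1
            · exact Or.inl ⟨h1, by omega⟩
        · simp [w9, w12] at hb
          refine Runs.of_wp fun t2 ht2 => ⟨m1, h1.mono ?_, by omega, w6, w12⟩
          ext ⟨θ', i⟩
          simp only [Set.mem_union, Set.mem_ofPred_eq]
          constructor
          · exact Or.inl
          · rintro (h1 | ⟨h1, h2, h3⟩)
            · exact h1
            · omega
      · rintro t2 s2 ⟨m2, h2, ht2, x6, x12⟩
        refine Runs.seq (Runs.mono (runs_freeC hσ h2 hn hkn x6 (i := ⟨C3, htn⟩) x12 hfree) ?_)
        rintro t3 s3 ⟨h3, ht3, y6⟩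
        refine Runs.of_wp ⟨by simp; omega, fun t4 ht4 t5 ht5 => ⟨by simp [y6], m2, ?_, ?_⟩⟩
        · refine (h3.set_nvar (v := Function.update s3.nvar 6 (NExp.val s3 (V 6 + 1)))
            fun x _ h _ _ _ _ _ => Function.update_of_ne h _ _).mono ?_
          ext ⟨θ', i⟩
          rw [hpre]
          simp only [Set.mem_insert_iff, Set.mem_union, Set.mem_ofPred_eq, Prod.mk.injEq,
            Fin.ext_iff]
          tauto
        · have : (6 ::= V 6 + 1).cost = 4 := rfl
          unfold scanTypeCost
          omega
  have c1 : (8 ::= .cell 2 (V 6 * V 1 + V 7)).cost = 7 := rfl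
  have c2 : (12 ::= .cell 4 (V 6)).cost = 3 := rfl
  have c3 : (Cmd.cond (.neq (.cell 1 (V 7)) (V 6)) (9 ::= V 8 + 1) (9 ::= V 8)).cost = 11 := by decide
  unfold scanTypeC
  refine Runs.wp_seq ⟨?_, Runs.wp_seq ⟨?_, Runs.wp_seq ⟨fun hb => ⟨?_, ?_⟩, fun hb => ⟨?_, ?_⟩⟩⟩⟩
  · simp [h6, h.slot, h.layout.slots, hcell]; omega
  · simp [h6, hcell4]; omega
  · simp [h6, h.slot, h.layout.slots, hcell]; omega
  · simp [h6, h.slot, ← ht] at hb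
    refine (hkey _ ?_ ?_ ?_ ?_ ?_).mono fun t4 s4 h4 t3 ht3 t2 ht2 t1 ht1 => ?_
    · intro x _ _ _ _ _ _ _
      simp (disch := omega) [Function.update_of_ne]
    · simp [h6]
    · simp [h6, h.slot, h.layout.slots, hcell]
    · simp [h6, h.slot, h.layout.slots, hcell, ← hnx, hb]
    · simp [h6, hcell4]
    · have := h4 (t1 + t2 + t3) (by omega)
      simpa only [Nat.add_assoc] using this
  · simp [h6, h.slot, h.layout.slots, hcell]; omega
  · simp [h6, h.slot, ← ht] at hb
    refine (hkey _ ?_ ?_ ?_ ?_ ?_).mono fun t4 s4 h4 t3 ht3 t2 ht2 t1 ht1 => ?_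
    · intro x _ _ _ _ _ _ _
      simp (disch := omega) [Function.update_of_ne]
    · simp [h6]
    · simp [h6, h.slot, h.layout.slots, hcell]
    · simp [h6, h.slot, h.layout.slots, hcell, ← hnx, hb]
    · simp [h6, hcell4]
    · have := h4 (t1 + t2 + t3) (by omega)
      simpa only [Nat.add_assoc] using this

theorem runs_scanC (hσ : I.Scannable σ r j) (hL : Layout I σ.M r s) (hS : Sim I σ r s)
    (hH : s.HasHeap s.key N H W m) (h7 : s.nvar 7 = j.val) (hD : s.rarr 4 j.val = s.rvar 0)
    (hn : n ≤ N) (hkn : k * n ≤ W) :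
    Runs W scanC s fun t s' => ScanPost I
      { σ with P := I.updateQueue σ.M σ.B σ.u σ.p σ.P j } r N H W s
      ((k + 1) * (scanTypeCost + 10)) m t s' := by
  have hkw : k ≤ W := (Nat.le_mul_of_pos_right k (Fin.pos j)).trans hkn
  have h0 : ScanAt I σ r j N H W s (scanPrefix σ.M j 0) m s := by
    have : scanPrefix σ.M j 0 = ∅ := by ext; simp [scanPrefix]
    exact ⟨hL, by rwa [this, Instance.scanned_empty], hH, h7, hD, Store.Kept.refl⟩
  have h1 := h0.set_nvar (v := Function.update s.nvar 6 0) fun x _ h _ _ _ _ _ =>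
    Function.update_of_ne h _ _
  have hb : (BExp.nlt (V 6) (V 0)).time = 4 := rfl
  have hc : (6 ::= 0).cost = 2 := rfl
  refine Runs.wp_seq ⟨by simp, ?_⟩
  refine (Runs.loop (J := fun (g : ℕ × ℕ) s' => s'.nvar 6 = g.1 ∧ g.1 ≤ k ∧
    ScanAt I σ r j N H W s (scanPrefix σ.M j g.1) g.2 s')
    (Φ := fun g => Heap.unit * g.2 + (k - g.1) * (scanTypeCost + 5)) ?_ (0, m)
    ⟨by simp, by simp, h1⟩).mono ?_
  · rintro ⟨x, m1⟩ s1 ⟨e1, e2, e3⟩ hx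
    simp [e1, e3.layout.types] at hx
    refine (runs_scanTypeC hσ (θ := ⟨x, hx⟩) e3 hn hkn e1).mono ?_
    rintro t s2 ⟨f1, m2, f2, f3⟩
    refine ⟨(x + 1, m2), ⟨f1, hx, f2⟩, ?_⟩
    clear e3 f2
    dsimp only at f3
    obtain ⟨y, hy⟩ : ∃ y, k = x + 1 + y := ⟨k - (x + 1), by omega⟩
    simp only [show k - x = y + 1 by omega, show k - (x + 1) = y by omega, Nat.succ_mul, hb]
    omega
  · rintro t s1 ⟨⟨x, m1⟩, ⟨e1, e2, e3⟩, e4, e5⟩ t0 ht0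
    simp [e1, e3.layout.types] at e4
    simp only at e2 e5 e3
    obtain rfl : x = k := by omega
    have hS' : scanPrefix σ.M j x = {a | a ∈ scanSet σ.M j} := by
      ext a; simp [scanPrefix]
    have h2 := e3.sim
    rw [hS', Instance.scanned_scanSet] at h2
    refine ⟨e3.kept, h2, m1, e3.heap, ?_⟩
    simp only [Nat.sub_self, Nat.sub_zero, hb] at e5
    have : (x + 1) * (scanTypeCost + 10) = x * (scanTypeCost + 5) + 5 * x + scanTypeCost + 10 := by
      ring
    omega

end AdTypes

/-! ### Lazy dual updates when the tree grows -/

namespace AdTypes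

variable {k n : ℕ} {I : Instance k n} {σ : HState k n} {r : Fin n} {s s' : Store} {N H W : ℕ}

/-- The second memory state results from the first by moving the slot `m` from the queue to the
tree. -/
structure Store.Grown (s s' : Store) (m : ℕ) : Prop where
  nvar : ∀ x, x < 6 ∨ 13 ≤ x ∧ x < 40 → s'.nvar x = s.nvar x
  slot : s'.nvar 7 = m
  narr : ∀ a < 7, a ≠ 5 → s'.narr a = s.narr a
  visited : s'.narr 5 = Function.update (s.narr 5) m 1
  inq : s'.narr 7 = Function.update (s.narr 7) m 0
  dual : s'.rvar 0 = s.rarr 3 m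
  best : s'.rvar 1 = s.rvar 1
  rarr : ∀ a, a ≠ 4 → s'.rarr a = s.rarr a
  time : s'.rarr 4 = Function.update (s.rarr 4) m (s.rarr 3 m)

/-- The key of the extracted entry is its slack plus `D`, that is, exactly the new value of `D`.
Every other entry loses the same amount of slack that `D` gains, so no key has to be rewritten. The
new tree slot records the current `D`, from which its price starts to fall. -/
theorem Sim.grown (hS : Sim I σ r s) (h : I.InPhase σ r) {a : Ad k n} {l m : Fin n} {δ : ℝ}
    (hP : σ.P a = some l) (hδ : δ = I.slack σ.u σ.p a l) (ham : (a, m) ∈ σ.M)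
    (hs : s.Grown s' m) : Sim I { σ with
        u := newU σ δ
        p := newP σ r δ
        B := insert (a, l) (insert (a, m) σ.B)
        P := Function.update σ.P a none } r s' := by
  have hB := h.fills.grow_mem_iff (B := σ.B) (j := l) ham
  obtain ⟨hl, haT, -⟩ := h.entry a l hP
  have hmT : m ∉ treeSlots r σ.B := fun h' => haT ((h.mem_treeSlots_iff ham).1 h')
  have hslots : ∀ x, x ∈ treeSlots r (insert (a, l) (insert (a, m) σ.B)) ↔
      x = m ∨ x ∈ treeSlots r σ.B := fun x => by
    rw [mem_treeSlots_extend hB hl]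
    exact or_congr_left ⟨fun h' => h.fills.matching.slot_eq h' ham, fun h' => h' ▸ ham⟩
  obtain ⟨q1, q2, q3⟩ := hS.queued a m l ham hP
  have hD : s'.rvar 0 = s.rvar 0 + δ := by rw [hs.dual, q3, hδ]; ring
  have hne : ∀ {x : Fin n}, x ∈ treeSlots r σ.B → x.val ≠ m.val := fun hx h' =>
    hmT (Fin.ext h' ▸ hx)
  have hslack : ∀ b l', σ.P b = some l' →
      I.slack (newU σ δ) (newP σ r δ) b l' + s'.rvar 0 = I.slack σ.u σ.p b l' + s.rvar 0 := by
    intro b l' hb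
    obtain ⟨h1, h2, -⟩ := h.entry b l' hb
    rw [slack_update h2 h1, hD]
    ring
  have hold : ∀ {b l'}, Function.update σ.P a none b = some l' → b ≠ a ∧ σ.P b = some l' := by
    intro b l' hb
    by_cases hba : b = a
    · simp [hba] at hb
    · rw [Function.update_of_ne hba] at hb
      exact ⟨hba, hb⟩
  have hfree : ∀ {b}, ¬ Matched σ.M b → b ≠ a := by rintro b hb rfl; exact hb ⟨m, ham⟩
  constructor
  · intro x hx
    rw [hslots] at hx
    rw [hs.rarr 2 (by simp), hs.time]
    rcases hx with rfl | hx
    · simp only [newP, if_neg hmT, Function.update_self, hs.dual, hS.price _ hmT]; ring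
    · simp only [newP, if_pos hx, Function.update_of_ne (hne hx), hD, hS.price_tree x hx]; ring
  · intro x hx
    rw [hslots, not_or] at hx
    rw [hs.rarr 2 (by simp)]
    simp only [newP, if_neg hx.2, hS.price x hx.2]
  · intro x
    rw [hslots, hs.visited]
    by_cases hx : x = m
    · subst hx; simp
    · rw [Function.update_of_ne (fun h' => hx (Fin.ext h')), hS.visited]
      simp [hx]
  · intro b x hb hx
    rw [hslots] at hx
    rw [hs.narr 6 (by simp) (by simp)]
    rcases hx with rfl | hx
    · obtain rfl := h.fills.matching.ad_eq hb ham
      refine ⟨l, q2, (hB _).2 (Or.inl rfl), fun h' => ?_⟩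
      exact hne hl (congrArg Fin.val (h.fills.matching.slot_eq h' hb))
    · obtain ⟨l', h1, h2, h3⟩ := hS.parent b x hb hx
      exact ⟨l', h1, (hB _).2 (Or.inr (Or.inr h2)), h3⟩
  · intro b x l' hb hl'
    obtain ⟨hba, hl'⟩ := hold hl'
    have hx : x.val ≠ m.val := fun h' => hba (h.fills.matching.ad_eq hb (Fin.ext h' ▸ ham))
    rw [hs.narr 6 (by simp) (by simp), hs.inq, hs.rarr 3 (by simp), Function.update_of_ne hx]
    refine (hS.queued b x l' hb hl').imp id (And.imp id fun h' => h'.trans (hslack b l' hl').symm)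
  · intro x hx
    rw [hs.inq] at hx
    by_cases hxm : x = m.val
    · simp [hxm] at hx
    · rw [Function.update_of_ne hxm] at hx
      obtain ⟨b, j', l', h1, h2, h3⟩ := hS.unqueued x hx
      refine ⟨b, j', l', h1, h2, ?_⟩
      rw [← h3]
      refine Function.update_of_ne ?_ _ _
      rintro rfl
      exact hxm (h1.trans (congrArg Fin.val (h.fills.matching.slot_eq h2 ham)))
  · intro b l' hb hl'
    obtain ⟨hba, hl'⟩ := hold hl'
    rw [hs.nvar 15 (by simp), hs.best]
    exact (hS.free b l' hb hl').imp id fun h' => h'.trans (hslack b l' hl').symm.le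
  · rw [hs.nvar 15 (by simp), hs.nvar 13 (by simp), hs.nvar 14 (by simp), hs.best]
    intro h'
    obtain ⟨b, l', h1, h2, h3, h4, h5⟩ := hS.best h'
    exact ⟨b, l', h1, (Function.update_of_ne (hfree h1) _ _).trans h2, h3, h4,
      h5.trans (hslack b l' h2).symm⟩

/-- The memory states agree on everything that a phase does not change before its end. -/
structure Store.Framed (s s' : Store) : Prop where
  nvar : ∀ x < 6, s'.nvar x = s.nvar x
  narr : ∀ a < 5, s'.narr a = s.narr a
  rarr : ∀ a < 3, s'.rarr a = s.rarr a

theorem Store.Framed.trans {s'' : Store} (h : s.Framed s') (h' : s'.Framed s'') : s.Framed s'' :=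
  ⟨fun x hx => (h'.nvar x hx).trans (h.nvar x hx), fun a ha => (h'.narr a ha).trans (h.narr a ha),
    fun a ha => (h'.rarr a ha).trans (h.rarr a ha)⟩

theorem Store.Kept.framed (h : s.Kept s') : s.Framed s' :=
  ⟨fun x hx => h.nvar x (Or.inl hx), fun a ha => h.narr a (by omega),
    fun a ha => h.rarr a (by omega) (by omega)⟩

theorem Store.Grown.framed {m : ℕ} (h : s.Grown s' m) : s.Framed s' :=
  ⟨fun x hx => h.nvar x (Or.inl hx), fun a ha => h.narr a (by omega) (by omega),
    fun a ha => h.rarr a (by omega)⟩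

theorem Layout.congr_framed {M : Finset (Edge k n)} (h : Layout I M r s) (hs : s.Framed s') :
    Layout I M r s' := by
  obtain ⟨h1, h2, h3, h4, h5, h6, h7, h8, h9, h10⟩ := h
  constructor
  · rw [hs.nvar 0 (by simp), h1]
  · rw [hs.nvar 1 (by simp), h2]
  · rw [hs.nvar 2 (by simp), h3]
  · rwa [hs.rarr 0 (by simp)]
  · rwa [hs.rarr 1 (by simp)]
  · rwa [hs.narr 1 (by simp)]
  · rwa [hs.narr 1 (by simp)]
  · rwa [hs.narr 1 (by simp), hs.narr 2 (by simp)]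
  · rwa [hs.narr 3 (by simp)]
  · rwa [hs.narr 1 (by simp), hs.narr 4 (by simp)]

theorem not_isAugmenting {M B : Finset (Edge k n)} (hA : ∀ a ∈ treeAds B, Matched M a) :
    ¬ ∃ A, IsAugmenting M B r A := by
  rintro ⟨A, a, ha, hA'⟩
  obtain ⟨j, h1, -⟩ := hA'.mem_ads
  exact ha (hA a (mem_treeAds.2 ⟨j, hA'.subset h1⟩))

/-- The root has been scanned, so the first free ad of every type is in the queue, and `0 < k`
provides a type. -/
theorem Sim.hasBest (hS : Sim I σ r s) (h : I.InPhase σ r) (hk : 0 < k)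
    (hA : ∀ a ∈ treeAds σ.B, Matched σ.M a) : s.nvar 15 = 1 := by
  obtain ⟨i, h1, h2⟩ := h.fills.exists_first_free (by omega) (Fin.pos r) ⟨0, hk⟩
  obtain ⟨l, h3, -⟩ := h.cover r root_mem_treeSlots (⟨0, hk⟩, i) (mem_scanSet.2 (Or.inl ⟨h1, h2⟩))
    fun h' => h1 (hA _ h')
  exact (hS.free _ l h1 h3).1

/-- Comparing the heap minimum with the best free entry decides the overall minimum: the heap covers
the entries of matched ads, and the stored best entry bounds all entries of free ads. -/
theorem Sim.isNext_of_lt_best (hS : Sim I σ r s) (hn : n ≤ N) {x : ℕ}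
    (hmin : ∀ y < N, s.key x ≤ s.key y) (hx : s.narr 7 x = 1) (hb : s.rarr 3 x ≤ s.rvar 1) :
    ∃ a m l, x = m.val ∧ (a, m) ∈ σ.M ∧ I.IsNext σ a l := by
  obtain ⟨a, m, l, rfl, h1, h2⟩ := hS.unqueued x hx
  refine ⟨a, m, l, rfl, h1, h2, fun b l' hb' => ?_⟩
  have h3 := (hS.queued a m l h1 h2).2.2
  by_cases hbM : Matched σ.M b
  · obtain ⟨j, hj⟩ := hbM
    obtain ⟨q1, -, q3⟩ := hS.queued b j l' hj hb'
    have := hmin j (by omega)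
    simp only [Store.key, q1, hx, if_true, WithTop.coe_le_coe] at this
    linarith
  · have := (hS.free b l' hbM hb').2
    linarith

theorem Sim.isNext_best (hS : Sim I σ r s) (hn : n ≤ N) {x : ℕ}
    (hmin : ∀ y < N, s.key x ≤ s.key y) (h15 : s.nvar 15 = 1)
    (hb : ¬ (s.narr 7 x = 1 ∧ ¬ s.rvar 1 ≤ s.rarr 3 x)) :
    ∃ a l, ¬ Matched σ.M a ∧ I.IsNext σ a l ∧ s.nvar 13 = a.1.val ∧ s.nvar 14 = l.val ∧
      s.rvar 1 = I.slack σ.u σ.p a l + s.rvar 0 := by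
  obtain ⟨a, l, h1, h2, h3, h4, h5⟩ := hS.best h15
  refine ⟨a, l, h1, ⟨h2, fun b l' hb' => ?_⟩, h3, h4, h5⟩
  by_cases hbM : Matched σ.M b
  · obtain ⟨j, hj⟩ := hbM
    obtain ⟨q1, -, q3⟩ := hS.queued b j l' hj hb'
    have := hmin j (by omega)
    by_cases hx : s.narr 7 x = 1
    · have h6 : s.rvar 1 ≤ s.rarr 3 x := by by_contra h'; exact hb ⟨hx, h'⟩
      simp only [Store.key, q1, hx, if_true, WithTop.coe_le_coe] at this
      linarith
    · simp [Store.key, q1, hx] at this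
  · have := (hS.free b l' hbM hb').2
    linarith

end AdTypes

/-! ### The loop that grows the tree -/

namespace AdTypes

variable {k n : ℕ} {I : Instance k n} {σ : HState k n} {r : Fin n} {s s' : Store} {N H W : ℕ}

/-- Move the slot `55` from the queue to the tree and scan it. -/
def growC : Cmd :=
  7 ::= V 55 ;; Heap.extractC ;; .setR 0 (.cell 3 (V 7)) ;; .putN 5 (V 7) 1 ;;
    .putR 4 (V 7) (.var 0) ;; scanC

/-- Grow the tree until the best free ad becomes tight. -/
def growTreeC : Cmd :=
  19 ::= 1 ;; .loop (.neq (V 19) 1) (Heap.findC ;;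
    .cond (.conj (.neq (.cell 7 (V 55)) 1) (.neg (.rle (.var 1) (.cell 3 (V 55))))) growC
      (.setR 0 (.var 1) ;; 19 ::= 0))

def growCost (k H : ℕ) : ℕ :=
  800 * (H + 1) + Heap.unit * H + (k + 1) * (scanTypeCost + 10) + 30

theorem runs_growC (hI : I.IsMonotone) (hk : 0 < k) (h : I.InPhase σ r)
    (hA : ∀ a ∈ treeAds σ.B, Matched σ.M a) (hL : Layout I σ.M r s) (hS : Sim I σ r s)
    (hH : s.HasMin N H W) (hn : n ≤ N) (hkn : k * n ≤ W) {a : Ad k n} {m l : Fin n}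
    (hx : s.nvar 55 = m.val) (ham : (a, m) ∈ σ.M) (hnext : I.IsNext σ a l) :
    Runs W growC s fun t s' => ∃ σ', I.Step σ σ' ∧ I.InPhase σ' r ∧
      (∀ a ∈ treeAds σ'.B, Matched σ'.M a) ∧ σ'.M = σ.M ∧ Sim I σ' r s' ∧ s.Framed s' ∧
      s'.nvar 19 = s.nvar 19 ∧ (∃ m', s'.HasHeap s'.key N H W m') ∧
      (treeSlots r σ'.B).card = (treeSlots r σ.B).card + 1 ∧ t ≤ growCost k H := by
  have hw : n + 1 ≤ W := Heap.le_word hH.1.word (by omega)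
  have hm := m.isLt
  obtain ⟨hl, haT, -⟩ := h.entry a l hnext.1
  have hB := h.fills.grow_mem_iff (B := σ.B) (j := l) ham
  have hA' := not_isAugmenting (r := r) hA
  have hphase := h.grow hI hk hA' hnext rfl ham
  have hmT : m ∉ treeSlots r σ.B := fun h' => haT ((h.mem_treeSlots_iff ham).1 h')
  have hslots : treeSlots r (insert (a, l) (insert (a, m) σ.B)) = insert m (treeSlots r σ.B) := by
    ext x
    rw [mem_treeSlots_extend hB hl, Finset.mem_insert]
    exact or_congr_left ⟨fun h' => h.fills.matching.slot_eq h' ham, fun h' => h' ▸ ham⟩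
  have hmat : ∀ b ∈ treeAds (insert (a, l) (insert (a, m) σ.B)), Matched σ.M b := by
    intro b hb
    rcases (mem_treeAds_extend hB).1 hb with rfl | hb
    exacts [⟨m, ham⟩, hA b hb]
  unfold growC
  refine Runs.wp_seq ⟨by simp [hx]; omega, ?_⟩
  simp only [NExp.val_var, hx]
  have hH1 : Store.HasMin { s with nvar := Function.update s.nvar 7 m.val } N H W :=
    hH.congr ⟨fun x hx => Function.update_of_ne (by omega) _ _, fun _ _ => rfl⟩ rfl
      (by simp) (by simp)
  refine (hH1.runs_extractC.mono ?_).seq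
  rintro t1 s1 ⟨e1, ⟨m1, e2⟩, e3⟩
  dsimp only at e1
  rw [Function.update_of_ne (by simp), hx] at e1
  have e7 : s1.nvar 7 = m.val := by rw [e1.nvar 7 (by simp)]; simp [Store.dequeue]
  refine Runs.wp_seq (Runs.wp_seq ⟨by simp [e7]; omega, by simp; omega, Runs.wp_seq
    ⟨by simp [e7]; omega, ?_⟩⟩)
  simp only [NExp.val_var, NExp.val_one, RExp.val_cell, RExp.val_var, Function.update_self, e7]
  generalize hs2 : Store.mk _ _ _ _ = s2
  have hg : s.Grown s2 m := by
    have hr : s1.rarr = s.rarr := e1.rarr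
    subst hs2
    constructor
    · intro x hx
      change s1.nvar x = _
      rw [e1.nvar x (by omega)]
      simp (disch := omega) [Store.dequeue, Function.update_of_ne]
    · exact e7
    · intro b hb1 hb2
      dsimp only
      rw [Function.update_of_ne hb2, e1.narr b (by omega)]
      simp (disch := omega) [Store.dequeue, Function.update_of_ne]
    · simp [e1.narr 5, Store.dequeue]
    · simp [e1.narr 7, Store.dequeue]
    · simp [hr]
    · simp [e1.rvar 1, Store.dequeue]
    · intro b hb
      dsimp only
      rw [Function.update_of_ne hb, hr]
    · simp [hr]
  have hkey : s2.key = s1.key := by subst hs2; funext x; simp [Store.key]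
  have hH2 : s2.HasHeap s2.key N H W m1 := by
    rw [hkey]
    refine e2.congr ?_
    subst hs2
    exact ⟨fun _ _ => rfl, fun b hb => Function.update_of_ne (by omega) _ _⟩
  clear hs2
  have hS2 := hS.grown h hnext.1 rfl ham hg
  have hL2 := hL.congr_framed hg.framed
  have hsc := Instance.Scannable.mk (I := I) (r := r) (j := m)
    (σ := { σ with
        u := newU σ (I.slack σ.u σ.p a l)
        p := newP σ r (I.slack σ.u σ.p a l)
        B := insert (a, l) (insert (a, m) σ.B)
        P := Function.update σ.P a none })
    h.fills h.sorted hphase.dual.tight (fun b x hb => (hphase.mem_treeSlots_iff hb).symm)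
    (fun b hb => ⟨fun h' => hb (hmat b h'), hphase.dual.free b hb⟩)
    (by simp only [hslots]; exact Finset.mem_insert_self _ _)
    (Fin.le_def.2 (by have := (h.fills.slots m).1 ⟨a, ham⟩; omega))
  refine (runs_scanC hsc hL2 hS2 hH2 hg.slot (by simp [hg.time, hg.dual]) hn hkn).mono ?_
  rintro t2 s3 ⟨f1, f2, m3, f3, f4⟩ t5 ht5 t6 ht6 t7 ht7 t8 ht8
  refine ⟨_, .grow σ r a l m _ h.root hA' hnext rfl ham, hphase, hmat, rfl, f2,
    hg.framed.trans f1.framed, ?_, ⟨m3, f3⟩, ?_, ?_⟩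
  · rw [f1.nvar 19 (by simp), hg.nvar 19 (by simp)]
  · simp only [hslots]
    exact Finset.card_insert_of_notMem hmT
  -- After the extraction the pool holds at most `H` trees. Their entire potential is charged to
  -- this step, which is affordable because the extraction costs `O(H)` anyway.
  · have hm1 := Nat.mul_le_mul_left Heap.unit hH2.le
    have c1 : (Cmd.setR 0 (.cell 3 (V 7))).cost = 3 := rfl
    have c2 : (Cmd.putN 5 (V 7) 1).cost = 3 := rfl
    have c3 : (Cmd.putR 4 (V 7) (.var 0)).cost = 3 := rfl
    have c4 : (7 ::= V 55).cost = 2 := rfl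
    unfold growCost
    omega

/-- The memory describes the prices and the tree of the state `σ`. -/
structure TreeSim (σ : HState k n) (r : Fin n) (s : Store) : Prop where
  price_tree : ∀ j ∈ treeSlots r σ.B, σ.p j = s.rarr 2 j.val - (s.rvar 0 - s.rarr 4 j.val)
  price : ∀ j, j ∉ treeSlots r σ.B → σ.p j = s.rarr 2 j.val
  visited : ∀ j : Fin n, s.narr 5 j.val = 1 ↔ j ∈ treeSlots r σ.B
  parent : ∀ a j, (a, j) ∈ σ.M → j ∈ treeSlots r σ.B →
    ∃ l : Fin n, s.narr 6 j.val = l.val ∧ (a, l) ∈ σ.B ∧ (a, l) ∉ σ.M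
  inq : ∀ x, n ≤ x → s.narr 7 x ≠ 1

/-- The tree contains the free ad of type `13`; its parent is the slot `14`. -/
def Reached (I : Instance k n) (σ₀ : HState k n) (r : Fin n) (s : Store) : Prop :=
  ∃ σ a l, Relation.ReflTransGen I.Step σ₀ σ ∧ I.InPhase σ r ∧ σ.M = σ₀.M ∧ TreeSim σ r s ∧
    ¬ Matched σ.M a ∧ (a, l) ∈ σ.B ∧ s.nvar 13 = a.1.val ∧ s.nvar 14 = l.val

theorem Sim.reached (hI : I.IsMonotone) (hk : 0 < k) (hS : Sim I σ r s) (h : I.InPhase σ r)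
    (hA : ∀ a ∈ treeAds σ.B, Matched σ.M a) {a : Ad k n} {l : Fin n} (ha : ¬ Matched σ.M a)
    (hnext : I.IsNext σ a l) (h13 : s.nvar 13 = a.1.val) (h14 : s.nvar 14 = l.val)
    (h1 : s.rvar 1 = I.slack σ.u σ.p a l + s.rvar 0) {σ₀ : HState k n}
    (h₀ : Relation.ReflTransGen I.Step σ₀ σ) (hM : σ.M = σ₀.M) (hn : s'.narr = s.narr)
    (hr : s'.rarr = s.rarr) (h0 : s'.rvar 0 = s.rvar 1)
    (hv : ∀ x, x = 13 ∨ x = 14 → s'.nvar x = s.nvar x) : Reached I σ₀ r s' := by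
  have hA' := not_isAugmenting (r := r) hA
  obtain ⟨hl, -, -⟩ := h.entry a l hnext.1
  have hB := reach_mem_iff (B := σ.B) (j := l) ha
  have hslots : ∀ x, x ∈ treeSlots r (insert (a, l) σ.B) ↔ x ∈ treeSlots r σ.B := fun x => by
    rw [mem_treeSlots_extend hB hl]
    exact or_iff_right fun h' => ha ⟨x, h'⟩
  refine ⟨_, a, l, h₀.tail (.reach σ r a l _ h.root hA' hnext rfl ha),
    h.reach hI hk hA' hnext rfl ha, hM, ⟨?_, ?_, ?_, ?_, ?_⟩, ha, Finset.mem_insert_self _ _,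
    (hv 13 (by simp)).trans h13, (hv 14 (by simp)).trans h14⟩
  · intro x hx
    rw [hslots] at hx
    simp only [newP, if_pos hx, hS.price_tree x hx, hr, h0, h1]
    ring
  · intro x hx
    rw [hslots] at hx
    simp only [newP, if_neg hx, hS.price x hx, hr]
  · intro x
    rw [hslots, hn, hS.visited]
  · intro b x hb hx
    rw [hslots] at hx
    rw [hn]
    obtain ⟨l', e1, e2, e3⟩ := hS.parent b x hb hx
    exact ⟨l', e1, Finset.mem_insert_of_mem e2, e3⟩
  · intro x hx h7
    rw [hn] at h7
    obtain ⟨-, j, -, rfl, -⟩ := hS.unqueued x h7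
    omega

theorem Store.HasMin.hasHeap (h : s.HasMin N H W) : ∃ m, s.HasHeap s.key N H W m := by
  obtain ⟨h1, g, h2, h3⟩ := h
  exact ⟨_, h1, g, h2, h3.whole, rfl⟩

theorem runs_growTreeC (hI : I.IsMonotone) (hk : 0 < k) (h : I.InPhase σ r)
    (hA : ∀ a ∈ treeAds σ.B, Matched σ.M a) (hL : Layout I σ.M r s) (hS : Sim I σ r s) {m : ℕ}
    (hH : s.HasHeap s.key N H W m) (hn : n ≤ N) (hkn : k * n ≤ W) :
    Runs W growTreeC s fun t s' => Reached I σ r s' ∧ s.Framed s' ∧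
      (∃ m', s'.HasHeap s'.key N H W m') ∧ t ≤ n * (growCost k H + 200 * (H + 1) + 100) := by
  have hr := r.isLt
  set c := growCost k H + 200 * (H + 1) + 80 with hc
  have hw : 1 ≤ W := Heap.le_word hH.env.word (by omega)
  have c1 : (19 ::= 1).cost = 2 := rfl
  have c2 : (BExp.neq (V 19) 1).time = 3 := rfl
  have c3 : (BExp.conj (.neq (.cell 7 (V 55)) 1) (.neg (.rle (.var 1) (.cell 3 (V 55))))).time = 10 :=
    rfl
  have c4 : (Cmd.setR 0 (.var 1)).cost = 2 := rfl
  have c5 : (19 ::= 0).cost = 2 := rfl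
  refine Runs.wp_seq ⟨by simpa using hw, ?_⟩
  simp only [NExp.val_one]
  have hnear : ∀ v, s.Framed { s with nvar := Function.update s.nvar 19 v } := fun v =>
    ⟨fun x hx => Function.update_of_ne (by omega) _ _, fun _ _ => rfl, fun _ _ => rfl⟩
  -- The ghost `g` counts the slots outside the tree, plus one for the last round, in which a free
  -- ad becomes tight.
  refine (Runs.loop (J := fun (g : ℕ) s' => s.Framed s' ∧ (∃ m', s'.HasHeap s'.key N H W m') ∧
    ((s'.nvar 19 = 1 ∧ ∃ σ', Relation.ReflTransGen I.Step σ σ' ∧ σ'.M = σ.M ∧ I.InPhase σ' r ∧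
      (∀ a ∈ treeAds σ'.B, Matched σ'.M a) ∧ Sim I σ' r s' ∧
      g + (treeSlots r σ'.B).card = n + 1) ∨
      s'.nvar 19 = 0 ∧ g = 0 ∧ Reached I σ r s')) (Φ := fun g => g * c) ?_
    (n + 1 - (treeSlots r σ.B).card) ⟨hnear 1, ⟨m, hH.congr ⟨fun x hx =>
      Function.update_of_ne (by omega) _ _, fun _ _ => rfl⟩⟩, Or.inl ⟨by simp, σ, .refl, rfl, h, hA,
      ?_, ?_⟩⟩).mono ?_
  · rintro g s1 ⟨f1, ⟨m1, f2⟩, f3⟩ hb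
    simp only [BExp.holds_neq, NExp.val_var, NExp.val_one] at hb
    obtain ⟨-, σ', g1, g2, g3, g4, g5, g6⟩ : _ := f3.resolve_right (by simp [hb])
    refine (Runs.mono (f2.runs_findC (by omega)) ?_).seq
    rintro t2 s2 ⟨i1, i2, i3, i4, i5⟩
    have hS2 := g5.congr i1
    have hf2 := f1.trans i1.kept.framed
    have hg : 1 ≤ g := by
      have := Finset.card_le_univ (treeSlots r σ'.B)
      rw [Fintype.card_fin] at this
      omega
    obtain ⟨g', rfl⟩ : ∃ g', g = g' + 1 := ⟨g - 1, by omega⟩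
    refine Runs.cond (fun hb => ?_) fun hb => ?_
    · simp only [BExp.holds_conj, BExp.holds_neq, BExp.holds_neg, BExp.holds_rle, NExp.val_cell,
        NExp.val_var, NExp.val_one, RExp.val_var, RExp.val_cell] at hb
      obtain ⟨a, m, l, h1, h2, h3⟩ := hS2.isNext_of_lt_best hn i4 hb.1 (not_le.1 hb.2).le
      have hL2 : Layout I σ'.M r s2 := g2 ▸ hL.congr_framed hf2
      refine (runs_growC hI hk g3 g4 hL2 hS2 i2 hn hkn h1 h2 h3).mono ?_
      rintro t3 s3 ⟨σ'', j1, j2, j3, j4, j5, j6, j7, j8, j9, j10⟩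
      refine ⟨g', ⟨hf2.trans j6, j8, Or.inl ⟨?_, σ'', g1.tail j1, j4.trans g2, j2, j3, j5, ?_⟩⟩, ?_⟩
      · rw [j7, i1.nvar 19 (by simp)]; assumption
      · omega
      · rw [Nat.succ_mul, c2]; omega
    · simp only [BExp.holds_conj, BExp.holds_neq, BExp.holds_neg, BExp.holds_rle, NExp.val_cell,
        NExp.val_var, NExp.val_one, RExp.val_var, RExp.val_cell] at hb
      obtain ⟨a, l, h1, h2, h3, h4, h5⟩ := hS2.isNext_best hn i4 (hS2.hasBest g3 hk g4) hb
      refine Runs.of_wp ⟨by simp, fun t3 ht3 => ⟨0, ⟨hf2.trans ⟨fun x hx =>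
        Function.update_of_ne (by omega) _ _, fun _ _ => rfl, fun _ _ => rfl⟩, ?_, Or.inr ⟨by simp, rfl,
        hS2.reached hI hk g3 g4 h1 h2 h3 h4 h5 g1 g2 rfl rfl (by simp) ?_⟩⟩, ?_⟩⟩
      · obtain ⟨m2, hm2⟩ := i2.hasHeap
        exact ⟨m2, hm2.congr ⟨fun x hx => Function.update_of_ne (by omega) _ _, fun _ _ => rfl⟩⟩
      · rintro x (rfl | rfl) <;> simp
      · rw [show (Cmd.seq (Cmd.setR 0 (.var 1)) (19 ::= 0)).cost = 4 from rfl] at ht3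
        have : 90 ≤ c := by rw [hc, growCost]; omega
        rw [Nat.succ_mul, c2, c3]
        clear_value c
        clear hb hS2 f1
        omega
  · exact hS.set_nvar (by simp) (by simp) (by simp)
  · have := Finset.card_le_univ (treeSlots r σ.B)
    rw [Fintype.card_fin] at this
    omega
  · rintro t1 s1 ⟨g, ⟨f1, f2, f3⟩, hb, ht⟩ t0 ht0
    simp only [BExp.holds_neq, NExp.val_var, NExp.val_one] at hb
    obtain ⟨e1, e2, e3⟩ := f3.resolve_left (by simp [hb])
    refine ⟨e3, f1, f2, ?_⟩
    have hcard : 1 ≤ (treeSlots r σ.B).card := Finset.card_pos.2 ⟨r, root_mem_treeSlots⟩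
    have : (n + 1 - (treeSlots r σ.B).card) * c ≤ n * c := Nat.mul_le_mul_right _ (by omega)
    have h2 : n * (growCost k H + 200 * (H + 1) + 100) = n * c + 20 * n := by rw [hc]; ring
    omega

end AdTypes

/-! ### Augmenting by shifting types along the path -/

namespace AdTypes

variable {k n : ℕ} {I : Instance k n} {σ : HState k n} {r : Fin n} {s s' : Store} {N H W : ℕ}

theorem Runs.loop_true {b : BExp} {c : Cmd} {Q : ℕ → Store → Prop} (hb : b.Holds s)
    (h : Runs W c s fun t s' => Runs W (.loop b c) s' fun t' s'' => Q (b.time + 1 + t + t') s'') :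
    Runs W (.loop b c) s Q := by
  obtain ⟨t, s1, h1, t', s2, h2, h3⟩ := h
  exact ⟨_, _, .loopStep _ _ _ _ _ _ _ hb h1 h2, h3⟩

theorem Runs.loop_false {b : BExp} {c : Cmd} {Q : ℕ → Store → Prop} (hb : ¬ b.Holds s)
    (h : Q (b.time + 1) s) : Runs W (.loop b c) s Q :=
  ⟨_, _, .loopDone _ _ _ hb, h⟩

/-- Every slot of an alternating path is the root or matched on the path. -/
theorem AltPath.slot_cases {M B : Finset (Edge k n)} {a : Ad k n} {A : Finset (Edge k n)}
    (h : AltPath M B r a A) : ∀ c x, (c, x) ∈ A → x = r ∨ ∃ b, (b, x) ∈ A ∧ (b, x) ∈ M := by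
  induction h with
  | last a h1 h2 => simp
  | cons a b j A h1 h2 h3 h4 _ ih =>
    intro c x hcx
    simp only [Finset.mem_insert, Prod.mk.injEq] at hcx
    rcases hcx with ⟨-, rfl⟩ | ⟨-, rfl⟩ | hcx
    · exact Or.inr ⟨b, by simp, h4⟩
    · exact Or.inr ⟨b, by simp, h4⟩
    · exact (ih c x hcx).imp id fun ⟨b', h5, h6⟩ => ⟨b', by simp [h5], h6⟩

theorem AltPath.root_mem {M B : Finset (Edge k n)} {a : Ad k n} {A : Finset (Edge k n)}
    (h : AltPath M B r a A) : ∃ c, (c, r) ∈ A := by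
  induction h with
  | last a h1 h2 => exact ⟨a, by simp⟩
  | cons a b j A h1 h2 h3 h4 _ ih =>
    obtain ⟨c, hc⟩ := ih
    exact ⟨c, by simp [hc]⟩

/-- Shift the types along the path. -/
def shiftC : Cmd :=
  .loop (.neg (.neq (V 16) (V 2)))
    (18 ::= .cell 1 (V 16) ;; .putN 1 (V 16) (V 17) ;; 17 ::= V 18 ;; 16 ::= .cell 6 (V 16))

open Classical in
-- The memory records only types, so augmenting means moving the type of each ad on the path to its
-- parent slot. The variable `16` is the current slot and `17` the type to be written there. The
-- walk ends at the root before writing, which is why the type for `r` is found in `17`. Its length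
-- is counted by the matching edges on the path.
theorem AltPath.runs_shiftC {M B : Finset (Edge k n)} {a : Ad k n} {A : Finset (Edge k n)}
    (h : AltPath M B r a A) (hm : IsMatching M) (hr : ∀ b, (b, r) ∉ M) (hT : IsTree M B r)
    (hkW : k ≤ W) (hnW : n ≤ W) {l : Fin n} (hl : (a, l) ∈ B) (hlM : (a, l) ∉ M) :
    ∀ s : Store, s.nvar 16 = l.val → s.nvar 17 = a.1.val → s.nvar 2 = r.val →
    (∀ b j, (b, j) ∈ M → j ∈ treeSlots r B →
      ∃ x : Fin n, s.narr 6 j.val = x.val ∧ (b, x) ∈ B ∧ (b, x) ∉ M) →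
    (∀ c x, (c, x) ∈ A → (c, x) ∈ M → s.narr 1 x.val = c.1.val) →
    Runs W shiftC s fun t s' => (∀ x < 16, s'.nvar x = s.nvar x) ∧ s'.nvar 17 ≤ W ∧
      (∀ b, b ≠ 1 → s'.narr b = s.narr b) ∧ s'.rvar = s.rvar ∧ s'.rarr = s.rarr ∧
      (∀ x : Fin n, (∀ c, (c, x) ∉ A) → s'.narr 1 x.val = s.narr 1 x.val) ∧
      (∀ c x, (c, x) ∈ A → (c, x) ∉ M →
        (if x = r then s'.nvar 17 else s'.narr 1 x.val) = c.1.val) ∧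
      t ≤ 30 * (A.filter (· ∈ M)).card + 10 := by
  obtain ⟨d, hd⟩ := hT.depth
  have htime : (BExp.neg (.neq (V 16) (V 2))).time = 4 := rfl
  have hcost : (18 ::= .cell 1 (V 16) ;; .putN 1 (V 16) (V 17) ;; 17 ::= V 18 ;;
    16 ::= .cell 6 (V 16)).cost = 11 := rfl
  induction h generalizing l with
  | last a h1 h2 =>
    intro s h16 h17 h2' hpar hty
    obtain rfl := hT.parent_unique _ _ _ hl hlM h1 h2
    refine Runs.loop_false (by simp [h16, h2']) ⟨fun _ _ => rfl, by have := a.1.isLt; omega,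
      fun _ _ => rfl, rfl, rfl, fun _ _ => rfl, ?_, by omega⟩
    intro c x hcx hcM
    simp only [Finset.mem_singleton, Prod.mk.injEq] at hcx
    rw [if_pos hcx.2, h17, hcx.1]
  | cons a b j A h1 h2 h3 h4 hp ih =>
    intro s h16 h17 h2' hpar hty
    obtain rfl := hT.parent_unique _ _ _ hl hlM h1 h2
    have hlr : l ≠ r := by rintro rfl; exact hr _ h4
    have hlT : l ∈ treeSlots r B := mem_treeSlots.2 (Or.inr ⟨_, h1⟩)
    obtain ⟨x, hx, hxB, hxM⟩ := hpar b l h4 hlT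
    have hbA : (b, l) ∉ A := fun h' => (hp.depth_lt hd _ _ h' h4).false
    have hlA : ∀ c, (c, l) ∉ A := by
      intro c hc
      rcases hp.slot_cases c l hc with h | ⟨b', h5, h6⟩
      · exact hlr h
      · exact hbA (hm.ad_eq h6 h4 ▸ h5)
    have hτ : s.narr 1 l.val = b.1.val := hty b l (by simp) h4
    have hbk := b.1.isLt
    have hak := a.1.isLt
    refine Runs.loop_true ?_ (Runs.of_wp ⟨?_, ?_, ?_, ?_, ?_, fun t ht => ?_⟩)
    · simp only [BExp.holds_neg, BExp.holds_neq, NExp.val_var, h16, h2']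
      exact fun h => hlr (Fin.ext h)
    · simp [h16, hτ]; omega
    · simp [h16]; omega
    · simp [h17]; omega
    · simp [h16, hτ]; omega
    · simp [h16, hx]; omega
    · simp (disch := omega) only [NExp.val_var, NExp.val_cell, Function.update_self,
        Function.update_of_ne, h16, h17, hτ, hx]
      refine Runs.mono (ih hxB hxM _ ?_ ?_ ?_ hpar ?_) ?_
      · simp
      · simp
      · simpa using h2'
      · intro c y hy hyM
        dsimp only
        rw [Function.update_self, Function.update_of_ne]
        · exact hty c y (by simp [hy]) hyM
        · intro h'
          obtain rfl := Fin.ext h'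
          exact hlA c hy
      · rintro t1 s1 ⟨e1, e2, e3, e4, e5, e6, e7, e8⟩
        refine ⟨?_, e2, ?_, e4, e5, ?_, ?_, ?_⟩
        · intro y hy
          rw [e1 y hy]
          simp (disch := omega) [Function.update_of_ne]
        · intro c hc
          rw [e3 c hc]
          exact Function.update_of_ne hc _ _
        · intro y hy
          rw [e6 y fun c hc => hy c (by simp [hc])]
          dsimp only
          rw [Function.update_self, Function.update_of_ne]
          intro h'
          obtain rfl := Fin.ext h'
          exact hy a (by simp)
        · intro c y hy hyM
          simp only [Finset.mem_insert, Prod.mk.injEq] at hy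
          rcases hy with ⟨rfl, rfl⟩ | ⟨rfl, rfl⟩ | hy
          · rw [if_neg hlr, e6 _ hlA]
            simp
          · exact absurd h4 hyM
          · exact e7 c y hy hyM
        · rw [Finset.filter_insert, if_neg h2, Finset.filter_insert, if_pos h4,
            Finset.card_insert_of_notMem (by simp [hbA])]
          omega

theorem AltPath.hasTypes_symmDiff {M B : Finset (Edge k n)} {a : Ad k n} {A : Finset (Edge k n)}
    (h : AltPath M B r a A) (hm : IsMatching M) (hr : ∀ b, (b, r) ∉ M) {t t' : ℕ → ℕ}
    (ht : HasTypes M t) (h1 : ∀ x : Fin n, (∀ c, (c, x) ∉ A) → t' x.val = t x.val)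
    (h2 : ∀ c x, (c, x) ∈ A → (c, x) ∉ M → t' x.val = c.1.val) : HasTypes (symmDiff M A) t' := by
  intro c x hcx
  rcases Finset.mem_symmDiff.1 hcx with ⟨h3, h4⟩ | ⟨h3, h4⟩
  · rw [h1 x, ht c x h3]
    intro b hb
    rcases h.slot_cases b x hb with rfl | ⟨b', h5, h6⟩
    · exact hr _ h3
    · exact h4 (hm.ad_eq h6 h3 ▸ h5)
  · exact h2 c x h3 h4

theorem IsMatching.card_le {M : Finset (Edge k n)} (hm : IsMatching M) : M.card ≤ n := by
  have := Finset.card_le_card_of_injOn (t := Finset.univ) (fun e : Edge k n => e.2) (by simp)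
    (fun e he f hf h => hm e he f hf (Or.inr h))
  simpa using this

/-- Run `c` while the counter `x` is less than the variable `b`. -/
def forC (x b : ℕ) (c : Cmd) : Cmd := .loop (.nlt (V x) (V b)) (c ;; x ::= V x + 1)

theorem runs_forC {x b lo hi T : ℕ} {c : Cmd} (P : ℕ → Store → Prop) (hW : hi ≤ W)
    (hb : ∀ i s, P i s → s.nvar b = hi)
    (hc : ∀ i s, lo ≤ i → i < hi → s.nvar x = i → P i s → Runs W c s fun t s' => t ≤ T ∧
      s'.nvar x = i ∧ P (i + 1) { s' with nvar := Function.update s'.nvar x (i + 1) })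
    (hlo : lo ≤ hi) (hx : s.nvar x = lo) (h0 : P lo s) :
    Runs W (forC x b c) s fun t s' => P hi s' ∧ s'.nvar x = hi ∧ t ≤ (hi - lo) * (T + 9) + 5 := by
  have h1 : (BExp.nlt (V x) (V b)).time = 4 := rfl
  have h2 : (x ::= V x + 1).cost = 4 := rfl
  refine (Runs.loop (J := fun i s' => s'.nvar x = i ∧ lo ≤ i ∧ i ≤ hi ∧ P i s')
    (Φ := fun i => (hi - i) * (T + 9)) ?_ lo ⟨hx, le_rfl, hlo, h0⟩).mono ?_
  · rintro i s1 ⟨e1, e2, e3, e4⟩ hi'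
    simp only [BExp.holds_neg, BExp.holds_nle, NExp.val_var, e1, hb i s1 e4, not_le] at hi'
    refine (Runs.mono (hc i s1 e2 hi' e1 e4) ?_).seq
    rintro t s2 ⟨f1, f2, f3⟩
    refine Runs.of_wp ⟨by simp [f2]; omega, fun t2 ht2 => ⟨i + 1, ⟨by simp [f2], by omega, hi', ?_⟩, ?_⟩⟩
    · simpa [f2] using f3
    · rw [show hi - i = hi - (i + 1) + 1 by omega, Nat.succ_mul, h1]; omega
  · rintro t s1 ⟨i, ⟨e1, e2, e3, e4⟩, e5, e6⟩
    simp only [BExp.holds_neg, BExp.holds_nle, NExp.val_var, e1, hb i s1 e4, not_not] at e5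
    obtain rfl : i = hi := by omega
    exact ⟨e4, e1, by rw [h1] at e6; simp only [Nat.sub_self, Nat.zero_mul] at e6; omega⟩

/-- Store the new prices. -/
def pricesC : Cmd :=
  6 ::= 0 ;; forC 6 1 (.cond (.neq (.cell 5 (V 6)) 1)
    (.putR 2 (V 6) (.cell 2 (V 6) - (.var 0 - .cell 4 (V 6)))) .skip)

/-- Update the prices and augment the matching. -/
def endC : Cmd := pricesC ;; 16 ::= V 14 ;; 17 ::= V 13 ;; shiftC ;; .putN 1 (V 2) (V 17)

theorem TreeSim.runs_pricesC (h : TreeSim σ r s) (hn : s.nvar 1 = n) (hW : n ≤ W) :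
    Runs W pricesC s fun t s' => (∀ x, x ≠ 6 → s'.nvar x = s.nvar x) ∧ s'.narr = s.narr ∧
      (∀ a, a ≠ 2 → s'.rarr a = s.rarr a) ∧ (∀ j : Fin n, s'.rarr 2 j.val = σ.p j) ∧
      t ≤ n * 50 + 10 := by
  have hc : (Cmd.cond (.neq (.cell 5 (V 6)) 1)
    (.putR 2 (V 6) (.cell 2 (V 6) - (.var 0 - .cell 4 (V 6)))) .skip).cost ≤ 20 := by decide
  have hc1 : (6 ::= 0).cost = 2 := rfl
  refine Runs.wp_seq ⟨by simp, (runs_forC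
    (s := { s with nvar := Function.update s.nvar 6 0 }) (lo := 0) (hi := n) (T := 20) (fun i s' =>
    (∀ x, x ≠ 6 → s'.nvar x = s.nvar x) ∧ s'.narr = s.narr ∧ s'.rvar = s.rvar ∧
      (∀ a, a ≠ 2 → s'.rarr a = s.rarr a) ∧
      (∀ j : Fin n, s'.rarr 2 j.val = if j.val < i then σ.p j else s.rarr 2 j.val)) hW ?_ ?_
      (Nat.zero_le _) (by simp) ⟨fun x hx => Function.update_of_ne hx _ _, rfl, rfl, fun _ _ => rfl,
        by simp⟩).mono ?_⟩
  · rintro i s1 ⟨h1, -⟩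
    rw [h1 1 (by simp), hn]
  · rintro i s1 - hi h6 ⟨h1, h2, h3, h4, h5⟩
    have hsucc : ∀ j : Fin n, j.val ≠ i → (if j.val < i + 1 then σ.p j else s.rarr 2 j.val) =
        if j.val < i then σ.p j else s.rarr 2 j.val := fun j hj => by
      split_ifs <;> first | rfl | omega
    refine Runs.of_wp ⟨fun hb => ⟨by simp [h6]; omega, fun t ht => ⟨ht.trans hc, h6, ?_⟩⟩,
      fun hb t ht => ⟨ht.trans hc, h6, ?_⟩⟩
    all_goals
      simp only [BExp.holds_neq, NExp.val_cell, NExp.val_var, NExp.val_one, h6, h2] at hb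
      have hb' := h.visited ⟨i, hi⟩
      dsimp only at hb'
    · refine ⟨fun x hx => (Function.update_of_ne hx _ _).trans (h1 x hx), h2, h3, fun a ha =>
        (Function.update_of_ne ha _ _).trans (h4 a ha), fun j => ?_⟩
      simp only [Function.update_self, NExp.val_var, h6]
      by_cases hj : j.val = i
      · obtain rfl : j = ⟨i, hi⟩ := Fin.ext hj
        have h7 := h5 ⟨i, hi⟩
        simp only [lt_irrefl, if_false] at h7
        rw [if_pos (Nat.lt_succ_self _), Function.update_self, h.price_tree _ (hb'.1 hb)]
        simp only [RExp.val_sub, RExp.val_cell, RExp.val_var, NExp.val_var, h6, h7, h3,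
          h4 4 (by simp)]
      · rw [Function.update_of_ne hj, h5, hsucc j hj]
    · refine ⟨fun x hx => (Function.update_of_ne hx _ _).trans (h1 x hx), h2, h3, h4, fun j => ?_⟩
      dsimp only
      by_cases hj : j.val = i
      · obtain rfl : j = ⟨i, hi⟩ := Fin.ext hj
        rw [h5, if_neg (lt_irrefl _), if_pos (Nat.lt_succ_self _), h.price _ (mt hb'.2 hb)]
      · rw [h5, hsucc j hj]
  · rintro t s1 ⟨⟨h1, h2, -, h4, h5⟩, -, h6⟩ t1 ht1
    refine ⟨h1, h2, h4, fun j => ?_, by omega⟩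
    rw [h5 j, if_pos j.isLt]

theorem Store.HasHeap.congr_key {m : ℕ} (h : s.HasHeap s.key N H W m) (hs : s.SameHeap s')
    (h7 : s'.narr 7 = s.narr 7) (h3 : s'.rarr 3 = s.rarr 3) : s'.HasHeap s'.key N H W m := by
  have : s'.key = s.key := by funext x; simp only [key, h7, h3]
  rw [this]
  exact h.congr hs

/-- The memory between two phases: the matching and the prices of a state of the algorithm. -/
structure Interphase (I : Instance k n) (σ : HState k n) (s : Store) : Prop where
  between : I.Between σ
  hasTypes : HasTypes σ.M (s.narr 1)
  prices : ∀ j : Fin n, s.rarr 2 j.val = σ.p j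

/-- In a strict instance the augmented matching is sorted automatically, and this is a step of the
algorithm. Otherwise it is replaced by a sorted matching with the same types and the same duals; the
memory, which records only types and prices, describes this one equally well. -/
theorem Instance.InPhase.exists_between (hI : I.IsMonotone) (h : I.InPhase σ r)
    {A : Finset (Edge k n)} (hA : IsAugmenting σ.M σ.B r A) {t : ℕ → ℕ}
    (ht : HasTypes (symmDiff σ.M A) t) : ∃ σ', I.Between σ' ∧ σ'.rest = r.val ∧ σ'.p = σ.p ∧
      HasTypes σ'.M t ∧ (I.IsStrict → I.Step σ σ') := by
  obtain ⟨hf, hd⟩ := h.augment hA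
  by_cases hst : I.IsStrict
  · exact ⟨_, h.between_of_sorted hf hd (hd.sorted hst hf.matching), h.rest, rfl, ht,
      fun _ => .augment σ r A h.root hA⟩
  · obtain ⟨M', h1, h2, h3, h4⟩ := exists_sorted hI hf hd
    refine ⟨_, h.between_of_sorted h1 h2 h3, h.rest, rfl, fun c j hc => ?_, fun h' => absurd h' hst⟩
    obtain ⟨a, ha⟩ := (hf.slots j).2 ((h1.slots j).1 ⟨c, hc⟩)
    rw [ht a j ha, h4 a c j ha hc]

theorem Reached.runs_endC (hI : I.IsMonotone) (h : Reached I σ r s) (hL : Layout I σ.M r s)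
    {m : ℕ} (hH : s.HasHeap s.key N H W m) (hkW : k ≤ W) (hnW : n ≤ W) :
    Runs W endC s fun t s' => (∃ σ', Interphase I σ' s' ∧ σ'.rest = r.val ∧
      (I.IsStrict → Relation.ReflTransGen I.Step σ σ')) ∧ (∀ x < 6, s'.nvar x = s.nvar x) ∧
      (∀ a < 2, s'.rarr a = s.rarr a) ∧ s'.HasHeap s'.key N H W m ∧
      (∀ x, n ≤ x → s'.narr 7 x ≠ 1) ∧ t ≤ n * 100 + 100 := by
  obtain ⟨σ', a, l, h1, h2, h3, h4, h5, h6, h13, h14⟩ := h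
  have hr := r.isLt
  have hl := l.isLt
  have hak := a.1.isLt
  have hT : HasTypes σ'.M (s.narr 1) := h3 ▸ hL.hasTypes
  obtain ⟨A, hA⟩ := h2.tree.exists_altPath (mem_treeAds.2 ⟨l, h6⟩)
  refine (Runs.mono (h4.runs_pricesC hL.slots hnW) ?_).seq
  rintro t1 s1 ⟨e1, e2, e3, e4, e5⟩
  refine Runs.wp_seq ⟨by simp [e1, h14]; omega, Runs.wp_seq ⟨by simp [e1, h13]; omega, ?_⟩⟩
  refine (Runs.mono (hA.runs_shiftC h2.fills.matching h2.root_free h2.tree hkW hnW h6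
    (fun h' => h5 ⟨l, h'⟩) _ ?_ ?_ ?_ ?_ ?_) ?_).seq
  · simp [e1, h14]
  · simp [e1, h13]
  · simp [e1, hL.root]
  · simpa only [e2] using h4.parent
  · intro c x _ hc
    simpa only [e2] using hT c x hc
  rintro t2 s2 ⟨f1, f2, f3, f4, f5, f6, f7, f8⟩
  have g2 : s2.nvar 2 = r.val := by
    rw [f1 2 (by simp)]
    simp [e1, hL.root]
  have hcard := (Finset.card_le_card (fun e he => (Finset.mem_filter.1 he).2 :
    A.filter (· ∈ σ'.M) ⊆ σ'.M)).trans h2.fills.matching.card_le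
  refine Runs.of_wp ⟨by simp [g2]; omega, by simpa using f2, fun t3 ht3 t4 ht4 t5 ht5 =>
    ⟨?_, ?_, ?_, ?_, ?_, ?_⟩⟩
  -- The last command writes the carried type to the root; only then does the array describe the
  -- augmented matching.
  · have hty := hA.hasTypes_symmDiff (t' := Function.update (s2.narr 1) r.val (s2.nvar 17))
      h2.fills.matching h2.root_free hT ?_ ?_
    · obtain ⟨σ'', k1, k2, k3, k4, k5⟩ := h2.exists_between hI ⟨a, h5, hA⟩ hty
      refine ⟨σ'', ⟨k1, ?_, fun j => ?_⟩, k2, fun hst => h1.tail (k5 hst)⟩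
      · simpa [g2] using k4
      · simp only [f5, k3, e4]
    · intro x hx
      rw [Function.update_of_ne]
      · rw [f6 x hx]
        simp [e2]
      · intro h'
        obtain rfl := Fin.ext h'
        obtain ⟨c, hc⟩ := hA.root_mem
        exact hx c hc
    · intro c x hc hcM
      rw [← f7 c x hc hcM]
      by_cases hx : x = r
      · subst hx; simp
      · rw [if_neg hx, Function.update_of_ne fun h' => hx (Fin.ext h')]
  · intro x hx
    dsimp only
    rw [f1 x (by omega)]
    simp (disch := omega) only [Function.update_of_ne]
    rw [e1 x (by omega)]
  · intro x hx
    dsimp only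
    rw [f5]
    exact e3 x (by omega)
  · have h7 : ∀ b, b ≠ 1 → Function.update s2.narr 1 (Function.update (s2.narr 1) r.val
        (s2.nvar 17)) b = s.narr b := fun b hb => by
      rw [Function.update_of_ne hb, f3 b hb]
      simp [e2]
    simp only [NExp.val_var, g2]
    refine hH.congr_key ⟨fun x hx => ?_, fun b hb => h7 b (by omega)⟩ (h7 7 (by simp)) ?_
    · dsimp only
      rw [f1 x (by omega)]
      simp (disch := omega) only [Function.update_of_ne]
      rw [e1 x (by omega)]
    · dsimp only
      rw [f5]
      exact e3 3 (by simp)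
  · intro x hx
    dsimp only
    rw [show Function.update s2.narr _ _ 7 = s.narr 7 by
      rw [Function.update_of_ne (by simp), f3 7 (by simp)]; simp [e2]]
    exact h4.inq x hx
  · have c1 : (16 ::= V 14).cost = 2 := rfl
    have c2 : (17 ::= V 13).cost = 2 := rfl
    have c3 : (Cmd.putN 1 (V 2) (V 17)).cost = 3 := rfl
    omega

end AdTypes

/-! ### The start of a phase: tables and the first scan -/

namespace AdTypes

variable {k n : ℕ} {I : Instance k n} {σ : HState k n} {r : Fin n} {s s' : Store} {N H W : ℕ}

/-- Empty the queue and the tree. -/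
def resetC : Cmd := 6 ::= 0 ;; forC 6 1 (.putN 5 (V 6) 0 ;; .putN 7 (V 6) 0)

/-- Compute the tables for the matching with the types in the array `1`. -/
def tablesC : Cmd :=
  6 ::= 0 ;; forC 6 0 (8 ::= 0 ;; 7 ::= V 2 ;;
    forC 7 1 (.putN 2 (V 6 * V 1 + V 7) (V 8) ;; .cond (.neq (.cell 1 (V 7)) (V 6))
      (.putN 3 (V 6 * V 1 + V 8) (V 7) ;; 8 ::= V 8 + 1) .skip) ;;
    .putN 4 (V 6) (V 8))

/-- Start the phase of the slot `2`. -/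
def startC : Cmd :=
  resetC ;; .putN 1 (V 2) (V 0) ;; tablesC ;; .setR 0 0 ;; 15 ::= 0 ;; .putN 5 (V 2) 1 ;;
    .putR 4 (V 2) 0 ;; 7 ::= V 2 ;; scanC

theorem row_inj {n a b c d : ℕ} (h : a * n + b = c * n + d) (hb : b < n) (hd : d < n) :
    a = c ∧ b = d := by
  have h1 : (a * n + b) / n = a := by
    rw [Nat.add_comm, Nat.add_mul_div_right _ _ (by omega), Nat.div_eq_of_lt hb, Nat.zero_add]
  have h2 : (c * n + d) / n = c := by
    rw [Nat.add_comm, Nat.add_mul_div_right _ _ (by omega), Nat.div_eq_of_lt hd, Nat.zero_add]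
  have : a = c := by rw [← h1, h, h2]
  subst this
  exact ⟨rfl, by omega⟩

theorem runs_resetC (hn : s.nvar 1 = n) (hW : n ≤ W) (hinq : ∀ x, n ≤ x → s.narr 7 x ≠ 1) :
    Runs W resetC s fun t s' => (∀ x, x ≠ 6 → s'.nvar x = s.nvar x) ∧
      (∀ a, a ≠ 5 → a ≠ 7 → s'.narr a = s.narr a) ∧ s'.rvar = s.rvar ∧ s'.rarr = s.rarr ∧
      (∀ x < n, s'.narr 5 x = 0) ∧ (∀ x, s'.narr 7 x ≠ 1) ∧ t ≤ n * 15 + 10 := by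
  have hc1 : (6 ::= 0).cost = 2 := rfl
  have hc : (Cmd.putN 5 (V 6) 0 ;; .putN 7 (V 6) 0).cost = 6 := rfl
  refine Runs.wp_seq ⟨by simp, (runs_forC (s := { s with nvar := Function.update s.nvar 6 0 })
    (lo := 0) (hi := n) (T := 6) (fun i s' =>
      (∀ x, x ≠ 6 → s'.nvar x = s.nvar x) ∧ (∀ a, a ≠ 5 → a ≠ 7 → s'.narr a = s.narr a) ∧
      s'.rvar = s.rvar ∧ s'.rarr = s.rarr ∧ (∀ x < i, s'.narr 5 x = 0) ∧
      (∀ x, x < i ∨ n ≤ x → s'.narr 7 x ≠ 1)) hW ?_ ?_ (Nat.zero_le _) (by simp)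
      ⟨fun x hx => Function.update_of_ne hx _ _, fun _ _ _ => rfl, rfl, rfl, by simp,
        fun x hx => hinq x (by omega)⟩).mono ?_⟩
  · rintro i s1 ⟨h1, -⟩
    rw [h1 1 (by simp), hn]
  · rintro i s1 - hi h6 ⟨h1, h2, h3, h4, h5, h7⟩
    refine Runs.of_wp ⟨by simp [h6]; omega, by simp, by simp [h6]; omega, by simp, fun t ht =>
      ⟨by omega, h6, fun x hx => (Function.update_of_ne hx _ _).trans (h1 x hx), ?_, h3, h4, ?_, ?_⟩⟩
    · intro a ha ha'
      simp only [Function.update_of_ne ha, Function.update_of_ne ha', h2 a ha ha']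
    · intro x hx
      by_cases hxi : x = i
      · subst hxi; simp [h6]
      · simp [h6, hxi, h5 x (by omega)]
    · intro x hx
      by_cases hxi : x = i
      · subst hxi; simp [h6]
      · simpa [h6, hxi] using h7 x (by omega)
  · rintro t s1 ⟨⟨h1, h2, h3, h4, h5, h7⟩, -, h6⟩ t1 ht1
    exact ⟨h1, h2, h3, h4, h5, fun x => h7 x (by omega), by omega⟩

/-- The tables are filled for the types below `x`, and for the slots below `y` also for the type
`x`. -/
structure Tables (t : ℕ → ℕ) (k n r x y : ℕ) (s : Store) : Prop where
  cnt : ∀ θ j, θ < k → r ≤ j → j < n → θ < x ∨ θ = x ∧ j < y →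
    s.narr 2 (θ * n + j) = typeCount t (r + 1) θ j
  slotOf : ∀ θ j, θ < k → r ≤ j → j < n → θ < x ∨ θ = x ∧ j < y → t j = θ →
    s.narr 3 (θ * n + typeCount t (r + 1) θ j) = j
  tot : ∀ θ < x, s.narr 4 θ = typeCount t (r + 1) θ n

theorem typeCount_of_le {t : ℕ → ℕ} {b θ x : ℕ} (h : x ≤ b) : typeCount t b θ x = 0 := by
  induction x with
  | zero => rfl
  | succ x ih => rw [typeCount_succ, ih (by omega), if_neg (by omega)]

/-- The running count is at once the number of slots of the type before `y` and, if `y` has this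
type, the number of the ad in `y`. So both tables are filled in one pass. -/
theorem Tables.step {t : ℕ → ℕ} {r x y : ℕ} (h : Tables t k n r x y s) (hy : y < n)
    (hrx : t r ≠ x) (hr : r ≤ y)
    (h2 : s'.narr 2 = Function.update (s.narr 2) (x * n + y) (typeCount t (r + 1) x y))
    (h3 : s'.narr 3 = if t y = x then
      Function.update (s.narr 3) (x * n + typeCount t (r + 1) x y) y else s.narr 3)
    (h4 : s'.narr 4 = s.narr 4) : Tables t k n r x (y + 1) s' where
  cnt θ j hθ hj hjn hlt := by
    rw [h2]
    by_cases he : θ * n + j = x * n + y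
    · obtain ⟨rfl, rfl⟩ := row_inj he hjn hy
      rw [Function.update_self]
    · rw [Function.update_of_ne he]
      refine h.cnt θ j hθ hj hjn ?_
      rcases hlt with h' | ⟨rfl, h'⟩
      · exact Or.inl h'
      · exact Or.inr ⟨rfl, by have : j ≠ y := by { rintro rfl; exact he rfl }
                              omega⟩
  slotOf θ j hθ hj hjn hlt hθj := by
    rw [h3]
    have hcj := typeCount_le t (r + 1) θ j
    have hcy := typeCount_le t (r + 1) x y
    by_cases hjy : θ = x ∧ j = y
    · obtain ⟨rfl, rfl⟩ := hjy
      rw [if_pos hθj, Function.update_self]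
    · have hold := h.slotOf θ j hθ hj hjn (by omega) hθj
      split_ifs with hty
      · rw [Function.update_of_ne, hold]
        intro he
        obtain ⟨rfl, he⟩ := row_inj he (by omega) (by omega)
        -- An earlier slot `j` of the same type has a strictly smaller count, so its cell is not
        -- overwritten.
        have hm := typeCount_mono t (r + 1) θ (show j + 1 ≤ y by omega)
        have hrj : r ≠ j := by rintro rfl; exact hrx hθj
        rw [typeCount_succ, if_pos ⟨by omega, hθj⟩] at hm
        omega
      · exact hold
  tot := by rw [h4]; exact h.tot

theorem runs_tablesC (h0 : s.nvar 0 = k) (h1 : s.nvar 1 = n) (h2 : s.nvar 2 = r.val)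
    (hr : s.narr 1 r.val = k) (hn : n ≤ W) (hk : k ≤ W) (hkn : k * n ≤ W) :
    Runs W tablesC s fun t s' =>
      (∀ x, x ≠ 6 → x ≠ 7 → x ≠ 8 → s'.nvar x = s.nvar x) ∧
      (∀ a, a ≠ 2 → a ≠ 3 → a ≠ 4 → s'.narr a = s.narr a) ∧ s'.rvar = s.rvar ∧ s'.rarr = s.rarr ∧
      Tables (s.narr 1) k n r.val k 0 s' ∧ t ≤ k * (n * 50 + 50) + 10 := by
  have hrn := r.isLt
  set τ := s.narr 1 with hτ
  have hc1 : (6 ::= 0).cost = 2 := rfl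
  have hc2 : (8 ::= 0).cost = 2 := rfl
  have hc3 : (7 ::= V 2).cost = 2 := rfl
  have hc4 : (Cmd.putN 4 (V 6) (V 8)).cost = 3 := rfl
  have hc : (Cmd.putN 2 (V 6 * V 1 + V 7) (V 8) ;; .cond (.neq (.cell 1 (V 7)) (V 6))
      (.putN 3 (V 6 * V 1 + V 8) (V 7) ;; 8 ::= V 8 + 1) .skip).cost ≤ 40 := by decide
  generalize hbody : (Cmd.putN 2 (V 6 * V 1 + V 7) (V 8) ;; .cond (.neq (.cell 1 (V 7)) (V 6))
      (.putN 3 (V 6 * V 1 + V 8) (V 7) ;; 8 ::= V 8 + 1) .skip) = body at hc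
  let F : Store → Prop := fun s' => (∀ x, x ≠ 6 → x ≠ 7 → x ≠ 8 → s'.nvar x = s.nvar x) ∧
      (∀ a, a ≠ 2 → a ≠ 3 → a ≠ 4 → s'.narr a = s.narr a) ∧ s'.rvar = s.rvar ∧ s'.rarr = s.rarr
  refine Runs.wp_seq ⟨by simp, (runs_forC (s := { s with nvar := Function.update s.nvar 6 0 })
    (lo := 0) (hi := k) (T := n * 49 + 20) (fun x s' => F s' ∧ Tables τ k n r.val x 0 s') hk ?_ ?_
      (Nat.zero_le _) (by simp) ⟨⟨fun x hx _ _ => Function.update_of_ne hx _ _, fun _ _ _ _ => rfl,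
        rfl, rfl⟩, ⟨by omega, by omega, by omega⟩⟩).mono ?_⟩
  · rintro i s1 ⟨⟨e1, -⟩, -⟩
    rw [e1 0 (by simp) (by simp) (by simp), h0]
  · rintro x s1 - hx h6 ⟨⟨e1, e2, e3, e4⟩, e5⟩
    have e12 : s1.nvar 2 = r.val := by rw [e1 2 (by simp) (by simp) (by simp), h2]
    rw [hbody]
    refine Runs.wp_seq ⟨by simp, Runs.wp_seq ⟨by simp [e12]; omega, ?_⟩⟩
    refine (Runs.mono (runs_forC
      (s := { s1 with
        nvar := Function.update (Function.update s1.nvar 8 0) 7 (Function.update s1.nvar 8 0 2) })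
      (lo := r.val) (hi := n) (T := 40) (fun y s' => F s' ∧
      s'.nvar 6 = x ∧ s'.nvar 8 = typeCount τ (r.val + 1) x y ∧ Tables τ k n r.val x y s') hn ?_ ?_
      hrn.le (by simp [e12]) ⟨⟨fun x hx h7 h8 => ?_, e2, e3, e4⟩, by simp [h6], ?_, ?_⟩) ?_).seq
    · rintro i s1 ⟨⟨e1, -⟩, -⟩
      rw [e1 1 (by simp) (by simp) (by simp), h1]
    · rintro y s2 hy hyn h7 ⟨⟨e1, e2, e3, e4⟩, g6, g8, g⟩
      have e11 : s2.nvar 1 = n := by rw [e1 1 (by simp) (by simp) (by simp), h1]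
      have eτ : s2.narr 1 = τ := e2 1 (by simp) (by simp) (by simp)
      have hcy := typeCount_le τ (r.val + 1) x y
      have hrow := row_lt (θ := (⟨x, hx⟩ : Fin k)) hyn
      dsimp only at hrow
      have hsucc : (if τ y = x then typeCount τ (r.val + 1) x y + 1 else
          typeCount τ (r.val + 1) x y) = typeCount τ (r.val + 1) x (y + 1) := by
        rw [typeCount_succ]
        by_cases hty : τ y = x
        · have : r.val ≠ y := by rintro rfl; omega
          rw [if_pos hty, if_pos ⟨by omega, hty⟩]
        · rw [if_neg hty, if_neg (fun h => hty h.2)]; rfl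
      rw [← hbody] at hc ⊢
      refine Runs.of_wp ⟨by simp [g6, e11, h7]; omega, by simp [g8]; omega, fun hb =>
        ⟨by simp [g6, e11, g8]; omega, by simp [h7]; omega, by simp [g8]; omega, fun t ht =>
        ⟨ht.trans hc, by simpa using h7, ⟨?_, ?_, e3, e4⟩, by simpa using g6, ?_, ?_⟩⟩, fun hb t ht =>
        ⟨ht.trans hc, by simpa using h7, ⟨?_, ?_, e3, e4⟩, by simpa using g6, ?_, ?_⟩⟩
      all_goals simp [h7, eτ, g6] at hb
      · intro z _ hz7 hz8
        simp only [Function.update_of_ne hz7, Function.update_of_ne hz8]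
        exact e1 z ‹_› hz7 hz8
      · intro a ha2 ha3 ha4
        simp only [Function.update_of_ne ha2, Function.update_of_ne ha3, e2 a ha2 ha3 ha4]
      · simp [g8, ← hsucc, hb]
      · refine g.step hyn (by omega) hy ?_ ?_ ?_
        · simp [g6, e11, h7, g8]
        · simp [g6, e11, h7, g8, hb]
        · simp
      · intro z _ hz7 hz8
        simp only [Function.update_of_ne hz7]
        exact e1 z ‹_› hz7 hz8
      · intro a ha2 ha3 ha4
        simp only [Function.update_of_ne ha2, e2 a ha2 ha3 ha4]
      · simp [g8, ← hsucc, hb]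
      · refine g.step hyn (by omega) hy ?_ ?_ ?_
        · simp [g6, e11, h7, g8]
        · simp [hb]
        · simp
    · simp [h7, h8, e1 x hx]
    · rw [typeCount_of_le (by omega)]; simp
    · refine ⟨fun θ j hθ hj hjn hlt => e5.cnt θ j hθ hj hjn (by omega),
        fun θ j hθ hj hjn hlt => e5.slotOf θ j hθ hj hjn (by omega), e5.tot⟩
    · rintro t2 s2 ⟨⟨⟨f1, f2, f3, f4⟩, f6, f8, f⟩, f7, f9⟩
      refine Runs.of_wp ⟨by simp [f6]; omega, by
        have := typeCount_le τ (r.val + 1) x n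
        simp [f8]; omega, fun t3 ht3 t4 ht4 t5 ht5 => ⟨?_, f6, ⟨⟨?_, ?_, f3, f4⟩, ?_⟩⟩⟩
      · have : (n - r.val) * (40 + 9) ≤ n * 49 := Nat.mul_le_mul_right _ (by omega)
        omega
      · intro z hz6 hz7 hz8
        simp only [Function.update_of_ne hz6, f1 z hz6 hz7 hz8]
      · intro a ha2 ha3 ha4
        simp only [Function.update_of_ne ha4, f2 a ha2 ha3 ha4]
      · refine ⟨fun θ j hθ hj hjn hlt => f.cnt θ j hθ hj hjn (by omega),
          fun θ j hθ hj hjn hlt => f.slotOf θ j hθ hj hjn (by omega), fun θ hθ => ?_⟩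
        by_cases hθx : θ = x
        · subst hθx; simp [f6, f8]
        · simpa [f6, hθx] using f.tot θ (by omega)
  · rintro t s1 ⟨⟨⟨f1, f2, f3, f4⟩, f5⟩, -, f6⟩ t1 ht1
    refine ⟨f1, f2, f3, f4, f5, ?_⟩
    have : (k - 0) * (n * 49 + 20 + 9) ≤ k * (n * 50 + 50) :=
      Nat.mul_le_mul (by omega) (by omega)
    omega

def startCost (k n H : ℕ) : ℕ :=
  n * 15 + k * (n * 50 + 50) + Heap.unit * H + (k + 1) * (scanTypeCost + 10) + 100

/-- The part of the memory that does not change after the initialization. -/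
structure Static (I : Instance k n) (s : Store) : Prop where
  types : s.nvar 0 = k
  slots : s.nvar 1 = n
  value : ∀ (θ : Fin k) (i : Fin n), s.rarr 0 (θ.val * n + i.val) = I.v θ i
  discount : ∀ (θ : Fin k) (j : Fin n), s.rarr 1 (θ.val * n + j.val) = I.α θ j

theorem Static.congr (h : Static I s) (h0 : s'.nvar 0 = s.nvar 0) (h1 : s'.nvar 1 = s.nvar 1)
    (hr0 : s'.rarr 0 = s.rarr 0) (hr1 : s'.rarr 1 = s.rarr 1) : Static I s' :=
  ⟨h0.trans h.types, h1.trans h.slots, hr0 ▸ h.value, hr1 ▸ h.discount⟩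

theorem Tables.layout {M : Finset (Edge k n)} (h : Tables (s.narr 1) k n r.val k 0 s)
    (hst : Static I s) (h2 : s.nvar 2 = r.val) (hf : Fills M (r.val + 1)) (hs : Sorted M)
    (ht : HasTypes M (s.narr 1)) (hr : s.narr 1 r.val = k) : Layout I M r s where
  types := hst.types
  slots := hst.slots
  root := h2
  value := hst.value
  discount := hst.discount
  hasTypes := ht
  root_type := hr
  cnt θ j hj := h.cnt θ j θ.isLt hj j.isLt (Or.inl θ.isLt)
  slotOf θ i l hl := by
    have := (hf.slots l).1 ⟨_, hl⟩
    have h1 := h.slotOf θ l θ.isLt (by omega) l.isLt (Or.inl θ.isLt) (ht _ _ hl)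
    rwa [hs.typeCount_eq hf ht hl] at h1
  tot θ := h.tot θ θ.isLt

theorem Interphase.runs_startC (h : Interphase I σ s) (hst : Static I s)
    (hrest : σ.rest = r.val + 1) (h2 : s.nvar 2 = r.val) {m : ℕ} (hH : s.HasHeap s.key N H W m)
    (hinq : ∀ x, n ≤ x → s.narr 7 x ≠ 1) (hn : n ≤ N) (hkn : k * n ≤ W) :
    Runs W startC s fun t s' => ∃ σ', I.Step σ σ' ∧ I.InPhase σ' r ∧ σ'.B = ∅ ∧
      Layout I σ'.M r s' ∧ Sim I σ' r s' ∧ (∀ x < 6, s'.nvar x = s.nvar x) ∧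
      (∀ a < 3, s'.rarr a = s.rarr a) ∧ (∃ m', s'.HasHeap s'.key N H W m') ∧
      t ≤ startCost k n H := by
  have hrn := r.isLt
  have hw : n + 1 ≤ W := Heap.le_word hH.env.word (by omega)
  have hkw : k ≤ W := (Nat.le_mul_of_pos_right k (Fin.pos r)).trans hkn
  have hf : Fills σ.M (r.val + 1) := hrest ▸ h.between.fills
  have hroot : ∀ a, (a, r) ∉ σ.M := fun a ha => by have := (hf.slots r).1 ⟨a, ha⟩; omega
  unfold startC
  refine (Runs.mono (runs_resetC hst.slots (by omega) hinq) ?_).seq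
  rintro t1 s1 ⟨e1, e2, e3, e4, e5, e6, e7⟩
  refine Runs.wp_seq ⟨by simp [e1, h2]; omega, by simp [e1, hst.types]; omega, ?_⟩
  simp only [NExp.val_var, e1 2 (by simp), e1 0 (by simp), h2, hst.types]
  generalize hs2 : Store.mk _ _ _ _ = s2
  have hs2n : s2.nvar = s1.nvar := by subst hs2; rfl
  have hτ : s2.narr 1 = Function.update (s.narr 1) r.val k := by
    subst hs2; simp [e2 1]
  have hs2a : ∀ a, a ≠ 1 → s2.narr a = s1.narr a := by
    subst hs2; exact fun a ha => Function.update_of_ne ha _ _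
  have hs2r : s2.rarr = s1.rarr := by subst hs2; rfl
  clear hs2
  have hroot_type : s2.narr 1 r.val = k := by rw [hτ, Function.update_self]
  have hty : HasTypes σ.M (s2.narr 1) := by
    intro a j haj
    rw [hτ, Function.update_of_ne, h.hasTypes a j haj]
    intro h'
    exact hroot a (Fin.ext h' ▸ haj)
  refine (Runs.mono (runs_tablesC (k := k) (n := n) (r := r) (by rw [hs2n, e1 0 (by simp), hst.types])
    (by rw [hs2n, e1 1 (by simp), hst.slots]) (by rw [hs2n, e1 2 (by simp), h2]) hroot_type
    (by omega) hkw hkn) ?_).seq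
  rintro t3 s3 ⟨f1, f2, f3, f4, f5, f6⟩
  have g2 : s3.nvar 2 = r.val := by rw [f1 2 (by simp) (by simp) (by simp), hs2n, e1 2 (by simp), h2]
  have hnv : ∀ x < 6, s3.nvar x = s.nvar x := fun x hx => by
    rw [f1 x (by omega) (by omega) (by omega), hs2n, e1 x (by omega)]
  have hra : s3.rarr = s.rarr := by rw [f4, hs2r, e4]
  have g7 : s3.narr 7 = s1.narr 7 := by
    rw [f2 7 (by simp) (by simp) (by simp), hs2a 7 (by simp)]
  have g5 : s3.narr 5 = s1.narr 5 := by
    rw [f2 5 (by simp) (by simp) (by simp), hs2a 5 (by simp)]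
  have hτ3 : s3.narr 1 = s2.narr 1 := f2 1 (by simp) (by simp) (by simp)
  refine Runs.wp_seq (Runs.wp_seq ⟨by simp, Runs.wp_seq ⟨by simp [g2]; omega, by simp; omega, Runs.wp_seq
    ⟨by simp [g2]; omega, Runs.wp_seq ⟨by simp [g2]; omega, ?_⟩⟩⟩⟩)
  simp (disch := omega) only [NExp.val_var, NExp.val_zero, NExp.val_one, RExp.val_zero,
    Function.update_of_ne, g2]
  generalize hs4 : Store.mk _ _ _ _ = s4
  have hv4 : ∀ x < 6, s4.nvar x = s.nvar x := by
    subst hs4; intro x hx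
    simp (disch := omega) only [Function.update_of_ne, hnv x hx]
  have hv7 : s4.nvar 7 = r.val := by subst hs4; simp
  have hv15 : s4.nvar 15 = 0 := by subst hs4; simp
  have hn4 : ∀ a, a ≠ 5 → s4.narr a = s3.narr a := by
    subst hs4; exact fun a ha => Function.update_of_ne ha _ _
  have hn5 : s4.narr 5 = Function.update (s3.narr 5) r.val 1 := by subst hs4; simp
  have hr4 : ∀ a, a ≠ 4 → s4.rarr a = s.rarr a := by
    subst hs4; intro a ha
    simp only [Function.update_of_ne ha, hra]
  have hrr : s4.rarr 4 r.val = 0 := by subst hs4; simp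
  have hr0 : s4.rvar 0 = 0 := by subst hs4; simp
  clear hs4
  have hinq4 : ∀ x, s4.narr 7 x ≠ 1 := by rw [hn4 7 (by simp), g7]; exact e6
  have hst4 : Static I s4 := hst.congr (hv4 0 (by simp)) (hv4 1 (by simp)) (hr4 0 (by simp))
    (hr4 1 (by simp))
  -- After the reset every key is `⊤`, so any heap structure left by the previous phase is in order
  -- and need not be rebuilt.
  have hH4 : s4.HasHeap s4.key N H W m := by
    refine (hH.rekey fun x _ => ?_).congr ⟨fun x hx => hv4 x (by omega), fun a ha => ?_⟩
    · simp only [Store.key, if_neg (hinq4 x)]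
    · rw [hn4 a (by omega), f2 a (by omega) (by omega) (by omega), hs2a a (by omega),
        e2 a (by omega) (by omega)]
  have hL : Layout I σ.M r s4 := by
    have hτ4 : s4.narr 1 = s2.narr 1 := (hn4 1 (by simp)).trans hτ3
    refine Tables.layout ?_ hst4 ((hv4 2 (by simp)).trans h2) hf h.between.sorted (hτ4 ▸ hty)
      (hτ4 ▸ hroot_type)
    rw [hτ4]
    exact ⟨hn4 2 (by simp) ▸ f5.cnt, hn4 3 (by simp) ▸ f5.slotOf, hn4 4 (by simp) ▸ f5.tot⟩
  have htS : ∀ j : Fin n, j ∈ treeSlots r (∅ : Finset (Edge k n)) ↔ j = r := by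
    simp [mem_treeSlots]
  have hphase := h.between.enter hrest
  have hsc := Instance.Scannable.mk (I := I) (r := r) (j := r)
    (σ := { σ with rest := r.val, root := some r, B := ∅, P := fun _ => none }) hf h.between.sorted
    h.between.dual.tight (fun a l hal => by
      rw [htS]
      simp only [treeAds, Finset.image_empty, Finset.notMem_empty, false_iff]
      rintro rfl; exact hroot a hal)
    (fun a ha => ⟨by simp [treeAds], h.between.dual.free a ha⟩) root_mem_treeSlots le_rfl
  have hS : Sim I { σ with rest := r.val, root := some r, B := ∅, P := fun _ => none } r s4 := by
    constructor
    · intro j hj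
      rw [htS] at hj
      subst hj
      simp only [hr4 2 (by simp), h.prices, hr0, hrr]; ring
    · intro j _
      simp only [hr4 2 (by simp), h.prices]
    · intro j
      rw [htS, hn5, g5]
      by_cases hj : j = r
      · subst hj; simp
      · rw [Function.update_of_ne fun h' => hj (Fin.ext h'), e5 j j.isLt]
        simp [hj]
    · intro a j haj hj
      rw [htS] at hj
      subst hj
      exact absurd haj (hroot a)
    · simp
    · intro x hx
      exact absurd hx (hinq4 x)
    · simp
    · simp [hv15]
  refine (runs_scanC hsc hL hS hH4 hv7 (by rw [hrr, hr0]) hn hkn).mono ?_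
  rintro t5 s5 ⟨k1, k2, m', k3, k4⟩ u1 hu1 u2 hu2 u3 hu3 u4 hu4 u5 hu5 u6 hu6
  refine ⟨_, .enter σ r h.between.root hrest, hphase, rfl, hL.congr k1, k2, fun x hx => ?_,
    fun a ha => ?_, ⟨m', k3⟩, ?_⟩
  · rw [k1.nvar x (by omega), hv4 x hx]
  · rw [k1.rarr a (by omega) (by omega), hr4 a (by omega)]
  · have hm1 := Nat.mul_le_mul_left Heap.unit hH4.le
    have c1 : (Cmd.putN 1 (V 2) (V 0)).cost = 3 := rfl
    have c2 : (Cmd.setR 0 0).cost = 2 := rfl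
    have c3 : (15 ::= 0).cost = 2 := rfl
    have c4 : (Cmd.putN 5 (V 2) 1).cost = 3 := rfl
    have c5 : (Cmd.putR 4 (V 2) 0).cost = 3 := rfl
    have c6 : (7 ::= V 2).cost = 2 := rfl
    unfold startCost
    omega

end AdTypes

/-! ### All phases and the initial prices -/

namespace AdTypes

variable {k n : ℕ} {I : Instance k n} {σ : HState k n} {r : Fin n} {s s' : Store} {N H W : ℕ}

/-- The phase of the slot `2`. -/
def phaseC : Cmd := startC ;; growTreeC ;; endC

/-- All phases; the variable `2` holds the number of the remaining slots. -/
def phasesC : Cmd := .loop (.nlt 0 (V 2)) (2 ::= V 2 - 1 ;; phaseC)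

def phaseCost (k n H : ℕ) : ℕ :=
  startCost k n H + n * (growCost k H + 200 * (H + 1) + 100) + (n * 100 + 100)

theorem Interphase.runs_phaseC (hI : I.IsMonotone) (hk : 0 < k) (h : Interphase I σ s)
    (hst : Static I s) (hrest : σ.rest = r.val + 1) (h2 : s.nvar 2 = r.val) {m : ℕ}
    (hH : s.HasHeap s.key N H W m) (hinq : ∀ x, n ≤ x → s.narr 7 x ≠ 1) (hn : n ≤ N)
    (hkn : k * n ≤ W) :
    Runs W phaseC s fun t s' => (∃ σ', Interphase I σ' s' ∧ σ'.rest = r.val ∧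
      (I.IsStrict → Relation.ReflTransGen I.Step σ σ')) ∧ Static I s' ∧ s'.nvar 2 = r.val ∧
      (∃ m', s'.HasHeap s'.key N H W m') ∧ (∀ x, n ≤ x → s'.narr 7 x ≠ 1) ∧
      t ≤ phaseCost k n H := by
  have hw : n + 1 ≤ W := Heap.le_word hH.env.word (by omega)
  have hkw : k ≤ W := (Nat.le_mul_of_pos_right k (Fin.pos r)).trans hkn
  refine (Runs.mono (h.runs_startC hst hrest h2 hH hinq hn hkn) ?_).seq
  rintro t1 s1 ⟨σ1, e1, e2, e3, e4, e5, e6, e7, ⟨m1, e8⟩, e9⟩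
  refine (Runs.mono (runs_growTreeC hI hk e2 (by simp [e3, treeAds]) e4 e5 e8 hn hkn) ?_).seq
  rintro t2 s2 ⟨f1, f2, ⟨m2, f3⟩, f4⟩
  refine (f1.runs_endC hI (e4.congr_framed f2) f3 hkw (by omega)).mono ?_
  rintro t3 s3 ⟨⟨σ3, g1, g2, g3⟩, g4, g5, g6, g7, g8⟩
  refine ⟨⟨σ3, g1, g2, fun hs => (g3 hs).head e1⟩, hst.congr ?_ ?_ ?_ ?_, ?_, ⟨m2, g6⟩, g7, ?_⟩
  · rw [g4 0 (by simp), f2.nvar 0 (by simp), e6 0 (by simp)]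
  · rw [g4 1 (by simp), f2.nvar 1 (by simp), e6 1 (by simp)]
  · rw [g5 0 (by simp), f2.rarr 0 (by simp), e7 0 (by simp)]
  · rw [g5 1 (by simp), f2.rarr 1 (by simp), e7 1 (by simp)]
  · rw [g4 2 (by simp), f2.nvar 2 (by simp), e6 2 (by simp), h2]
  · unfold phaseCost; omega

theorem Interphase.runs_phasesC (hI : I.IsMonotone) (hk : 0 < k) (h : Interphase I σ s)
    (hst : Static I s) (hrest : σ.rest = n) (h2 : s.nvar 2 = n) {m : ℕ}
    (hH : s.HasHeap s.key N H W m) (hinq : ∀ x, n ≤ x → s.narr 7 x ≠ 1) (hn : n ≤ N)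
    (hkn : k * n ≤ W) :
    Runs W phasesC s fun t s' => (∃ σ', Interphase I σ' s' ∧ σ'.rest = 0 ∧
      (I.IsStrict → Relation.ReflTransGen I.Step σ σ')) ∧ Static I s' ∧
      t ≤ n * (phaseCost k n H + 9) + 5 := by
  have hw : n + 1 ≤ W := Heap.le_word hH.env.word (by omega)
  have c1 : (BExp.nlt 0 (V 2)).time = 4 := rfl
  have c2 : (2 ::= V 2 - 1).cost = 4 := rfl
  refine (Runs.loop (J := fun ρ s' => (∃ σ', Interphase I σ' s' ∧ σ'.rest = ρ ∧
      (I.IsStrict → Relation.ReflTransGen I.Step σ σ')) ∧ Static I s' ∧ s'.nvar 2 = ρ ∧ ρ ≤ n ∧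
      (∃ m', s'.HasHeap s'.key N H W m') ∧ (∀ x, n ≤ x → s'.narr 7 x ≠ 1))
    (Φ := fun ρ => ρ * (phaseCost k n H + 9)) ?_ n
    ⟨⟨σ, h, hrest, fun _ => .refl⟩, hst, h2, le_rfl, ⟨m, hH⟩, hinq⟩).mono ?_
  · rintro ρ s1 ⟨⟨σ1, e1, e2, e3⟩, e4, e5, e6, ⟨m1, e7⟩, e8⟩ hb
    simp only [BExp.holds_neg, BExp.holds_nle, NExp.val_zero, NExp.val_var, e5] at hb
    obtain ⟨r, rfl⟩ : ∃ r, ρ = r + 1 := ⟨ρ - 1, by omega⟩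
    have hval : NExp.val s1 (V 2 - 1) = r := by simp [e5]
    refine Runs.wp_seq ⟨by omega, ?_⟩
    rw [hval]
    refine (Interphase.runs_phaseC (s := { s1 with nvar := Function.update s1.nvar 2 r })
      (r := ⟨r, e6⟩) hI hk ⟨e1.between, e1.hasTypes, e1.prices⟩
      (e4.congr (by simp) (by simp) rfl rfl) e2 (by simp) (e7.congr_key ⟨fun x hx =>
        Function.update_of_ne (by omega) _ _, fun _ _ => rfl⟩ rfl rfl) e8 hn hkn).mono ?_
    rintro t2 s2 ⟨⟨σ2, f1, f2, f3⟩, f4, f5, f6, f7, f8⟩ t3 ht3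
    refine ⟨r, ⟨⟨σ2, f1, f2, fun hs => (e3 hs).trans (f3 hs)⟩, f4, f5, by omega, f6, f7⟩, ?_⟩
    rw [c1, Nat.succ_mul]; omega
  · rintro t s1 ⟨ρ, ⟨e1, e4, e5, -⟩, hb, ht⟩
    simp only [BExp.holds_neg, BExp.holds_nle, NExp.val_zero, NExp.val_var, e5] at hb
    obtain rfl : ρ = 0 := by omega
    exact ⟨e1, e4, by rw [c1] at ht; simp only [Nat.zero_mul] at ht; omega⟩

/-- Store the largest weight of an edge in all cells of the real array `2`. -/
def initPricesC : Cmd :=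
  6 ::= 0 ;; forC 6 0 (.cond (.rle (.cell 0 (V 6 * V 1) * .cell 1 (V 6 * V 1)) (.var 0)) .skip
    (.setR 0 (.cell 0 (V 6 * V 1) * .cell 1 (V 6 * V 1)))) ;;
  6 ::= 0 ;; forC 6 1 (.putR 2 (V 6) (.var 0))

/-- By monotonicity the heaviest edge of a type joins its first ad to the first slot, so the maximum
is found with `k` products. -/
theorem Instance.IsMonotone.iSup_eq (hI : I.IsMonotone) (hk : 0 < k) (hn : 0 < n) {x : ℝ}
    (h1 : x ≤ ⨆ e : Edge k n, I.w e.1 e.2)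
    (h2 : ∀ θ : Fin k, I.v θ ⟨0, hn⟩ * I.α θ ⟨0, hn⟩ ≤ x) : x = ⨆ e : Edge k n, I.w e.1 e.2 := by
  have : Nonempty (Edge k n) := ⟨((⟨0, hk⟩, ⟨0, hn⟩), ⟨0, hn⟩)⟩
  refine le_antisymm h1 (ciSup_le fun ⟨⟨θ, i⟩, j⟩ => le_trans ?_ (h2 θ))
  obtain ⟨ha, hb, hc, hd⟩ := hI θ
  exact mul_le_mul (ha (Fin.mk_le_mk.2 (Nat.zero_le _))) (hb (Fin.mk_le_mk.2 (Nat.zero_le _)))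
    (hd j) (hc _)

theorem Static.runs_initPricesC (hst : Static I s) (hI : I.IsMonotone) (hk : 0 < k) (hn : 0 < n)
    (hkW : k ≤ W) (hnW : n ≤ W) (h0 : s.rvar 0 = 0) :
    Runs W initPricesC s fun t s' => (∀ x, x ≠ 6 → s'.nvar x = s.nvar x) ∧ s'.narr = s.narr ∧
      (∀ a, a ≠ 2 → s'.rarr a = s.rarr a) ∧
      (∀ j : Fin n, s'.rarr 2 j.val = ⨆ e : Edge k n, I.w e.1 e.2) ∧
      t ≤ k * 50 + n * 50 + 20 := by
  set p := ⨆ e : Edge k n, I.w e.1 e.2 with hp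
  have hbdd : BddAbove (Set.range fun e : Edge k n => I.w e.1 e.2) := Set.finite_range _ |>.bddAbove
  have hle : ∀ θ : Fin k, I.v θ ⟨0, hn⟩ * I.α θ ⟨0, hn⟩ ≤ p := fun θ =>
    le_ciSup hbdd ((θ, ⟨0, hn⟩), ⟨0, hn⟩)
  have hp0 : 0 ≤ p := le_trans (mul_nonneg ((hI ⟨0, hk⟩).2.2.1 _) ((hI ⟨0, hk⟩).2.2.2 _)) (hle ⟨0, hk⟩)
  have c1 : (6 ::= 0).cost = 2 := rfl
  have c2 : (Cmd.cond (.rle (.cell 0 (V 6 * V 1) * .cell 1 (V 6 * V 1)) (.var 0)) .skip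
    (.setR 0 (.cell 0 (V 6 * V 1) * .cell 1 (V 6 * V 1)))).cost ≤ 30 := by decide
  have c3 : (Cmd.putR 2 (V 6) (.var 0)).cost = 3 := rfl
  refine Runs.wp_seq ⟨by simp, (Runs.mono (runs_forC
    (s := { s with nvar := Function.update s.nvar 6 0 }) (lo := 0) (hi := k) (T := 30) (fun x s' =>
    (∀ x, x ≠ 6 → s'.nvar x = s.nvar x) ∧ s'.narr = s.narr ∧ s'.rarr = s.rarr ∧ s'.rvar 0 ≤ p ∧
      ∀ θ : Fin k, θ.val < x → I.v θ ⟨0, hn⟩ * I.α θ ⟨0, hn⟩ ≤ s'.rvar 0) hkW ?_ ?_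
      (Nat.zero_le _) (by simp) ⟨fun x hx => Function.update_of_ne hx _ _, rfl, rfl,
        by simpa [h0] using hp0, by simp⟩) ?_).seq⟩
  · rintro i s1 ⟨h1, -⟩
    rw [h1 0 (by simp), hst.types]
  · rintro x s1 - hx h6 ⟨h1, h2, h3, h4, h5⟩
    have hval : RExp.val s1 (.cell 0 (V 6 * V 1) * .cell 1 (V 6 * V 1)) =
        I.v ⟨x, hx⟩ ⟨0, hn⟩ * I.α ⟨x, hx⟩ ⟨0, hn⟩ := by
      simp only [RExp.val_mul, RExp.val_cell, NExp.val_mul, NExp.val_var, h6, h3, h1 1 (by simp),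
        hst.slots]
      rw [← hst.value, ← hst.discount]; rfl
    refine Runs.of_wp ⟨fun hb t ht => ⟨ht.trans c2, h6, ?_⟩, fun hb t ht => ⟨ht.trans c2, h6, ?_⟩⟩
    all_goals rw [BExp.holds_rle, hval, RExp.val_var] at hb
    · refine ⟨fun y hy => (Function.update_of_ne hy _ _).trans (h1 y hy), h2, h3, h4, fun θ hθ => ?_⟩
      by_cases hθx : θ.val = x
      · subst hθx; exact hb
      · exact h5 θ (by omega)
    · refine ⟨fun y hy => (Function.update_of_ne hy _ _).trans (h1 y hy), h2, h3, ?_, fun θ hθ => ?_⟩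
      · simp only [Function.update_self, hval, hle]
      · simp only [Function.update_self, hval]
        by_cases hθx : θ.val = x
        · subst hθx; exact le_rfl
        · exact (h5 θ (by omega)).trans (not_le.1 hb).le
  · rintro t1 s1 ⟨⟨h1, h2, h3, h4, h5⟩, -, h6⟩
    have hx := hI.iSup_eq hk hn h4 fun θ => h5 θ θ.isLt
    refine Runs.wp_seq ⟨by simp, (runs_forC
      (s := { s1 with nvar := Function.update s1.nvar 6 0 }) (lo := 0) (hi := n) (T := 3) (fun x s' =>
      (∀ x, x ≠ 6 → s'.nvar x = s.nvar x) ∧ s'.narr = s.narr ∧ (∀ a, a ≠ 2 → s'.rarr a = s.rarr a) ∧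
        s'.rvar 0 = p ∧ ∀ j < x, s'.rarr 2 j = p) hnW ?_ ?_
        (Nat.zero_le _) (by simp) ⟨fun x hx => ?_, h2, fun a _ => by rw [← h3], hx, by simp⟩).mono ?_⟩
    · rintro i s1 ⟨h1, -⟩
      rw [h1 1 (by simp), hst.slots]
    · rintro x s2 - hxn g6 ⟨g1, g2, g3, g4, g5⟩
      refine Runs.of_wp ⟨by simp [g6]; omega, fun t ht => ⟨by omega, g6, fun y hy =>
        (Function.update_of_ne hy _ _).trans (g1 y hy), g2, fun a ha =>
        (Function.update_of_ne ha _ _).trans (g3 a ha), g4, fun j hj => ?_⟩⟩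
      by_cases hjx : j = x
      · subst hjx; simp [g6, g4]
      · simpa [g6, hjx] using g5 j (by omega)
    · exact (Function.update_of_ne hx _ _).trans (h1 x hx)
    · rintro t2 s2 ⟨⟨g1, g2, g3, g4, g5⟩, -, g6⟩ t3 ht3 t4 ht4
      exact ⟨g1, g2, g3, fun j => g5 j j.isLt, by omega⟩

end AdTypes

/-! ### The output and the total running time -/

namespace AdTypes

variable {k n : ℕ} {I : Instance k n} {σ : HState k n} {s s' : Store} {N H W : ℕ}

/-- Write the output. -/
def outputC : Cmd :=
  6 ::= 0 ;; forC 6 0 (.putN 4 (V 6) 0) ;;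
  7 ::= 0 ;; forC 7 1 (6 ::= .cell 1 (V 7) ;; .putN 0 (V 7) (V 6 * V 1 + .cell 4 (V 6) + 1) ;;
    .putN 4 (V 6) (.cell 4 (V 6) + 1))

/-- In a sorted matching the number of the ad in a slot is the number of earlier slots of its type,
hence one counter per type suffices. -/
theorem Interphase.runs_outputC (h : Interphase I σ s) (hst : Static I s) (hrest : σ.rest = 0)
    (hk : k ≤ W) (hn : n ≤ W) (hkn : k * n ≤ W) :
    Runs W outputC s fun t s' => s'.output k n = σ.M ∧ t ≤ k * 20 + n * 50 + 20 := by
  set τ := s.narr 1 with hτ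
  have hf : Fills σ.M 0 := hrest ▸ h.between.fills
  have hs := h.between.sorted
  have hτk : ∀ j < n, τ j < k := fun j hj => by
    obtain ⟨a, ha⟩ := (hf.slots ⟨j, hj⟩).2 (Nat.zero_le _)
    exact lt_of_eq_of_lt (h.hasTypes a _ ha) a.1.isLt
  have c1 : (6 ::= 0).cost = 2 := rfl
  have c2 : (7 ::= 0).cost = 2 := rfl
  have c3 : (Cmd.putN 4 (V 6) 0).cost = 3 := rfl
  have c4 : (6 ::= .cell 1 (V 7) ;; .putN 0 (V 7) (V 6 * V 1 + .cell 4 (V 6) + 1) ;;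
    .putN 4 (V 6) (.cell 4 (V 6) + 1)).cost ≤ 30 := by decide
  refine Runs.wp_seq ⟨by simp, (Runs.mono (runs_forC
    (s := { s with nvar := Function.update s.nvar 6 0 }) (lo := 0) (hi := k) (T := 3) (fun x s' =>
    (∀ x, x ≠ 6 → s'.nvar x = s.nvar x) ∧ s'.narr 1 = τ ∧ ∀ θ < x, s'.narr 4 θ = 0) hk ?_ ?_
      (Nat.zero_le _) (by simp) ⟨fun x hx => Function.update_of_ne hx _ _, rfl, by simp⟩) ?_).seq⟩
  · rintro i s1 ⟨h1, -⟩
    rw [h1 0 (by simp), hst.types]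
  · rintro x s1 - hx h6 ⟨h1, h2, h3⟩
    refine Runs.of_wp ⟨by simp [h6]; omega, by simp, fun t ht => ⟨by omega, h6, fun y hy =>
      (Function.update_of_ne hy _ _).trans (h1 y hy), by simpa using h2, fun θ hθ => ?_⟩⟩
    by_cases hθx : θ = x
    · subst hθx; simp [h6]
    · simpa [h6, hθx] using h3 θ (by omega)
  · rintro t1 s1 ⟨⟨h1, h2, h3⟩, -, h6⟩
    refine Runs.wp_seq ⟨by simp, (runs_forC
      (s := { s1 with nvar := Function.update s1.nvar 7 0 }) (lo := 0) (hi := n) (T := 30) (fun y s' =>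
      s'.nvar 1 = n ∧ s'.narr 1 = τ ∧ (∀ θ < k, s'.narr 4 θ = typeCount τ 0 θ y) ∧
        ∀ j < y, s'.narr 0 j = τ j * n + typeCount τ 0 (τ j) j + 1) hn ?_ ?_
        (Nat.zero_le _) (by simp) ⟨?_, h2, h3, by simp⟩).mono ?_⟩
    · rintro i s2 ⟨h1, -⟩
      exact h1
    · rintro y s2 - hy g7 ⟨g1, g2, g3, g4⟩
      have hty := hτk y hy
      have hc := typeCount_le τ 0 (τ y) y
      have hrow := row_lt (θ := (⟨τ y, hty⟩ : Fin k)) (n := n) (i := typeCount τ 0 (τ y) y) (by omega)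
      dsimp only at hrow
      refine Runs.of_wp ⟨?_, ?_, ?_, ?_, ?_, fun t ht => ⟨ht.trans c4, ?_, ?_, ?_, ?_, ?_⟩⟩
      · simp [g2, g7]; omega
      · simp [g7]; omega
      · simp [g2, g7, g1, g3 _ hty]; omega
      · simp [g2, g7]; omega
      · simp [g2, g7, g3 _ hty]; omega
      · simpa using g7
      · simpa using g1
      · simpa using g2
      · intro θ hθ
        rw [typeCount_succ]
        by_cases hθy : θ = τ y
        · subst hθy
          simp [g2, g7, g3 _ hty]
        · simp [g2, g7, hθy, g3 θ hθ, Ne.symm hθy]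
      · intro j hj
        by_cases hjy : j = y
        · subst hjy; simp [g2, g7, g1, g3 _ hty]
        · simpa [g7, hjy] using g4 j (by omega)
    · simpa using (h1 1 (by simp)).trans hst.slots
    · rintro t2 s2 ⟨⟨-, -, -, g4⟩, -, g6⟩ t3 ht3 t4 ht4
      refine ⟨?_, by omega⟩
      ext ⟨⟨θ, i⟩, j⟩
      obtain ⟨⟨θ', i'⟩, hc⟩ := (hf.slots j).2 (Nat.zero_le _)
      have e1 : τ j = θ'.val := h.hasTypes _ _ hc
      have e2 : typeCount τ 0 θ' j = i'.val := hs.typeCount_eq hf h.hasTypes hc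
      simp only [Store.output, Finset.mem_filter, Finset.mem_univ, true_and, g4 j j.isLt, e1, e2]
      constructor
      · intro he
        obtain ⟨h7, h8⟩ := row_inj (Nat.succ.inj he) i'.isLt i.isLt
        rwa [← Fin.ext h7, ← Fin.ext h8]
      · intro he
        have := hf.matching.ad_eq he hc
        simp only [Prod.mk.injEq] at this
        rw [this.1, this.2]

/-- An implementation of the Hungarian algorithm for the Ad Types Problem. -/
def hungarianC : Cmd :=
  Heap.buildC ;; initPricesC ;; 2 ::= V 1 ;; phasesC ;; outputC

theorem encode_apply (f : Fin k → Fin n → ℝ) (θ : Fin k) (i : Fin n) :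
    encode f (θ.val * n + i.val) = f θ i := by
  have h1 : (θ.val * n + i.val) / n = θ.val := by
    rw [Nat.add_comm, Nat.add_mul_div_right _ _ (Fin.pos i), Nat.div_eq_of_lt i.isLt, Nat.zero_add]
  have h2 : (θ.val * n + i.val) % n = i.val := by
    rw [Nat.add_comm, Nat.add_mul_mod_self_right, Nat.mod_eq_of_lt i.isLt]
  simp only [encode, h1, h2]
  rw [dif_pos ⟨θ.isLt, i.isLt⟩]

theorem static_input : Static I I.input where
  types := rfl
  slots := rfl
  value := encode_apply I.v
  discount := encode_apply I.α

theorem runs_hungarianC (hI : I.IsMonotone) (hk : 0 < k) (hn : 0 < n)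
    (hW : (2 * n + 1) * (2 * n + 2) ≤ W) (hkn : k * n ≤ W) :
    Runs W hungarianC I.input fun t s' => ∃ H, 2 ^ H ≤ 2 * n ∧
      t ≤ 1000 * n + n * (phaseCost k n H + 9) + 100 * (k + n) + 100 ∧
      ∃ σ, I.Between σ ∧ σ.Final ∧ σ.M = s'.output k n ∧ (I.IsStrict → I.Reachable σ) := by
  have hnW : n ≤ W := le_trans (by nlinarith) hW
  have hkW : k ≤ W := (Nat.le_mul_of_pos_right k hn).trans hkn
  have hin : I.input.nvar 1 = n := rfl
  have c1 : (2 ::= V 1).cost = 2 := rfl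
  refine (Runs.mono (runs_buildC (s := I.input) hn (by rwa [hin]) fun x => ?_) ?_).seq
  · simp [Store.key, Instance.input]
  rintro t1 s1 ⟨e1, e2, e3, e4, N, H, m, e5, e6, e7, e8, e9⟩
  rw [hin] at e6 e8 e9
  have hst : Static I s1 := static_input.congr (e1 0 (by simp) (by simp) (by simp) (by simp))
    (e1 1 (by simp) (by simp) (by simp) (by simp)) (by rw [e4]) (by rw [e4])
  refine (Runs.mono (hst.runs_initPricesC hI hk hn hkW hnW (by rw [e3]; rfl)) ?_).seq
  rintro t2 s2 ⟨f1, f2, f3, f4, f5⟩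
  have g1 : s2.nvar 1 = n := (f1 1 (by simp)).trans hst.slots
  refine Runs.wp_seq ⟨by simpa [g1] using hnW, ?_⟩
  rw [NExp.val_var, g1]
  have hst3 : Static I { s2 with nvar := Function.update s2.nvar 2 n } :=
    hst.congr (by simp [f1]) (by simp [f1]) (f3 0 (by simp)) (f3 1 (by simp))
  have hi : Interphase I I.start { s2 with nvar := Function.update s2.nvar 2 n } :=
    ⟨I.between_start hI hk hn, fun a j h => by simp [Instance.start] at h, f4⟩
  refine (Runs.mono (hi.runs_phasesC (s := { s2 with nvar := Function.update s2.nvar 2 n })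
    hI hk hst3 rfl (by simp) (e5.congr_key (s' := { s2 with nvar := Function.update s2.nvar 2 n })
    ⟨fun x hx => ?_, fun a _ => by rw [← f2]⟩ (by rw [← f2]) (f3 3 (by simp))) ?_ e6 hkn) ?_).seq
  · dsimp only
    rw [Function.update_of_ne (by omega), f1 x (by omega)]
  · intro x _
    dsimp only
    rw [f2, e2 7 (by simp)]
    simp [Instance.input]
  rintro t4 s4 ⟨⟨σ, k1, k2, k3⟩, k4, k5⟩
  refine (k1.runs_outputC k4 k2 hkW hnW hkn).mono ?_
  rintro t5 s5 ⟨k6, k7⟩ t3 ht3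
  exact ⟨H, e7 ▸ e8, by omega, σ, k1.between, ⟨k2, k1.between.root⟩, k6.symm, k3⟩

def costFactor : ℕ := 3400 + 2 * Heap.unit + 4 * scanTypeCost

/-- A phase costs `O(n * k)` for the tables and `O(k + H)` for each of at most `n` slots that enter
the tree. Positivity of `k` and `n` absorbs the lower order terms. -/
theorem total_cost_le (hk : 0 < k) (hn : 0 < n) :
    1000 * n + n * (phaseCost k n H + 9) + 100 * (k + n) + 100 ≤
      costFactor * (n * (n * (k + H))) := by
  have h1 : phaseCost k n H ≤ (2000 + 2 * Heap.unit + 4 * scanTypeCost) * (n * (k + H)) := by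
    obtain ⟨Z, hZ⟩ : ∃ Z, Z = n * (k + H) := ⟨_, rfl⟩
    have a1 : n * k + n * H = Z := by rw [hZ]; ring
    have a2 : n ≤ n * k := Nat.le_mul_of_pos_right n hk
    have a3 : k ≤ n * k := Nat.le_mul_of_pos_left k hn
    have a4 : H ≤ n * H := Nat.le_mul_of_pos_left H hn
    have b1 : Heap.unit * H + n * (Heap.unit * H) ≤ 2 * (Heap.unit * Z) := by
      have := Nat.mul_le_mul_left Heap.unit (show H + n * H ≤ 2 * Z by omega)
      linarith
    have b2 : (k + 1) * scanTypeCost + n * ((k + 1) * scanTypeCost) ≤ 4 * (scanTypeCost * Z) := by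
      have := Nat.mul_le_mul_left scanTypeCost (show (k + 1) + (n * k + n) ≤ 4 * Z by omega)
      linarith
    have e : phaseCost k n H = (Heap.unit * H + n * (Heap.unit * H)) +
        ((k + 1) * scanTypeCost + n * ((k + 1) * scanTypeCost)) +
        (60 * (n * k) + 1000 * (n * H) + 60 * k + 1255 * n + 210) := by
      unfold phaseCost startCost growCost; ring
    have e2 : (2000 + 2 * Heap.unit + 4 * scanTypeCost) * Z =
        2000 * Z + 2 * (Heap.unit * Z) + 4 * (scanTypeCost * Z) := by ring
    rw [e, ← hZ, e2]
    omega
  obtain ⟨Y, hY⟩ : ∃ Y, Y = n * (n * (k + H)) := ⟨_, rfl⟩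
  have a1 : n ≤ n * (k + H) := Nat.le_mul_of_pos_right n (by omega)
  have a2 : n * (k + H) ≤ Y := hY ▸ Nat.le_mul_of_pos_left _ hn
  have a3 : k + H ≤ n * (k + H) := Nat.le_mul_of_pos_left _ hn
  have h2 := Nat.mul_le_mul_left n h1
  have h3 : n * ((2000 + 2 * Heap.unit + 4 * scanTypeCost) * (n * (k + H))) =
      (2000 + 2 * Heap.unit + 4 * scanTypeCost) * Y := by rw [hY]; ring
  have h4 : costFactor * Y = (2000 + 2 * Heap.unit + 4 * scanTypeCost) * Y + 1400 * Y := by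
    unfold costFactor; ring
  rw [← hY, h4, Nat.mul_add]
  omega

/-- Taking logarithms gives `H * log 2 ≤ log 2 + log n`, and `log 2 > 1 / 2`. -/
theorem height_le_log (hn : 0 < n) (hH : 2 ^ H ≤ 2 * n) : (H : ℝ) ≤ 1 + 2 * Real.log n := by
  have hn' : (0 : ℝ) < n := by exact_mod_cast hn
  have h0 : 0 ≤ Real.log n := Real.log_natCast_nonneg n
  have h1 : (2 : ℝ) ^ H ≤ 2 * n := by exact_mod_cast hH
  have h2 := Real.log_le_log (by positivity) h1
  rw [Real.log_pow, Real.log_mul (by simp) hn'.ne'] at h2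
  have h3 := Real.log_two_gt_d9
  by_contra h4
  nlinarith

theorem exists_implementation : ∃ (prog : Cmd) (C : ℕ), ∀ (k n : ℕ), 1 ≤ k → 1 ≤ n →
    ∀ I : Instance k n, I.IsMonotone →
      ∃ (t : ℕ) (m : Store), Exec ((n + k) ^ C) prog I.input t m ∧
        (t : ℝ) ≤ C * ((n : ℝ) ^ 2 * ((k : ℝ) + Real.log n)) ∧
        I.IsMaxWeightMatching (m.output k n) ∧
        (I.IsStrict → ∃ s : HState k n, I.Reachable s ∧ s.Final ∧ s.M = m.output k n) := by
  -- The factor `2` turns the height into the logarithm: as `1 ≤ k`, the bound `H ≤ 1 + 2 * log n`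
  -- yields `k + H ≤ 2 * (k + log n)`. The same constant is the exponent of the word size, for which
  -- `4` would be enough: both factors of `(2 * n + 1) * (2 * n + 2)` are at most `2 * (n + k) ≤ (n
  -- + k) ^ 2`.
  refine ⟨hungarianC, 2 * costFactor, fun k n hk hn I hI => ?_⟩
  have hC : 4 ≤ 2 * costFactor := by unfold costFactor; omega
  have hpow : (n + k) ^ 4 ≤ (n + k) ^ (2 * costFactor) := Nat.pow_le_pow_right (by omega) hC
  have hsq : 2 * (n + k) ≤ (n + k) ^ 2 := by nlinarith
  have hsq2 : (n + k) ^ 4 = (n + k) ^ 2 * (n + k) ^ 2 := by ring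
  have hW : (2 * n + 1) * (2 * n + 2) ≤ (n + k) ^ (2 * costFactor) := by
    refine le_trans ?_ hpow
    rw [hsq2]
    exact Nat.mul_le_mul (by omega) (by omega)
  have hkn : k * n ≤ (n + k) ^ (2 * costFactor) := by
    refine le_trans ?_ hpow
    rw [hsq2]
    exact Nat.mul_le_mul (by omega) (by omega)
  obtain ⟨t, m, h1, H, h2, h3, σ, h4, h5, h6, h7⟩ := runs_hungarianC hI hk hn hW hkn
  refine ⟨t, m, h1, ?_, h6 ▸ h4.isMaxWeightMatching h5, fun hs => ⟨σ, h7 hs, h5, h6⟩⟩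
  have h8 : (t : ℝ) ≤ costFactor * (n * (n * (k + H))) := by
    exact_mod_cast h3.trans (total_cost_le hk hn)
  have h9 := height_le_log hn h2
  have hk' : (1 : ℝ) ≤ k := by exact_mod_cast hk
  have h10 : (costFactor : ℝ) * (n * (n * (k + H))) ≤
      costFactor * (n * (n * (2 * (k + Real.log n)))) := by
    have : (k : ℝ) + H ≤ 2 * (k + Real.log n) := by linarith
    gcongr
  refine h8.trans (h10.trans (le_of_eq ?_))
  push_cast
  ring

end AdTypes

theorem theorem1 :
    -- the Hungarian algorithm for the Ad Types Problem is correct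
    (∀ (k n : ℕ), 1 ≤ k → 1 ≤ n → ∀ I : AdTypes.Instance k n, I.IsStrict →
      -- every execution is finite
      Acc (fun t s => I.Step s t) I.start ∧
      -- no execution gets stuck, it ends with a maximum-weight matching,
      -- the queue stays small, and every scan inspects few edges
      ∀ s : AdTypes.HState k n, I.Reachable s →
        (¬ s.Final → ∃ t, I.Step s t) ∧
        (s.Final → I.IsMaxWeightMatching s.M) ∧
        s.queue.card ≤ n + k ∧
        ∀ j : Fin n, (AdTypes.scanSet s.M j).card ≤ 3 * k) ∧
    -- it can be implemented in the claimed time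
    ∃ (prog : AdTypes.Cmd) (C : ℕ), ∀ (k n : ℕ), 1 ≤ k → 1 ≤ n →
      ∀ I : AdTypes.Instance k n, I.IsMonotone →
        ∃ (t : ℕ) (m : AdTypes.Store), AdTypes.Exec ((n + k) ^ C) prog I.input t m ∧
          (t : ℝ) ≤ C * ((n : ℝ) ^ 2 * ((k : ℝ) + Real.log n)) ∧
          I.IsMaxWeightMatching (m.output k n) ∧
          (I.IsStrict → ∃ s : AdTypes.HState k n,
            I.Reachable s ∧ s.Final ∧ s.M = m.output k n) := by
  refine ⟨fun k n hk hn I hI => hI.hungarian_correct hk hn, AdTypes.exists_implementation⟩
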